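/- **Proposition (product of two AC manifolds).** All manifolds are smooth, finite-dimensional and without boundary. *Definitions.* Let $\nu>0$. A Riemannian manifold $(Z,g)$ is *asymptotically conic (AC) of rate $\nu$*, with non-empty compact cross-section $(F,\kappa)$, if there are $R_0>0$ and a diffeomorphism of $(R_0,\infty)\times F$ onto an open subset of $Z$ such that the sets $\{\rho\ge R\}$ are closed and the complements of $\{\rho>R\}$ are compact for $R>R_0$, and $g=d\rho^2+\rho^2\kappa+g'$ on this end with $|g'|=O(\rho^{-\nu})$ with respect to $d\rho^2+\rho^2\kappa$. Extend $\rho$ by $R_0$ to the rest of $Z$. A *compact iterated edge space of depth $1$* is a compact Hausdorff space $Y_0$ which is the disjoint union of an open Riemannian manifold $(Y_0^{\mathrm{reg}},h_0)$ and of finitely many (at least one) compact manifolds $S_\alpha$, such that the $S_\alpha$ have disjoint neighbourhoods that are smooth bundles over $S_\alpha$ of truncated cones $\{0\le s<c_\alpha\}$ over compact Riemannian manifolds $(F_\alpha,\kappa_\alpha)$, in whose local trivializations $h_0=q_\alpha+ds^2+s^2\kappa_\alpha+\eta$, with $q_\alpha$ a metric on $S_\alpha$ and $|\eta|=O(s^{\delta})$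 for some $\delta>0$. A *resolution blowup (of rate $\nu$)* of $(Y_0,h_0)$ is a compact manifold $Y$ with a smooth family of metrics $h_\varepsilon$, $0<\varepsilon<\varepsilon_0$, obtained by replacing each conic fibre $\{s<c_\alpha\}$ over $S_\alpha$ by the truncation $\{\rho<c_\alpha/\varepsilon\}$ of an AC manifold $(W_\alpha,g_\alpha)$ of rate $\nu$ with cross-section $(F_\alpha,\kappa_\alpha)$, glued along $s=\varepsilon\rho$, such that $h_\varepsilon=h_0$ outside the cone bundles, $h_\varepsilon=h_0+O((\varepsilon/s)^{\nu})$ on the part $s>\varepsilon R_0$ of the cone bundles, and $h_\varepsilon=q_\alpha+\varepsilon^2g_\alpha+O((\varepsilon\rho)^{\delta})$ for some $\delta>0$ in local trivializations of the bundle with fibres $\{\rho<c_\alpha/\varepsilon\}\subset W_\alpha$. $(Z,g)$ is *QAC of depth $1$ and rate $\nu$ with limiting link $(Y_0,h_0)$* if there are a resolution blowup $(Y,h_\varepsilon)$ of rate $\nu$ of $(Y_0,h_0)$, an $R_0>0$ and a diffeomorphism of $(R_0,\infty)\times Y$ onto an open subset of $Z$, with $\{\rho\ge R\}$ closed and the complement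 of $\{\rho>R\}$ compact for $R>R_0$, such that $g=d\rho^2+\rho^2h_{1/\rho}+g'$ there with $|g'|=O(\rho^{-\nu})$. The *spherical suspension* $Y_0$ of compact Riemannian manifolds $(F_1,\kappa_1)$ and $(F_2,\kappa_2)$ is the quotient of $[0,\pi/2]\times F_1\times F_2$ in which $F_2$ is collapsed at $\theta=0$ and $F_1$ at $\theta=\pi/2$, with the metric $h_0=d\theta^2+\cos^2\theta\,\kappa_1+\sin^2\theta\,\kappa_2$ on $0<\theta<\pi/2$ and the distance $d\in[0,\pi]$ given by $$\cos d=\cos\theta\cos\theta'\cos\min(d_{\kappa_1},\pi)+\sin\theta\sin\theta'\cos\min(d_{\kappa_2},\pi).$$ The metric cone over a metric space $(Y,d)$ is $[0,\infty)\times Y$ with $\{0\}\times Y$ collapsed to the vertex $o$ and with the distance $d_C((r,y),(s,y'))^2=r^2+s^2-2rs\cos\min(d(y,y'),\pi)$. *Statement.* Let $(Z_1,g_1)$ and $(Z_2,g_2)$ be connected AC manifolds of rates $\nu_1,\nu_2>0$ with cross-sections $(F_1,\kappa_1)$ and $(F_2,\kappa_2)$, and let $(Y_0,h_0)$ be the spherical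 suspension of the cross-sections. Then: 1. $(Y_0,h_0)$ is a compact iterated edge space of depth $1$, and $(Z_1\times Z_2,\ g_1\oplus g_2)$ is a QAC space of depth $1$ and rate $\min\{1,\nu_1,\nu_2\}$ with limiting link $(Y_0,h_0)$. 2. The tangent cone at infinity of $(Z_1\times Z_2,g_1\oplus g_2)$ is the metric cone $C(Y_0)$ over the spherical suspension: for every base point $p$, the rescaled spaces $(Z_1\times Z_2,\ \varepsilon^2(g_1\oplus g_2),\ p)$ converge to $(C(Y_0),d_C,o)$ in the pointed Gromov–Hausdorff sense as $\varepsilon\to0^+$. -/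

import Mathlib

open Set Filter Topology Bundle
open scoped Manifold ContDiff ENNReal NNReal

section
variable {E H E' H' : Type} [NormedAddCommGroup E] [NormedSpace ℝ E]
  [TopologicalSpace H] {I : ModelWithCorners ℝ E H} [NormedAddCommGroup E'] [NormedSpace ℝ E']
  [TopologicalSpace H'] {J : ModelWithCorners ℝ E' H'}
  {M N : Type*} [TopologicalSpace M] [ChartedSpace H M] [IsManifold I ∞ M]
  [TopologicalSpace N] [ChartedSpace H' N] [IsManifold J ∞ N]

/-- The pullback of a smooth field of bilinear forms under a smooth map is smooth. -/
theorem contMDiff_pullback_form (b : ∀ y : N, TangentSpace J y →L[ℝ] TangentSpace J y →L[ℝ] ℝ)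
    (hb : ContMDiff J (J.prod 𝓘(ℝ, E' →L[ℝ] E' →L[ℝ] ℝ)) ∞
      (fun y ↦ TotalSpace.mk' (E' →L[ℝ] E' →L[ℝ] ℝ) y (b y)))
    {f : M → N} (hf : ContMDiff I J ∞ f)
    (c : ∀ x : M, TangentSpace I x →L[ℝ] TangentSpace I x →L[ℝ] ℝ)
    (hc : ∀ x v w, c x v w = b (f x) (mfderiv I J f x v) (mfderiv I J f x w)) :
    ContMDiff I (I.prod 𝓘(ℝ, E →L[ℝ] E →L[ℝ] ℝ)) ∞
      (fun x ↦ TotalSpace.mk' (E →L[ℝ] E →L[ℝ] ℝ) x (c x)) := by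
  intro x₀
  rw [contMDiffAt_section]
  have hb' := (contMDiffAt_section (f x₀)).1 (hb (f x₀))
  have hA : ContMDiffAt I 𝓘(ℝ, E →L[ℝ] E') ∞
      (inTangentCoordinates I J id f (mfderiv I J f) x₀) x₀ :=
    (hf x₀).mfderiv_const (by simp)
  have hG := hb'.comp x₀ (hf x₀)
  simp only [hom_trivializationAt_apply, Function.comp_def] at hG ⊢
  set A := inTangentCoordinates I J id f (mfderiv I J f) x₀ with hAdef
  set G : M → E' →L[ℝ] E' →L[ℝ] ℝ := fun x ↦
      (ContinuousLinearMap.inCoordinates E' (TangentSpace J) (E' →L[ℝ] ℝ)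
        (fun y : N ↦ TangentSpace J y →L[ℝ] ℝ) (f x₀) (f x) (f x₀) (f x) (b (f x))) with hGdef
  have h1 : ContMDiffAt I 𝓘(ℝ, (E' →L[ℝ] ℝ) →L[ℝ] (E →L[ℝ] ℝ)) ∞
      (fun x ↦ ContinuousLinearMap.precomp ℝ (A x)) x₀ := hA.clm_precomp
  have key : ContMDiffAt I 𝓘(ℝ, E →L[ℝ] E →L[ℝ] ℝ) ∞
      (fun x ↦ (ContinuousLinearMap.precomp ℝ (A x)).comp ((G x).comp (A x))) x₀ :=
    h1.clm_comp (hG.clm_comp hA)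
  refine key.congr_of_eventuallyEq ?_
  have hx : ∀ᶠ x in 𝓝 x₀, x ∈ (chartAt H x₀).source :=
    (chartAt H x₀).open_source.mem_nhds (mem_chart_source H x₀)
  have hfx : ∀ᶠ x in 𝓝 x₀, f x ∈ (chartAt H' (f x₀)).source :=
    hf.continuous.continuousAt.eventually
      ((chartAt H' (f x₀)).open_source.mem_nhds (mem_chart_source H' (f x₀)))
  filter_upwards [hx, hfx] with x hx hfx
  ext v w
  rw [inCoordinates_apply_eq₂ (by simpa using hx) (by simpa using hx) (by simp)]
  simp only [ContinuousLinearMap.comp_apply, ContinuousLinearMap.precomp_apply, hGdef]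
  rw [inCoordinates_apply_eq₂ (by simpa using hfx) (by simpa using hfx) (by simp)]
  have hAv : ∀ u : E, (trivializationAt E' (TangentSpace J) (f x₀)).symm (f x) (A x u)
      = mfderiv I J f x ((trivializationAt E (TangentSpace I) x₀).symm x u) := by
    intro u
    have h : A x = _ := ContinuousLinearMap.inCoordinates_eq (F := E) (E := TangentSpace I)
      (F' := E') (E' := TangentSpace J) (x₀ := x₀) (x := x) (y₀ := f x₀) (y := f x)
      (ϕ := mfderiv I J f x)
      (by simpa using hx) (by simpa using hfx)
    rw [h]
    simp only [ContinuousLinearMap.comp_apply]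
    simpa using (trivializationAt E' (TangentSpace J) (f x₀)).symm_apply_apply_mk (by simpa using hfx) _
  rw [hAv, hAv, hc]
  rfl
end


universe u

/-- A smooth finite-dimensional manifold without boundary (Hausdorff and second countable). -/
structure Mfd : Type (u + 1) where
  carrier : Type u
  E : Type
  H : Type
  [normed : NormedAddCommGroup E]
  [space : NormedSpace ℝ E]
  [finDim : FiniteDimensional ℝ E]
  [topH : TopologicalSpace H]
  I : ModelWithCorners ℝ E H
  [boundaryless : I.Boundaryless]
  [top : TopologicalSpace carrier]
  [charted : ChartedSpace H carrier]
  [smooth : IsManifold I ∞ carrier]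
  [t2 : T2Space carrier]
  [secondCountable : SecondCountableTopology carrier]

namespace Mfd

instance : CoeSort Mfd.{u} (Type u) := ⟨Mfd.carrier⟩

attribute [instance] normed space finDim topH boundaryless top charted smooth t2 secondCountable

/-- Smooth Riemannian metrics on `M`. -/
abbrev Metric (M : Mfd.{u}) : Type u :=
  ContMDiffRiemannianMetric M.I ∞ M.E (fun x : M ↦ TangentSpace M.I x)

/-- The product manifold. -/
noncomputable abbrev prod (M N : Mfd.{u}) : Mfd.{u} where
  carrier := M × N
  E := M.E × N.E
  H := ModelProd M.H N.H
  I := M.I.prod N.I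

end Mfd

noncomputable section

namespace Mfd.Metric

variable {M N : Mfd.{u}}

/-- The quadratic form `g(v, v)` of a Riemannian metric at the point `x`. -/
def sq (g : M.Metric) (x : M) (v : TangentSpace M.I x) : ℝ := g.inner x v v

/-- The product metric `g ⊕ h` on `M × N`. -/
def prod (g : M.Metric) (h : N.Metric) : (M.prod N).Metric where
  inner p :=
    ((show M.E →L[ℝ] M.E →L[ℝ] ℝ from g.inner p.1).bilinearComp
        (ContinuousLinearMap.fst ℝ M.E N.E) (ContinuousLinearMap.fst ℝ M.E N.E) +
      (show N.E →L[ℝ] N.E →L[ℝ] ℝ from h.inner p.2).bilinearComp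
        (ContinuousLinearMap.snd ℝ M.E N.E) (ContinuousLinearMap.snd ℝ M.E N.E) :
      M.E × N.E →L[ℝ] M.E × N.E →L[ℝ] ℝ)
  symm p v w := congrArg₂ (· + ·) (g.symm p.1 v.1 w.1) (h.symm p.2 v.2 w.2)
  pos p v hv := by
    change 0 < g.inner p.1 v.1 v.1 + h.inner p.2 v.2 v.2
    have h1 : ∀ u : TangentSpace M.I p.1, 0 ≤ g.inner p.1 u u := fun u ↦ by
      by_cases hu : u = 0
      · simp [hu]
      · exact (g.pos p.1 u hu).le
    have h2 : ∀ u : TangentSpace N.I p.2, 0 ≤ h.inner p.2 u u := fun u ↦ by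
      by_cases hu : u = 0
      · simp [hu]
      · exact (h.pos p.2 u hu).le
    by_cases hv1 : v.1 = 0
    · have hv2 : v.2 ≠ 0 := fun hv2 ↦ hv (Prod.ext hv1 hv2)
      exact add_pos_of_nonneg_of_pos (h1 _) (h.pos p.2 v.2 hv2)
    · exact add_pos_of_pos_of_nonneg (g.pos p.1 v.1 hv1) (h2 _)
  isVonNBounded p := by
    have h1 : ∀ u : TangentSpace M.I p.1, 0 ≤ g.inner p.1 u u := fun u ↦ by
      by_cases hu : u = 0
      · simp [hu]
      · exact (g.pos p.1 u hu).le
    have h2 : ∀ u : TangentSpace N.I p.2, 0 ≤ h.inner p.2 u u := fun u ↦ by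
      by_cases hu : u = 0
      · simp [hu]
      · exact (h.pos p.2 u hu).le
    have b1 : Bornology.IsBounded {v : M.E | g.inner p.1 v v < 1} :=
      (NormedSpace.isVonNBounded_iff ℝ).1 (g.isVonNBounded p.1)
    have b2 : Bornology.IsBounded {v : N.E | h.inner p.2 v v < 1} :=
      (NormedSpace.isVonNBounded_iff ℝ).1 (h.isVonNBounded p.2)
    have b : Bornology.IsVonNBounded ℝ
        {v : M.E × N.E | g.inner p.1 v.1 v.1 + h.inner p.2 v.2 v.2 < 1} := by
      refine (NormedSpace.isVonNBounded_iff ℝ).2 ((b1.prod b2).subset ?_)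
      intro v (hv : g.inner p.1 v.1 v.1 + h.inner p.2 v.2 v.2 < 1)
      constructor
      · change g.inner p.1 v.1 v.1 < 1
        linarith [h2 v.2]
      · change h.inner p.2 v.2 v.2 < 1
        linarith [h1 v.1]
    exact b
  contMDiff := by
    have c1 := contMDiff_pullback_form (I := M.I.prod N.I) (M := M × N) g.inner g.contMDiff
      contMDiff_fst
      (fun p : M × N ↦ (show M.E →L[ℝ] M.E →L[ℝ] ℝ from g.inner p.1).bilinearComp
        (ContinuousLinearMap.fst ℝ M.E N.E) (ContinuousLinearMap.fst ℝ M.E N.E))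
      (fun x v w ↦ by rw [mfderiv_fst]; rfl)
    have c2 := contMDiff_pullback_form (I := M.I.prod N.I) (M := M × N) h.inner h.contMDiff
      contMDiff_snd
      (fun p : M × N ↦ (show N.E →L[ℝ] N.E →L[ℝ] ℝ from h.inner p.2).bilinearComp
        (ContinuousLinearMap.snd ℝ M.E N.E) (ContinuousLinearMap.snd ℝ M.E N.E))
      (fun x v w ↦ by rw [mfderiv_snd]; rfl)
    exact c1.add_section c2

/-- The Riemannian distance with values in `[0, ∞]`: the infimum of the `g`-lengths of `C¹` paths
(infinite between different components). -/
def edist (g : M.Metric) (x y : M) : ℝ≥0∞ :=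
  letI : RiemannianBundle (fun x : M ↦ TangentSpace M.I x) := ⟨g.toRiemannianMetric⟩
  Manifold.riemannianEDist M.I x y

/-- The Riemannian distance (meaningful on connected manifolds). -/
def dist (g : M.Metric) (x y : M) : ℝ := (g.edist x y).toReal

/-- The Riemannian distance truncated at `π`. -/
def angle (g : M.Metric) (x y : M) : ℝ := (min (g.edist x y) (ENNReal.ofReal Real.pi)).toReal

end Mfd.Metric

/-! ### Asymptotically conic manifolds -/

/-- `(Z, g)` is asymptotically conic of rate `ν` with compact cross-section `(F, h)`: outside a
compact set, `Z` is identified with `(R₀, ∞) × F`, where `g = dρ² + ρ² h + g'` and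
`|g'| = O(ρ ^ (-ν))` with respect to the exact cone metric. -/
structure ACStructure {Z : Mfd.{u}} (g : Z.Metric) {F : Mfd.{u}} (h : F.Metric) (ν : ℝ) where
  compact_link : CompactSpace F
  nonempty_link : Nonempty F
  rate_pos : 0 < ν
  R₀ : ℝ
  R₀_pos : 0 < R₀
  Φ : PartialDiffeomorph (𝓘(ℝ, ℝ).prod F.I) Z.I (ℝ × F) Z ∞
  source_eq : Φ.source = Ioi R₀ ×ˢ univ
  isCompact_compl : ∀ R : ℝ, R > R₀ → IsCompact (Φ '' (Ioi R ×ˢ univ))ᶜ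
  isClosed_end : ∀ R : ℝ, R > R₀ → IsClosed (Φ '' (Ici R ×ˢ univ))
  asymptotic : ∃ C : ℝ, ∀ r : ℝ, r > R₀ → ∀ (f : F) (t : ℝ) (v : TangentSpace F.I f),
    |g.sq (Φ (r, f)) (mfderiv (𝓘(ℝ, ℝ).prod F.I) Z.I Φ (r, f) (t, v)) -
        (t ^ 2 + r ^ 2 * h.sq f v)| ≤
      C * r ^ (-ν) * (t ^ 2 + r ^ 2 * h.sq f v)

open Classical in
/-- The radial function: the coordinate `ρ` on the end, extended by the constant `R₀` to the
compact part. -/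
def ACStructure.rho {Z F : Mfd.{u}} {g : Z.Metric} {h : F.Metric} {ν : ℝ}
    (A : ACStructure g h ν) (z : Z) : ℝ :=
  if z ∈ A.Φ.target then (A.Φ.invFun z).1 else A.R₀

/-! ### Compact iterated edge spaces of depth one -/

/-- The structure of a compact iterated edge space of depth one on the space `Y₀`.  The regular
part is a Riemannian manifold `(reg, h₀)`.  The singular stratum is the disjoint union of finitely
many closed manifolds `S α`, and `S α` has a neighbourhood `tube α` in `Y₀` which is a smooth
bundle of truncated cones `C_{0,c}(F α)` over `S α` (with `c = width α`), with bundle projection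
`proj α` and radial function `rad α`.  In the local trivializations `ψ α b`, the metric is
`h₀ = q + ds² + s² κ + η` with `|η| = O(s ^ δ)`, where `q` is a metric on `S α` and `κ` a metric
on the link `F α`. -/
structure EdgeStructure (Y₀ : Type u) [TopologicalSpace Y₀] where
  compact : CompactSpace Y₀
  t2 : T2Space Y₀
  reg : Mfd.{u}
  h₀ : reg.Metric
  incl : reg → Y₀
  incl_openEmbedding : IsOpenEmbedding incl
  /-- the index set of the families of strata -/
  ι : Type
  finite_index : Finite ι
  nonempty_index : Nonempty ι
  S : ι → Mfd.{u}
  compact_S : ∀ α, CompactSpace (S α)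
  nonempty_S : ∀ α, Nonempty (S α)
  q : ∀ α, (S α).Metric
  F : ι → Mfd.{u}
  compact_F : ∀ α, CompactSpace (F α)
  nonempty_F : ∀ α, Nonempty (F α)
  κ : ∀ α, (F α).Metric
  width : ι → ℝ
  width_pos : ∀ α, 0 < width α
  /-- the inclusion of the singular stratum, i.e. the vertices of the cones -/
  vertex : ∀ α, S α → Y₀
  tube : ι → Set Y₀
  isOpen_tube : ∀ α, IsOpen (tube α)
  tube_disjoint : Pairwise fun α β ↦ Disjoint (tube α) (tube β)
  proj : ∀ α, Y₀ → S α
  rad : ι → Y₀ → ℝ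
  continuousOn_proj : ∀ α, ContinuousOn (proj α) (tube α)
  continuousOn_rad : ∀ α, ContinuousOn (rad α) (tube α)
  rad_mem : ∀ α, ∀ y ∈ tube α, rad α y ∈ Ico 0 (width α)
  isClosed_sublevel : ∀ α, ∀ t < width α, IsClosed {y | y ∈ tube α ∧ rad α y ≤ t}
  vertex_mem : ∀ α x, vertex α x ∈ tube α
  rad_vertex : ∀ α x, rad α (vertex α x) = 0
  proj_vertex : ∀ α x, proj α (vertex α x) = x
  vertex_proj : ∀ α, ∀ y ∈ tube α, rad α y = 0 → vertex α (proj α y) = y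
  mem_reg_iff : ∀ α, ∀ y ∈ tube α, y ∈ range incl ↔ 0 < rad α y
  cover : ∀ y, y ∈ range incl ∨ ∃ α x, vertex α x = y
  /-- the index set of the local trivializations of the cone bundle over `S α` -/
  B : ι → Type u
  V : ∀ α, B α → Set (S α)
  V_cover : ∀ α x, ∃ b, x ∈ V α b
  ψ : ∀ α, B α → PartialDiffeomorph ((S α).I.prod (𝓘(ℝ, ℝ).prod (F α).I)) reg.I
    (S α × (ℝ × F α)) reg ∞
  ψ_source : ∀ α b, (ψ α b).source = V α b ×ˢ (Ioo 0 (width α) ×ˢ univ)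
  ψ_target : ∀ α b, (ψ α b).target = {m | incl m ∈ tube α ∧ proj α (incl m) ∈ V α b}
  proj_ψ : ∀ α b, ∀ x ∈ V α b, ∀ s ∈ Ioo 0 (width α), ∀ f,
    proj α (incl (ψ α b (x, s, f))) = x
  rad_ψ : ∀ α b, ∀ x ∈ V α b, ∀ s ∈ Ioo 0 (width α), ∀ f,
    rad α (incl (ψ α b (x, s, f))) = s
  /-- the transition maps are bundle maps of cones: they act on the links, independently of `s` -/
  ψ_conic : ∀ α b b', ∀ x ∈ V α b ∩ V α b', ∀ s ∈ Ioo 0 (width α), ∀ s' ∈ Ioo 0 (width α),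
    ∀ f f', ψ α b (x, s, f) = ψ α b' (x, s, f') → ψ α b (x, s', f) = ψ α b' (x, s', f')
  metric_near_edge : ∀ α, ∃ C δ : ℝ, 0 < δ ∧
    ∀ b, ∀ x ∈ V α b, ∀ s ∈ Ioo 0 (width α), ∀ (f : F α) (u : TangentSpace (S α).I x) (t : ℝ)
      (v : TangentSpace (F α).I f),
      |h₀.sq (ψ α b (x, s, f)) (mfderiv ((S α).I.prod (𝓘(ℝ, ℝ).prod (F α).I)) reg.I (ψ α b)
          (x, s, f) (u, t, v)) - ((q α).sq x u + t ^ 2 + s ^ 2 * (κ α).sq f v)| ≤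
        C * s ^ δ * ((q α).sq x u + t ^ 2 + s ^ 2 * (κ α).sq f v)

/-! ### Resolution blowups -/

/-- `(Y, h_ε)`, `0 < ε < ε₀`, is a resolution blowup of the depth one edge space `(Y₀, h₀)`: each
truncated cone fibre `C_{0,c}(F α)` over `S α` is replaced by the truncation `{ρ < c / ε}` of an
asymptotically conic manifold `(W α, gW α)` with cross-section `F α`, rescaled by `ε`.

For each `ε`, the map `J ε` embeds the part `s > ε R₀` of the regular part of `Y₀` in `Y`, the maps
`T ε α b` are the local trivializations of the bundle over `S α` with fibre `{ρ < c / ε} ⊆ W α`,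
and the two are matched by `s = ε ρ`. -/
structure ResolutionBlowup {Y₀ : Type u} [TopologicalSpace Y₀] (𝓔 : EdgeStructure Y₀)
    (Y : Mfd.{u}) (h : ℝ → Y.Metric) (ν : ℝ) where
  compact : CompactSpace Y
  ε₀ : ℝ
  ε₀_pos : 0 < ε₀
  smooth_family : ContMDiffOn (𝓘(ℝ, ℝ).prod Y.I) (Y.I.prod 𝓘(ℝ, Y.E →L[ℝ] Y.E →L[ℝ] ℝ)) ∞
    (fun p : ℝ × Y ↦ TotalSpace.mk' (Y.E →L[ℝ] Y.E →L[ℝ] ℝ)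
      (E := fun y : Y ↦ TangentSpace Y.I y →L[ℝ] TangentSpace Y.I y →L[ℝ] ℝ)
      p.2 ((h p.1).inner p.2)) (Ioo 0 ε₀ ×ˢ univ)
  W : 𝓔.ι → Mfd.{u}
  gW : ∀ α, (W α).Metric
  ac : ∀ α, ACStructure (gW α) (𝓔.κ α) ν
  width_gt : ∀ α, ε₀ * (ac α).R₀ < 𝓔.width α
  J : ℝ → PartialDiffeomorph 𝓔.reg.I Y.I 𝓔.reg Y ∞
  J_source : ∀ ε ∈ Ioo 0 ε₀, (J ε).source =
    {m | ∀ α, 𝓔.incl m ∈ 𝓔.tube α → ε * (ac α).R₀ < 𝓔.rad α (𝓔.incl m)}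
  T : ℝ → ∀ α, 𝓔.B α →
    PartialDiffeomorph ((𝓔.S α).I.prod (W α).I) Y.I (𝓔.S α × W α) Y ∞
  T_source : ∀ ε ∈ Ioo 0 ε₀, ∀ α b,
    (T ε α b).source = 𝓔.V α b ×ˢ {w | (ac α).rho w < 𝓔.width α / ε}
  cover : ∀ ε ∈ Ioo 0 ε₀, ∀ y, y ∈ (J ε).target ∨ ∃ α b, y ∈ (T ε α b).target
  /-- on the ends of the fibres, the two descriptions agree -/
  gluing : ∀ ε ∈ Ioo 0 ε₀, ∀ α b, ∀ x ∈ 𝓔.V α b, ∀ r ∈ Ioo (ac α).R₀ (𝓔.width α / ε), ∀ f,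
    T ε α b (x, (ac α).Φ (r, f)) = J ε (𝓔.ψ α b (x, ε * r, f))
  /-- the compact cores of the fibres are disjoint from the image of `Y₀` -/
  core_disjoint : ∀ ε ∈ Ioo 0 ε₀, ∀ α b, ∀ p ∈ (T ε α b).source,
    T ε α b p ∈ (J ε).target → p.2 ∈ (ac α).Φ.target
  edge_disjoint : ∀ ε ∈ Ioo 0 ε₀, ∀ α β b b', α ≠ β →
    Disjoint (T ε α b).target (T ε β b').target
  /-- the `T ε α b` are local trivializations of a bundle over `S α` -/
  T_proj : ∀ ε ∈ Ioo 0 ε₀, ∀ α b b', ∀ p ∈ (T ε α b).source, ∀ p' ∈ (T ε α b').source,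
    T ε α b p = T ε α b' p' → p.1 = p'.1
  /-- the transition maps of the fibre bundle do not depend on `ε` -/
  T_transition : ∀ ε ∈ Ioo 0 ε₀, ∀ ε' ∈ Ioo 0 ε₀, ∀ α b b', ∀ x w w',
    (x, w) ∈ (T ε α b).source ∩ (T ε' α b).source →
    (x, w') ∈ (T ε α b').source ∩ (T ε' α b').source →
    T ε α b (x, w) = T ε α b' (x, w') → T ε' α b (x, w) = T ε' α b' (x, w')
  /-- away from the tubes, `Y` is identified with `Y₀` independently of `ε` -/
  J_const : ∀ ε ∈ Ioo 0 ε₀, ∀ ε' ∈ Ioo 0 ε₀, ∀ m, (∀ α, 𝓔.incl m ∉ 𝓔.tube α) → J ε m = J ε' m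
  /-- away from the tubes, `h_ε = h₀` -/
  metric_outer : ∀ ε ∈ Ioo 0 ε₀, ∀ m, (∀ α, 𝓔.incl m ∉ 𝓔.tube α) →
    ∀ v : TangentSpace 𝓔.reg.I m,
      (h ε).sq (J ε m) (mfderiv 𝓔.reg.I Y.I (J ε) m v) = 𝓔.h₀.sq m v
  /-- in the tubes, `h_ε = h₀ + O((ε / s) ^ ν)` -/
  metric_tube : ∀ α, ∃ C : ℝ, ∀ ε ∈ Ioo 0 ε₀, ∀ m ∈ (J ε).source, 𝓔.incl m ∈ 𝓔.tube α →
    ∀ v : TangentSpace 𝓔.reg.I m,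
      |(h ε).sq (J ε m) (mfderiv 𝓔.reg.I Y.I (J ε) m v) - 𝓔.h₀.sq m v| ≤
        C * (ε / 𝓔.rad α (𝓔.incl m)) ^ ν * 𝓔.h₀.sq m v
  /-- on the fibre bundles, `h_ε = q + ε² gW + η` with `|η| = O((ε ρ) ^ δ)` -/
  metric_fibre : ∀ α, ∃ C δ : ℝ, 0 < δ ∧ ∀ ε ∈ Ioo 0 ε₀, ∀ b, ∀ x ∈ 𝓔.V α b, ∀ w,
    (ac α).rho w < 𝓔.width α / ε →
    ∀ (u : TangentSpace (𝓔.S α).I x) (v : TangentSpace (W α).I w),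
      |(h ε).sq (T ε α b (x, w))
          (mfderiv ((𝓔.S α).I.prod (W α).I) Y.I (T ε α b) (x, w) (u, v)) -
          ((𝓔.q α).sq x u + ε ^ 2 * (gW α).sq w v)| ≤
        C * (ε * (ac α).rho w) ^ δ * ((𝓔.q α).sq x u + ε ^ 2 * (gW α).sq w v)

/-! ### QAC spaces of depth one -/

/-- `(Z, g)` is a QAC space of depth one and rate `ν`, with limiting link the edge space
`(Y₀, h₀)`: outside a compact set, `Z` is identified with `(R₀, ∞) × Y`, where
`g = dρ² + ρ² h_{1/ρ} + g'` and `|g'| = O(ρ ^ (-ν))`, for a resolution blowup `(Y, h_ε)` of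
`(Y₀, h₀)`. -/
structure QACStructure {Z : Mfd.{u}} (g : Z.Metric) {Y₀ : Type u} [TopologicalSpace Y₀]
    (𝓔 : EdgeStructure Y₀) (ν : ℝ) where
  rate_pos : 0 < ν
  Y : Mfd.{u}
  h : ℝ → Y.Metric
  blowup : ResolutionBlowup 𝓔 Y h ν
  R₀ : ℝ
  R₀_pos : 0 < R₀
  R₀_large : R₀⁻¹ ≤ blowup.ε₀
  Ψ : PartialDiffeomorph (𝓘(ℝ, ℝ).prod Y.I) Z.I (ℝ × Y) Z ∞
  source_eq : Ψ.source = Ioi R₀ ×ˢ univ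
  isCompact_compl : ∀ R : ℝ, R > R₀ → IsCompact (Ψ '' (Ioi R ×ˢ univ))ᶜ
  isClosed_end : ∀ R : ℝ, R > R₀ → IsClosed (Ψ '' (Ici R ×ˢ univ))
  asymptotic : ∃ C : ℝ, ∀ r : ℝ, r > R₀ → ∀ (y : Y) (t : ℝ) (v : TangentSpace Y.I y),
    |g.sq (Ψ (r, y)) (mfderiv (𝓘(ℝ, ℝ).prod Y.I) Z.I Ψ (r, y) (t, v)) -
        (t ^ 2 + r ^ 2 * (h r⁻¹).sq y v)| ≤
      C * r ^ (-ν) * (t ^ 2 + r ^ 2 * (h r⁻¹).sq y v)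

/-! ### Spherical suspensions, metric cones and tangent cones at infinity -/

/-- The identifications on `[0, π/2] × F₁ × F₂`: `F₂` is collapsed at `θ = 0` and `F₁` is
collapsed at `θ = π/2`. -/
def suspensionSetoid (F₁ F₂ : Type u) : Setoid (Icc (0 : ℝ) (Real.pi / 2) × F₁ × F₂) where
  r x y := x.1 = y.1 ∧ ((x.1 : ℝ) ≠ Real.pi / 2 → x.2.1 = y.2.1) ∧ ((x.1 : ℝ) ≠ 0 → x.2.2 = y.2.2)
  iseqv :=
    { refl := fun _ ↦ ⟨rfl, fun _ ↦ rfl, fun _ ↦ rfl⟩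
      symm := fun ⟨h, h₁, h₂⟩ ↦
        ⟨h.symm, fun hx ↦ (h₁ (h ▸ hx)).symm, fun hx ↦ (h₂ (h ▸ hx)).symm⟩
      trans := fun ⟨h, h₁, h₂⟩ ⟨k, k₁, k₂⟩ ↦
        ⟨h.trans k, fun hx ↦ (h₁ hx).trans (k₁ (h ▸ hx)), fun hx ↦ (h₂ hx).trans (k₂ (h ▸ hx))⟩ }

/-- The spherical suspension of `F₁` and `F₂`, with the quotient topology. -/
abbrev Suspension (F₁ F₂ : Type u) : Type u := Quotient (suspensionSetoid F₁ F₂)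

/-- The point of the suspension with coordinates `(θ, a, b)`. -/
def Suspension.mk {F₁ F₂ : Type u} (θ : Icc (0 : ℝ) (Real.pi / 2)) (a : F₁) (b : F₂) :
    Suspension F₁ F₂ :=
  Quotient.mk (suspensionSetoid F₁ F₂) (θ, a, b)

instance (F₁ F₂ : Type u) [Nonempty F₁] [Nonempty F₂] : Nonempty (Suspension F₁ F₂) :=
  ⟨Suspension.mk ⟨0, le_rfl, by positivity⟩ (Classical.arbitrary F₁) (Classical.arbitrary F₂)⟩

/-- The distance on the spherical suspension, i.e. the length distance of
`dθ² + cos² θ κ₁ + sin² θ κ₂`: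
`cos d = cos θ cos θ' cos (min (d₁, π)) + sin θ sin θ' cos (min (d₂, π))`, `d ∈ [0, π]`. -/
def Suspension.dist {F₁ F₂ : Mfd.{u}} (κ₁ : F₁.Metric) (κ₂ : F₂.Metric) :
    Suspension F₁ F₂ → Suspension F₁ F₂ → ℝ :=
  Quotient.lift₂
    (fun x y ↦ Real.arccos (Real.cos x.1 * Real.cos y.1 * Real.cos (κ₁.angle x.2.1 y.2.1) +
      Real.sin x.1 * Real.sin y.1 * Real.cos (κ₂.angle x.2.2 y.2.2)))
    (by
      rintro ⟨θ, a, b⟩ ⟨φ, c, d⟩ ⟨θ', a', b'⟩ ⟨φ', c', d'⟩ ⟨h, h₁, h₂⟩ ⟨k, k₁, k₂⟩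
      dsimp only at h h₁ h₂ k k₁ k₂ ⊢
      subst h k
      congr 2
      · by_cases hθ : (θ : ℝ) = Real.pi / 2
        · simp [hθ]
        · by_cases hφ : (φ : ℝ) = Real.pi / 2
          · simp [hφ]
          · rw [h₁ hθ, k₁ hφ]
      · by_cases hθ : (θ : ℝ) = 0
        · simp [hθ]
        · by_cases hφ : (φ : ℝ) = 0
          · simp [hφ]
          · rw [h₂ hθ, k₂ hφ])

/-- The regular part of the edge space is `(0, π/2) × F₁ × F₂` with the metric
`h₀ = dθ² + cos² θ κ₁ + sin² θ κ₂`. -/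
def EdgeStructure.IsSphericalSuspension {F₁ F₂ : Mfd.{u}} (𝓔 : EdgeStructure (Suspension F₁ F₂))
    (κ₁ : F₁.Metric) (κ₂ : F₂.Metric) : Prop :=
  ∃ D : PartialDiffeomorph (𝓘(ℝ, ℝ).prod (F₁.I.prod F₂.I)) 𝓔.reg.I (ℝ × (F₁ × F₂)) 𝓔.reg ∞,
    D.source = Ioo 0 (Real.pi / 2) ×ˢ univ ∧ D.target = univ ∧
    ∀ (θ : ℝ) (hθ : θ ∈ Ioo 0 (Real.pi / 2)) (a : F₁) (b : F₂),
      𝓔.incl (D (θ, a, b)) = Suspension.mk ⟨θ, hθ.1.le, hθ.2.le⟩ a b ∧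
      ∀ (t : ℝ) (v : TangentSpace F₁.I a) (w : TangentSpace F₂.I b),
        𝓔.h₀.sq (D (θ, a, b))
            (mfderiv (𝓘(ℝ, ℝ).prod (F₁.I.prod F₂.I)) 𝓔.reg.I D (θ, a, b) (t, v, w)) =
          t ^ 2 + Real.cos θ ^ 2 * κ₁.sq a v + Real.sin θ ^ 2 * κ₂.sq b w

/-- The identifications on `[0, ∞) × Y`: everything is collapsed at `r = 0`. -/
def coneSetoid (Y : Type u) : Setoid (ℝ≥0 × Y) where
  r x y := x.1 = y.1 ∧ (x.1 ≠ 0 → x.2 = y.2)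
  iseqv :=
    { refl := fun _ ↦ ⟨rfl, fun _ ↦ rfl⟩
      symm := fun ⟨h, h'⟩ ↦ ⟨h.symm, fun hx ↦ (h' (h ▸ hx)).symm⟩
      trans := fun ⟨h, h'⟩ ⟨k, k'⟩ ↦ ⟨h.trans k, fun hx ↦ (h' hx).trans (k' (h ▸ hx))⟩ }

/-- The cone over `Y`. -/
abbrev Cone (Y : Type u) : Type u := Quotient (coneSetoid Y)

/-- The vertex of the cone. -/
def Cone.vertex (Y : Type u) [Nonempty Y] : Cone Y :=
  Quotient.mk (coneSetoid Y) (0, Classical.arbitrary Y)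

/-- The distance of the metric cone over a space with distance function `d`:
`r² + s² - 2 r s cos (min (d, π))` is the square of the distance of `(r, y)` and `(s, y')`. -/
def Cone.dist {Y : Type u} (d : Y → Y → ℝ) : Cone Y → Cone Y → ℝ :=
  Quotient.lift₂
    (fun x y ↦ √((x.1 : ℝ) ^ 2 + (y.1 : ℝ) ^ 2 -
      2 * x.1 * y.1 * Real.cos (min (d x.2 y.2) Real.pi)))
    (by
      rintro ⟨r, a⟩ ⟨s, b⟩ ⟨r', a'⟩ ⟨s', b'⟩ ⟨h, h'⟩ ⟨k, k'⟩
      dsimp only at h h' k k' ⊢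
      subst h k
      by_cases hr : r = 0
      · simp [hr]
      · by_cases hs : s = 0
        · simp [hs]
        · rw [h' hr, k' hs])

/-- `(C, d, o)` is the tangent cone at infinity of `(Z, g)`: for every base point `p`, the rescaled
spaces `(Z, ε² g, p)` converge to `(C, d, o)` in the pointed Gromov-Hausdorff sense as `ε → 0`. -/
def IsTangentConeAtInfinity {Z : Mfd.{u}} (g : Z.Metric) {C : Type u} (d : C → C → ℝ) (o : C) :
    Prop :=
  ∀ p : Z, ∀ r > 0, ∀ δ > 0, ∀ᶠ ε : ℝ in 𝓝[>] 0, ∃ f : Z → C, f p = o ∧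
    (∀ x y, ε * g.dist p x < r → ε * g.dist p y < r → |d (f x) (f y) - ε * g.dist x y| < δ) ∧
    ∀ c, d o c < r - δ → ∃ x, ε * g.dist p x < r ∧ d (f x) c < δ

end

/-! Let σᵢ be a smoothed radius of Zᵢ, equal to K on the core and to ρᵢ where ρᵢ ≥ 2K, and slice the
product by the level sets σ₁² + σ₂² = r² with r ≥ 10K. On such a level set at least one factor is
far out. Where this is Z₁, its radius is √(r² − σ₂²), so the level set is a copy of F₁ × {σ₂ < cr}
(`regionMap`); the other half is a copy of F₂ × {σ₁ < cr}. Where both factors are far out the radii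
are r cos θ and r sin θ (`wedgeMap`), and the level set looks like the regular part of the spherical
suspension, dilated by r. So a level set is the suspension in which the cones on F₂ over the stratum
F₁ are replaced by truncations of Z₂, and the cones on F₁ over F₂ by truncations of Z₁. This is the
resolution blowup, with ε = 1/r.

All levels have to be identified with one manifold, the level r = 10K. `transport` applies a change
of radii to the factor that is not known to be far out, and recovers the other radius from the level
equation. The change of radii `stretch` is the identity up to 2K, so that cores are carried along
unchanged, and is multiplication by r/(10K) from 3K on. Where both radii are large, both recipes
therefore dilate both radii by the same factor; they agree there, and the identification is smooth
(`flowDiffeo`).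

The metric h_ε is r⁻² times the metric which `blend` induces on the level r = 1/ε. `blend` is the
product metric, interpolated to the sum of the exact cone metrics near σ₁ = σ₂. With tubes of
squared width 1/2, the only points outside the tubes are those with θ = π/4, and there a blowup must
satisfy h_ε = h₀ exactly. The estimates demanded of a blowup are `fibre_estimate` (h_ε against q +
ε² g_W) and `abs_wedgeChart_sub_le` (h_ε against h₀). In both, the errors come from the AC decay at
the radii of the two factors; the fibre estimate also contains the error from the slope of √(r² −
σ₂²).

For the QAC asymptotics, the velocity of the levels as r grows is compared with the unit normal
(`flow_estimate`). It would be the unit normal if the change of radii were an exact dilation; the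
defect in the radius is at most 3K (`stretch_offset_le`), hence of relative size K/r. This, together
with the decay of both factors, gives the rate min(1, ν₁, ν₂).

The tangent cone is found with distances only. The distance of a Riemannian product is Pythagorean
(`dist_prod`). On each factor the distance is that of the cone over Fᵢ, up to an error η(ρ(x) +
ρ(y)) + C for every η in (0, 1) (`exists_abs_coneDist_sub_dist_le`): for the upper bound a plane
segment is lifted to the end, for the lower bound a curve is developed into the plane. Finally, the
product of the cones over F₁ and F₂ is isometric to the cone over the suspension
(`cone_dist_conePoint`), so that rescaled polar coordinates are the required Gromov–Hausdorff
approximations. -/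

section
-- Smoothness of pulled back bilinear forms
variable {E H E' H' EP HP : Type*} [NormedAddCommGroup E] [NormedSpace ℝ E]
  [TopologicalSpace H] {I : ModelWithCorners ℝ E H} [NormedAddCommGroup E'] [NormedSpace ℝ E']
  [TopologicalSpace H'] {J : ModelWithCorners ℝ E' H'}
  [NormedAddCommGroup EP] [NormedSpace ℝ EP] [TopologicalSpace HP] {IP : ModelWithCorners ℝ EP HP}
  {M N P : Type*} [TopologicalSpace M] [ChartedSpace H M] [IsManifold I ∞ M]
  [TopologicalSpace N] [ChartedSpace H' N] [IsManifold J ∞ N]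
  [TopologicalSpace P] [ChartedSpace HP P] [IsManifold IP ∞ P]

/-- The rescaled pullback of a field of bilinear forms under a family of maps is smooth in the
point and the parameter wherever the field and the family are smooth. -/
theorem contMDiffAt_pullback_form_param
    {b : ∀ y : N, TangentSpace J y →L[ℝ] TangentSpace J y →L[ℝ] ℝ} {f : P → M → N} {p₀ : P × M}
    (hb : ContMDiffAt J (J.prod 𝓘(ℝ, E' →L[ℝ] E' →L[ℝ] ℝ)) ∞
      (fun y ↦ TotalSpace.mk' (E' →L[ℝ] E' →L[ℝ] ℝ) y (b y)) (f p₀.1 p₀.2))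
    (hf : ContMDiffAt (IP.prod I) J ∞ (Function.uncurry f) p₀)
    {a : P → ℝ} (ha : ContMDiffAt IP 𝓘(ℝ, ℝ) ∞ a p₀.1)
    {c : P → ∀ x : M, TangentSpace I x →L[ℝ] TangentSpace I x →L[ℝ] ℝ}
    (hc : ∀ᶠ p : P × M in 𝓝 p₀, ∀ v w,
      c p.1 p.2 v w = a p.1 * b (f p.1 p.2) (mfderiv I J (f p.1) p.2 v) (mfderiv I J (f p.1) p.2 w)) :
    ContMDiffAt (IP.prod I) (I.prod 𝓘(ℝ, E →L[ℝ] E →L[ℝ] ℝ)) ∞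
      (fun p : P × M ↦ TotalSpace.mk' (E →L[ℝ] E →L[ℝ] ℝ)
        (E := fun x : M ↦ TangentSpace I x →L[ℝ] TangentSpace I x →L[ℝ] ℝ)
        p.2 (c p.1 p.2)) p₀ := by
  rw [contMDiffAt_totalSpace]
  refine ⟨contMDiffAt_snd, ?_⟩
  have hb' := (contMDiffAt_section (f p₀.1 p₀.2)).1 hb
  have hf' : ContMDiffAt (IP.prod I) J ∞ (fun p : P × M ↦ f p.1 p.2) p₀ := hf
  have hA : ContMDiffAt (IP.prod I) 𝓘(ℝ, E →L[ℝ] E') ∞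
      (inTangentCoordinates I J Prod.snd (fun p : P × M ↦ f p.1 p.2)
        (fun p : P × M ↦ mfderiv I J (f p.1) p.2) p₀) p₀ := by
    -- The differential in the point alone is smooth in parameter and point together: the family is
    -- viewed as parametrized by P × M and uses only the P component.
    refine ContMDiffAt.mfderiv (n := ∞) (fun p : P × M ↦ f p.1) Prod.snd ?_ contMDiffAt_snd (by simp)
    have h2 : ContMDiffAt ((IP.prod I).prod I) (IP.prod I) ∞
        (fun q : (P × M) × M ↦ (q.1.1, q.2)) (p₀, p₀.2) :=
      (contMDiffAt_fst.comp _ contMDiffAt_fst).prodMk contMDiffAt_snd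
    exact ContMDiffAt.comp (g := Function.uncurry f) (p₀, p₀.2) hf h2
  have hG := hb'.comp p₀ hf'
  simp only [hom_trivializationAt_apply, Function.comp_def] at hG ⊢
  set A := inTangentCoordinates I J Prod.snd (fun p : P × M ↦ f p.1 p.2)
        (fun p : P × M ↦ mfderiv I J (f p.1) p.2) p₀ with hAdef
  set G : P × M → E' →L[ℝ] E' →L[ℝ] ℝ := fun p ↦
      (ContinuousLinearMap.inCoordinates E' (TangentSpace J) (E' →L[ℝ] ℝ)
        (fun y : N ↦ TangentSpace J y →L[ℝ] ℝ) (f p₀.1 p₀.2) (f p.1 p.2) (f p₀.1 p₀.2) (f p.1 p.2)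
        (b (f p.1 p.2))) with hGdef
  have h1 : ContMDiffAt (IP.prod I) 𝓘(ℝ, (E' →L[ℝ] ℝ) →L[ℝ] (E →L[ℝ] ℝ)) ∞
      (fun x ↦ ContinuousLinearMap.precomp ℝ (A x)) p₀ := hA.clm_precomp
  -- In trivializations the rescaled pullback is a · Aᵀ G A, a product of smooth operator-valued
  -- functions.
  have key : ContMDiffAt (IP.prod I) 𝓘(ℝ, E →L[ℝ] E →L[ℝ] ℝ) ∞
      (fun x ↦ a x.1 • (ContinuousLinearMap.precomp ℝ (A x)).comp ((G x).comp (A x))) p₀ :=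
    (ha.comp p₀ contMDiffAt_fst).smul (h1.clm_comp (hG.clm_comp hA))
  refine key.congr_of_eventuallyEq ?_
  have hx : ∀ᶠ p : P × M in 𝓝 p₀, p.2 ∈ (chartAt H p₀.2).source :=
    continuousAt_snd.eventually
      ((chartAt H p₀.2).open_source.mem_nhds (mem_chart_source H p₀.2))
  have hfx : ∀ᶠ p : P × M in 𝓝 p₀, f p.1 p.2 ∈ (chartAt H' (f p₀.1 p₀.2)).source :=
    hf'.continuousAt.eventually
      ((chartAt H' (f p₀.1 p₀.2)).open_source.mem_nhds (mem_chart_source H' _))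
  filter_upwards [hx, hfx, hc] with p hx hfx hc
  ext v w
  rw [inCoordinates_apply_eq₂ (by simpa using hx) (by simpa using hx) (by simp)]
  simp only [ContinuousLinearMap.comp_apply, ContinuousLinearMap.precomp_apply,
    smul_apply, smul_eq_mul, hGdef]
  rw [inCoordinates_apply_eq₂ (by simpa using hfx) (by simpa using hfx) (by simp)]
  have hAv : ∀ u : E, (trivializationAt E' (TangentSpace J) (f p₀.1 p₀.2)).symm (f p.1 p.2) (A p u)
      = mfderiv I J (f p.1) p.2 ((trivializationAt E (TangentSpace I) p₀.2).symm p.2 u) := by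
    intro u
    have h : A p = _ := ContinuousLinearMap.inCoordinates_eq (F := E) (E := TangentSpace I)
      (F' := E') (E' := TangentSpace J) (x₀ := p₀.2) (x := p.2) (y₀ := f p₀.1 p₀.2)
      (y := f p.1 p.2) (ϕ := mfderiv I J (f p.1) p.2)
      (by simpa using hx) (by simpa using hfx)
    rw [h]
    simp only [ContinuousLinearMap.comp_apply]
    simpa using (trivializationAt E' (TangentSpace J) (f p₀.1 p₀.2)).symm_apply_apply_mk
      (by simpa using hfx) _
  rw [hAv, hAv, hc]
  change _ = a p.1 * _
  simp

/-- The pullback of a field of bilinear forms is smooth wherever the field and the map are. -/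
theorem contMDiffAt_pullback_form
    {b : ∀ y : N, TangentSpace J y →L[ℝ] TangentSpace J y →L[ℝ] ℝ} {f : M → N} {x₀ : M}
    (hb : ContMDiffAt J (J.prod 𝓘(ℝ, E' →L[ℝ] E' →L[ℝ] ℝ)) ∞
      (fun y ↦ TotalSpace.mk' (E' →L[ℝ] E' →L[ℝ] ℝ) y (b y)) (f x₀))
    (hf : ContMDiffAt I J ∞ f x₀)
    {c : ∀ x : M, TangentSpace I x →L[ℝ] TangentSpace I x →L[ℝ] ℝ}
    (hc : ∀ᶠ x : M in 𝓝 x₀, ∀ v w,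
      c x v w = b (f x) (mfderiv I J f x v) (mfderiv I J f x w)) :
    ContMDiffAt I (I.prod 𝓘(ℝ, E →L[ℝ] E →L[ℝ] ℝ)) ∞
      (fun x : M ↦ TotalSpace.mk' (E →L[ℝ] E →L[ℝ] ℝ) x (c x)) x₀ := by
  have hs : Tendsto Prod.snd (𝓝 ((0 : ℝ), x₀)) (𝓝 x₀) := continuousAt_snd
  have hc' : ∀ᶠ x : M in 𝓝 x₀, ∀ v w,
      c x v w = 1 * b (f x) (mfderiv I J f x v) (mfderiv I J f x w) := by
    filter_upwards [hc] with x h v w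
    rw [h, one_mul]
  -- A single map is a family that is constant in a dummy real parameter.
  have h := contMDiffAt_pullback_form_param (IP := 𝓘(ℝ, ℝ)) (P := ℝ) (f := fun _ ↦ f)
    (p₀ := (0, x₀)) (a := fun _ ↦ (1 : ℝ)) (c := fun _ ↦ c) hb
    (ContMDiffAt.comp (0, x₀) hf contMDiffAt_snd) contMDiffAt_const (hs.eventually hc')
  exact ContMDiffAt.comp (f := fun x : M ↦ ((0 : ℝ), x)) x₀ h (contMDiffAt_const.prodMk contMDiffAt_id)

end

/-- A positive definite quadratic form on a finite-dimensional space has a bounded unit ball. -/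
theorem isVonNBounded_of_pos_def {E : Type*} [NormedAddCommGroup E] [NormedSpace ℝ E]
    [FiniteDimensional ℝ E] (b : E →L[ℝ] E →L[ℝ] ℝ) (hb : ∀ v, v ≠ 0 → 0 < b v v) :
    Bornology.IsVonNBounded ℝ {v : E | b v v < 1} := by
  rw [NormedSpace.isVonNBounded_iff]
  have hcont : Continuous fun v : E ↦ b v v := by fun_prop
  rcases (Metric.sphere (0 : E) 1).eq_empty_or_nonempty with he | hne
  · have : Subsingleton E := by
      by_contra h
      rw [not_subsingleton_iff_nontrivial] at h
      obtain ⟨v, hv⟩ := exists_norm_eq E zero_le_one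
      have : v ∈ Metric.sphere (0 : E) 1 := by simp [hv]
      simp [he] at this
    exact (Set.toFinite _).isBounded
  · obtain ⟨v₀, hv₀, hmin⟩ := (isCompact_sphere (0 : E) 1).exists_isMinOn hne hcont.continuousOn
    set m := b v₀ v₀
    have hm : 0 < m := hb v₀ (by rintro rfl; simp at hv₀)
    -- With m the minimum on the unit sphere, homogeneity gives ‖v‖² ≤ m⁻¹, and x² ≤ a implies x ≤ 1
    -- + a.
    refine (Metric.isBounded_iff_subset_closedBall 0).2 ⟨1 + m⁻¹, fun v hv ↦ ?_⟩
    simp only [mem_ofPred_eq] at hv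
    rw [mem_closedBall_zero_iff]
    by_cases h0 : v = 0
    · simp only [h0, norm_zero]; positivity
    have hn : 0 < ‖v‖ := norm_pos_iff.2 h0
    have h1 : m ≤ b (‖v‖⁻¹ • v) (‖v‖⁻¹ • v) := hmin (by simp [norm_smul, hn.ne'])
    have h2 : b (‖v‖⁻¹ • v) (‖v‖⁻¹ • v) = (‖v‖ ^ 2)⁻¹ * b v v := by
      simp; field_simp
    have h3 : m * ‖v‖ ^ 2 ≤ b v v := by
      rw [h2, inv_mul_eq_div, le_div_iff₀ (by positivity)] at h1; exact h1
    have h4 : ‖v‖ ^ 2 ≤ m⁻¹ := by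
      rw [← one_div, le_div_iff₀ hm]; linarith
    have : 0 < m⁻¹ := inv_pos.2 hm
    nlinarith

/-- The Riemannian metric given by a smooth positive definite symmetric form. -/
noncomputable def Mfd.Metric.ofForm (M : Mfd.{u})
    (b : ∀ x : M, TangentSpace M.I x →L[ℝ] TangentSpace M.I x →L[ℝ] ℝ)
    (symm : ∀ x v w, b x v w = b x w v) (pos : ∀ x v, v ≠ 0 → 0 < b x v v)
    (smooth : ContMDiff M.I (M.I.prod 𝓘(ℝ, M.E →L[ℝ] M.E →L[ℝ] ℝ)) ∞
      (fun x ↦ TotalSpace.mk' (M.E →L[ℝ] M.E →L[ℝ] ℝ) x (b x))) : M.Metric where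
  inner := b
  symm := symm
  pos := pos
  isVonNBounded x := isVonNBounded_of_pos_def (E := M.E) (b x) (pos x)
  contMDiff := smooth

theorem Mfd.Metric.sq_nonneg {M : Mfd.{u}} (g : M.Metric) (x : M) (v : TangentSpace M.I x) :
    0 ≤ g.sq x v := by
  by_cases hv : v = 0
  · simp [Mfd.Metric.sq, hv]
  · exact (g.pos x v hv).le

theorem Mfd.Metric.prod_sq {M N : Mfd.{u}} (g : M.Metric) (h : N.Metric) (p : M × N)
    (v : TangentSpace M.I p.1) (w : TangentSpace N.I p.2) :
    (g.prod h).sq p (v, w) = g.sq p.1 v + h.sq p.2 w := rfl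

/-! ### Gluing a manifold from open pieces whose model spaces are merely isomorphic -/

/-- A cover of a topological space by open pieces of manifolds, with smooth transition maps. -/
structure SmoothCover (X : Type u) [TopologicalSpace X] where
  E : Type
  [normed : NormedAddCommGroup E]
  [space : NormedSpace ℝ E]
  [finDim : FiniteDimensional ℝ E]
  ι : Type
  M : ι → Mfd.{u}
  L : ∀ i, (M i).E ≃L[ℝ] E
  e : ∀ i, OpenPartialHomeomorph (M i) X
  cover : ∀ x, ∃ i, x ∈ (e i).target
  compat : ∀ i j, ContMDiffOn (M i).I (M j).I ∞ ((e j).symm ∘ e i)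
    ((e i).source ∩ e i ⁻¹' (e j).target)

namespace SmoothCover

attribute [instance] normed space finDim

variable {X : Type u} [TopologicalSpace X] (𝒞 : SmoothCover X)

/-- The charts of the pieces, with values in the common model space. -/
noncomputable def pieceChart (i : 𝒞.ι) (m : 𝒞.M i) : OpenPartialHomeomorph (𝒞.M i) 𝒞.E :=
  (chartAt (𝒞.M i).H m).transHomeomorph
    ((𝒞.M i).I.toHomeomorph.trans (𝒞.L i).toHomeomorph)

theorem contMDiffOn_pieceChart (i : 𝒞.ι) (m : 𝒞.M i) :
    ContMDiffOn (𝒞.M i).I 𝓘(ℝ, 𝒞.E) ∞ (𝒞.pieceChart i m) (𝒞.pieceChart i m).source := by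
  have h1 : ContMDiffOn (𝒞.M i).I 𝓘(ℝ, (𝒞.M i).E) ∞ (extChartAt (𝒞.M i).I m)
      (chartAt (𝒞.M i).H m).source := contMDiffOn_extChartAt
  exact (𝒞.L i).contDiff.contMDiff.comp_contMDiffOn h1

theorem contMDiffOn_pieceChart_symm (i : 𝒞.ι) (m : 𝒞.M i) :
    ContMDiffOn 𝓘(ℝ, 𝒞.E) (𝒞.M i).I ∞ (𝒞.pieceChart i m).symm (𝒞.pieceChart i m).target := by
  have h1 : ContMDiffOn 𝓘(ℝ, (𝒞.M i).E) (𝒞.M i).I ∞ (extChartAt (𝒞.M i).I m).symm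
      (extChartAt (𝒞.M i).I m).target := contMDiffOn_extChartAt_symm m
  refine h1.comp (s := (𝒞.pieceChart i m).target) (𝒞.L i).symm.contDiff.contMDiff.contMDiffOn ?_
  intro x hx
  simp only [pieceChart, OpenPartialHomeomorph.transHomeomorph_target, mem_preimage] at hx
  rw [extChartAt_target]
  refine ⟨hx, ?_⟩
  rw [ModelWithCorners.range_eq_univ]; trivial

/-- The charts of the glued manifold. -/
noncomputable def chart (i : 𝒞.ι) (m : 𝒞.M i) : OpenPartialHomeomorph X 𝒞.E :=
  (𝒞.e i).symm.trans (𝒞.pieceChart i m)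

theorem contMDiffOn_comp_chart_symm (i j : 𝒞.ι) (m : 𝒞.M i) :
    ContMDiffOn 𝓘(ℝ, 𝒞.E) (𝒞.M j).I ∞ ((𝒞.e j).symm ∘ (𝒞.chart i m).symm)
      ((𝒞.chart i m).target ∩ (𝒞.chart i m).symm ⁻¹' (𝒞.e j).target) := by
  refine (𝒞.compat i j).comp ((𝒞.contMDiffOn_pieceChart_symm i m).mono ?_) ?_
  · intro x hx
    exact hx.1.1
  · rintro x ⟨⟨h1, h2⟩, h3⟩
    exact ⟨h2, h3⟩

theorem contMDiffOn_transition (i j : 𝒞.ι) (m : 𝒞.M i) (m' : 𝒞.M j) :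
    ContMDiffOn 𝓘(ℝ, 𝒞.E) 𝓘(ℝ, 𝒞.E) ∞ (𝒞.chart j m' ∘ (𝒞.chart i m).symm)
      ((𝒞.chart i m).target ∩ (𝒞.chart i m).symm ⁻¹' (𝒞.chart j m').source) := by
  refine (𝒞.contMDiffOn_pieceChart j m').comp
    ((𝒞.contMDiffOn_comp_chart_symm i j m).mono ?_) ?_
  · rintro x ⟨h1, h2⟩
    exact ⟨h1, h2.1⟩
  · rintro x ⟨h1, h2⟩
    exact h2.2

noncomputable def idx (x : X) : 𝒞.ι := (𝒞.cover x).choose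

theorem mem_target_idx (x : X) : x ∈ (𝒞.e (𝒞.idx x)).target := (𝒞.cover x).choose_spec

@[reducible] noncomputable def chartedSpace : ChartedSpace 𝒞.E X where
  atlas := {c | ∃ i m, c = 𝒞.chart i m}
  chartAt x := 𝒞.chart (𝒞.idx x) ((𝒞.e (𝒞.idx x)).symm x)
  mem_chart_source x := ⟨𝒞.mem_target_idx x, mem_chart_source (𝒞.M (𝒞.idx x)).H _⟩
  chart_mem_atlas _ := ⟨_, _, rfl⟩

theorem isManifold :
    letI := 𝒞.chartedSpace
    IsManifold 𝓘(ℝ, 𝒞.E) ∞ X := by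
  letI := 𝒞.chartedSpace
  apply isManifold_of_contDiffOn
  rintro _ _ ⟨i, m, rfl⟩ ⟨j, m', rfl⟩
  have h := (𝒞.contMDiffOn_transition i j m m').contDiffOn
  refine h.mono ?_
  rintro x ⟨⟨h1, h2⟩, -⟩
  exact ⟨h1, h2⟩

/-- The manifold glued from the pieces of the cover. -/
noncomputable def toMfd [T2Space X] [SecondCountableTopology X] : Mfd.{u} :=
  letI := 𝒞.chartedSpace
  letI := 𝒞.isManifold
  { carrier := X, E := 𝒞.E, H := 𝒞.E, I := 𝓘(ℝ, 𝒞.E) }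

variable [T2Space X] [SecondCountableTopology X]

/-- The pieces of the cover are open pieces of the glued manifold. -/
noncomputable def piece (i : 𝒞.ι) :
    PartialDiffeomorph (𝒞.M i).I 𝒞.toMfd.I (𝒞.M i) 𝒞.toMfd ∞ where
  toPartialEquiv := (𝒞.e i).toPartialEquiv
  open_source := (𝒞.e i).open_source
  open_target := (𝒞.e i).open_target
  contMDiffOn_toFun := by
    intro m hm
    letI := 𝒞.chartedSpace
    have := 𝒞.isManifold
    have hc : 𝒞.chart i m ∈ IsManifold.maximalAtlas 𝓘(ℝ, 𝒞.E) ∞ X :=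
      IsManifold.subset_maximalAtlas ⟨i, m, rfl⟩
    have h1 := contMDiffOn_symm_of_mem_maximalAtlas hc
    have hm' : m ∈ (𝒞.pieceChart i m).source := mem_chart_source (𝒞.M i).H m
    have h2 : ContMDiffOn (𝒞.M i).I 𝓘(ℝ, 𝒞.E) ∞ ((𝒞.chart i m).symm ∘ 𝒞.pieceChart i m)
        ((𝒞.pieceChart i m).source ∩ (𝒞.e i).source) := by
      refine h1.comp ((𝒞.contMDiffOn_pieceChart i m).mono inter_subset_left) ?_
      rintro x ⟨hx, hx'⟩
      refine ⟨(𝒞.pieceChart i m).map_source hx, ?_⟩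
      change (𝒞.pieceChart i m).symm (𝒞.pieceChart i m x) ∈ (𝒞.e i).source
      rw [(𝒞.pieceChart i m).left_inv hx]
      exact hx'
    have ho : ((𝒞.pieceChart i m).source ∩ (𝒞.e i).source) ∈ 𝓝 m :=
      ((𝒞.pieceChart i m).open_source.inter (𝒞.e i).open_source).mem_nhds ⟨hm', hm⟩
    refine ((h2.contMDiffAt ho).congr_of_eventuallyEq ?_).contMDiffWithinAt
    filter_upwards [ho] with x hx
    change 𝒞.e i x = 𝒞.e i ((𝒞.pieceChart i m).symm (𝒞.pieceChart i m x))
    rw [(𝒞.pieceChart i m).left_inv hx.1]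
  contMDiffOn_invFun := by
    intro x hx
    letI := 𝒞.chartedSpace
    have := 𝒞.isManifold
    set m := (𝒞.e i).symm x
    have hc : 𝒞.chart i m ∈ IsManifold.maximalAtlas 𝓘(ℝ, 𝒞.E) ∞ X :=
      IsManifold.subset_maximalAtlas ⟨i, m, rfl⟩
    have h1 := contMDiffOn_of_mem_maximalAtlas hc
    have hx' : x ∈ (𝒞.chart i m).source := ⟨hx, mem_chart_source (𝒞.M i).H m⟩
    have h2 : ContMDiffOn 𝓘(ℝ, 𝒞.E) (𝒞.M i).I ∞ ((𝒞.pieceChart i m).symm ∘ 𝒞.chart i m)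
        (𝒞.chart i m).source :=
      (𝒞.contMDiffOn_pieceChart_symm i m).comp h1 fun y hy ↦ (𝒞.pieceChart i m).map_source hy.2
    have ho : (𝒞.chart i m).source ∈ 𝓝 x := (𝒞.chart i m).open_source.mem_nhds hx'
    refine ((h2.contMDiffAt ho).congr_of_eventuallyEq ?_).contMDiffWithinAt
    filter_upwards [ho] with y hy
    exact ((𝒞.pieceChart i m).left_inv hy.2).symm

end SmoothCover

/-! ### Differentials of partial diffeomorphisms -/

namespace PartialDiffeomorph

variable {E E' H H' M N : Type*} [NormedAddCommGroup E] [NormedSpace ℝ E] [TopologicalSpace H]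
  {I : ModelWithCorners ℝ E H} [NormedAddCommGroup E'] [NormedSpace ℝ E'] [TopologicalSpace H']
  {J : ModelWithCorners ℝ E' H'} [TopologicalSpace M] [ChartedSpace H M]
  [TopologicalSpace N] [ChartedSpace H' N] (Φ : PartialDiffeomorph I J M N ∞)

theorem contMDiffAt {x : M} (hx : x ∈ Φ.source) : ContMDiffAt I J ∞ Φ x :=
  Φ.contMDiffOn_toFun.contMDiffAt (Φ.open_source.mem_nhds hx)

theorem contMDiffAt_invFun {y : N} (hy : y ∈ Φ.target) : ContMDiffAt J I ∞ Φ.invFun y :=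
  Φ.contMDiffOn_invFun.contMDiffAt (Φ.open_target.mem_nhds hy)

theorem mfderiv_invFun_mfderiv {x : M} (hx : x ∈ Φ.source) (v : TangentSpace I x) :
    mfderiv J I Φ.invFun (Φ x) (mfderiv I J Φ x v) = v := by
  have h1 := (Φ.contMDiffAt hx).mdifferentiableAt (by simp)
  have h2 := (Φ.contMDiffAt_invFun (Φ.map_source hx)).mdifferentiableAt (by simp)
  have h : mfderiv I I (Φ.invFun ∘ Φ.toFun) x = ContinuousLinearMap.id ℝ (TangentSpace I x) := by
    rw [← mfderiv_id]
    apply Filter.EventuallyEq.mfderiv_eq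
    filter_upwards [Φ.open_source.mem_nhds hx] with y hy using Φ.left_inv hy
  have h3 := congrArg (fun L : TangentSpace I x →L[ℝ] TangentSpace I x ↦ L v)
    ((mfderiv_comp x h2 h1).symm.trans h)
  exact h3

theorem mfderiv_mfderiv_invFun {y : N} (hy : y ∈ Φ.target) (v : TangentSpace J y) :
    mfderiv I J Φ (Φ.invFun y) (mfderiv J I Φ.invFun y v) = v :=
  Φ.symm.mfderiv_invFun_mfderiv hy v

end PartialDiffeomorph

/-! ### Polar coordinates on the end of an AC manifold -/

namespace ACStructure

variable {Z F : Mfd.{u}} {g : Z.Metric} {κ : F.Metric} {ν : ℝ} (A : ACStructure g κ ν)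

/-- The coordinate of a point of the end in the cross-section. -/
noncomputable def link (z : Z) : F := (A.Φ.invFun z).2

theorem mem_source {r : ℝ} (hr : A.R₀ < r) (f : F) : (r, f) ∈ A.Φ.source := by
  rw [A.source_eq]; exact ⟨hr, trivial⟩

theorem Φ_mem_target {r : ℝ} (hr : A.R₀ < r) (f : F) : A.Φ (r, f) ∈ A.Φ.target :=
  A.Φ.map_source (A.mem_source hr f)

theorem invFun_Φ {r : ℝ} (hr : A.R₀ < r) (f : F) : A.Φ.invFun (A.Φ (r, f)) = (r, f) :=
  A.Φ.left_inv (A.mem_source hr f)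

theorem rho_Φ {r : ℝ} (hr : A.R₀ < r) (f : F) : A.rho (A.Φ (r, f)) = r := by
  rw [rho, if_pos (A.Φ_mem_target hr f), A.invFun_Φ hr]

theorem link_Φ {r : ℝ} (hr : A.R₀ < r) (f : F) : A.link (A.Φ (r, f)) = f := by
  rw [link, A.invFun_Φ hr]

theorem rho_of_mem {z : Z} (hz : z ∈ A.Φ.target) : A.rho z = (A.Φ.invFun z).1 := if_pos hz

theorem mem_target_iff {z : Z} : z ∈ A.Φ.target ↔ A.R₀ < A.rho z := by
  constructor
  · intro hz
    have h := A.Φ.map_target hz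
    rw [A.rho_of_mem hz]
    rw [A.source_eq] at h
    exact h.1
  · intro hz
    by_contra h
    rw [rho, if_neg h] at hz
    exact lt_irrefl _ hz

theorem R₀_le_rho (z : Z) : A.R₀ ≤ A.rho z := by
  by_cases hz : z ∈ A.Φ.target
  · exact (A.mem_target_iff.1 hz).le
  · rw [rho, if_neg hz]

theorem rho_pos (z : Z) : 0 < A.rho z := A.R₀_pos.trans_le (A.R₀_le_rho z)

theorem invFun_eq {z : Z} (hz : A.R₀ < A.rho z) : A.Φ.invFun z = (A.rho z, A.link z) := by
  rw [A.rho_of_mem (A.mem_target_iff.2 hz)]; rfl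

theorem Φ_rho_link {z : Z} (hz : A.R₀ < A.rho z) : A.Φ (A.rho z, A.link z) = z := by
  rw [← A.invFun_eq hz]
  exact A.Φ.right_inv (A.mem_target_iff.2 hz)

theorem setOf_lt_rho {R : ℝ} (hR : A.R₀ ≤ R) : {z | R < A.rho z} = A.Φ '' (Ioi R ×ˢ univ) := by
  ext z
  constructor
  · intro (hz : R < A.rho z)
    exact ⟨(A.rho z, A.link z), ⟨hz, trivial⟩, A.Φ_rho_link (hR.trans_lt hz)⟩
  · rintro ⟨⟨r, f⟩, ⟨hr, -⟩, rfl⟩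
    change R < A.rho _
    rw [A.rho_Φ (hR.trans_lt hr)]
    exact hr

theorem setOf_le_rho {R : ℝ} (hR : A.R₀ < R) : {z | R ≤ A.rho z} = A.Φ '' (Ici R ×ˢ univ) := by
  ext z
  constructor
  · intro (hz : R ≤ A.rho z)
    exact ⟨(A.rho z, A.link z), ⟨hz, trivial⟩, A.Φ_rho_link (hR.trans_le hz)⟩
  · rintro ⟨⟨r, f⟩, ⟨hr, -⟩, rfl⟩
    change R ≤ A.rho _
    rw [A.rho_Φ (hR.trans_le hr)]
    exact hr

theorem isCompact_rho_le {R : ℝ} (hR : A.R₀ < R) : IsCompact {z | A.rho z ≤ R} := by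
  have h : {z | A.rho z ≤ R} = (A.Φ '' (Ioi R ×ˢ univ))ᶜ := by
    rw [← A.setOf_lt_rho hR.le]; ext z; simp
  rw [h]
  exact A.isCompact_compl R hR

/-- Strict superlevel sets beyond R₀ are images of open sets under Φ, and strict sublevel sets are
complements of the closed sets {ρ ≥ b}. The closedness of the latter is what makes the extension by
the constant R₀ continuous. -/
theorem continuous_rho : Continuous A.rho := by
  rw [continuous_iff_continuousAt]
  intro z
  refine tendsto_order.2 ⟨fun b hb ↦ ?_, fun b hb ↦ ?_⟩
  · by_cases h : b < A.R₀
    · exact Eventually.of_forall fun y ↦ h.trans_le (A.R₀_le_rho y)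
    · have ho : IsOpen {z | b < A.rho z} := by
        rw [A.setOf_lt_rho (not_lt.1 h)]
        refine A.Φ.toOpenPartialHomeomorph.isOpen_image_of_subset_source
          (isOpen_Ioi.prod isOpen_univ) ?_
        change _ ⊆ A.Φ.source
        rw [A.source_eq]
        exact prod_mono (Ioi_subset_Ioi (not_lt.1 h)) subset_rfl
      exact ho.mem_nhds hb
  · have hb' : A.R₀ < b := (A.R₀_le_rho z).trans_lt hb
    have ho : IsOpen {z | A.rho z < b} := by
      have h : {z | A.rho z < b} = (A.Φ '' (Ici b ×ˢ univ))ᶜ := by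
        rw [← A.setOf_le_rho hb']; ext z; simp
      rw [h]
      exact (A.isClosed_end b hb').isOpen_compl
    exact ho.mem_nhds hb

theorem eventually_lt_rho {z : Z} {R : ℝ} (hz : R < A.rho z) : ∀ᶠ y in 𝓝 z, R < A.rho y :=
  A.continuous_rho.continuousAt.eventually (lt_mem_nhds hz)

theorem eventually_rho_lt {z : Z} {R : ℝ} (hz : A.rho z < R) : ∀ᶠ y in 𝓝 z, A.rho y < R :=
  A.continuous_rho.continuousAt.eventually (gt_mem_nhds hz)

theorem contMDiffAt_rho {z : Z} (hz : A.R₀ < A.rho z) : ContMDiffAt Z.I 𝓘(ℝ, ℝ) ∞ A.rho z := by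
  refine (contMDiffAt_fst.comp z (A.Φ.contMDiffAt_invFun
    (A.mem_target_iff.2 hz))).congr_of_eventuallyEq ?_
  filter_upwards [A.eventually_lt_rho hz] with y hy
  exact A.rho_of_mem (A.mem_target_iff.2 hy)

theorem contMDiffAt_link {z : Z} (hz : A.R₀ < A.rho z) : ContMDiffAt Z.I F.I ∞ A.link z :=
  contMDiffAt_snd.comp z (A.Φ.contMDiffAt_invFun (A.mem_target_iff.2 hz))

/-- A smooth function of the radius which is constant near the compact part is smooth. -/
theorem contMDiff_comp_rho {β : ℝ → ℝ} (hβ : ContDiff ℝ ∞ β) {K c : ℝ} (hK : A.R₀ < K)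
    (hc : ∀ t < K, β t = c) : ContMDiff Z.I 𝓘(ℝ, ℝ) ∞ fun z ↦ β (A.rho z) := by
  intro z
  by_cases hz : A.R₀ < A.rho z
  · exact hβ.contMDiff.contMDiffAt.comp z (A.contMDiffAt_rho hz)
  · refine (contMDiffAt_const (c := c)).congr_of_eventuallyEq ?_
    filter_upwards [A.eventually_rho_lt ((not_lt.1 hz).trans_lt hK)] with y hy using hc _ hy

/-- The radial component of a tangent vector at a point of the end. -/
noncomputable def radial (z : Z) (X : TangentSpace Z.I z) : ℝ :=
  (mfderiv Z.I (𝓘(ℝ, ℝ).prod F.I) A.Φ.invFun z X).1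

/-- The component along the cross-section of a tangent vector at a point of the end. -/
noncomputable def angular (z : Z) (X : TangentSpace Z.I z) : TangentSpace F.I (A.link z) :=
  (mfderiv Z.I (𝓘(ℝ, ℝ).prod F.I) A.Φ.invFun z X).2

theorem mfderiv_Φ_radial_angular {z : Z} (hz : A.R₀ < A.rho z) (X : TangentSpace Z.I z) :
    mfderiv (𝓘(ℝ, ℝ).prod F.I) Z.I A.Φ (A.rho z, A.link z) (A.radial z X, A.angular z X) = X := by
  have h := A.Φ.mfderiv_mfderiv_invFun (A.mem_target_iff.2 hz) X
  rw [A.invFun_eq hz] at h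
  exact h

theorem radial_mfderiv_Φ {r : ℝ} (hr : A.R₀ < r) (f : F) (a : ℝ) (b : TangentSpace F.I f) :
    A.radial (A.Φ (r, f)) (mfderiv (𝓘(ℝ, ℝ).prod F.I) Z.I A.Φ (r, f) (a, b)) = a :=
  congrArg Prod.fst (A.Φ.mfderiv_invFun_mfderiv (A.mem_source hr f) (a, b))

theorem angular_mfderiv_Φ {r : ℝ} (hr : A.R₀ < r) (f : F) (a : ℝ) (b : TangentSpace F.I f) :
    (A.angular (A.Φ (r, f)) (mfderiv (𝓘(ℝ, ℝ).prod F.I) Z.I A.Φ (r, f) (a, b)) : F.E) = b :=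
  congrArg Prod.snd (A.Φ.mfderiv_invFun_mfderiv (A.mem_source hr f) (a, b))

theorem mfderiv_rho {z : Z} (hz : A.R₀ < A.rho z) (X : TangentSpace Z.I z) :
    mfderiv Z.I 𝓘(ℝ, ℝ) A.rho z X = A.radial z X := by
  have h1 := (A.Φ.contMDiffAt_invFun (A.mem_target_iff.2 hz)).mdifferentiableAt (by simp)
  have h : HasMFDerivAt Z.I 𝓘(ℝ, ℝ) A.rho z ((ContinuousLinearMap.fst ℝ ℝ F.E).comp
      (mfderiv Z.I (𝓘(ℝ, ℝ).prod F.I) A.Φ.invFun z)) := by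
    refine ((hasMFDerivAt_fst (I := 𝓘(ℝ, ℝ)) (I' := F.I) _).comp z
      h1.hasMFDerivAt).congr_of_eventuallyEq ?_
    filter_upwards [A.eventually_lt_rho hz] with y hy
    exact A.rho_of_mem (A.mem_target_iff.2 hy)
  rw [h.mfderiv]
  rfl

theorem mfderiv_link {z : Z} (hz : A.R₀ < A.rho z) (X : TangentSpace Z.I z) :
    mfderiv Z.I F.I A.link z X = A.angular z X := by
  have h1 := (A.Φ.contMDiffAt_invFun (A.mem_target_iff.2 hz)).mdifferentiableAt (by simp)
  have h : HasMFDerivAt Z.I F.I A.link z ((ContinuousLinearMap.snd ℝ ℝ F.E).comp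
      (mfderiv Z.I (𝓘(ℝ, ℝ).prod F.I) A.Φ.invFun z)) :=
    (hasMFDerivAt_snd (I := 𝓘(ℝ, ℝ)) (I' := F.I) _).comp z h1.hasMFDerivAt
  rw [h.mfderiv]
  rfl

/-- The exact cone metric on the end, as a field of bilinear forms. -/
noncomputable def coneForm (z : Z) : TangentSpace Z.I z →L[ℝ] TangentSpace Z.I z →L[ℝ] ℝ :=
  let L : Z.E →L[ℝ] ℝ × F.E := mfderiv Z.I (𝓘(ℝ, ℝ).prod F.I) A.Φ.invFun z
  let B : ℝ × F.E →L[ℝ] ℝ × F.E →L[ℝ] ℝ :=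
    (ContinuousLinearMap.mul ℝ ℝ).bilinearComp (ContinuousLinearMap.fst ℝ ℝ F.E)
      (ContinuousLinearMap.fst ℝ ℝ F.E) +
    A.rho z ^ 2 • (show F.E →L[ℝ] F.E →L[ℝ] ℝ from κ.inner (A.link z)).bilinearComp
      (ContinuousLinearMap.snd ℝ ℝ F.E) (ContinuousLinearMap.snd ℝ ℝ F.E)
  (B.bilinearComp L L : Z.E →L[ℝ] Z.E →L[ℝ] ℝ)

theorem coneForm_apply (z : Z) (X Y : TangentSpace Z.I z) : A.coneForm z X Y =
    A.radial z X * A.radial z Y +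
      A.rho z ^ 2 * κ.inner (A.link z) (A.angular z X) (A.angular z Y) := rfl

/-- Valid off the end as well, where the value is junk: by its formula the form is a square plus a
nonnegative multiple of κ. -/
theorem coneForm_nonneg (z : Z) (X : TangentSpace Z.I z) : 0 ≤ A.coneForm z X X := by
  rw [coneForm_apply]
  have h : 0 ≤ κ.inner (A.link z) (A.angular z X) (A.angular z X) := κ.sq_nonneg _ _
  nlinarith [mul_self_nonneg (A.radial z X), sq_nonneg (A.rho z), mul_nonneg (sq_nonneg (A.rho z)) h]

theorem coneForm_symm (z : Z) (X Y : TangentSpace Z.I z) :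
    A.coneForm z X Y = A.coneForm z Y X := by
  rw [coneForm_apply, coneForm_apply, κ.symm, mul_comm (A.radial z X)]

theorem sq_radial_le_coneForm (z : Z) (X : TangentSpace Z.I z) :
    A.radial z X ^ 2 ≤ A.coneForm z X X := by
  rw [coneForm_apply]
  have h : 0 ≤ κ.inner (A.link z) (A.angular z X) (A.angular z X) := κ.sq_nonneg _ _
  nlinarith [mul_nonneg (sq_nonneg (A.rho z)) h]

/-- The AC condition without coordinates: each tangent vector at a point of the end is the image of
its radial and angular components. The constant is enlarged to be positive. -/
theorem abs_sq_sub_coneForm_le : ∃ C : ℝ, 0 < C ∧ ∀ z, A.R₀ < A.rho z → ∀ X,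
    |g.sq z X - A.coneForm z X X| ≤ C * A.rho z ^ (-ν) * A.coneForm z X X := by
  obtain ⟨C, hC⟩ := A.asymptotic
  refine ⟨max C 1, by positivity, fun z hz X ↦ ?_⟩
  have h := hC (A.rho z) hz (A.link z) (A.radial z X) (A.angular z X)
  rw [A.mfderiv_Φ_radial_angular hz, A.Φ_rho_link hz] at h
  have h2 : A.radial z X ^ 2 + A.rho z ^ 2 * κ.sq (A.link z) (A.angular z X) =
    A.coneForm z X X := by rw [coneForm_apply, sq (A.radial z X)]; rfl
  rw [h2] at h
  refine h.trans ?_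
  have := A.coneForm_nonneg z X
  have := Real.rpow_nonneg (A.rho_pos z).le (-ν)
  gcongr
  exact le_max_left _ _

end ACStructure

/-! ### The smoothed radius on the real line -/

open Real (smoothTransition)

/-- A smooth function which is `K` for `t ≤ K` and `t` for `t ≥ 2 K`. -/
noncomputable def smoothRadius (K t : ℝ) : ℝ := K + (t - K) * smoothTransition ((t - K) / K)

theorem contDiff_smoothRadius (K : ℝ) : ContDiff ℝ ∞ (smoothRadius K) := by
  unfold smoothRadius
  have : ContDiff ℝ ∞ smoothTransition := Real.smoothTransition.contDiff
  fun_prop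

section
variable {K t : ℝ} (hK : 0 < K)
include hK

theorem smoothRadius_of_le (ht : t ≤ K) : smoothRadius K t = K := by
  rw [smoothRadius, Real.smoothTransition.zero_of_nonpos, mul_zero, add_zero]
  exact div_nonpos_of_nonpos_of_nonneg (by linarith) hK.le

theorem smoothRadius_of_ge (ht : 2 * K ≤ t) : smoothRadius K t = t := by
  rw [smoothRadius, Real.smoothTransition.one_of_one_le, mul_one, add_sub_cancel]
  rw [le_div_iff₀ hK]; linarith

theorem le_smoothRadius : K ≤ smoothRadius K t := by
  rcases le_total t K with h | h
  · rw [smoothRadius_of_le hK h]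
  · have := Real.smoothTransition.nonneg ((t - K) / K)
    rw [smoothRadius]; nlinarith

theorem smoothRadius_lt (ht : t < 2 * K) : smoothRadius K t < 2 * K := by
  rcases le_total t K with h | h
  · rw [smoothRadius_of_le hK h]; linarith
  · have := Real.smoothTransition.le_one ((t - K) / K)
    rw [smoothRadius]; nlinarith

theorem smoothRadius_le_max : smoothRadius K t ≤ max t K := by
  rcases le_total t K with h | h
  · rw [smoothRadius_of_le hK h]; exact le_max_right _ _
  · have := Real.smoothTransition.le_one ((t - K) / K)
    refine le_trans ?_ (le_max_left _ _)
    rw [smoothRadius]; nlinarith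

/-- The derivative is 0 below K and 1 above 2K, and it is bounded on the compact interval between.
-/
theorem exists_deriv_smoothRadius_le : ∃ C : ℝ, 1 ≤ C ∧ ∀ t, |deriv (smoothRadius K) t| ≤ C := by
  have hc : Continuous (deriv (smoothRadius K)) :=
    (contDiff_smoothRadius K).continuous_deriv (by simp)
  obtain ⟨C, hC⟩ := (isCompact_Icc (a := K) (b := 2 * K)).exists_bound_of_continuousOn hc.continuousOn
  refine ⟨max C 1, le_max_right _ _, fun t ↦ ?_⟩
  by_cases h1 : t < K
  · have : smoothRadius K =ᶠ[𝓝 t] fun _ ↦ K := by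
      filter_upwards [gt_mem_nhds h1] with s hs using smoothRadius_of_le hK hs.le
    rw [this.deriv_eq, deriv_const, abs_zero]; positivity
  by_cases h2 : 2 * K < t
  · have : smoothRadius K =ᶠ[𝓝 t] fun s ↦ s := by
      filter_upwards [lt_mem_nhds h2] with s hs using smoothRadius_of_ge hK hs.le
    rw [this.deriv_eq]; simp
  · exact (hC t ⟨not_lt.1 h1, not_lt.1 h2⟩).trans (le_max_left _ _)

end

/-! ### Changes of radii -/

/-- A smooth nondecreasing function which is `0` for `u ≤ 2 K` and `u / (10 K)` for `u ≥ 3 K`. -/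
noncomputable def radialRate (K u : ℝ) : ℝ :=
  u / (10 * K) * smoothTransition ((u - 2 * K) / K)

/-- A family of increasing bijections of `ℝ`, the identity for `u ≤ 2 K` and multiplication by
`r / (10 K)` for `u ≥ 3 K`. -/
noncomputable def stretch (K r u : ℝ) : ℝ := u + (r - 10 * K) * radialRate K u

theorem contDiff_radialRate (K : ℝ) : ContDiff ℝ ∞ (radialRate K) := by
  unfold radialRate
  have : ContDiff ℝ ∞ smoothTransition := Real.smoothTransition.contDiff
  fun_prop

theorem contDiff_stretch (K : ℝ) : ContDiff ℝ ∞ fun p : ℝ × ℝ ↦ stretch K p.1 p.2 := by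
  unfold stretch
  have := contDiff_radialRate K
  fun_prop

theorem hasDerivAt_stretch (K r u : ℝ) :
    HasDerivAt (fun r ↦ stretch K r u) (radialRate K u) r := by
  unfold stretch
  simpa using (((hasDerivAt_id r).sub_const (10 * K)).mul_const (radialRate K u)).const_add u

section
variable {K u r : ℝ} (hK : 0 < K)
include hK

theorem radialRate_of_le (hu : u ≤ 2 * K) : radialRate K u = 0 := by
  rw [radialRate, Real.smoothTransition.zero_of_nonpos, mul_zero]
  exact div_nonpos_of_nonpos_of_nonneg (by linarith) hK.le

theorem radialRate_of_ge (hu : 3 * K ≤ u) : radialRate K u = u / (10 * K) := by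
  rw [radialRate, Real.smoothTransition.one_of_one_le, mul_one]
  rw [le_div_iff₀ hK]; linarith

/-- The function vanishes up to 2K and is a product of nonnegative nondecreasing factors beyond.
Monotonicity makes `stretch K r` a strictly increasing perturbation of the identity as soon as r ≥
10K. -/
theorem radialRate_monotone : Monotone (radialRate K) := by
  intro a b hab
  by_cases ha : a ≤ 2 * K
  · rw [radialRate_of_le hK ha]
    by_cases hb : b ≤ 2 * K
    · rw [radialRate_of_le hK hb]
    · have : 0 ≤ b := by linarith
      exact mul_nonneg (by positivity) (Real.smoothTransition.nonneg _)
  · have : 0 ≤ a := by linarith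
    have : 0 ≤ b := by linarith
    unfold radialRate
    have := Real.smoothTransition.nonneg ((a - 2 * K) / K)
    have h : smoothTransition ((a - 2 * K) / K) ≤ smoothTransition ((b - 2 * K) / K) :=
      Real.smoothTransition.monotone (by gcongr)
    gcongr

theorem radialRate_nonneg : 0 ≤ radialRate K u := by
  rcases le_total u (2 * K) with h | h
  · rw [radialRate_of_le hK h]
  · exact (radialRate_of_le hK le_rfl).symm.le.trans (radialRate_monotone hK h)

theorem radialRate_le (hu : 0 ≤ u) : radialRate K u ≤ u / (10 * K) :=
  mul_le_of_le_one_right (by positivity) (Real.smoothTransition.le_one _)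

theorem stretch_of_le (hu : u ≤ 2 * K) : stretch K r u = u := by
  rw [stretch, radialRate_of_le hK hu, mul_zero, add_zero]

theorem stretch_of_ge (hu : 3 * K ≤ u) : stretch K r u = r / (10 * K) * u := by
  rw [stretch, radialRate_of_ge hK hu]; field_simp; ring

theorem stretch_strictMono (hr : 10 * K ≤ r) : StrictMono (stretch K r) := by
  intro a b hab
  have := radialRate_monotone hK hab.le
  unfold stretch
  nlinarith

theorem le_stretch (hr : 10 * K ≤ r) : u ≤ stretch K r u := by
  have := radialRate_nonneg (u := u) hK
  unfold stretch
  nlinarith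

theorem stretch_surjective (hr : 10 * K ≤ r) : Function.Surjective (stretch K r) := by
  intro x
  have hc : Continuous (stretch K r) :=
    (contDiff_stretch K).continuous.comp (by fun_prop : Continuous fun u : ℝ ↦ (r, u))
  have h1 : stretch K r (min x (2 * K)) ≤ x := by
    rw [stretch_of_le hK (min_le_right _ _)]; exact min_le_left _ _
  exact mem_range_of_exists_le_of_exists_ge hc ⟨_, h1⟩ ⟨x, le_stretch hK hr⟩

/-- The left-over u − 10K · `radialRate K u` equals `stretch K r u - r * radialRate K u` for every
r. It measures how far the motion of the radius is from pure dilation, and it is the offset s − rφ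
of `flow_estimate`. -/
theorem stretch_offset_nonneg (hu : 0 ≤ u) : 0 ≤ u - 10 * K * radialRate K u := by
  have := radialRate_le hK hu
  rw [le_div_iff₀ (by positivity)] at this
  linarith

/-- From 3K on the stretching is an exact dilation and the offset vanishes, so it is bounded
independently of r and u. -/
theorem stretch_offset_le : u - 10 * K * radialRate K u ≤ 3 * K := by
  rcases le_total u (3 * K) with h | h
  · have := radialRate_nonneg (u := u) hK
    nlinarith
  · rw [radialRate_of_ge hK h]
    have : u - 10 * K * (u / (10 * K)) = 0 := by field_simp; ring
    linarith

end

/-- The inverse of `stretch K r`. -/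
noncomputable def unstretch (K r : ℝ) : ℝ → ℝ := Function.invFun (stretch K r)

section
variable {K u x r : ℝ} (hK : 0 < K)
include hK

theorem unstretch_stretch (hr : 10 * K ≤ r) : unstretch K r (stretch K r u) = u :=
  Function.leftInverse_invFun (stretch_strictMono hK hr).injective u

theorem stretch_unstretch (hr : 10 * K ≤ r) : stretch K r (unstretch K r x) = x :=
  Function.rightInverse_invFun (stretch_surjective hK hr) x

theorem unstretch_strictMono (hr : 10 * K ≤ r) : StrictMono (unstretch K r) := by
  intro a b hab
  rwa [← (stretch_strictMono hK hr).lt_iff_lt, stretch_unstretch hK hr, stretch_unstretch hK hr]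

theorem unstretch_of_le (hr : 10 * K ≤ r) (hx : x ≤ 2 * K) : unstretch K r x = x := by
  conv_lhs => rw [← stretch_of_le (r := r) hK hx]
  exact unstretch_stretch hK hr

/-- The threshold 3r/10 is the image of 3K under `stretch K r`. -/
theorem unstretch_of_ge (hr : 10 * K ≤ r) (hx : 3 / 10 * r ≤ x) :
    unstretch K r x = 10 * K / r * x := by
  have hr0 : 0 < r := by linarith
  have h : stretch K r (10 * K / r * x) = x := by
    rw [stretch_of_ge hK]
    · field_simp
    · rw [div_mul_eq_mul_div, le_div_iff₀ hr0]; nlinarith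
  conv_lhs => rw [← h]
  exact unstretch_stretch hK hr

/-- Implicit function theorem for `stretch K r u - x = 0`: the derivative in u is 1 plus the
derivative of a nondecreasing function, hence nonzero. Injectivity identifies the implicit solution
with `unstretch`, which is therefore smooth jointly in r and x. -/
theorem contDiffAt_unstretch (hr : 10 * K < r) :
    ContDiffAt ℝ ∞ (fun p : ℝ × ℝ ↦ unstretch K p.1 p.2) (r, x) := by
  set u := unstretch K r x
  set f : (ℝ × ℝ) × ℝ → ℝ := fun q ↦ stretch K q.1.1 q.2 - q.1.2
  have hf : ContDiff ℝ ∞ f := by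
    have h := (contDiff_stretch K).comp
      (by fun_prop : ContDiff ℝ ∞ fun q : (ℝ × ℝ) × ℝ ↦ (q.1.1, q.2))
    exact h.sub (by fun_prop)
  have hfu : f ((r, x), u) = 0 := by
    simp only [f, u]; rw [stretch_unstretch hK hr.le]; simp
  have hd : HasFDerivAt f (fderiv ℝ f ((r, x), u)) ((r, x), u) :=
    (hf.differentiable (by simp) _).hasFDerivAt
  have hd2 : HasDerivAt (fun v ↦ f ((r, x), v)) (fderiv ℝ f ((r, x), u) (0, 1)) u := by
    have h := hd.comp_hasDerivAt u ((hasDerivAt_const u (r, x)).prodMk (hasDerivAt_id u))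
    exact h
  have hmono : Monotone fun v ↦ (r - 10 * K) * radialRate K v :=
    fun a b hab ↦ mul_le_mul_of_nonneg_left (radialRate_monotone hK hab) (by linarith)
  have hd3 : DifferentiableAt ℝ (fun v ↦ (r - 10 * K) * radialRate K v) u :=
    ((contDiff_radialRate K).differentiable (by simp) u).const_mul _
  have hd4 : HasDerivAt (fun v ↦ f ((r, x), v))
      (1 + deriv (fun v ↦ (r - 10 * K) * radialRate K v) u) u := by
    have := ((hasDerivAt_id u).add hd3.hasDerivAt).sub_const x
    exact this
  have hpos : fderiv ℝ f ((r, x), u) (0, 1) ≠ 0 := by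
    rw [hd2.unique hd4]
    have := hmono.deriv_nonneg (x := u)
    linarith
  have hinv : (fderiv ℝ f ((r, x), u) ∘L .inr ℝ (ℝ × ℝ) ℝ).IsInvertible :=
    ⟨ContinuousLinearEquiv.unitsEquivAut ℝ (Units.mk0 _ hpos), by ext; simp⟩
  have hfa : ContDiffAt ℝ ∞ f ((r, x), u) := hf.contDiffAt
  refine (hfa.contDiffAt_implicitFunction (by simp) hinv).congr_of_eventuallyEq ?_
  have hev := hfa.eventually_apply_implicitFunction (by simp) hinv
  have hr' : ∀ᶠ p : ℝ × ℝ in 𝓝 (r, x), 10 * K < p.1 :=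
    continuousAt_fst.eventually (lt_mem_nhds hr)
  filter_upwards [hev, hr'] with p hp hpr
  rw [hfu, sub_eq_zero] at hp
  conv_lhs => rw [← hp]
  exact unstretch_stretch hK hpr.le

end

/-! ### The smoothed radius and radial maps on an AC manifold -/

namespace ACStructure

variable {Z F : Mfd.{u}} {g : Z.Metric} {κ : F.Metric} {ν : ℝ} (A : ACStructure g κ ν) {K : ℝ}

/-- The smooth radial function: `K` on the compact part, and `ρ` for `ρ ≥ 2 K`. -/
noncomputable def sigma (K : ℝ) (z : Z) : ℝ := smoothRadius K (A.rho z)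

theorem contMDiff_sigma (hK : A.R₀ < K) : ContMDiff Z.I 𝓘(ℝ, ℝ) ∞ (A.sigma K) :=
  A.contMDiff_comp_rho (contDiff_smoothRadius K) hK
    fun _ ht ↦ smoothRadius_of_le (A.R₀_pos.trans hK) ht.le

section
variable (hK : 0 < K) {z : Z}
include hK

theorem sigma_of_ge (hz : 2 * K ≤ A.rho z) : A.sigma K z = A.rho z := smoothRadius_of_ge hK hz

theorem le_sigma : K ≤ A.sigma K z := le_smoothRadius hK

/-- `smoothRadius K` stays below 2K on arguments below 2K, so thresholds from 2K on do not see the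
smoothing. -/
theorem le_rho_iff {R : ℝ} (hR : 2 * K ≤ R) : R ≤ A.rho z ↔ R ≤ A.sigma K z := by
  constructor
  · intro h; rwa [A.sigma_of_ge hK (hR.trans h)]
  · intro h
    have : 2 * K ≤ A.rho z := by
      by_contra hlt
      have := smoothRadius_lt hK (not_le.1 hlt)
      rw [sigma] at h; linarith
    rwa [A.sigma_of_ge hK this] at h

theorem lt_rho_iff {R : ℝ} (hR : 2 * K ≤ R) : R < A.rho z ↔ R < A.sigma K z := by
  constructor
  · intro h; rwa [A.sigma_of_ge hK (hR.trans h.le)]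
  · intro h
    rwa [← A.sigma_of_ge hK ((A.le_rho_iff hK le_rfl).2 (hR.trans h.le))]

theorem rho_eq_sigma (hz : 2 * K ≤ A.sigma K z) : A.rho z = A.sigma K z :=
  (A.sigma_of_ge hK ((A.le_rho_iff hK le_rfl).2 hz)).symm

theorem sigma_Φ {r : ℝ} (hr : 2 * K ≤ r) (hR : A.R₀ < K) (f : F) : A.sigma K (A.Φ (r, f)) = r := by
  have h := A.rho_Φ (by linarith : A.R₀ < r) f
  rw [A.sigma_of_ge hK (by rwa [h]), h]

theorem rho_le_of_sigma_le {R : ℝ} (h : A.sigma K z ≤ R) : A.rho z ≤ max R (2 * K) := by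
  by_contra hlt
  have h2 := not_le.1 hlt
  have h3 : max R (2 * K) < A.sigma K z := (A.lt_rho_iff hK (le_max_right _ _)).1 h2
  exact absurd h (not_le.2 ((le_max_left _ _).trans_lt h3))

end

theorem isCompact_sigma_le (hK : A.R₀ < K) (R : ℝ) : IsCompact {z | A.sigma K z ≤ R} := by
  have h0 : 0 < K := A.R₀_pos.trans hK
  refine (A.isCompact_rho_le (R := max R (2 * K)) ?_).of_isClosed_subset
    (isClosed_le (A.contMDiff_sigma hK).continuous continuous_const)
    fun z hz ↦ A.rho_le_of_sigma_le h0 hz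
  exact lt_of_lt_of_le (by linarith) (le_max_right _ _)

theorem contMDiffAt_Φ {E' H' M : Type*} [NormedAddCommGroup E'] [NormedSpace ℝ E']
    [TopologicalSpace H'] {J : ModelWithCorners ℝ E' H'} [TopologicalSpace M] [ChartedSpace H' M]
    {a : M → ℝ} {b : M → F} {x : M} (hx : A.R₀ < a x)
    (ha : ContMDiffAt J 𝓘(ℝ, ℝ) ∞ a x) (hb : ContMDiffAt J F.I ∞ b x) :
    ContMDiffAt J Z.I ∞ (fun y ↦ A.Φ (a y, b y)) x :=
  (A.Φ.contMDiffAt (A.mem_source hx (b x))).comp x (ha.prodMk hb)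

open Classical in
/-- The map which acts on the radius by `p` beyond `2 K`, and is the identity elsewhere. -/
noncomputable def radialMap (K : ℝ) (p : ℝ → ℝ) (z : Z) : Z :=
  if 2 * K < A.rho z then A.Φ (p (A.rho z), A.link z) else z

theorem radialMap_of_le {p : ℝ → ℝ} {z : Z} (hz : A.rho z ≤ 2 * K) : A.radialMap K p z = z :=
  if_neg (not_lt.2 hz)

/-- On the end both branches are given by one formula, because p fixes the radii up to 2K. This is
why the map is smooth across ρ = 2K. -/
theorem radialMap_of_lt {p : ℝ → ℝ} (hid : ∀ u ≤ 2 * K, p u = u) {z : Z} (hz : A.R₀ < A.rho z) :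
    A.radialMap K p z = A.Φ (p (A.rho z), A.link z) := by
  by_cases h : 2 * K < A.rho z
  · exact if_pos h
  · rw [A.radialMap_of_le (not_lt.1 h), hid _ (not_lt.1 h), A.Φ_rho_link hz]

section
variable (hK : A.R₀ < K) {p : ℝ → ℝ} (hid : ∀ u ≤ 2 * K, p u = u) (hp : StrictMono p)
include hK hid hp

theorem lt_radial_of_lt {u : ℝ} (hu : 2 * K < u) : 2 * K < p u := by
  have := hp hu
  rwa [hid _ le_rfl] at this

theorem R₀_lt_radial {u : ℝ} (hu : A.R₀ < u) : A.R₀ < p u := by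
  have h0 : 0 < K := A.R₀_pos.trans hK
  rcases le_or_gt u (2 * K) with h | h
  · rwa [hid u h]
  · have := A.lt_radial_of_lt hK hid hp h; linarith

theorem rho_radialMap {z : Z} : A.rho (A.radialMap K p z) = p (A.rho z) := by
  have h0 : 0 < K := A.R₀_pos.trans hK
  by_cases h : 2 * K < A.rho z
  · rw [A.radialMap_of_lt hid (by linarith), A.rho_Φ]
    have := A.lt_radial_of_lt hK hid hp h; linarith
  · rw [A.radialMap_of_le (not_lt.1 h), hid _ (not_lt.1 h)]

theorem link_radialMap {z : Z} : A.link (A.radialMap K p z) = A.link z := by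
  have h0 : 0 < K := A.R₀_pos.trans hK
  by_cases h : 2 * K < A.rho z
  · rw [A.radialMap_of_lt hid (by linarith), A.link_Φ]
    have := A.lt_radial_of_lt hK hid hp h; linarith
  · rw [A.radialMap_of_le (not_lt.1 h)]

/-- The smoothing only concerns radii below 2K, which p fixes, so σ is transformed by p just as ρ
is. -/
theorem sigma_radialMap {z : Z} : A.sigma K (A.radialMap K p z) = p (A.sigma K z) := by
  have h0 : 0 < K := A.R₀_pos.trans hK
  by_cases h : 2 * K < A.rho z
  · have h2 := A.lt_radial_of_lt hK hid hp h
    rw [A.sigma_of_ge h0 (by rw [A.rho_radialMap hK hid hp]; exact h2.le),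
      A.rho_radialMap hK hid hp, A.sigma_of_ge h0 h.le]
  · rw [A.radialMap_of_le (not_lt.1 h), hid]
    by_contra hh
    exact h ((A.lt_rho_iff h0 le_rfl).2 (not_le.1 hh))

theorem radialMap_radialMap {q : ℝ → ℝ} (hid' : ∀ u ≤ 2 * K, q u = u) (hpq : ∀ u, q (p u) = u)
    (z : Z) : A.radialMap K q (A.radialMap K p z) = z := by
  have h0 : 0 < K := A.R₀_pos.trans hK
  by_cases h : 2 * K < A.rho z
  · have h1 := A.rho_radialMap hK hid hp (z := z)
    have h2 := A.lt_radial_of_lt hK hid hp h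
    rw [A.radialMap_of_lt hid' (z := A.radialMap K p z) (by rw [h1]; linarith), h1,
      A.link_radialMap hK hid hp, hpq, A.Φ_rho_link (by linarith)]
  · rw [A.radialMap_of_le (z := z) (not_lt.1 h), A.radialMap_of_le (not_lt.1 h)]

end

/-- On the end the formula of `radialMap_of_lt` is smooth; where ρ ≤ R₀ the map is locally the
identity. -/
theorem contMDiffAt_radialMap (hK : A.R₀ < K) {p : ℝ → ℝ → ℝ} {r : ℝ}
    (hid : ∀ᶠ r' in 𝓝 r, ∀ u ≤ 2 * K, p r' u = u) (hp : StrictMono (p r))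
    (hs : ∀ x, ContDiffAt ℝ ∞ (fun q : ℝ × ℝ ↦ p q.1 q.2) (r, x)) (z : Z) :
    ContMDiffAt (𝓘(ℝ, ℝ).prod Z.I) Z.I ∞ (fun q : ℝ × Z ↦ A.radialMap K (p q.1) q.2) (r, z) := by
  have h0 : 0 < K := A.R₀_pos.trans hK
  have hc : Tendsto Prod.snd (𝓝 (r, z)) (𝓝 z) := continuousAt_snd
  have hc' : Tendsto Prod.fst (𝓝 (r, z)) (𝓝 r) := continuousAt_fst
  by_cases h : A.R₀ < A.rho z
  · have h1 : ContMDiffAt (𝓘(ℝ, ℝ).prod Z.I) 𝓘(ℝ, ℝ) ∞ (fun q : ℝ × Z ↦ p q.1 (A.rho q.2))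
        (r, z) := by
      have h2 : ContMDiffAt (𝓘(ℝ, ℝ).prod Z.I) 𝓘(ℝ, ℝ × ℝ) ∞
          (fun q : ℝ × Z ↦ (q.1, A.rho q.2)) (r, z) :=
        contMDiffAt_fst.prodMk_space ((A.contMDiffAt_rho h).comp (r, z) contMDiffAt_snd)
      exact (hs (A.rho z)).contMDiffAt.comp (r, z) h2
    refine (A.contMDiffAt_Φ (x := (r, z)) (A.R₀_lt_radial hK hid.self_of_nhds hp h) h1
      ((A.contMDiffAt_link h).comp (r, z) contMDiffAt_snd)).congr_of_eventuallyEq ?_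
    filter_upwards [hc'.eventually hid, hc.eventually (A.eventually_lt_rho h)] with q hq hq'
    exact A.radialMap_of_lt hq hq'
  · refine contMDiffAt_snd.congr_of_eventuallyEq ?_
    filter_upwards [hc.eventually (A.eventually_rho_lt
      (by linarith : A.rho z < 2 * K))] with q hq
    exact A.radialMap_of_le hq.le

/-- The differential of the smooth radial function. -/
noncomputable def dsigma (K : ℝ) (z : Z) (X : TangentSpace Z.I z) : ℝ :=
  mfderiv Z.I 𝓘(ℝ, ℝ) (A.sigma K) z X

theorem dsigma_eq {z : Z} (hz : A.R₀ < A.rho z) (X : TangentSpace Z.I z) :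
    A.dsigma K z X = deriv (smoothRadius K) (A.rho z) * A.radial z X := by
  have h1 := ((A.contMDiffAt_rho hz).mdifferentiableAt (by simp)).hasMFDerivAt
  have h2 : HasDerivAt (smoothRadius K) (deriv (smoothRadius K) (A.rho z)) (A.rho z) :=
    ((contDiff_smoothRadius K).differentiable (by simp) _).hasDerivAt
  have h3 := h2.hasFDerivAt.hasMFDerivAt.comp z h1
  have h4 : HasMFDerivAt Z.I 𝓘(ℝ, ℝ) (A.sigma K) z _ := h3
  rw [dsigma, h4.mfderiv, ← A.mfderiv_rho hz]
  exact mul_comm (show ℝ from mfderiv Z.I 𝓘(ℝ, ℝ) A.rho z X) _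

theorem dsigma_of_lt {z : Z} (hK : 0 < K) (hz : A.rho z < K) (X : TangentSpace Z.I z) :
    A.dsigma K z X = 0 := by
  have h : A.sigma K =ᶠ[𝓝 z] fun _ ↦ K := by
    filter_upwards [A.eventually_rho_lt hz] with y hy using smoothRadius_of_le hK hy.le
  rw [dsigma, h.mfderiv_eq, mfderiv_const]
  rfl

theorem dsigma_of_ge {z : Z} (hK : A.R₀ < K) (hz : 2 * K ≤ A.sigma K z)
    (X : TangentSpace Z.I z) :
    A.dsigma K z X = A.radial z X := by
  have h0 : 0 < K := A.R₀_pos.trans hK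
  have hz' : 2 * K ≤ A.rho z := (A.le_rho_iff h0 le_rfl).2 hz
  rw [A.dsigma_eq (by linarith)]
  have h2 : HasDerivAt (smoothRadius K) (deriv (smoothRadius K) (A.rho z)) (A.rho z) :=
    ((contDiff_smoothRadius K).differentiable (by simp) _).hasDerivAt
  -- At ρ = 2K the function is known to be the identity only to the right; the one-sided derivative
  -- determines the two-sided one.
  have h3 : HasDerivWithinAt (smoothRadius K) 1 (Ici (A.rho z)) (A.rho z) :=
    (hasDerivWithinAt_id (A.rho z) _).congr
      (fun t ht ↦ smoothRadius_of_ge h0 (hz'.trans ht)) (smoothRadius_of_ge h0 hz')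
  rw [(uniqueDiffOn_Ici (A.rho z) _ self_mem_Ici).eq_deriv _ h2.hasDerivWithinAt h3, one_mul]

/-- `K` is a radius beyond which the metric is comparable with the exact cone metric, and `C`
bounds the deviation from the cone metric and the differential of the smooth radial function. -/
structure IsScale (K C : ℝ) : Prop where
  one_le : 1 ≤ K
  R₀_lt : A.R₀ < K
  C_ge : 1 ≤ C
  decay : ∀ z, A.R₀ < A.rho z → ∀ X,
    |g.sq z X - A.coneForm z X X| ≤ C * A.rho z ^ (-ν) * A.coneForm z X X
  half : ∀ z, K ≤ A.rho z → ∀ X, |g.sq z X - A.coneForm z X X| ≤ 1 / 2 * A.coneForm z X X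
  dsigma_sq_le : ∀ z X, A.dsigma K z X ^ 2 ≤ C * g.sq z X

variable {A} in
theorem IsScale.mono {K C C' : ℝ} (h : A.IsScale K C) (hC : C ≤ C') : A.IsScale K C' where
  one_le := h.one_le
  R₀_lt := h.R₀_lt
  C_ge := h.C_ge.trans hC
  decay z hz X := (h.decay z hz X).trans <| by
    have := A.coneForm_nonneg z X
    have := Real.rpow_nonneg (A.rho_pos z).le (-ν)
    gcongr
  half := h.half
  dsigma_sq_le z X := (h.dsigma_sq_le z X).trans <|
    mul_le_mul_of_nonneg_right hC (g.sq_nonneg z X)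

/-- For all large K rather than for some K, so that one scale can serve both factors of a product.
-/
theorem exists_isScale : ∀ᶠ K in atTop, ∃ C, A.IsScale K C := by
  obtain ⟨C, hC, hdecay⟩ := A.abs_sq_sub_coneForm_le
  have hlim : Tendsto (fun t : ℝ ↦ C * t ^ (-ν)) atTop (𝓝 (C * 0)) :=
    (tendsto_rpow_neg_atTop A.rate_pos).const_mul C
  rw [mul_zero] at hlim
  have hev := eventually_atTop.1 (hlim.eventually (gt_mem_nhds (by norm_num : (0 : ℝ) < 1 / 2)))
  obtain ⟨K₀, hK₀⟩ := hev
  filter_upwards [eventually_ge_atTop K₀, eventually_ge_atTop 1, eventually_gt_atTop A.R₀]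
    with K h1 h2 h3
  have h0 : 0 < K := by linarith
  have hhalf : ∀ z, K ≤ A.rho z → ∀ X,
      |g.sq z X - A.coneForm z X X| ≤ 1 / 2 * A.coneForm z X X := fun z hz X ↦
    (hdecay z (h3.trans_le hz) X).trans <|
      mul_le_mul_of_nonneg_right (hK₀ _ (h1.trans hz)).le (A.coneForm_nonneg z X)
  obtain ⟨D, hD1, hD⟩ := exists_deriv_smoothRadius_le h0
  -- Below K the differential vanishes. Beyond, dσ is at most D times the radial component, whose
  -- square is at most the cone metric, which is at most 2g.
  have hσ : ∀ z X, A.dsigma K z X ^ 2 ≤ 2 * D ^ 2 * g.sq z X := by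
    intro z X
    have hg := g.sq_nonneg z X
    by_cases hz : A.rho z < K
    · rw [A.dsigma_of_lt h0 hz]
      norm_num
      positivity
    · have hz := not_lt.1 hz
      rw [A.dsigma_eq (h3.trans_le hz), mul_pow]
      have h4 := A.sq_radial_le_coneForm z X
      have h5 := (abs_le.1 (hhalf z hz X)).1
      have h6 : deriv (smoothRadius K) (A.rho z) ^ 2 ≤ D ^ 2 :=
        sq_le_sq' (abs_le.1 (hD _)).1 (abs_le.1 (hD _)).2
      have h7 : A.radial z X ^ 2 ≤ 2 * g.sq z X := by linarith
      calc _ ≤ D ^ 2 * (2 * g.sq z X) := by gcongr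
        _ = _ := by ring
  refine ⟨max (max C 1) (2 * D ^ 2), h2, h3, (le_max_right _ _).trans (le_max_left _ _),
    fun z hz X ↦ (hdecay z hz X).trans ?_, hhalf, fun z X ↦ (hσ z X).trans ?_⟩
  · have := A.coneForm_nonneg z X
    have := Real.rpow_nonneg (A.rho_pos z).le (-ν)
    gcongr
    exact (le_max_left _ _).trans (le_max_left _ _)
  · exact mul_le_mul_of_nonneg_right (le_max_right _ _) (g.sq_nonneg z X)

end ACStructure

/-- Compare dimensions at one point of the end. It makes F₁ × Z₂ and F₂ × Z₁ equidimensional, so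
that both can be pieces of one level set. -/
theorem ACStructure.finrank_eq {Z F : Mfd.{u}} {g : Z.Metric} {κ : F.Metric} {ν : ℝ}
    (A : ACStructure g κ ν) : Module.finrank ℝ Z.E = 1 + Module.finrank ℝ F.E := by
  obtain ⟨f⟩ := A.nonempty_link
  have hs : (A.R₀ + 1, f) ∈ A.Φ.source := A.mem_source (by linarith) f
  let L : ℝ × F.E →L[ℝ] Z.E := mfderiv (𝓘(ℝ, ℝ).prod F.I) Z.I A.Φ (A.R₀ + 1, f)
  let L' : Z.E →L[ℝ] ℝ × F.E := mfderiv Z.I (𝓘(ℝ, ℝ).prod F.I) A.Φ.invFun (A.Φ (A.R₀ + 1, f))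
  have h1 : ∀ v, L' (L v) = v := fun v ↦ A.Φ.mfderiv_invFun_mfderiv hs v
  have h2 : ∀ v, L (L' v) = v := by
    intro v
    have h := A.Φ.mfderiv_mfderiv_invFun (A.Φ.map_source hs) v
    rw [A.invFun_Φ (by linarith)] at h
    exact h
  have e : (ℝ × F.E) ≃ₗ[ℝ] Z.E :=
    { toLinearMap := L.toLinearMap, invFun := L', left_inv := h1, right_inv := h2 }
  rw [← e.finrank_eq, Module.finrank_prod, Module.finrank_self]

/-! ### Level sets in the product and the transport between them -/

namespace ACPair

variable {Z₁ Z₂ F₁ F₂ : Mfd.{u}} {g₁ : Z₁.Metric} {g₂ : Z₂.Metric} {κ₁ : F₁.Metric}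
  {κ₂ : F₂.Metric} {ν₁ ν₂ : ℝ} (A : ACStructure g₁ κ₁ ν₁) (B : ACStructure g₂ κ₂ ν₂) (K : ℝ)

/-- The radius of the first factor on the level set `σ₁ ^ 2 + σ₂ ^ 2 = r ^ 2`. -/
noncomputable def coradius (r : ℝ) (w : Z₂) : ℝ := √(r ^ 2 - B.sigma K w ^ 2)

/-- The parametrization of the part of the level set `σ₁ ^ 2 + σ₂ ^ 2 = r ^ 2` where the first
factor is far out. -/
noncomputable def regionMap (r : ℝ) (q : F₁ × Z₂) : Z₁ × Z₂ :=
  (A.Φ (coradius B K r q.2, q.1), q.2)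

/-- The square of the radius on the product. -/
noncomputable def sqRadius (z : Z₁ × Z₂) : ℝ := A.sigma K z.1 ^ 2 + B.sigma K z.2 ^ 2

variable {K}

section
variable {r : ℝ} (hK : 0 < K) (hr : 10 * K ≤ r) {w : Z₂} (hw : B.sigma K w < 4 / 5 * r)
include hK hr hw

/-- The 3-4-5 triangle: σ₂ < 4r/5 leaves more than 3r/5 for the other radius. With r ≥ 10K this
exceeds 6K, well beyond the smoothing zone. -/
theorem lt_coradius : 3 / 5 * r < coradius B K r w := by
  have := B.le_sigma hK (z := w)
  rw [coradius]
  apply Real.lt_sqrt_of_sq_lt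
  nlinarith

theorem sq_coradius : coradius B K r w ^ 2 = r ^ 2 - B.sigma K w ^ 2 := by
  have := B.le_sigma hK (z := w)
  rw [coradius, Real.sq_sqrt]
  nlinarith

theorem six_lt_coradius : 6 * K < coradius B K r w := by
  have := lt_coradius B hK hr hw
  linarith

section
variable (hA : A.R₀ < K)
include hA

theorem R₀_lt_coradius : A.R₀ < coradius B K r w := by
  have := six_lt_coradius B hK hr hw
  linarith

theorem sigma_regionMap (f : F₁) : A.sigma K (regionMap A B K r (f, w)).1 = coradius B K r w :=
  A.sigma_Φ hK (by have := six_lt_coradius B hK hr hw; linarith) hA f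

theorem link_regionMap (f : F₁) : A.link (regionMap A B K r (f, w)).1 = f :=
  A.link_Φ (R₀_lt_coradius A B hK hr hw hA) f

theorem sqRadius_regionMap (f : F₁) : sqRadius A B K (regionMap A B K r (f, w)) = r ^ 2 := by
  rw [sqRadius, sigma_regionMap A B hK hr hw hA, sq_coradius B hK hr hw]
  exact sub_add_cancel _ _

end
end

theorem contMDiffAt_coradius {E' H' M : Type*} [NormedAddCommGroup E'] [NormedSpace ℝ E']
    [TopologicalSpace H'] {J : ModelWithCorners ℝ E' H'} [TopologicalSpace M] [ChartedSpace H' M]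
    {r : M → ℝ} {b : M → Z₂} {x : M} (hB : B.R₀ < K) (hr : 10 * K ≤ r x)
    (hw : B.sigma K (b x) < 4 / 5 * r x)
    (hrs : ContMDiffAt J 𝓘(ℝ, ℝ) ∞ r x) (hb : ContMDiffAt J Z₂.I ∞ b x) :
    ContMDiffAt J 𝓘(ℝ, ℝ) ∞ (fun y ↦ coradius B K (r y) (b y)) x := by
  have hK := B.R₀_pos.trans hB
  have h1 : ContMDiffAt J 𝓘(ℝ, ℝ × ℝ) ∞ (fun y ↦ (r y, B.sigma K (b y))) x :=
    hrs.prodMk_space ((B.contMDiff_sigma hB).contMDiffAt.comp x hb)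
  have hne : (r x) ^ 2 - B.sigma K (b x) ^ 2 ≠ 0 := by
    rw [← sq_coradius B hK hr hw]
    have := six_lt_coradius B hK hr hw
    exact pow_ne_zero 2 (by linarith)
  have h2 : ContDiffAt ℝ ∞ (fun p : ℝ × ℝ ↦ √(p.1 ^ 2 - p.2 ^ 2)) (r x, B.sigma K (b x)) :=
    ContDiffAt.sqrt (by fun_prop) hne
  exact ContMDiffAt.comp (g := fun p : ℝ × ℝ ↦ √(p.1 ^ 2 - p.2 ^ 2)) x h2.contMDiffAt h1

theorem contMDiffAt_regionMap {E' H' M : Type*} [NormedAddCommGroup E'] [NormedSpace ℝ E']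
    [TopologicalSpace H'] {J : ModelWithCorners ℝ E' H'} [TopologicalSpace M] [ChartedSpace H' M]
    {r : M → ℝ} {a : M → F₁} {b : M → Z₂} {x : M} (hA : A.R₀ < K) (hB : B.R₀ < K)
    (hr : 10 * K ≤ r x) (hw : B.sigma K (b x) < 4 / 5 * r x)
    (hrs : ContMDiffAt J 𝓘(ℝ, ℝ) ∞ r x) (ha : ContMDiffAt J F₁.I ∞ a x)
    (hb : ContMDiffAt J Z₂.I ∞ b x) :
    ContMDiffAt J (Z₁.I.prod Z₂.I) ∞ (fun y ↦ regionMap A B K (r y) (a y, b y)) x :=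
  (A.contMDiffAt_Φ (a := fun y ↦ coradius B K (r y) (b y)) (x := x)
    (R₀_lt_coradius A B (B.R₀_pos.trans hB) hr hw hA)
    (contMDiffAt_coradius B hB hr hw hrs hb) ha).prodMk hb

theorem regionMap_link {r : ℝ} (hK : 0 < K) (hA : A.R₀ < K) (hr : 10 * K ≤ r) {z : Z₁ × Z₂}
    (hz : sqRadius A B K z = r ^ 2) (hw : B.sigma K z.2 < 4 / 5 * r) :
    regionMap A B K r (A.link z.1, z.2) = z := by
  have h1 : coradius B K r z.2 = A.sigma K z.1 := by
    rw [coradius, ← hz, sqRadius, add_sub_cancel_right, Real.sqrt_sq]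
    exact hK.le.trans (A.le_sigma hK)
  have h2 := six_lt_coradius B hK hr hw
  rw [h1] at h2
  have h3 := A.rho_eq_sigma hK (z := z.1) (by linarith)
  rw [regionMap]
  dsimp only
  rw [h1, ← h3, A.Φ_rho_link (by rw [h3]; linarith)]

theorem sqRadius_swap (z : Z₁ × Z₂) : sqRadius B A K z.swap = sqRadius A B K z := add_comm _ _

/-- On each level set, one of the two factors is not far out. -/
theorem sigma_lt_or {r : ℝ} (hr : 0 < r) {z : Z₁ × Z₂} (hK : 0 < K)
    (hz : sqRadius A B K z = r ^ 2) :
    B.sigma K z.2 < 4 / 5 * r ∨ A.sigma K z.1 < 4 / 5 * r := by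
  by_contra! h
  have := A.le_sigma hK (z := z.1)
  have := B.le_sigma hK (z := z.2)
  rw [sqRadius] at hz
  -- If both radii were at least 4r/5, their squares would sum to at least 32r²/25 > r².
  nlinarith [h.1, h.2]

/-- `p` is an admissible change of radii from the level `r'` to the level `r`. -/
structure IsChange (K r' r : ℝ) (p : ℝ → ℝ) : Prop where
  id_of_le : ∀ u ≤ 2 * K, p u = u
  strictMono : StrictMono p
  of_ge : ∀ u, 3 / 10 * r' ≤ u → p u = r / r' * u

theorem isChange_stretch (hK : 0 < K) {r : ℝ} (hr : 10 * K ≤ r) :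
    IsChange K (10 * K) r (stretch K r) :=
  ⟨fun _ hu ↦ stretch_of_le hK hu, stretch_strictMono hK hr,
    fun _ hu ↦ stretch_of_ge hK (by linarith)⟩

theorem isChange_unstretch (hK : 0 < K) {r : ℝ} (hr : 10 * K ≤ r) :
    IsChange K r (10 * K) (unstretch K r) :=
  ⟨fun _ hu ↦ unstretch_of_le hK hr hu, unstretch_strictMono hK hr,
    fun _ hu ↦ unstretch_of_ge hK hr (by linarith)⟩

/-- The bound 4r'/5 lies in the range where p is dilation by r/r', so it is carried to 4r/5. -/
theorem IsChange.lt {K r r' : ℝ} {p : ℝ → ℝ} (hp : IsChange K r' r p) (hr' : 0 < r')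
    {u : ℝ} (hu : u < 4 / 5 * r') : p u < 4 / 5 * r := by
  have h := hp.strictMono hu
  rw [hp.of_ge (4 / 5 * r') (by linarith)] at h
  have : r / r' * (4 / 5 * r') = 4 / 5 * r := by field_simp
  linarith

variable (K)

/-- The map from the level set of radius `r'` to that of radius `r` induced by a change of radii,
on the part where the first factor is far out. -/
noncomputable def transportLeft (r : ℝ) (p : ℝ → ℝ) (z : Z₁ × Z₂) : Z₁ × Z₂ :=
  regionMap A B K r (A.link z.1, B.radialMap K p z.2)

open Classical in
/-- The map from the level set of radius `r'` to that of radius `r` induced by a change of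
radii. -/
noncomputable def transport (r' r : ℝ) (p : ℝ → ℝ) (z : Z₁ × Z₂) : Z₁ × Z₂ :=
  if B.sigma K z.2 < 4 / 5 * r' then transportLeft A B K r p z
  else (transportLeft B A K r p z.swap).swap

variable {K}

section
variable (hA : A.R₀ < K) (hB : B.R₀ < K) {r' r : ℝ} (hr' : 10 * K ≤ r')
  (hr : 10 * K ≤ r) {p : ℝ → ℝ} (hp : IsChange K r' r p) {z : Z₁ × Z₂}
  (hz : sqRadius A B K z = r' ^ 2)
include hA hB hr' hr hp hz

/-- If both radii are below 4r'/5, both exceed 3r'/5. Then p dilates the second radius by r/r', and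
the level equation forces the same dilation of the first. The resulting formula is symmetric in the
two factors. -/
theorem transport_overlap (h₁ : A.sigma K z.1 < 4 / 5 * r') (h₂ : B.sigma K z.2 < 4 / 5 * r') :
    transportLeft A B K r p z = (A.Φ (r / r' * A.sigma K z.1, A.link z.1),
      B.Φ (r / r' * B.sigma K z.2, B.link z.2)) := by
  have hK : 0 < K := A.R₀_pos.trans hA
  have hr0 : 0 < r' := by linarith
  have k₁ := A.le_sigma hK (z := z.1)
  have k₂ := B.le_sigma hK (z := z.2)
  have hz' := hz
  rw [sqRadius] at hz
  have l₁ : 3 / 5 * r' < A.sigma K z.1 := by nlinarith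
  have l₂ : 3 / 5 * r' < B.sigma K z.2 := by nlinarith
  have e₂ := B.rho_eq_sigma hK (z := z.2) (by linarith)
  have e₃ : B.radialMap K p z.2 = B.Φ (r / r' * B.sigma K z.2, B.link z.2) := by
    rw [B.radialMap_of_lt hp.id_of_le (by rw [e₂]; linarith), e₂, hp.of_ge _ (by linarith)]
  have e₄ : coradius B K r (B.radialMap K p z.2) = r / r' * A.sigma K z.1 := by
    rw [coradius, B.sigma_radialMap hB hp.id_of_le hp.strictMono, hp.of_ge _ (by linarith)]
    have : r ^ 2 - (r / r' * B.sigma K z.2) ^ 2 = (r / r' * A.sigma K z.1) ^ 2 := by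
      field_simp
      nlinarith [hz]
    rw [this, Real.sqrt_sq]
    have : 0 ≤ r := by linarith
    have : 0 ≤ A.sigma K z.1 := by linarith
    positivity
  rw [transportLeft, regionMap]
  dsimp only
  rw [e₄, e₃]

/-- The definition prefers the left recipe; by the symmetry of `transport_overlap` the right one is
equally good wherever it makes sense. -/
theorem transport_of_right (h₁ : A.sigma K z.1 < 4 / 5 * r') :
    transport A B K r' r p z = (transportLeft B A K r p z.swap).swap := by
  by_cases h₂ : B.sigma K z.2 < 4 / 5 * r'
  · rw [transport, if_pos h₂, transport_overlap A B hA hB hr' hr hp hz h₁ h₂,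
      transport_overlap B A hB hA hr' hr hp (by rwa [sqRadius_swap]) h₂ h₁]
    rfl
  · exact if_neg h₂

omit hA hB hr' hr hp hz in
theorem transport_of_left (h₂ : B.sigma K z.2 < 4 / 5 * r') :
    transport A B K r' r p z = transportLeft A B K r p z := if_pos h₂

omit hr hr' hz hA in
theorem sigma_transportLeft_lt (hr0 : 0 < r') (h₂ : B.sigma K z.2 < 4 / 5 * r') :
    B.sigma K (transportLeft A B K r p z).2 < 4 / 5 * r := by
  rw [transportLeft, regionMap]
  dsimp only
  rw [B.sigma_radialMap hB hp.id_of_le hp.strictMono]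
  exact hp.lt hr0 h₂

omit hz in
theorem sqRadius_transportLeft (h₂ : B.sigma K z.2 < 4 / 5 * r') :
    sqRadius A B K (transportLeft A B K r p z) = r ^ 2 := by
  have hK : 0 < K := A.R₀_pos.trans hA
  exact sqRadius_regionMap A B hK hr
    (sigma_transportLeft_lt A B hB hp (by linarith) h₂) hA _

theorem transportLeft_transportLeft {q : ℝ → ℝ} (hq : ∀ u ≤ 2 * K, q u = u)
    (hqp : ∀ u, q (p u) = u) (h₂ : B.sigma K z.2 < 4 / 5 * r') :
    transportLeft A B K r' q (transportLeft A B K r p z) = z := by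
  have hK : 0 < K := A.R₀_pos.trans hA
  have h3 := sigma_transportLeft_lt A B hB hp (by linarith) h₂
  rw [transportLeft]
  rw [show A.link (transportLeft A B K r p z).1 = A.link z.1 from
    link_regionMap A B hK hr h3 hA _]
  rw [show B.radialMap K q (transportLeft A B K r p z).2 = z.2 from
    B.radialMap_radialMap hB hp.id_of_le hp.strictMono hq hqp z.2]
  exact regionMap_link A B hK hA hr' hz h₂

theorem sqRadius_transport : sqRadius A B K (transport A B K r' r p z) = r ^ 2 := by
  have hK : 0 < K := A.R₀_pos.trans hA
  rcases sigma_lt_or A B (by linarith) hK hz with h | h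
  · rw [transport_of_left A B h]
    exact sqRadius_transportLeft A B hA hB hr' hr hp h
  · rw [transport_of_right A B hA hB hr' hr hp hz h, sqRadius_swap]
    exact sqRadius_transportLeft B A hB hA hr' hr hp h

theorem transport_transport {q : ℝ → ℝ} (hq : IsChange K r r' q)
    (hqp : ∀ u, q (p u) = u) :
    transport A B K r r' q (transport A B K r' r p z) = z := by
  have hK : 0 < K := A.R₀_pos.trans hA
  have hsq := sqRadius_transport A B hA hB hr' hr hp hz
  rcases sigma_lt_or A B (by linarith) hK hz with h | h
  · rw [transport_of_left A B h] at hsq ⊢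
    rw [transport_of_left A B (sigma_transportLeft_lt A B hB hp (by linarith) h)]
    exact transportLeft_transportLeft A B hA hB hr' hr hp hz hq.id_of_le hqp h
  · rw [transport_of_right A B hA hB hr' hr hp hz h] at hsq ⊢
    rw [transport_of_right A B hA hB hr hr' hq hsq
      (sigma_transportLeft_lt B A hA hp (by linarith) h), Prod.swap_swap,
      transportLeft_transportLeft B A hB hA hr' hr hp (by rwa [sqRadius_swap]) hq.id_of_le hqp h,
      Prod.swap_swap]

end

end ACPair

/-! ### The level set of radius 10K as a manifold -/

namespace ACPair

variable {Z₁ Z₂ F₁ F₂ : Mfd.{u}} {g₁ : Z₁.Metric} {g₂ : Z₂.Metric} {κ₁ : F₁.Metric}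
  {κ₂ : F₂.Metric} {ν₁ ν₂ : ℝ} (A : ACStructure g₁ κ₁ ν₁) (B : ACStructure g₂ κ₂ ν₂) (K : ℝ)

/-- The level set of radius `10 K` in the product. -/
abbrev Level : Type u := {z : Z₁ × Z₂ // sqRadius A B K z = (10 * K) ^ 2}

variable {K}

theorem isInducing_coe_level : IsInducing (Subtype.val : Level A B K → Z₁ × Z₂) := ⟨rfl⟩

theorem lt_sigma_of_lt {r : ℝ} (hr : 10 * K ≤ r) (hK : 0 < K) {z : Z₁ × Z₂}
    (hz : sqRadius A B K z = r ^ 2) (hw : B.sigma K z.2 < 4 / 5 * r) :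
    3 / 5 * r < A.sigma K z.1 := by
  have := A.le_sigma hK (z := z.1)
  have := B.le_sigma hK (z := z.2)
  rw [sqRadius] at hz
  nlinarith

theorem lt_rho_of_lt {r : ℝ} (hr : 10 * K ≤ r) (hA : A.R₀ < K) {z : Z₁ × Z₂}
    (hz : sqRadius A B K z = r ^ 2) (hw : B.sigma K z.2 < 4 / 5 * r) :
    A.R₀ < A.rho z.1 := by
  have hK : 0 < K := A.R₀_pos.trans hA
  have := lt_sigma_of_lt A B hr hK hz hw
  rw [A.rho_eq_sigma hK (by linarith)]
  linarith

section
variable {A B}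
variable (hA : A.R₀ < K) (hB : B.R₀ < K)
include hA hB

theorem level_nonempty : Nonempty (Level A B K) := by
  have hK : 0 < K := A.R₀_pos.trans hA
  obtain ⟨f₁⟩ := A.nonempty_link
  obtain ⟨f₂⟩ := B.nonempty_link
  refine ⟨⟨regionMap A B K (10 * K) (f₁, B.Φ (2 * K, f₂)), sqRadius_regionMap A B hK le_rfl ?_ hA _⟩⟩
  rw [B.sigma_Φ hK le_rfl hB]
  linarith

open Classical in
/-- The retraction to the level set, with an arbitrary value off the level set. -/
noncomputable def toLevel (z : Z₁ × Z₂) : Level A B K :=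
  if h : sqRadius A B K z = (10 * K) ^ 2 then ⟨z, h⟩ else (level_nonempty hA hB).some

theorem coe_toLevel {z : Z₁ × Z₂} (h : sqRadius A B K z = (10 * K) ^ 2) :
    (toLevel hA hB z : Z₁ × Z₂) = z := by
  rw [toLevel, dif_pos h]

theorem toLevel_coe (y : Level A B K) : toLevel hA hB (y : Z₁ × Z₂) = y :=
  Subtype.ext (coe_toLevel hA hB y.2)

omit hA in
theorem isOpen_sigma_lt {r : ℝ} : IsOpen {w : Z₂ | B.sigma K w < r} :=
  isOpen_lt (B.contMDiff_sigma hB).continuous continuous_const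

/-- The piece of the level set where the first factor is far out. -/
noncomputable def levelLeft : OpenPartialHomeomorph (F₁ × Z₂) (Level A B K) where
  toFun q := toLevel hA hB (regionMap A B K (10 * K) q)
  invFun y := (A.link y.1.1, y.1.2)
  source := {q | B.sigma K q.2 < 4 / 5 * (10 * K)}
  target := {y | B.sigma K y.1.2 < 4 / 5 * (10 * K)}
  map_source' q hq := by
    have hK : 0 < K := A.R₀_pos.trans hA
    change B.sigma K (toLevel hA hB (regionMap A B K (10 * K) q)).1.2 < _
    rw [coe_toLevel hA hB (sqRadius_regionMap A B hK le_rfl hq hA _)]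
    exact hq
  map_target' y hy := hy
  left_inv' q hq := by
    have hK : 0 < K := A.R₀_pos.trans hA
    rw [coe_toLevel hA hB (sqRadius_regionMap A B hK le_rfl hq hA _)]
    exact Prod.ext (link_regionMap A B hK le_rfl hq hA _) rfl
  right_inv' y hy := by
    have hK : 0 < K := A.R₀_pos.trans hA
    rw [regionMap_link A B hK hA le_rfl y.2 hy, toLevel_coe]
  open_source := (isOpen_sigma_lt hB).preimage continuous_snd
  open_target := (isOpen_sigma_lt hB).preimage
    (continuous_snd.comp continuous_subtype_val)
  continuousOn_toFun := by
    have hK : 0 < K := A.R₀_pos.trans hA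
    intro q hq
    refine ContinuousAt.continuousWithinAt ?_
    rw [(isInducing_coe_level A B).continuousAt_iff]
    have h := (contMDiffAt_regionMap A B (J := F₁.I.prod Z₂.I) (r := fun _ ↦ 10 * K)
      (a := Prod.fst) (b := Prod.snd) (x := q) hA hB le_rfl hq contMDiffAt_const
      contMDiffAt_fst contMDiffAt_snd).continuousAt
    refine h.congr ?_
    filter_upwards [((isOpen_sigma_lt hB).preimage continuous_snd).mem_nhds hq]
      with q' hq'
    exact (coe_toLevel hA hB (sqRadius_regionMap A B hK le_rfl hq' hA _)).symm
  continuousOn_invFun := by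
    have hK : 0 < K := A.R₀_pos.trans hA
    intro y hy
    have h1 := (A.contMDiffAt_link (lt_rho_of_lt A B le_rfl hA y.2 hy)).continuousAt
    have hc : ContinuousAt (fun y : Level A B K ↦ y.1.1) y := by fun_prop
    have hc2 : ContinuousAt (fun y : Level A B K ↦ y.1.2) y := by fun_prop
    exact ((ContinuousAt.comp (g := A.link) (f := fun y : Level A B K ↦ y.1.1) h1 hc).prodMk
      hc2).continuousWithinAt

end

variable (K) in
/-- Exchanging the two factors. -/
def levelSwap : Level B A K ≃ₜ Level A B K where
  toFun y := ⟨y.1.swap, (sqRadius_swap B A y.1).trans y.2⟩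
  invFun y := ⟨y.1.swap, (sqRadius_swap A B y.1).trans y.2⟩
  left_inv _ := rfl
  right_inv _ := rfl
  continuous_toFun := by fun_prop
  continuous_invFun := by fun_prop

section
variable {A B}
variable (hA : A.R₀ < K) (hB : B.R₀ < K)

/-- The manifolds of which the level set is glued. -/
noncomputable abbrev pieceMfd (F₁ F₂ Z₁ Z₂ : Mfd.{u}) : Bool → Mfd.{u}
  | true => F₁.prod Z₂
  | false => F₂.prod Z₁

/-- The two open pieces of the level set. -/
noncomputable def levelPiece : ∀ i : Bool,
    OpenPartialHomeomorph (pieceMfd F₁ F₂ Z₁ Z₂ i) (Level A B K)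
  | true => levelLeft hA hB
  | false => (levelLeft hB hA).transHomeomorph (levelSwap A B K)

variable (A B) in
/-- The inverses of the pieces, as functions on the product. -/
noncomputable def pieceProj : ∀ i : Bool, Z₁ × Z₂ → pieceMfd F₁ F₂ Z₁ Z₂ i
  | true => fun z ↦ (A.link z.1, z.2)
  | false => fun z ↦ (B.link z.2, z.1)

theorem levelPiece_symm (i : Bool) (y : Level A B K) :
    (levelPiece hA hB i).symm y = pieceProj A B i y := by
  cases i <;> rfl

/-- Smoothness in the ambient product, not only along the level set: composed with the smooth
inclusions of the pieces, it yields smooth transition maps. -/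
theorem contMDiffAt_pieceProj (i : Bool) {y : Level A B K} (hy : y ∈ (levelPiece hA hB i).target) :
    ContMDiffAt (Z₁.I.prod Z₂.I) (pieceMfd F₁ F₂ Z₁ Z₂ i).I ∞ (pieceProj A B i) (y : Z₁ × Z₂) := by
  have h1 : ContMDiffAt (Z₁.I.prod Z₂.I) Z₁.I ∞ Prod.fst y.1 := contMDiffAt_fst
  have h2 : ContMDiffAt (Z₁.I.prod Z₂.I) Z₂.I ∞ Prod.snd y.1 := contMDiffAt_snd
  cases i
  · exact ((B.contMDiffAt_link (lt_rho_of_lt B A (z := y.1.swap) le_rfl hB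
      ((sqRadius_swap A B y.1).trans y.2) hy)).comp y.1 h2).prodMk h1
  · exact ((A.contMDiffAt_link (lt_rho_of_lt A B le_rfl hA y.2 hy)).comp y.1 h1).prodMk h2

theorem contMDiffAt_coe_levelPiece (i : Bool) {q : pieceMfd F₁ F₂ Z₁ Z₂ i}
    (hq : q ∈ (levelPiece hA hB i).source) :
    ContMDiffAt (pieceMfd F₁ F₂ Z₁ Z₂ i).I (Z₁.I.prod Z₂.I) ∞
      (fun q ↦ (levelPiece hA hB i q : Z₁ × Z₂)) q := by
  have hK : 0 < K := A.R₀_pos.trans hA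
  have ho := (levelPiece hA hB i).open_source.mem_nhds hq
  cases i
  · have h := contMDiffAt_regionMap B A (J := F₂.I.prod Z₁.I) (r := fun _ ↦ 10 * K)
      (a := Prod.fst) (b := Prod.snd) (x := q) hB hA le_rfl hq contMDiffAt_const
      contMDiffAt_fst contMDiffAt_snd
    have h' : ContMDiffAt (F₂.I.prod Z₁.I) (Z₁.I.prod Z₂.I) ∞
      (fun q : F₂ × Z₁ ↦ (regionMap B A K (10 * K) q).swap) q :=
      (contMDiffAt_snd.comp q h).prodMk (contMDiffAt_fst.comp q h)
    refine h'.congr_of_eventuallyEq ?_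
    filter_upwards [ho] with q' hq'
    exact congrArg Prod.swap (coe_toLevel hB hA (sqRadius_regionMap B A hK le_rfl hq' hB _))
  · have h := contMDiffAt_regionMap A B (J := F₁.I.prod Z₂.I) (r := fun _ ↦ 10 * K)
      (a := Prod.fst) (b := Prod.snd) (x := q) hA hB le_rfl hq contMDiffAt_const
      contMDiffAt_fst contMDiffAt_snd
    refine h.congr_of_eventuallyEq ?_
    filter_upwards [ho] with q' hq'
    exact coe_toLevel hA hB (sqRadius_regionMap A B hK le_rfl hq' hA _)

theorem levelPiece_cover (y : Level A B K) : ∃ i, y ∈ (levelPiece hA hB i).target := by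
  have hK : 0 < K := A.R₀_pos.trans hA
  rcases sigma_lt_or A B (by linarith) hK y.2 with h | h
  · exact ⟨true, h⟩
  · exact ⟨false, h⟩

instance : SecondCountableTopology (Level A B K) :=
  TopologicalSpace.Subtype.secondCountableTopology _

/-- The level set as a manifold glued of two pieces. -/
noncomputable def levelCover : SmoothCover (Level A B K) where
  E := F₁.E × Z₂.E
  ι := Bool
  M := pieceMfd F₁ F₂ Z₁ Z₂
  L
    | true => ContinuousLinearEquiv.refl ℝ _
    | false => ContinuousLinearEquiv.ofFinrankEq (by
        change Module.finrank ℝ (F₂.E × Z₁.E) = Module.finrank ℝ (F₁.E × Z₂.E)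
        rw [Module.finrank_prod, Module.finrank_prod, A.finrank_eq, B.finrank_eq]
        ring)
  e := levelPiece hA hB
  cover := levelPiece_cover hA hB
  compat i j := by
    rintro q ⟨hq, hq'⟩
    have h := (contMDiffAt_pieceProj hA hB j hq').comp q (contMDiffAt_coe_levelPiece hA hB i hq)
    refine (h.congr_of_eventuallyEq ?_).contMDiffWithinAt
    exact Eventually.of_forall fun q' ↦ levelPiece_symm hA hB j _

/-- The level set as a manifold. -/
noncomputable abbrev levelMfd : Mfd.{u} := (levelCover hA hB).toMfd

/-- The pieces of the level set are partial diffeomorphisms. -/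
noncomputable def piece (i : Bool) : PartialDiffeomorph (pieceMfd F₁ F₂ Z₁ Z₂ i).I
    (levelMfd hA hB).I (pieceMfd F₁ F₂ Z₁ Z₂ i) (levelMfd hA hB) ∞ := (levelCover hA hB).piece i

/-- The inclusion of the level set. -/
def levelVal (y : levelMfd hA hB) : Z₁ × Z₂ := Subtype.val (p := fun z ↦ sqRadius A B K z = (10 * K) ^ 2) y

theorem contMDiff_levelVal :
    ContMDiff (levelMfd hA hB).I (Z₁.I.prod Z₂.I) ∞ (levelVal hA hB) := by
  intro y
  obtain ⟨i, hi⟩ := levelPiece_cover hA hB y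
  have h1 := (piece hA hB i).contMDiffAt_invFun (y := y) hi
  have h2 := contMDiffAt_coe_levelPiece hA hB i ((levelPiece hA hB i).map_target hi)
  refine (ContMDiffAt.comp y h2 h1).congr_of_eventuallyEq ?_
  filter_upwards [(piece hA hB i).open_target.mem_nhds hi] with y' hy'
  exact congrArg Subtype.val ((levelPiece hA hB i).right_inv hy').symm

/-- The retraction to the level set, as a map to the manifold. -/
noncomputable def toLevelMfd (z : Z₁ × Z₂) : levelMfd hA hB := toLevel hA hB z

theorem levelVal_toLevelMfd {z : Z₁ × Z₂} (h : sqRadius A B K z = (10 * K) ^ 2) :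
    levelVal hA hB (toLevelMfd hA hB z) = z := coe_toLevel hA hB h

theorem toLevelMfd_levelVal (y : levelMfd hA hB) :
    toLevelMfd hA hB (levelVal hA hB y) = y := toLevel_coe hA hB y

theorem sqRadius_levelVal (y : levelMfd hA hB) :
    sqRadius A B K (levelVal hA hB y) = (10 * K) ^ 2 :=
  Subtype.property (p := fun z ↦ sqRadius A B K z = (10 * K) ^ 2) y

/-- In a piece, the coordinates of a point of the level set are the ambient smooth map `pieceProj`;
so a map into the level set is smooth once it is smooth as a map into the product. -/
theorem contMDiffAt_toLevelMfd {E' H' M : Type*} [NormedAddCommGroup E'] [NormedSpace ℝ E']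
    [TopologicalSpace H'] {J : ModelWithCorners ℝ E' H'} [TopologicalSpace M] [ChartedSpace H' M]
    {f : M → Z₁ × Z₂} {x : M} (hf : ContMDiffAt J (Z₁.I.prod Z₂.I) ∞ f x)
    (hl : ∀ᶠ y in 𝓝 x, sqRadius A B K (f y) = (10 * K) ^ 2) :
    ContMDiffAt J (levelMfd hA hB).I ∞ (fun y ↦ toLevelMfd hA hB (f y)) x := by
  have hx := hl.self_of_nhds
  obtain ⟨i, hi⟩ := levelPiece_cover hA hB ⟨f x, hx⟩
  have h1 := (piece hA hB i).contMDiffAt ((levelPiece hA hB i).map_target hi)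
  have h2 := (contMDiffAt_pieceProj hA hB i hi).comp x hf
  have h3 : (levelPiece hA hB i).symm ⟨f x, hx⟩ = pieceProj A B i (f x) := levelPiece_symm hA hB i _
  rw [h3] at h1
  refine (ContMDiffAt.comp x h1 h2).congr_of_eventuallyEq ?_
  have hc : ContinuousAt (fun y ↦ toLevel hA hB (f y)) x := by
    rw [(isInducing_coe_level A B).continuousAt_iff]
    refine hf.continuousAt.congr ?_
    filter_upwards [hl] with y hy using (coe_toLevel hA hB hy).symm
  have hm : ∀ᶠ y in 𝓝 x, toLevel hA hB (f y) ∈ (levelPiece hA hB i).target := by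
    refine hc.eventually ((levelPiece hA hB i).open_target.mem_nhds ?_)
    have h5 : toLevel hA hB (f x) = ⟨f x, hx⟩ := Subtype.ext (coe_toLevel hA hB hx)
    change toLevel hA hB (f x) ∈ _
    rwa [h5]
  filter_upwards [hl, hm] with y hy hy'
  have h4 := (levelPiece hA hB i).right_inv hy'
  rw [levelPiece_symm, coe_toLevel hA hB hy] at h4
  exact h4.symm

end

end ACPair

/-! ### The end of the product as a half-line times the level set -/

namespace ACPair

variable {Z₁ Z₂ F₁ F₂ : Mfd.{u}} {g₁ : Z₁.Metric} {g₂ : Z₂.Metric} {κ₁ : F₁.Metric}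
  {κ₂ : F₂.Metric} {ν₁ ν₂ : ℝ} (A : ACStructure g₁ κ₁ ν₁) (B : ACStructure g₂ κ₂ ν₂) {K : ℝ}

theorem contMDiff_sqRadius (hA : A.R₀ < K) (hB : B.R₀ < K) :
    ContMDiff (Z₁.I.prod Z₂.I) 𝓘(ℝ, ℝ) ∞ (sqRadius A B K) := by
  have h1 := (A.contMDiff_sigma hA).comp (contMDiff_fst (I := Z₁.I) (J := Z₂.I) (N := Z₂))
  have h2 := (B.contMDiff_sigma hB).comp (contMDiff_snd (I := Z₁.I) (J := Z₂.I) (M := Z₁))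
  exact (h1.pow 2).add (h2.pow 2)

section
variable {E' H' M : Type*} [NormedAddCommGroup E'] [NormedSpace ℝ E']
    [TopologicalSpace H'] {J : ModelWithCorners ℝ E' H'} [TopologicalSpace M] [ChartedSpace H' M]
    {s r' r : M → ℝ} {p : ℝ → ℝ → ℝ} {z : M → Z₁ × Z₂} {x : M}
    (hA : A.R₀ < K) (hB : B.R₀ < K)
    (hr' : 10 * K ≤ r' x) (hr : 10 * K ≤ r x) (hp : IsChange K (r' x) (r x) (p (s x)))
    (hz : sqRadius A B K (z x) = r' x ^ 2)
    (hid : ∀ᶠ t in 𝓝 (s x), ∀ u ≤ 2 * K, p t u = u)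
    (hps : ∀ u, ContDiffAt ℝ ∞ (fun q : ℝ × ℝ ↦ p q.1 q.2) (s x, u))
    (hs : ContMDiffAt J 𝓘(ℝ, ℝ) ∞ s x) (hrs : ContMDiffAt J 𝓘(ℝ, ℝ) ∞ r x)
    (hzs : ContMDiffAt J (Z₁.I.prod Z₂.I) ∞ z x)
include hA hB hr' hr hp hz hid hps hs hrs hzs

theorem contMDiffAt_transportLeft (h₂ : B.sigma K (z x).2 < 4 / 5 * r' x) :
    ContMDiffAt J (Z₁.I.prod Z₂.I) ∞
      (fun y ↦ transportLeft A B K (r y) (p (s y)) (z y)) x := by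
  have hK : 0 < K := A.R₀_pos.trans hA
  have h1 : ContMDiffAt J Z₁.I ∞ (fun y ↦ (z y).1) x := contMDiffAt_fst.comp x hzs
  have h2 : ContMDiffAt J Z₂.I ∞ (fun y ↦ (z y).2) x := contMDiffAt_snd.comp x hzs
  refine contMDiffAt_regionMap A B (a := fun y ↦ A.link (z y).1)
    (b := fun y ↦ B.radialMap K (p (s y)) (z y).2) hA hB hr ?_ hrs ?_ ?_
  · rw [B.sigma_radialMap hB hp.id_of_le hp.strictMono]
    exact hp.lt (by linarith) h₂
  · exact ContMDiffAt.comp (g := A.link) (f := fun y ↦ (z y).1) x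
      (A.contMDiffAt_link (lt_rho_of_lt A B hr' hA hz h₂)) h1
  · exact ContMDiffAt.comp x
      (B.contMDiffAt_radialMap (r := s x) hB hid hp.strictMono hps (z x).2) (hs.prodMk h2)

/-- By continuity of σ, one of the two recipes is valid on a whole neighbourhood. For the right
recipe, its agreement with `transport` uses the level equation at the nearby points too, whence the
last hypothesis. -/
theorem contMDiffAt_transport (hr'c : ContinuousAt r' x)
    (hev : ∀ᶠ y in 𝓝 x, 10 * K ≤ r' y ∧ 10 * K ≤ r y ∧ IsChange K (r' y) (r y) (p (s y)) ∧
      sqRadius A B K (z y) = r' y ^ 2) :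
    ContMDiffAt J (Z₁.I.prod Z₂.I) ∞
      (fun y ↦ transport A B K (r' y) (r y) (p (s y)) (z y)) x := by
  have hK : 0 < K := A.R₀_pos.trans hA
  rcases sigma_lt_or A B (by linarith) hK hz with h | h
  · refine (contMDiffAt_transportLeft A B hA hB hr' hr hp hz hid hps hs hrs hzs
      h).congr_of_eventuallyEq ?_
    have hc : ContinuousAt (fun y ↦ B.sigma K (z y).2) x :=
      ContinuousAt.comp (g := B.sigma K) (f := fun y ↦ (z y).2)
        (B.contMDiff_sigma hB).continuous.continuousAt
        (continuousAt_snd.comp hzs.continuousAt)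
    filter_upwards [hc.eventually_lt (hr'c.const_mul (4 / 5)) h] with y hy
    exact transport_of_left A B hy
  · have hz' : ContMDiffAt J (Z₂.I.prod Z₁.I) ∞ (fun y ↦ (z y).swap) x :=
      (contMDiffAt_snd.comp x hzs).prodMk (contMDiffAt_fst.comp x hzs)
    have h1 := contMDiffAt_transportLeft B A (z := fun y ↦ (z y).swap) hB hA hr' hr hp
      ((sqRadius_swap A B _).trans hz) hid hps hs hrs hz' h
    have h2 : ContMDiffAt J (Z₁.I.prod Z₂.I) ∞
        (fun y ↦ (transportLeft B A K (r y) (p (s y)) (z y).swap).swap) x :=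
      (contMDiffAt_snd.comp x h1).prodMk (contMDiffAt_fst.comp x h1)
    refine h2.congr_of_eventuallyEq ?_
    have hc : ContinuousAt (fun y ↦ A.sigma K (z y).1) x :=
      ContinuousAt.comp (g := A.sigma K) (f := fun y ↦ (z y).1)
        (A.contMDiff_sigma hA).continuous.continuousAt
        (continuousAt_fst.comp hzs.continuousAt)
    filter_upwards [hc.eventually_lt (hr'c.const_mul (4 / 5)) h, hev] with y hy ⟨k1, k2, k3, k4⟩
    exact transport_of_right A B hA hB k1 k2 k3 k4 hy

end

section
variable {A B}
variable (hA : A.R₀ < K) (hB : B.R₀ < K)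

/-- The map of the level set of radius `10 K` to that of radius `r`. -/
noncomputable def expand (r : ℝ) (y : levelMfd hA hB) : Z₁ × Z₂ :=
  transport A B K (10 * K) r (stretch K r) (levelVal hA hB y)

/-- The inverse of `expand`, on the level set of radius `r`. -/
noncomputable def contract (r : ℝ) (w : Z₁ × Z₂) : levelMfd hA hB :=
  toLevelMfd hA hB (transport A B K r (10 * K) (unstretch K r) w)

variable {r : ℝ} (hr : 10 * K ≤ r)
include hr

theorem sqRadius_expand (y : levelMfd hA hB) : sqRadius A B K (expand hA hB r y) = r ^ 2 :=
  sqRadius_transport A B hA hB le_rfl hr (isChange_stretch (A.R₀_pos.trans hA) hr)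
    (sqRadius_levelVal hA hB y)

theorem contract_expand (y : levelMfd hA hB) : contract hA hB r (expand hA hB r y) = y := by
  have hK : 0 < K := A.R₀_pos.trans hA
  rw [contract, expand, transport_transport A B hA hB le_rfl hr (isChange_stretch hK hr)
    (sqRadius_levelVal hA hB y) (isChange_unstretch hK hr) fun u ↦ unstretch_stretch hK hr]
  exact toLevelMfd_levelVal hA hB y

theorem expand_contract {w : Z₁ × Z₂} (hw : sqRadius A B K w = r ^ 2) :
    expand hA hB r (contract hA hB r w) = w := by
  have hK : 0 < K := A.R₀_pos.trans hA
  rw [contract, expand, levelVal_toLevelMfd hA hB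
    (sqRadius_transport A B hA hB hr le_rfl (isChange_unstretch hK hr) hw)]
  exact transport_transport A B hA hB hr le_rfl (isChange_unstretch hK hr) hw
    (isChange_stretch hK hr) fun u ↦ stretch_unstretch hK hr

end

section
variable {A B}
variable (hA : A.R₀ < K) (hB : B.R₀ < K)
variable {E' H' M : Type*} [NormedAddCommGroup E'] [NormedSpace ℝ E']
    [TopologicalSpace H'] {J : ModelWithCorners ℝ E' H'} [TopologicalSpace M] [ChartedSpace H' M]

theorem contMDiffAt_expand {r : ℝ} (hr : 10 * K < r) (y : levelMfd hA hB) :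
    ContMDiffAt (𝓘(ℝ, ℝ).prod (levelMfd hA hB).I) (Z₁.I.prod Z₂.I) ∞
      (fun q : ℝ × levelMfd hA hB ↦ expand hA hB q.1 q.2) (r, y) := by
  have hK : 0 < K := A.R₀_pos.trans hA
  have hc : Tendsto Prod.fst (𝓝 (r, y)) (𝓝 r) := continuousAt_fst
  refine contMDiffAt_transport A B (s := Prod.fst) (r' := fun _ ↦ 10 * K) (r := Prod.fst)
    (p := stretch K) (z := fun q ↦ levelVal hA hB q.2) (x := (r, y)) hA hB le_rfl hr.le
    (isChange_stretch hK hr.le) (sqRadius_levelVal hA hB y)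
    (Eventually.of_forall fun t u hu ↦ stretch_of_le hK hu)
    (fun u ↦ (contDiff_stretch K).contDiffAt) contMDiffAt_fst contMDiffAt_fst
    ((contMDiff_levelVal hA hB).contMDiffAt.comp (r, y) contMDiffAt_snd) continuousAt_const ?_
  filter_upwards [hc.eventually (lt_mem_nhds hr)] with q hq
  exact ⟨le_rfl, hq.le, isChange_stretch hK hq.le, sqRadius_levelVal hA hB q.2⟩

theorem contMDiffAt_contract {r : M → ℝ} {z : M → Z₁ × Z₂} {x : M} (hr : 10 * K < r x)
    (hrs : ContMDiffAt J 𝓘(ℝ, ℝ) ∞ r x) (hzs : ContMDiffAt J (Z₁.I.prod Z₂.I) ∞ z x)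
    (hz : ∀ᶠ y in 𝓝 x, sqRadius A B K (z y) = r y ^ 2) :
    ContMDiffAt J (levelMfd hA hB).I ∞ (fun y ↦ contract hA hB (r y) (z y)) x := by
  have hK : 0 < K := A.R₀_pos.trans hA
  have hrev : ∀ᶠ y in 𝓝 x, 10 * K < r y := hrs.continuousAt.eventually (lt_mem_nhds hr)
  refine contMDiffAt_toLevelMfd hA hB ?_ ?_
  · refine contMDiffAt_transport A B (s := r) (r' := r) (r := fun _ ↦ 10 * K)
      (p := unstretch K) (z := z) (x := x) hA hB hr.le le_rfl
      (isChange_unstretch hK hr.le) hz.self_of_nhds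
      ?_ (fun u ↦ contDiffAt_unstretch hK hr) hrs contMDiffAt_const hzs hrs.continuousAt ?_
    · filter_upwards [lt_mem_nhds hr] with t ht u hu using unstretch_of_le hK ht.le hu
    · filter_upwards [hrev, hz] with y hy hy'
      exact ⟨hy.le, le_rfl, isChange_unstretch hK hy.le, hy'⟩
  · filter_upwards [hrev, hz] with y hy hy'
    exact sqRadius_transport A B hA hB hy.le le_rfl (isChange_unstretch hK hy.le) hy'

/-- The identification of the part of the product outside a compact set with the product of a
half-line and the level set. -/
noncomputable def flowDiffeo : PartialDiffeomorph (𝓘(ℝ, ℝ).prod (levelMfd hA hB).I) (Z₁.prod Z₂).I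
    (ℝ × levelMfd hA hB) (Z₁.prod Z₂) ∞ where
  toFun q := expand hA hB q.1 q.2
  invFun w := (√(sqRadius A B K w), contract hA hB √(sqRadius A B K w) w)
  source := Ioi (10 * K) ×ˢ univ
  target := {w | (10 * K) ^ 2 < sqRadius A B K w}
  map_source' := by
    rintro ⟨r, y⟩ ⟨hr : 10 * K < r, -⟩
    have hK : 0 < K := A.R₀_pos.trans hA
    change _ < sqRadius A B K (expand hA hB r y)
    rw [sqRadius_expand hA hB hr.le]
    nlinarith
  map_target' := by
    intro w (hw : (10 * K) ^ 2 < sqRadius A B K w)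
    exact ⟨mem_Ioi.2 (Real.lt_sqrt_of_sq_lt hw), trivial⟩
  left_inv' := by
    rintro ⟨r, y⟩ ⟨hr : 10 * K < r, -⟩
    have hK : 0 < K := A.R₀_pos.trans hA
    dsimp only
    rw [sqRadius_expand hA hB hr.le, Real.sqrt_sq (by linarith), contract_expand hA hB hr.le]
  right_inv' := by
    intro w (hw : (10 * K) ^ 2 < sqRadius A B K w)
    have hK : 0 < K := A.R₀_pos.trans hA
    dsimp only
    rw [expand_contract hA hB (Real.lt_sqrt_of_sq_lt hw).le]
    rw [Real.sq_sqrt]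
    exact (sq_nonneg _).trans hw.le
  open_source := isOpen_Ioi.prod isOpen_univ
  open_target := isOpen_lt continuous_const (contMDiff_sqRadius A B hA hB).continuous
  contMDiffOn_toFun := by
    rintro ⟨r, y⟩ ⟨hr : 10 * K < r, -⟩
    exact (contMDiffAt_expand hA hB hr y).contMDiffWithinAt
  contMDiffOn_invFun := by
    intro w (hw : (10 * K) ^ 2 < sqRadius A B K w)
    have hK : 0 < K := A.R₀_pos.trans hA
    have hpos : 0 < sqRadius A B K w := lt_of_le_of_lt (sq_nonneg _) hw
    have h1 : ContMDiffAt (Z₁.I.prod Z₂.I) 𝓘(ℝ, ℝ) ∞ (fun w ↦ √(sqRadius A B K w)) w :=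
      ContMDiffAt.comp (g := Real.sqrt) w (Real.contDiffAt_sqrt hpos.ne').contMDiffAt
        (contMDiff_sqRadius A B hA hB).contMDiffAt
    refine ContMDiffAt.contMDiffWithinAt (h1.prodMk ?_)
    refine contMDiffAt_contract hA hB (z := fun w ↦ w) (Real.lt_sqrt_of_sq_lt hw) h1
      contMDiffAt_id ?_
    filter_upwards [(contMDiff_sqRadius A B hA hB).continuous.continuousAt.eventually
      (lt_mem_nhds hpos)] with w' hw'
    exact (Real.sq_sqrt hw'.le).symm

theorem flowDiffeo_apply (q : ℝ × levelMfd hA hB) :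
    flowDiffeo hA hB q = expand hA hB q.1 q.2 := rfl

end

end ACPair

/-! ### The exact cone metrics and the interpolated metric -/

namespace ACStructure

variable {Z F : Mfd.{u}} {g : Z.Metric} {κ : F.Metric} {ν : ℝ} (A : ACStructure g κ ν)

/-- The form is the pullback of the square dt² under ρ plus ρ² times the pullback of κ under the
link map. -/
theorem contMDiffAt_coneForm {z : Z} (hz : A.R₀ < A.rho z) :
    ContMDiffAt Z.I (Z.I.prod 𝓘(ℝ, Z.E →L[ℝ] Z.E →L[ℝ] ℝ)) ∞
      (fun x ↦ TotalSpace.mk' (Z.E →L[ℝ] Z.E →L[ℝ] ℝ)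
        (E := fun x : Z ↦ TangentSpace Z.I x →L[ℝ] TangentSpace Z.I x →L[ℝ] ℝ) x
        (A.coneForm x)) z := by
  let L : ∀ x : Z, Z.E →L[ℝ] ℝ × F.E := fun x ↦
    mfderiv Z.I (𝓘(ℝ, ℝ).prod F.I) A.Φ.invFun x
  let c₁ : ∀ x : Z, TangentSpace Z.I x →L[ℝ] TangentSpace Z.I x →L[ℝ] ℝ := fun x ↦
    (((ContinuousLinearMap.mul ℝ ℝ).bilinearComp (ContinuousLinearMap.fst ℝ ℝ F.E)
      (ContinuousLinearMap.fst ℝ ℝ F.E)).bilinearComp (L x) (L x) : Z.E →L[ℝ] Z.E →L[ℝ] ℝ)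
  let c₂ : ∀ x : Z, TangentSpace Z.I x →L[ℝ] TangentSpace Z.I x →L[ℝ] ℝ := fun x ↦
    (((show F.E →L[ℝ] F.E →L[ℝ] ℝ from κ.inner (A.link x)).bilinearComp
      (ContinuousLinearMap.snd ℝ ℝ F.E) (ContinuousLinearMap.snd ℝ ℝ F.E)).bilinearComp
        (L x) (L x) : Z.E →L[ℝ] Z.E →L[ℝ] ℝ)
  have h₁ := contMDiffAt_pullback_form (I := Z.I) (J := 𝓘(ℝ, ℝ)) (f := A.rho) (x₀ := z)
    (b := (riemannianMetricVectorSpace ℝ).inner)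
    (((riemannianMetricVectorSpace ℝ).contMDiff.of_le le_top) _) (A.contMDiffAt_rho hz)
    (c := c₁) (by
      filter_upwards [A.eventually_lt_rho hz] with x hx v w
      rw [A.mfderiv_rho hx, A.mfderiv_rho hx]
      exact mul_comm (A.radial x v) (A.radial x w))
  have h₂ := contMDiffAt_pullback_form (I := Z.I) (J := F.I) (f := A.link) (x₀ := z)
    (b := κ.inner) (κ.contMDiff _) (A.contMDiffAt_link hz)
    (c := c₂) (by
      filter_upwards [A.eventually_lt_rho hz] with x hx v w
      rw [A.mfderiv_link hx, A.mfderiv_link hx]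
      rfl)
  have h₃ : ContMDiffAt Z.I 𝓘(ℝ, ℝ) ∞ (fun x ↦ A.rho x ^ 2) z := (A.contMDiffAt_rho hz).pow 2
  exact h₁.add_section (h₃.smul_section h₂)

theorem coneForm_pos {z : Z} (hz : A.R₀ < A.rho z) {X : TangentSpace Z.I z} (hX : X ≠ 0) :
    0 < A.coneForm z X X := by
  rw [coneForm_apply]
  have h0 : 0 < A.rho z ^ 2 := pow_pos (A.rho_pos z) 2
  have h1 := A.mfderiv_Φ_radial_angular hz X
  by_cases hr : A.radial z X = 0
  · by_cases ha : A.angular z X = 0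
    · refine absurd ?_ hX
      rw [← h1, hr, ha]
      exact map_zero _
    · have := κ.pos _ _ ha
      nlinarith
  · have h : 0 ≤ κ.inner (A.link z) (A.angular z X) (A.angular z X) := κ.sq_nonneg _ _
    have := mul_self_pos.2 hr
    nlinarith [mul_nonneg h0.le h]

end ACStructure

/-- The weight with which the exact cone metrics enter the interpolation: `1` where the two radii
agree and `0` where one of them is not large, or where they are not comparable. -/
noncomputable def coneWeight (K s t : ℝ) : ℝ :=
  (1 - Real.smoothTransition ((2 * (s ^ 2 - t ^ 2) / (s ^ 2 + t ^ 2)) ^ 2)) *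
    Real.smoothTransition ((s ^ 2 + t ^ 2 - 16 * K ^ 2) / K ^ 2)

theorem coneWeight_nonneg (K s t : ℝ) : 0 ≤ coneWeight K s t :=
  mul_nonneg (sub_nonneg.2 (Real.smoothTransition.le_one _)) (Real.smoothTransition.nonneg _)

theorem coneWeight_le_one (K s t : ℝ) : coneWeight K s t ≤ 1 :=
  mul_le_one₀ (sub_le_self 1 (Real.smoothTransition.nonneg _))
    (Real.smoothTransition.nonneg _) (Real.smoothTransition.le_one _)

theorem coneWeight_comm (K s t : ℝ) : coneWeight K s t = coneWeight K t s := by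
  rw [coneWeight, coneWeight, add_comm (s ^ 2)]
  congr 3
  rw [← neg_sub (t ^ 2), mul_neg, neg_div, neg_sq]

/-- Concerns the hypersurface σ₁ = σ₂, the only place where h_ε has to equal h₀ exactly. -/
theorem coneWeight_self {K s : ℝ} (hK : 0 < K) (h : 17 * K ^ 2 ≤ 2 * s ^ 2) :
    coneWeight K s s = 1 := by
  rw [coneWeight, sub_self, mul_zero, zero_div, zero_pow two_ne_zero, Real.smoothTransition.zero,
    Real.smoothTransition.one_of_one_le, sub_zero, mul_one]
  rw [le_div_iff₀ (by positivity)]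
  linarith

/-- The two cutoffs say that the total radius exceeds 4K and that the squared radii differ by less
than a factor 3. Together they put both radii beyond 2K, so both cone metrics make sense on the
support of the weight. -/
theorem coneWeight_ne_zero {K s t : ℝ} (h : coneWeight K s t ≠ 0) :
    16 * K ^ 2 < s ^ 2 + t ^ 2 ∧ s ^ 2 + t ^ 2 < 4 * s ^ 2 ∧ s ^ 2 + t ^ 2 < 4 * t ^ 2 := by
  have h1 : 0 < (s ^ 2 + t ^ 2 - 16 * K ^ 2) / K ^ 2 := by
    by_contra hle
    exact h (by rw [coneWeight, Real.smoothTransition.zero_of_nonpos (not_lt.1 hle), mul_zero])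
  have h2 : (2 * (s ^ 2 - t ^ 2) / (s ^ 2 + t ^ 2)) ^ 2 < 1 := by
    by_contra hle
    exact h (by rw [coneWeight, Real.smoothTransition.one_of_one_le (not_lt.1 hle), sub_self,
      zero_mul])
  have h3 : 16 * K ^ 2 < s ^ 2 + t ^ 2 := by
    rcases div_pos_iff.1 h1 with h | h
    · linarith
    · nlinarith [h.2, sq_nonneg K]
  have h4 : 0 < s ^ 2 + t ^ 2 := by nlinarith [sq_nonneg K]
  rw [sq_lt_one_iff_abs_lt_one, abs_lt, lt_div_iff₀ h4, div_lt_iff₀ h4] at h2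
  exact ⟨h3, by linarith [h2.1], by linarith [h2.2]⟩

theorem contDiffAt_coneWeight {K : ℝ} {p : ℝ × ℝ} (hp : 0 < p.1) :
    ContDiffAt ℝ ∞ (fun p : ℝ × ℝ ↦ coneWeight K p.1 p.2) p := by
  have h : p.1 ^ 2 + p.2 ^ 2 ≠ 0 := by positivity
  have h0 : ContDiffAt ℝ ∞ (fun p : ℝ × ℝ ↦
      2 * (p.1 ^ 2 - p.2 ^ 2) / (p.1 ^ 2 + p.2 ^ 2)) p :=
    ContDiffAt.div (f := fun p : ℝ × ℝ ↦ 2 * (p.1 ^ 2 - p.2 ^ 2))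
      (g := fun p : ℝ × ℝ ↦ p.1 ^ 2 + p.2 ^ 2) (by fun_prop) (by fun_prop) h
  have h1 : ContDiffAt ℝ ∞ (fun p : ℝ × ℝ ↦
      (2 * (p.1 ^ 2 - p.2 ^ 2) / (p.1 ^ 2 + p.2 ^ 2)) ^ 2) p := h0.pow 2
  have h2 : ContDiffAt ℝ ∞ (fun p : ℝ × ℝ ↦ (p.1 ^ 2 + p.2 ^ 2 - 16 * K ^ 2) / K ^ 2) p := by
    fun_prop
  exact (contDiffAt_const.sub (Real.smoothTransition.contDiffAt.comp p h1)).mul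
    (Real.smoothTransition.contDiffAt.comp p h2)

section
variable {E H : Type*} [NormedAddCommGroup E] [NormedSpace ℝ E]
  [TopologicalSpace H] {I : ModelWithCorners ℝ E H}
  {M : Type*} [TopologicalSpace M] [ChartedSpace H M] [IsManifold I ∞ M]

/-- A smooth interpolation of two fields of bilinear forms is smooth, provided that the second one
is smooth where its weight does not vanish. -/
theorem contMDiffAt_interpolation
    {b c : ∀ x : M, TangentSpace I x →L[ℝ] TangentSpace I x →L[ℝ] ℝ} {w : M → ℝ} {x₀ : M}
    (hb : ContMDiffAt I (I.prod 𝓘(ℝ, E →L[ℝ] E →L[ℝ] ℝ)) ∞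
      (fun x ↦ TotalSpace.mk' (E →L[ℝ] E →L[ℝ] ℝ) x (b x)) x₀)
    (hw : ContMDiffAt I 𝓘(ℝ, ℝ) ∞ w x₀)
    (hc : (∀ᶠ x in 𝓝 x₀, w x = 0) ∨
      ContMDiffAt I (I.prod 𝓘(ℝ, E →L[ℝ] E →L[ℝ] ℝ)) ∞
      (fun x ↦ TotalSpace.mk' (E →L[ℝ] E →L[ℝ] ℝ) x (c x)) x₀) :
    ContMDiffAt I (I.prod 𝓘(ℝ, E →L[ℝ] E →L[ℝ] ℝ)) ∞
      (fun x ↦ TotalSpace.mk' (E →L[ℝ] E →L[ℝ] ℝ)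
        (E := fun x : M ↦ TangentSpace I x →L[ℝ] TangentSpace I x →L[ℝ] ℝ) x
        ((1 - w x) • b x + w x • c x)) x₀ := by
  have h1 : ContMDiffAt I 𝓘(ℝ, ℝ) ∞ (fun x ↦ 1 - w x) x₀ := contMDiffAt_const.sub hw
  have h2 : ContMDiffAt I (I.prod 𝓘(ℝ, E →L[ℝ] E →L[ℝ] ℝ)) ∞
      (fun x ↦ TotalSpace.mk' (E →L[ℝ] E →L[ℝ] ℝ)
        (E := fun x : M ↦ TangentSpace I x →L[ℝ] TangentSpace I x →L[ℝ] ℝ) x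
        ((1 - w x) • b x)) x₀ := h1.smul_section hb
  rcases hc with hc | hc
  · refine h2.congr_of_eventuallyEq ?_
    filter_upwards [hc] with x hx
    congr 1
    ext u v
    change (1 - w x) * b x u v + w x * c x u v = (1 - w x) * b x u v
    rw [hx, zero_mul, add_zero]
  · have h3 : ContMDiffAt I (I.prod 𝓘(ℝ, E →L[ℝ] E →L[ℝ] ℝ)) ∞
      (fun x ↦ TotalSpace.mk' (E →L[ℝ] E →L[ℝ] ℝ)
        (E := fun x : M ↦ TangentSpace I x →L[ℝ] TangentSpace I x →L[ℝ] ℝ) x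
        (w x • c x)) x₀ := hw.smul_section hc
    exact h2.add_section h3

end

namespace ACPair

variable {Z₁ Z₂ F₁ F₂ : Mfd.{u}} {g₁ : Z₁.Metric} {g₂ : Z₂.Metric} {κ₁ : F₁.Metric}
  {κ₂ : F₂.Metric} {ν₁ ν₂ : ℝ} (A : ACStructure g₁ κ₁ ν₁) (B : ACStructure g₂ κ₂ ν₂) {K : ℝ}

/-- The sum of the two cone metrics. -/
noncomputable def coneSum (z : Z₁.prod Z₂) :
    TangentSpace (Z₁.prod Z₂).I z →L[ℝ] TangentSpace (Z₁.prod Z₂).I z →L[ℝ] ℝ :=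
  ((show Z₁.E →L[ℝ] Z₁.E →L[ℝ] ℝ from A.coneForm z.1).bilinearComp
      (ContinuousLinearMap.fst ℝ Z₁.E Z₂.E) (ContinuousLinearMap.fst ℝ Z₁.E Z₂.E) +
    (show Z₂.E →L[ℝ] Z₂.E →L[ℝ] ℝ from B.coneForm z.2).bilinearComp
      (ContinuousLinearMap.snd ℝ Z₁.E Z₂.E) (ContinuousLinearMap.snd ℝ Z₁.E Z₂.E) :
    Z₁.E × Z₂.E →L[ℝ] Z₁.E × Z₂.E →L[ℝ] ℝ)

theorem contMDiffAt_coneSum {z : Z₁ × Z₂} (h₁ : A.R₀ < A.rho z.1) (h₂ : B.R₀ < B.rho z.2) :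
    ContMDiffAt (Z₁.prod Z₂).I
      ((Z₁.prod Z₂).I.prod 𝓘(ℝ, (Z₁.prod Z₂).E →L[ℝ] (Z₁.prod Z₂).E →L[ℝ] ℝ)) ∞
      (fun x ↦ TotalSpace.mk' ((Z₁.prod Z₂).E →L[ℝ] (Z₁.prod Z₂).E →L[ℝ] ℝ)
        (E := fun x : Z₁.prod Z₂ ↦ TangentSpace (Z₁.prod Z₂).I x →L[ℝ]
          TangentSpace (Z₁.prod Z₂).I x →L[ℝ] ℝ) x (coneSum A B x)) z := by
  have c₁ := contMDiffAt_pullback_form (I := Z₁.I.prod Z₂.I) (M := Z₁ × Z₂) (x₀ := z)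
    (f := Prod.fst) (A.contMDiffAt_coneForm h₁) contMDiffAt_fst
    (c := fun p ↦ (show Z₁.E →L[ℝ] Z₁.E →L[ℝ] ℝ from A.coneForm p.1).bilinearComp
      (ContinuousLinearMap.fst ℝ Z₁.E Z₂.E) (ContinuousLinearMap.fst ℝ Z₁.E Z₂.E))
    (Eventually.of_forall fun x v w ↦ by rw [mfderiv_fst]; rfl)
  have c₂ := contMDiffAt_pullback_form (I := Z₁.I.prod Z₂.I) (M := Z₁ × Z₂) (x₀ := z)
    (f := Prod.snd) (B.contMDiffAt_coneForm h₂) contMDiffAt_snd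
    (c := fun p ↦ (show Z₂.E →L[ℝ] Z₂.E →L[ℝ] ℝ from B.coneForm p.2).bilinearComp
      (ContinuousLinearMap.snd ℝ Z₁.E Z₂.E) (ContinuousLinearMap.snd ℝ Z₁.E Z₂.E))
    (Eventually.of_forall fun x v w ↦ by rw [mfderiv_snd]; rfl)
  exact c₁.add_section c₂

variable (K) in
/-- The weight of the cone metrics at a point of the product. -/
noncomputable def weight (z : Z₁ × Z₂) : ℝ := coneWeight K (A.sigma K z.1) (B.sigma K z.2)

theorem weight_nonneg (z : Z₁ × Z₂) : 0 ≤ weight A B K z := coneWeight_nonneg _ _ _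

theorem weight_le_one (z : Z₁ × Z₂) : weight A B K z ≤ 1 := coneWeight_le_one _ _ _

theorem weight_swap (z : Z₁ × Z₂) : weight B A K z.swap = weight A B K z := coneWeight_comm _ _ _

theorem weight_ne_zero (hK : 0 < K) {z : Z₁ × Z₂} (hz : weight A B K z ≠ 0) :
    2 * K < A.rho z.1 ∧ 2 * K < B.rho z.2 := by
  have h := coneWeight_ne_zero hz
  rw [A.lt_rho_iff hK le_rfl, B.lt_rho_iff hK le_rfl]
  have h1 := A.le_sigma hK (z := z.1)
  have h2 := B.le_sigma hK (z := z.2)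
  constructor <;> nlinarith

theorem contMDiff_weight (hA : A.R₀ < K) (hB : B.R₀ < K) :
    ContMDiff (Z₁.I.prod Z₂.I) 𝓘(ℝ, ℝ) ∞ (weight A B K) := by
  intro z
  have h1 : ContMDiffAt (Z₁.I.prod Z₂.I) 𝓘(ℝ, ℝ) ∞ (fun z : Z₁ × Z₂ ↦ A.sigma K z.1) z :=
    (A.contMDiff_sigma hA z.1).comp z contMDiffAt_fst
  have h2 : ContMDiffAt (Z₁.I.prod Z₂.I) 𝓘(ℝ, ℝ) ∞ (fun z : Z₁ × Z₂ ↦ B.sigma K z.2) z :=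
    (B.contMDiff_sigma hB z.2).comp z contMDiffAt_snd
  have h3 : ContMDiffAt 𝓘(ℝ, ℝ × ℝ) 𝓘(ℝ, ℝ) ∞ (fun p : ℝ × ℝ ↦ coneWeight K p.1 p.2)
      (A.sigma K z.1, B.sigma K z.2) :=
    (contDiffAt_coneWeight ((A.R₀_pos.trans hA).trans_le
      (A.le_sigma (A.R₀_pos.trans hA)))).contMDiffAt
  exact h3.comp z (h1.prodMk_space h2)

variable (K) in
/-- The interpolation between the product metric and the sum of the cone metrics. -/
noncomputable def blendForm (z : Z₁.prod Z₂) :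
    TangentSpace (Z₁.prod Z₂).I z →L[ℝ] TangentSpace (Z₁.prod Z₂).I z →L[ℝ] ℝ :=
  (1 - weight A B K z) • (g₁.prod g₂).inner z + weight A B K z • coneSum A B z

theorem contMDiff_blendForm (hA : A.R₀ < K) (hB : B.R₀ < K) :
    ContMDiff (Z₁.prod Z₂).I
      ((Z₁.prod Z₂).I.prod 𝓘(ℝ, (Z₁.prod Z₂).E →L[ℝ] (Z₁.prod Z₂).E →L[ℝ] ℝ)) ∞
      (fun x ↦ TotalSpace.mk' ((Z₁.prod Z₂).E →L[ℝ] (Z₁.prod Z₂).E →L[ℝ] ℝ)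
        (E := fun x : Z₁.prod Z₂ ↦ TangentSpace (Z₁.prod Z₂).I x →L[ℝ]
          TangentSpace (Z₁.prod Z₂).I x →L[ℝ] ℝ) x (blendForm A B K x)) := by
  intro z
  have hK : 0 < K := A.R₀_pos.trans hA
  have hw : ContMDiffAt (Z₁.prod Z₂).I 𝓘(ℝ, ℝ) ∞ (weight A B K) z := contMDiff_weight A B hA hB z
  refine contMDiffAt_interpolation (I := (Z₁.prod Z₂).I) (M := Z₁.prod Z₂) ((g₁.prod g₂).contMDiff z)
    hw ?_
  by_cases hz : A.R₀ < A.rho z.1 ∧ B.R₀ < B.rho z.2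
  · exact Or.inr (contMDiffAt_coneSum A B hz.1 hz.2)
  · left
    rw [not_and_or] at hz
    have hc₁ : Tendsto Prod.fst (𝓝 z) (𝓝 z.1) := continuousAt_fst
    have hc₂ : Tendsto Prod.snd (𝓝 z) (𝓝 z.2) := continuousAt_snd
    rcases hz with hz | hz
    · filter_upwards [hc₁.eventually (A.eventually_rho_lt ((not_lt.1 hz).trans_lt hA))] with x hx
      by_contra h
      linarith [(weight_ne_zero A B hK h).1]
    · filter_upwards [hc₂.eventually (B.eventually_rho_lt ((not_lt.1 hz).trans_lt hB))] with x hx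
      by_contra h
      linarith [(weight_ne_zero A B hK h).2]

/-- The interpolating metric on the product. -/
noncomputable def blend (hA : A.R₀ < K) (hB : B.R₀ < K) : (Z₁.prod Z₂).Metric :=
  Mfd.Metric.ofForm (Z₁.prod Z₂) (blendForm A B K)
    (fun z v w ↦ by
      change (1 - weight A B K z) * ((g₁.prod g₂).inner z v w) + weight A B K z *
        (A.coneForm z.1 v.1 w.1 + B.coneForm z.2 v.2 w.2) =
        (1 - weight A B K z) * ((g₁.prod g₂).inner z w v) + weight A B K z *
        (A.coneForm z.1 w.1 v.1 + B.coneForm z.2 w.2 v.2)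
      exact congrArg₂ (· + ·) (congrArg (_ * ·) ((g₁.prod g₂).symm z v w)) (congrArg (_ * ·)
        (congrArg₂ (· + ·) (A.coneForm_symm z.1 v.1 w.1) (B.coneForm_symm z.2 v.2 w.2))))
    (fun z v hv ↦ by
      have hK : 0 < K := A.R₀_pos.trans hA
      change 0 < (1 - weight A B K z) * ((g₁.prod g₂).inner z v v) + weight A B K z *
        (A.coneForm z.1 v.1 v.1 + B.coneForm z.2 v.2 v.2)
      have h1 := (g₁.prod g₂).pos z v hv
      have h2 := weight_nonneg A B (K := K) z
      have h3 := weight_le_one A B (K := K) z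
      by_cases h0 : weight A B K z = 0
      · rw [h0]; linarith
      obtain ⟨k₁, k₂⟩ := weight_ne_zero A B hK h0
      have hpos : 0 < weight A B K z := lt_of_le_of_ne h2 (Ne.symm h0)
      have h4 : 0 < A.coneForm z.1 v.1 v.1 + B.coneForm z.2 v.2 v.2 := by
        by_cases hv1 : v.1 = 0
        · have hv2 : v.2 ≠ 0 := fun hv2 ↦ hv (Prod.ext hv1 hv2)
          exact add_pos_of_nonneg_of_pos (A.coneForm_nonneg _ _) (B.coneForm_pos (by linarith) hv2)
        · exact add_pos_of_pos_of_nonneg (A.coneForm_pos (by linarith) hv1) (B.coneForm_nonneg _ _)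
      exact add_pos_of_nonneg_of_pos (mul_nonneg (by linarith) h1.le) (mul_pos hpos h4))
    (contMDiff_blendForm A B hA hB)

theorem blend_sq (hA : A.R₀ < K) (hB : B.R₀ < K) (z : Z₁ × Z₂) (X : TangentSpace Z₁.I z.1)
    (Y : TangentSpace Z₂.I z.2) :
    (blend A B hA hB).sq z (X, Y) = (1 - weight A B K z) * (g₁.sq z.1 X + g₂.sq z.2 Y) +
      weight A B K z * (A.coneForm z.1 X X + B.coneForm z.2 Y Y) := rfl

end ACPair

theorem eq_zero_of_mfderiv_eq_zero {E H E' H' M N : Type*} [NormedAddCommGroup E]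
    [NormedSpace ℝ E] [TopologicalSpace H] {I : ModelWithCorners ℝ E H} [NormedAddCommGroup E']
    [NormedSpace ℝ E'] [TopologicalSpace H'] {J : ModelWithCorners ℝ E' H'}
    [TopologicalSpace M] [ChartedSpace H M] [TopologicalSpace N] [ChartedSpace H' N]
    {f : M → N} {g : N → M} {x : M} (hf : MDifferentiableAt I J f x)
    (hg : MDifferentiableAt J I g (f x)) (h : ∀ᶠ y in 𝓝 x, g (f y) = y) (v : TangentSpace I x)
    (hv : mfderiv I J f x v = 0) : v = 0 := by
  have h2 := hg.hasMFDerivAt.comp x hf.hasMFDerivAt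
  have h3 : HasMFDerivAt I I (g ∘ f) x (ContinuousLinearMap.id ℝ (TangentSpace I x)) :=
    (hasMFDerivAt_id x).congr_of_eventuallyEq h
  have h4 := congrArg (fun L : TangentSpace I x →L[ℝ] TangentSpace I x ↦ L v)
    (hasMFDerivAt_unique h2 h3)
  refine h4.symm.trans ?_
  change mfderiv J I g (f x) (mfderiv I J f x v) = 0
  rw [hv]
  exact map_zero _

/-! ### The family of metrics on the level set -/

namespace ACPair

variable {Z₁ Z₂ F₁ F₂ : Mfd.{u}} {g₁ : Z₁.Metric} {g₂ : Z₂.Metric} {κ₁ : F₁.Metric}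
  {κ₂ : F₂.Metric} {ν₁ ν₂ : ℝ} {A : ACStructure g₁ κ₁ ν₁} {B : ACStructure g₂ κ₂ ν₂} {K : ℝ}
  (hA : A.R₀ < K) (hB : B.R₀ < K)

theorem contMDiff_expand {r : ℝ} (hr : 10 * K < r) :
    ContMDiff (levelMfd hA hB).I (Z₁.I.prod Z₂.I) ∞ (expand hA hB r) := fun y ↦
  ContMDiffAt.comp (g := fun q : ℝ × levelMfd hA hB ↦ expand hA hB q.1 q.2)
    (f := fun y ↦ (r, y)) y (contMDiffAt_expand hA hB hr y)
    (contMDiffAt_const.prodMk contMDiffAt_id)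

theorem flowDiffeo_invFun (w : Z₁ × Z₂) : (flowDiffeo hA hB).invFun w =
    (√(sqRadius A B K w), contract hA hB √(sqRadius A B K w) w) := rfl

theorem flowDiffeo_invFun_expand {r : ℝ} (hr : 10 * K < r) (y : levelMfd hA hB) :
    (flowDiffeo hA hB).invFun (expand hA hB r y) = (r, y) := by
  have hK : 0 < K := A.R₀_pos.trans hA
  rw [flowDiffeo_invFun, sqRadius_expand hA hB hr.le, Real.sqrt_sq (by linarith),
    contract_expand hA hB hr.le]

/-- The second component of the inverse of `flowDiffeo` is a smooth left inverse of `expand hA hB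
r`. This gives positivity of the induced form. -/
theorem mfderiv_expand_injective {r : ℝ} (hr : 10 * K < r) (y : levelMfd hA hB)
    (v : TangentSpace (levelMfd hA hB).I y)
    (hv : mfderiv (levelMfd hA hB).I (Z₁.I.prod Z₂.I) (expand hA hB r) y v = 0) : v = 0 := by
  have hs : ((r, y) : ℝ × levelMfd hA hB) ∈ (flowDiffeo hA hB).source := ⟨hr, trivial⟩
  have h1 := (flowDiffeo hA hB).contMDiffAt_invFun ((flowDiffeo hA hB).map_source hs)
  have h3 := h1.mdifferentiableAt (by simp)
  have hl := flowDiffeo_invFun_expand hA hB hr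
  have h4 : MDifferentiableAt (Z₁.I.prod Z₂.I) (levelMfd hA hB).I
      (fun w ↦ ((flowDiffeo hA hB).invFun w).2) (expand hA hB r y) := h3.snd
  clear h1 h3
  generalize (flowDiffeo hA hB).invFun = G at *
  exact eq_zero_of_mfderiv_eq_zero (f := expand hA hB r)
    ((contMDiff_expand hA hB hr y).mdifferentiableAt (by simp))
    h4 (Eventually.of_forall fun y' ↦ congrArg Prod.snd (hl y')) v hv

/-- The rescaled form induced on the level set of radius `r`. -/
noncomputable def levelForm (r : ℝ) (y : levelMfd hA hB) :
    TangentSpace (levelMfd hA hB).I y →L[ℝ] TangentSpace (levelMfd hA hB).I y →L[ℝ] ℝ :=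
  let L : (levelMfd hA hB).E →L[ℝ] Z₁.E × Z₂.E :=
    mfderiv (levelMfd hA hB).I (Z₁.I.prod Z₂.I) (expand hA hB r) y
  let b : Z₁.E × Z₂.E →L[ℝ] Z₁.E × Z₂.E →L[ℝ] ℝ := blendForm A B K (expand hA hB r y)
  ((r ^ 2)⁻¹ • b.bilinearComp L L :
    (levelMfd hA hB).E →L[ℝ] (levelMfd hA hB).E →L[ℝ] ℝ)

theorem levelForm_apply (r : ℝ) (y : levelMfd hA hB) (v w : TangentSpace (levelMfd hA hB).I y) :
    levelForm hA hB r y v w = (r ^ 2)⁻¹ * (blend A B hA hB).inner (expand hA hB r y)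
      (mfderiv (levelMfd hA hB).I (Z₁.I.prod Z₂.I) (expand hA hB r) y v)
      (mfderiv (levelMfd hA hB).I (Z₁.I.prod Z₂.I) (expand hA hB r) y w) := rfl

theorem contMDiffAt_levelForm {a : ℝ → ℝ} {ε : ℝ} (ha : ContDiffAt ℝ ∞ a ε) (hr : 10 * K < a ε)
    (y : levelMfd hA hB) :
    ContMDiffAt (𝓘(ℝ, ℝ).prod (levelMfd hA hB).I) ((levelMfd hA hB).I.prod
        𝓘(ℝ, (levelMfd hA hB).E →L[ℝ] (levelMfd hA hB).E →L[ℝ] ℝ)) ∞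
      (fun p : ℝ × levelMfd hA hB ↦
        TotalSpace.mk' ((levelMfd hA hB).E →L[ℝ] (levelMfd hA hB).E →L[ℝ] ℝ)
        (E := fun y : levelMfd hA hB ↦ TangentSpace (levelMfd hA hB).I y →L[ℝ]
          TangentSpace (levelMfd hA hB).I y →L[ℝ] ℝ)
        p.2 (levelForm hA hB (a p.1) p.2)) (ε, y) := by
  have hK : 0 < K := A.R₀_pos.trans hA
  have h1 : ContMDiffAt (𝓘(ℝ, ℝ).prod (levelMfd hA hB).I) (Z₁.I.prod Z₂.I) ∞
      (fun q : ℝ × levelMfd hA hB ↦ expand hA hB (a q.1) q.2) (ε, y) := by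
    refine ContMDiffAt.comp (g := fun q : ℝ × levelMfd hA hB ↦ expand hA hB q.1 q.2)
      (f := fun q : ℝ × levelMfd hA hB ↦ (a q.1, q.2)) (ε, y) (contMDiffAt_expand hA hB hr y) ?_
    exact ContMDiffAt.prodMk (ContMDiffAt.comp (g := a) (ε, y) ha.contMDiffAt contMDiffAt_fst)
      contMDiffAt_snd
  have h2 : ContDiffAt ℝ ∞ (fun ε ↦ (a ε ^ 2)⁻¹) ε :=
    (ha.pow 2).inv (pow_ne_zero 2 (by linarith))
  exact contMDiffAt_pullback_form_param (IP := 𝓘(ℝ, ℝ)) (P := ℝ) (I := (levelMfd hA hB).I)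
    (J := (Z₁.prod Z₂).I) (f := fun ε ↦ expand hA hB (a ε)) (p₀ := (ε, y))
    (a := fun ε ↦ (a ε ^ 2)⁻¹) (c := fun ε y ↦ levelForm hA hB (a ε) y)
    ((blend A B hA hB).contMDiff _) h1 h2.contMDiffAt
    (Eventually.of_forall fun p v w ↦ levelForm_apply hA hB (a p.1) p.2 v w)

/-- The rescaled metric induced on the level set of radius `r`. -/
noncomputable def levelMetric (r : ℝ) (hr : 10 * K < r) : (levelMfd hA hB).Metric :=
  Mfd.Metric.ofForm (levelMfd hA hB) (levelForm hA hB r)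
    (fun y v w ↦ by
      rw [levelForm_apply, levelForm_apply]
      exact congrArg (_ * ·) ((blend A B hA hB).symm _ _ _))
    (fun y v hv ↦ by
      have hK : 0 < K := A.R₀_pos.trans hA
      have hr0 : 0 < r := by linarith
      rw [levelForm_apply]
      exact mul_pos (by positivity) ((blend A B hA hB).pos _ _
        fun h ↦ hv (mfderiv_expand_injective hA hB hr y v h)))
    (fun y ↦ ContMDiffAt.comp (f := fun y : levelMfd hA hB ↦ ((0 : ℝ), y)) y
      (contMDiffAt_levelForm hA hB (a := fun _ ↦ r) (ε := 0) contDiffAt_const hr y)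
      (contMDiffAt_const.prodMk contMDiffAt_id))

/-- The chain rule: a map L into the abstract level manifold is measured through its image G in the
product. All charts of the blowup are computed this way. -/
theorem levelMetric_sq_mfderiv {r : ℝ} (hr : 10 * K < r) {E' H' M : Type*}
    [NormedAddCommGroup E'] [NormedSpace ℝ E'] [TopologicalSpace H'] {J : ModelWithCorners ℝ E' H'}
    [TopologicalSpace M] [ChartedSpace H' M] {L : M → levelMfd hA hB} {G : M → Z₁ × Z₂} {m : M}
    (hL : MDifferentiableAt J (levelMfd hA hB).I L m)
    (h : ∀ᶠ m' in 𝓝 m, expand hA hB r (L m') = G m') (v : TangentSpace J m) :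
    (levelMetric hA hB r hr).sq (L m) (mfderiv J (levelMfd hA hB).I L m v) =
      (r ^ 2)⁻¹ * (blend A B hA hB).sq (G m) (mfderiv J (Z₁.I.prod Z₂.I) G m v) := by
  have h1 := ((contMDiff_expand hA hB hr (L m)).mdifferentiableAt (by simp)).hasMFDerivAt.comp m
    hL.hasMFDerivAt
  have h2 := h1.congr_of_eventuallyEq (h.mono fun _ hx ↦ hx.symm)
  have h3 : ∀ (p : Z₁ × Z₂) (_ : expand hA hB r (L m) = p) (X : Z₁.E × Z₂.E),
      (blend A B hA hB).sq p X = (blend A B hA hB).sq (expand hA hB r (L m)) X := by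
    rintro p rfl X; rfl
  rw [h2.mfderiv]
  exact congrArg ((r ^ 2)⁻¹ * ·) (h3 (G m) h.self_of_nhds _).symm

open Classical in
variable (K) in
/-- The radius corresponding to the parameter `ε`. -/
noncomputable def levelRadius (ε : ℝ) : ℝ := if ε ∈ Ioo 0 (10 * K)⁻¹ then ε⁻¹ else 20 * K

theorem levelRadius_of_mem {ε : ℝ} (hε : ε ∈ Ioo 0 (10 * K)⁻¹) : levelRadius K ε = ε⁻¹ := if_pos hε

/-- The default radius 20K outside the parameter interval only serves to have a metric for every
real ε. -/
theorem lt_levelRadius (hK : 0 < K) (ε : ℝ) : 10 * K < levelRadius K ε := by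
  by_cases hε : ε ∈ Ioo 0 (10 * K)⁻¹
  · rw [levelRadius_of_mem hε]
    exact (lt_inv_comm₀ hε.1 (by positivity)).1 hε.2
  · rw [levelRadius, if_neg hε]; linarith

/-- The family of metrics on the level set. -/
noncomputable def levelFamily (ε : ℝ) : (levelMfd hA hB).Metric :=
  levelMetric hA hB (levelRadius K ε) (lt_levelRadius (A.R₀_pos.trans hA) ε)

theorem levelFamily_inv {r : ℝ} (hr : 10 * K < r) :
    levelFamily hA hB r⁻¹ = levelMetric hA hB r hr := by
  have hK : 0 < K := A.R₀_pos.trans hA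
  have h : levelRadius K r⁻¹ = r := by
    rw [levelRadius_of_mem, inv_inv]
    exact ⟨inv_pos.2 (by linarith), (inv_lt_inv₀ (by linarith) (by linarith)).2 hr⟩
  rw [levelFamily]
  congr 1

theorem contMDiffOn_levelFamily :
    ContMDiffOn (𝓘(ℝ, ℝ).prod (levelMfd hA hB).I) ((levelMfd hA hB).I.prod
        𝓘(ℝ, (levelMfd hA hB).E →L[ℝ] (levelMfd hA hB).E →L[ℝ] ℝ)) ∞
      (fun p : ℝ × levelMfd hA hB ↦
        TotalSpace.mk' ((levelMfd hA hB).E →L[ℝ] (levelMfd hA hB).E →L[ℝ] ℝ)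
        (E := fun y : levelMfd hA hB ↦ TangentSpace (levelMfd hA hB).I y →L[ℝ]
          TangentSpace (levelMfd hA hB).I y →L[ℝ] ℝ)
        p.2 ((levelFamily hA hB p.1).inner p.2)) (Ioo 0 (10 * K)⁻¹ ×ˢ univ) := by
  have hK : 0 < K := A.R₀_pos.trans hA
  rintro ⟨ε, y⟩ ⟨hε, -⟩
  have hr := lt_levelRadius hK ε
  rw [levelRadius_of_mem hε] at hr
  refine ContMDiffAt.contMDiffWithinAt ((contMDiffAt_levelForm hA hB (a := fun ε ↦ ε⁻¹)
    (contDiffAt_inv ℝ hε.1.ne') hr y).congr_of_eventuallyEq ?_)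
  have hc : Tendsto Prod.fst (𝓝 (ε, y)) (𝓝 ε) := continuousAt_fst
  filter_upwards [hc.eventually (Ioo_mem_nhds hε.1 hε.2)] with p hp
  have : (levelFamily hA hB p.1).inner p.2 = levelForm hA hB (levelRadius K p.1) p.2 := rfl
  rw [this, levelRadius_of_mem hp]

end ACPair

/-! ### The spherical suspension as an edge space -/

/-- The angle `θ ∈ (0, π / 2)` with `tan θ = exp t`. -/
noncomputable def susAngle (t : ℝ) : ℝ := Real.arctan (Real.exp t)

/-- The coordinate log tan θ turns (0, π/2) into the whole line, so that the regular part of the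
suspension is the plain product ℝ × F₁ × F₂. -/
theorem susAngle_mem (t : ℝ) : susAngle t ∈ Ioo 0 (Real.pi / 2) :=
  ⟨Real.arctan_pos.2 (Real.exp_pos t), Real.arctan_lt_pi_div_two _⟩

theorem sin_susAngle_pos (t : ℝ) : 0 < Real.sin (susAngle t) :=
  Real.sin_pos_of_pos_of_lt_pi (susAngle_mem t).1 (by linarith [(susAngle_mem t).2, Real.pi_pos])

theorem cos_susAngle_pos (t : ℝ) : 0 < Real.cos (susAngle t) :=
  Real.cos_pos_of_mem_Ioo ⟨by linarith [(susAngle_mem t).1, Real.pi_pos], (susAngle_mem t).2⟩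

theorem tan_susAngle (t : ℝ) : Real.tan (susAngle t) = Real.exp t := Real.tan_arctan _

theorem log_tan_susAngle (t : ℝ) : Real.log (Real.tan (susAngle t)) = t := by
  rw [tan_susAngle, Real.log_exp]

theorem tan_pos_of_mem {θ : ℝ} (h : θ ∈ Ioo 0 (Real.pi / 2)) : 0 < Real.tan θ :=
  Real.tan_pos_of_pos_of_lt_pi_div_two h.1 h.2

theorem susAngle_log_tan {θ : ℝ} (h : θ ∈ Ioo 0 (Real.pi / 2)) :
    susAngle (Real.log (Real.tan θ)) = θ := by
  rw [susAngle, Real.exp_log (tan_pos_of_mem h), Real.arctan_tan (by linarith [h.1, Real.pi_pos]) h.2]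

theorem contDiff_susAngle : ContDiff ℝ ∞ susAngle := Real.contDiff_exp.arctan

theorem contDiffAt_log_tan {θ : ℝ} (h : θ ∈ Ioo 0 (Real.pi / 2)) :
    ContDiffAt ℝ ∞ (fun θ ↦ Real.log (Real.tan θ)) θ := by
  have hc : Real.cos θ ≠ 0 :=
    (Real.cos_pos_of_mem_Ioo ⟨by linarith [h.1, Real.pi_pos], h.2⟩).ne'
  exact (Real.contDiffAt_tan.2 hc).log (tan_pos_of_mem h).ne'

theorem hasDerivAt_log_tan {θ : ℝ} (h : θ ∈ Ioo 0 (Real.pi / 2)) :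
    HasDerivAt (fun θ ↦ Real.log (Real.tan θ)) (Real.sin θ * Real.cos θ)⁻¹ θ := by
  have hc : 0 < Real.cos θ :=
    (Real.cos_pos_of_mem_Ioo ⟨by linarith [h.1, Real.pi_pos], h.2⟩)
  have hs : 0 < Real.sin θ := Real.sin_pos_of_pos_of_lt_pi h.1 (by linarith [h.2, Real.pi_pos])
  have h1 := (Real.hasDerivAt_tan hc.ne').log (tan_pos_of_mem h).ne'
  convert h1 using 1
  rw [Real.tan_eq_sin_div_cos]
  field_simp

/-- The inverse of `sin ∘ susAngle`. -/
noncomputable def logRad (s : ℝ) : ℝ := Real.log (Real.tan (Real.arcsin s))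

theorem arcsin_mem {s : ℝ} (hs : s ∈ Ioo (0 : ℝ) 1) : Real.arcsin s ∈ Ioo 0 (Real.pi / 2) :=
  ⟨Real.arcsin_pos.2 hs.1, Real.arcsin_lt_pi_div_two.2 hs.2⟩

theorem susAngle_logRad {s : ℝ} (hs : s ∈ Ioo (0 : ℝ) 1) : susAngle (logRad s) = Real.arcsin s :=
  susAngle_log_tan (arcsin_mem hs)

theorem sin_susAngle_logRad {s : ℝ} (hs : s ∈ Ioo (0 : ℝ) 1) :
    Real.sin (susAngle (logRad s)) = s := by
  rw [susAngle_logRad hs, Real.sin_arcsin (by linarith [hs.1]) hs.2.le]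

theorem logRad_sin (t : ℝ) : logRad (Real.sin (susAngle t)) = t := by
  rw [logRad, Real.arcsin_sin (by linarith [(susAngle_mem t).1, Real.pi_pos]) (susAngle_mem t).2.le,
    log_tan_susAngle]

theorem contDiffAt_logRad {s : ℝ} (hs : s ∈ Ioo (0 : ℝ) 1) : ContDiffAt ℝ ∞ logRad s :=
  (contDiffAt_log_tan (arcsin_mem hs)).comp s
    (Real.contDiffAt_arcsin (by linarith [hs.1]) hs.2.ne)

/-- With s = sin θ, d log tan θ = dθ / (sin θ cos θ) and dθ = ds / cos θ. -/
theorem hasDerivAt_logRad {s : ℝ} (hs : s ∈ Ioo (0 : ℝ) 1) :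
    HasDerivAt logRad (s * (1 - s ^ 2))⁻¹ s := by
  have h1 := (hasDerivAt_log_tan (arcsin_mem hs)).comp s
    (Real.hasDerivAt_arcsin (by linarith [hs.1]) hs.2.ne)
  have hp : 0 < 1 - s ^ 2 := by nlinarith [hs.1, hs.2]
  have hq := Real.sqrt_pos.2 hp
  have hs0 := hs.1
  refine h1.congr_deriv ?_
  rw [Real.sin_arcsin (by linarith [hs.1]) hs.2.le, Real.cos_arcsin]
  field_simp
  exact (Real.sq_sqrt hp.le).symm

/-- In the coordinate log tan θ, exchanging the two factors is the reflection t ↦ −t; the cone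
bundle at π/2 is obtained from the one at 0 by this sign. -/
theorem susAngle_neg (t : ℝ) : susAngle (-t) = Real.pi / 2 - susAngle t := by
  rw [susAngle, susAngle, Real.exp_neg, Real.arctan_inv_of_pos (Real.exp_pos t)]

theorem sin_susAngle_neg (t : ℝ) : Real.sin (susAngle (-t)) = Real.cos (susAngle t) := by
  rw [susAngle_neg, Real.sin_pi_div_two_sub]

theorem cos_susAngle_neg (t : ℝ) : Real.cos (susAngle (-t)) = Real.sin (susAngle t) := by
  rw [susAngle_neg, Real.cos_pi_div_two_sub]

section
variable {E H : Type*} [NormedAddCommGroup E] [NormedSpace ℝ E]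
  [TopologicalSpace H] {I : ModelWithCorners ℝ E H}
  {M : Type*} [TopologicalSpace M] [ChartedSpace H M] [IsManifold I ∞ M]
  {b c : ∀ x : M, TangentSpace I x →L[ℝ] TangentSpace I x →L[ℝ] ℝ} {x₀ : M}
  (hb : ContMDiffAt I (I.prod 𝓘(ℝ, E →L[ℝ] E →L[ℝ] ℝ)) ∞
    (fun x ↦ TotalSpace.mk' (E →L[ℝ] E →L[ℝ] ℝ) x (b x)) x₀)
include hb

theorem contMDiffAt_smul_form {w : M → ℝ} (hw : ContMDiffAt I 𝓘(ℝ, ℝ) ∞ w x₀) :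
    ContMDiffAt I (I.prod 𝓘(ℝ, E →L[ℝ] E →L[ℝ] ℝ)) ∞
      (fun x ↦ TotalSpace.mk' (E →L[ℝ] E →L[ℝ] ℝ)
        (E := fun x : M ↦ TangentSpace I x →L[ℝ] TangentSpace I x →L[ℝ] ℝ) x (w x • b x)) x₀ :=
  hw.smul_section hb

theorem contMDiffAt_add_form
    (hc : ContMDiffAt I (I.prod 𝓘(ℝ, E →L[ℝ] E →L[ℝ] ℝ)) ∞
      (fun x ↦ TotalSpace.mk' (E →L[ℝ] E →L[ℝ] ℝ) x (c x)) x₀) :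
    ContMDiffAt I (I.prod 𝓘(ℝ, E →L[ℝ] E →L[ℝ] ℝ)) ∞
      (fun x ↦ TotalSpace.mk' (E →L[ℝ] E →L[ℝ] ℝ)
        (E := fun x : M ↦ TangentSpace I x →L[ℝ] TangentSpace I x →L[ℝ] ℝ) x (b x + c x)) x₀ :=
  hb.add_section hc

end

/-- The regular part of the suspension, with coordinates `(log (tan θ), a, b)`. -/
noncomputable abbrev susReg (F₁ F₂ : Mfd.{u}) : Mfd.{u} where
  carrier := ℝ × (F₁ × F₂)
  E := ℝ × (F₁.E × F₂.E)
  H := ModelProd ℝ (ModelProd F₁.H F₂.H)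
  I := 𝓘(ℝ, ℝ).prod (F₁.I.prod F₂.I)

section
variable {F₁ F₂ : Mfd.{u}} (κ₁ : F₁.Metric) (κ₂ : F₂.Metric)

/-- The metric `dθ ^ 2 + cos ^ 2 θ κ₁ + sin ^ 2 θ κ₂` as a field of forms. -/
noncomputable def susForm (m : ℝ × (F₁ × F₂)) :
    TangentSpace (𝓘(ℝ, ℝ).prod (F₁.I.prod F₂.I)) m →L[ℝ]
      TangentSpace (𝓘(ℝ, ℝ).prod (F₁.I.prod F₂.I)) m →L[ℝ] ℝ :=
  let p₁ := (ContinuousLinearMap.fst ℝ F₁.E F₂.E).comp (ContinuousLinearMap.snd ℝ ℝ (F₁.E × F₂.E))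
  let p₂ := (ContinuousLinearMap.snd ℝ F₁.E F₂.E).comp (ContinuousLinearMap.snd ℝ ℝ (F₁.E × F₂.E))
  ((Real.sin (susAngle m.1) * Real.cos (susAngle m.1)) ^ 2 • (ContinuousLinearMap.mul ℝ ℝ).bilinearComp
      (ContinuousLinearMap.fst ℝ ℝ (F₁.E × F₂.E)) (ContinuousLinearMap.fst ℝ ℝ (F₁.E × F₂.E)) +
    (Real.cos (susAngle m.1) ^ 2 • (show F₁.E →L[ℝ] F₁.E →L[ℝ] ℝ from
      κ₁.inner m.2.1).bilinearComp p₁ p₁ +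
    Real.sin (susAngle m.1) ^ 2 • (show F₂.E →L[ℝ] F₂.E →L[ℝ] ℝ from
      κ₂.inner m.2.2).bilinearComp p₂ p₂) :
    ℝ × (F₁.E × F₂.E) →L[ℝ] ℝ × (F₁.E × F₂.E) →L[ℝ] ℝ)

theorem contMDiff_susForm : ContMDiff (𝓘(ℝ, ℝ).prod (F₁.I.prod F₂.I))
    ((𝓘(ℝ, ℝ).prod (F₁.I.prod F₂.I)).prod
      𝓘(ℝ, (ℝ × (F₁.E × F₂.E)) →L[ℝ] (ℝ × (F₁.E × F₂.E)) →L[ℝ] ℝ)) ∞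
    (fun m : ℝ × (F₁ × F₂) ↦
      TotalSpace.mk' ((ℝ × (F₁.E × F₂.E)) →L[ℝ] (ℝ × (F₁.E × F₂.E)) →L[ℝ] ℝ)
      (E := fun m : ℝ × (F₁ × F₂) ↦ TangentSpace (𝓘(ℝ, ℝ).prod (F₁.I.prod F₂.I)) m →L[ℝ]
        TangentSpace (𝓘(ℝ, ℝ).prod (F₁.I.prod F₂.I)) m →L[ℝ] ℝ) m (susForm κ₁ κ₂ m)) := by
  intro m
  let p₁ := (ContinuousLinearMap.fst ℝ F₁.E F₂.E).comp (ContinuousLinearMap.snd ℝ ℝ (F₁.E × F₂.E))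
  let p₂ := (ContinuousLinearMap.snd ℝ F₁.E F₂.E).comp (ContinuousLinearMap.snd ℝ ℝ (F₁.E × F₂.E))
  have hf : ∀ x : ℝ × (F₁ × F₂), HasMFDerivAt (𝓘(ℝ, ℝ).prod (F₁.I.prod F₂.I)) F₁.I
      (fun m : ℝ × (F₁ × F₂) ↦ m.2.1) x p₁ := fun x ↦
    (hasMFDerivAt_fst (I := F₁.I) (I' := F₂.I) x.2).comp x
      (hasMFDerivAt_snd (I := 𝓘(ℝ, ℝ)) (I' := F₁.I.prod F₂.I) x)
  have hg : ∀ x : ℝ × (F₁ × F₂), HasMFDerivAt (𝓘(ℝ, ℝ).prod (F₁.I.prod F₂.I)) F₂.I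
      (fun m : ℝ × (F₁ × F₂) ↦ m.2.2) x p₂ := fun x ↦
    (hasMFDerivAt_snd (I := F₁.I) (I' := F₂.I) x.2).comp x
      (hasMFDerivAt_snd (I := 𝓘(ℝ, ℝ)) (I' := F₁.I.prod F₂.I) x)
  have h₀ := contMDiffAt_pullback_form (I := 𝓘(ℝ, ℝ).prod (F₁.I.prod F₂.I)) (J := 𝓘(ℝ, ℝ))
    (f := Prod.fst) (x₀ := m) (b := (riemannianMetricVectorSpace ℝ).inner)
    (((riemannianMetricVectorSpace ℝ).contMDiff.of_le le_top) _) contMDiffAt_fst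
    (c := fun _ ↦ (ContinuousLinearMap.mul ℝ ℝ).bilinearComp
      (ContinuousLinearMap.fst ℝ ℝ (F₁.E × F₂.E)) (ContinuousLinearMap.fst ℝ ℝ (F₁.E × F₂.E)))
    (Eventually.of_forall fun x v w ↦ by rw [mfderiv_fst]; exact mul_comm v.1 w.1)
  have h₁ := contMDiffAt_pullback_form (I := 𝓘(ℝ, ℝ).prod (F₁.I.prod F₂.I)) (J := F₁.I)
    (f := fun m : ℝ × (F₁ × F₂) ↦ m.2.1) (x₀ := m) (b := κ₁.inner) (κ₁.contMDiff _)
    (contMDiffAt_fst.comp m contMDiffAt_snd)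
    (c := fun m ↦ (show F₁.E →L[ℝ] F₁.E →L[ℝ] ℝ from κ₁.inner m.2.1).bilinearComp p₁ p₁)
    (Eventually.of_forall fun x v w ↦ by rw [(hf x).mfderiv]; rfl)
  have h₂ := contMDiffAt_pullback_form (I := 𝓘(ℝ, ℝ).prod (F₁.I.prod F₂.I)) (J := F₂.I)
    (f := fun m : ℝ × (F₁ × F₂) ↦ m.2.2) (x₀ := m) (b := κ₂.inner) (κ₂.contMDiff _)
    (contMDiffAt_snd.comp m contMDiffAt_snd)
    (c := fun m ↦ (show F₂.E →L[ℝ] F₂.E →L[ℝ] ℝ from κ₂.inner m.2.2).bilinearComp p₂ p₂)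
    (Eventually.of_forall fun x v w ↦ by rw [(hg x).mfderiv]; rfl)
  have hs : ∀ {f : ℝ → ℝ}, ContDiff ℝ ∞ f → ContMDiffAt (𝓘(ℝ, ℝ).prod (F₁.I.prod F₂.I)) 𝓘(ℝ, ℝ) ∞
      (fun m : ℝ × (F₁ × F₂) ↦ f m.1) m := fun hf ↦ hf.contMDiff.contMDiffAt.comp m contMDiffAt_fst
  have k₀ := contMDiffAt_smul_form h₀ (hs ((((Real.contDiff_sin.comp contDiff_susAngle).mul
    (Real.contDiff_cos.comp contDiff_susAngle))).pow 2))
  have k₁ := contMDiffAt_smul_form h₁ (hs ((Real.contDiff_cos.comp contDiff_susAngle).pow 2))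
  have k₂ := contMDiffAt_smul_form h₂ (hs ((Real.contDiff_sin.comp contDiff_susAngle).pow 2))
  exact contMDiffAt_add_form k₀ (contMDiffAt_add_form k₁ k₂)

/-- The metric of the regular part of the suspension. -/
noncomputable def susMetric : (susReg F₁ F₂).Metric :=
  Mfd.Metric.ofForm (susReg F₁ F₂) (susForm κ₁ κ₂)
    (fun m v w ↦ by
      change (Real.sin (susAngle m.1) * Real.cos (susAngle m.1)) ^ 2 * (v.1 * w.1) +
      (Real.cos (susAngle m.1) ^ 2 * κ₁.inner m.2.1 v.2.1 w.2.1 +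
      Real.sin (susAngle m.1) ^ 2 * κ₂.inner m.2.2 v.2.2 w.2.2) =
      (Real.sin (susAngle m.1) * Real.cos (susAngle m.1)) ^ 2 * (w.1 * v.1) +
      (Real.cos (susAngle m.1) ^ 2 * κ₁.inner m.2.1 w.2.1 v.2.1 +
      Real.sin (susAngle m.1) ^ 2 * κ₂.inner m.2.2 w.2.2 v.2.2)
      have h1 : κ₁.inner m.2.1 v.2.1 w.2.1 = κ₁.inner m.2.1 w.2.1 v.2.1 := κ₁.symm _ _ _
      have h2 : κ₂.inner m.2.2 v.2.2 w.2.2 = κ₂.inner m.2.2 w.2.2 v.2.2 := κ₂.symm _ _ _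
      linear_combination (Real.cos (susAngle m.1) ^ 2) * h1 + (Real.sin (susAngle m.1) ^ 2) * h2)
    (fun m v hv ↦ by
      change 0 < (Real.sin (susAngle m.1) * Real.cos (susAngle m.1)) ^ 2 * (v.1 * v.1) +
      (Real.cos (susAngle m.1) ^ 2 * κ₁.sq m.2.1 v.2.1 +
      Real.sin (susAngle m.1) ^ 2 * κ₂.sq m.2.2 v.2.2)
      have hs := sin_susAngle_pos m.1
      have hc := cos_susAngle_pos m.1
      have n₀ := mul_self_nonneg v.1
      have n₁ := κ₁.sq_nonneg m.2.1 v.2.1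
      have n₂ := κ₂.sq_nonneg m.2.2 v.2.2
      by_cases h₀ : v.1 = 0
      · by_cases h₁ : v.2.1 = 0
        · by_cases h₂ : v.2.2 = 0
          · exact absurd (Prod.ext h₀ (Prod.ext h₁ h₂)) hv
          · have n₃ : 0 < κ₂.sq m.2.2 v.2.2 := κ₂.pos _ _ h₂
            positivity
        · have n₃ : 0 < κ₁.sq m.2.1 v.2.1 := κ₁.pos _ _ h₁
          positivity
      · have n₃ := mul_self_pos.2 h₀
        positivity)
    (contMDiff_susForm κ₁ κ₂)

/-- The first coefficient comes from dθ = sin θ cos θ dt for t = log tan θ. -/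
theorem susMetric_sq (m : ℝ × (F₁ × F₂)) (t : ℝ) (v : TangentSpace F₁.I m.2.1)
    (w : TangentSpace F₂.I m.2.2) : (susMetric κ₁ κ₂).sq m (t, v, w) =
    (Real.sin (susAngle m.1) * Real.cos (susAngle m.1)) ^ 2 * (t * t) +
      (Real.cos (susAngle m.1) ^ 2 * κ₁.sq m.2.1 v +
      Real.sin (susAngle m.1) ^ 2 * κ₂.sq m.2.2 w) := rfl

variable (F₁ F₂)

/-- The polar coordinates of the regular part of the suspension. -/
noncomputable def susPolar : PartialDiffeomorph (𝓘(ℝ, ℝ).prod (F₁.I.prod F₂.I)) (susReg F₁ F₂).I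
    (ℝ × (F₁ × F₂)) (susReg F₁ F₂) ∞ where
  toFun m := (Real.log (Real.tan m.1), m.2)
  invFun m := (susAngle m.1, m.2)
  source := Ioo 0 (Real.pi / 2) ×ˢ univ
  target := univ
  map_source' _ _ := trivial
  map_target' m _ := ⟨susAngle_mem m.1, trivial⟩
  left_inv' _ hm := Prod.ext (susAngle_log_tan hm.1) rfl
  right_inv' m _ := Prod.ext (log_tan_susAngle m.1) rfl
  open_source := isOpen_Ioo.prod isOpen_univ
  open_target := isOpen_univ
  contMDiffOn_toFun m hm := (ContMDiffAt.prodMk (ContMDiffAt.comp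
    (g := fun θ ↦ Real.log (Real.tan θ)) m (contDiffAt_log_tan hm.1).contMDiffAt contMDiffAt_fst)
      contMDiffAt_snd).contMDiffWithinAt
  contMDiffOn_invFun m _ := (ContMDiffAt.prodMk (ContMDiffAt.comp
    (g := susAngle) m contDiff_susAngle.contMDiff.contMDiffAt contMDiffAt_fst)
      contMDiffAt_snd).contMDiffWithinAt

theorem susPolar_apply (θ : ℝ) (p : F₁ × F₂) :
    susPolar F₁ F₂ (θ, p) = (Real.log (Real.tan θ), p) := rfl

variable {F₁ F₂}

theorem susMetric_polar {θ : ℝ} (hθ : θ ∈ Ioo 0 (Real.pi / 2)) (a : F₁) (b : F₂) (t : ℝ)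
    (v : TangentSpace F₁.I a) (w : TangentSpace F₂.I b) :
    (susMetric κ₁ κ₂).sq (susPolar F₁ F₂ (θ, a, b)) (mfderiv (𝓘(ℝ, ℝ).prod (F₁.I.prod F₂.I))
      (susReg F₁ F₂).I (susPolar F₁ F₂) (θ, a, b) (t, v, w)) =
    t ^ 2 + Real.cos θ ^ 2 * κ₁.sq a v + Real.sin θ ^ 2 * κ₂.sq b w := by
  have h : HasMFDerivAt (𝓘(ℝ, ℝ).prod (F₁.I.prod F₂.I)) (𝓘(ℝ, ℝ).prod (F₁.I.prod F₂.I))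
      (susPolar F₁ F₂) (θ, a, b) _ :=
    ((hasDerivAt_log_tan hθ).hasFDerivAt.hasMFDerivAt.comp (θ, a, b)
      (hasMFDerivAt_fst (I := 𝓘(ℝ, ℝ)) (I' := F₁.I.prod F₂.I) (θ, a, b))).prodMk
    (hasMFDerivAt_snd (I := 𝓘(ℝ, ℝ)) (I' := F₁.I.prod F₂.I) (θ, a, b))
  rw [h.mfderiv]
  refine (susMetric_sq κ₁ κ₂ (susPolar F₁ F₂ (θ, a, b)) (t * (Real.sin θ * Real.cos θ)⁻¹) v w).trans ?_
  rw [susPolar_apply, susAngle_log_tan hθ]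
  have hc : 0 < Real.cos θ :=
    (Real.cos_pos_of_mem_Ioo ⟨by linarith [hθ.1, Real.pi_pos], hθ.2⟩)
  have hs : 0 < Real.sin θ := Real.sin_pos_of_pos_of_lt_pi hθ.1 (by linarith [hθ.2, Real.pi_pos])
  field_simp
  ring

end

namespace Suspension

section
variable {F₁ F₂ : Type u}

/-- The sine of the angle, as a function on the suspension. -/
noncomputable def sinAngle : Suspension F₁ F₂ → ℝ :=
  Quotient.lift (fun x ↦ Real.sin x.1) fun _ _ h ↦ by rw [show _ = _ from h.1]

/-- The cosine of the angle, as a function on the suspension. -/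
noncomputable def cosAngle : Suspension F₁ F₂ → ℝ :=
  Quotient.lift (fun x ↦ Real.cos x.1) fun _ _ h ↦ by rw [show _ = _ from h.1]

theorem exists_mk (y : Suspension F₁ F₂) : ∃ θ a b, y = mk θ a b := by
  induction y using Quotient.inductionOn with
  | h x => exact ⟨x.1, x.2.1, x.2.2, rfl⟩

theorem mk_eq_mk {θ θ' : Icc (0 : ℝ) (Real.pi / 2)} {a a' : F₁} {b b' : F₂} :
    mk θ a b = mk θ' a' b' ↔ θ = θ' ∧ ((θ : ℝ) ≠ Real.pi / 2 → a = a') ∧ ((θ : ℝ) ≠ 0 → b = b') :=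
  Quotient.eq (r := suspensionSetoid F₁ F₂)

theorem sin_nonneg (θ : Icc (0 : ℝ) (Real.pi / 2)) : 0 ≤ Real.sin θ :=
  Real.sin_nonneg_of_nonneg_of_le_pi θ.2.1 (by linarith [θ.2.2, Real.pi_pos])

theorem cos_nonneg (θ : Icc (0 : ℝ) (Real.pi / 2)) : 0 ≤ Real.cos θ :=
  Real.cos_nonneg_of_mem_Icc ⟨by linarith [θ.2.1, Real.pi_pos], θ.2.2⟩

theorem sin_pos_iff (θ : Icc (0 : ℝ) (Real.pi / 2)) : 0 < Real.sin θ ↔ (θ : ℝ) ≠ 0 := by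
  constructor
  · rintro h h0; rw [h0, Real.sin_zero] at h; exact h.false
  · intro h
    exact Real.sin_pos_of_pos_of_lt_pi (lt_of_le_of_ne θ.2.1 (Ne.symm h))
      (by linarith [θ.2.2, Real.pi_pos])

theorem cos_pos_iff (θ : Icc (0 : ℝ) (Real.pi / 2)) : 0 < Real.cos θ ↔ (θ : ℝ) ≠ Real.pi / 2 := by
  constructor
  · rintro h h0; rw [h0, Real.cos_pi_div_two] at h; exact h.false
  · intro h
    exact Real.cos_pos_of_mem_Ioo ⟨by linarith [θ.2.1, Real.pi_pos], lt_of_le_of_ne θ.2.2 h⟩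

theorem sinAngle_nonneg (y : Suspension F₁ F₂) : 0 ≤ sinAngle y := by
  obtain ⟨θ, a, b, rfl⟩ := exists_mk y; exact sin_nonneg θ

theorem cosAngle_nonneg (y : Suspension F₁ F₂) : 0 ≤ cosAngle y := by
  obtain ⟨θ, a, b, rfl⟩ := exists_mk y; exact cos_nonneg θ

theorem sin_sq_add_cos_sq (y : Suspension F₁ F₂) : sinAngle y ^ 2 + cosAngle y ^ 2 = 1 := by
  obtain ⟨θ, a, b, rfl⟩ := exists_mk y; exact Real.sin_sq_add_cos_sq θ

/-- The projection to the first factor, away from `θ = π / 2`. -/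
noncomputable def fst (y : Suspension F₁ F₂) : F₁ := (Quotient.out y).2.1

/-- The projection to the second factor, away from `θ = 0`. -/
noncomputable def snd (y : Suspension F₁ F₂) : F₂ := (Quotient.out y).2.2

theorem out_eq (y : Suspension F₁ F₂) : mk (Quotient.out y).1 (fst y) (snd y) = y :=
  Quotient.out_eq y

theorem fst_mk {θ : Icc (0 : ℝ) (Real.pi / 2)} (a : F₁) (b : F₂) (hθ : (θ : ℝ) ≠ Real.pi / 2) :
    fst (mk θ a b) = a := by
  obtain ⟨h, h₁, -⟩ := mk_eq_mk.1 (out_eq (mk θ a b))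
  exact h₁ (by rwa [h])

theorem snd_mk {θ : Icc (0 : ℝ) (Real.pi / 2)} (a : F₁) (b : F₂) (hθ : (θ : ℝ) ≠ 0) :
    snd (mk θ a b) = b := by
  obtain ⟨h, -, h₁⟩ := mk_eq_mk.1 (out_eq (mk θ a b))
  exact h₁ (by rwa [h])

/-- The angle of the parametrization of the regular part, as an element of `[0, π / 2]`. -/
noncomputable def clampAngle (t : ℝ) : Icc (0 : ℝ) (Real.pi / 2) :=
  ⟨susAngle t, (susAngle_mem t).1.le, (susAngle_mem t).2.le⟩

/-- The inclusion of the regular part. -/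
noncomputable def incl (m : ℝ × (F₁ × F₂)) : Suspension F₁ F₂ := mk (clampAngle m.1) m.2.1 m.2.2

theorem fst_incl (m : ℝ × (F₁ × F₂)) : fst (incl m) = m.2.1 :=
  fst_mk _ _ (susAngle_mem m.1).2.ne

theorem snd_incl (m : ℝ × (F₁ × F₂)) : snd (incl m) = m.2.2 :=
  snd_mk _ _ (susAngle_mem m.1).1.ne'

theorem mem_range_incl (y : Suspension F₁ F₂) :
    y ∈ range (incl : ℝ × (F₁ × F₂) → Suspension F₁ F₂) ↔ 0 < sinAngle y ∧ 0 < cosAngle y := by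
  constructor
  · rintro ⟨m, rfl⟩
    exact ⟨sin_susAngle_pos m.1, cos_susAngle_pos m.1⟩
  · obtain ⟨θ, a, b, rfl⟩ := exists_mk y
    rintro ⟨h₁, h₂⟩
    have hθ : (θ : ℝ) ∈ Ioo 0 (Real.pi / 2) :=
      ⟨lt_of_le_of_ne θ.2.1 (Ne.symm ((sin_pos_iff θ).1 h₁)),
        lt_of_le_of_ne θ.2.2 ((cos_pos_iff θ).1 h₂)⟩
    refine ⟨(Real.log (Real.tan θ), a, b), mk_eq_mk.2 ⟨Subtype.ext (susAngle_log_tan hθ), ?_⟩⟩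
    exact ⟨fun _ ↦ rfl, fun _ ↦ rfl⟩

variable [TopologicalSpace F₁] [TopologicalSpace F₂]

theorem continuous_sinAngle : Continuous (sinAngle : Suspension F₁ F₂ → ℝ) :=
  Continuous.quotient_lift (by fun_prop) _

theorem continuous_cosAngle : Continuous (cosAngle : Suspension F₁ F₂ → ℝ) :=
  Continuous.quotient_lift (by fun_prop) _

theorem isOpen_cos_pos :
    IsOpen {x : Icc (0 : ℝ) (Real.pi / 2) × F₁ × F₂ | 0 < Real.cos x.1} :=
  isOpen_lt continuous_const (by fun_prop)

theorem isOpen_sin_pos :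
    IsOpen {x : Icc (0 : ℝ) (Real.pi / 2) × F₁ × F₂ | 0 < Real.sin x.1} :=
  isOpen_lt continuous_const (by fun_prop)

/-- Tested upstairs in the quotient topology: on the saturated open set cos θ > 0 the choice of
representative does not matter, and the map is the coordinate projection. -/
theorem continuousOn_fst : ContinuousOn (fst : Suspension F₁ F₂ → F₁) {y | 0 < cosAngle y} := by
  rw [continuousOn_open_iff (isOpen_lt continuous_const continuous_cosAngle)]
  intro V hV
  refine isOpen_coinduced.2 ?_
  have : IsOpen {x : Icc (0 : ℝ) (Real.pi / 2) × F₁ × F₂ | 0 < Real.cos x.1 ∧ x.2.1 ∈ V} :=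
    isOpen_cos_pos.and (hV.preimage (continuous_fst.comp continuous_snd))
  convert this using 1
  ext ⟨θ, a, b⟩
  change 0 < Real.cos θ ∧ fst (mk θ a b) ∈ V ↔ 0 < Real.cos θ ∧ a ∈ V
  refine and_congr_right fun h ↦ ?_
  rw [fst_mk a b ((cos_pos_iff θ).1 h)]

theorem continuousOn_snd : ContinuousOn (snd : Suspension F₁ F₂ → F₂) {y | 0 < sinAngle y} := by
  rw [continuousOn_open_iff (isOpen_lt continuous_const continuous_sinAngle)]
  intro V hV
  refine isOpen_coinduced.2 ?_
  have : IsOpen {x : Icc (0 : ℝ) (Real.pi / 2) × F₁ × F₂ | 0 < Real.sin x.1 ∧ x.2.2 ∈ V} :=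
    isOpen_sin_pos.and (hV.preimage (continuous_snd.comp continuous_snd))
  convert this using 1
  ext ⟨θ, a, b⟩
  change 0 < Real.sin θ ∧ snd (mk θ a b) ∈ V ↔ 0 < Real.sin θ ∧ b ∈ V
  refine and_congr_right fun h ↦ ?_
  rw [snd_mk a b ((sin_pos_iff θ).1 h)]

theorem _root_.ContinuousOn.exists_disjoint_of_ne {X Y : Type*} [TopologicalSpace X]
    [TopologicalSpace Y] [T2Space Y] {f : X → Y} {s : Set X} (hf : ContinuousOn f s)
    (hs : IsOpen s) {x y : X} (hx : x ∈ s) (hy : y ∈ s) (h : f x ≠ f y) :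
    ∃ U V : Set X, IsOpen U ∧ IsOpen V ∧ x ∈ U ∧ y ∈ V ∧ Disjoint U V := by
  obtain ⟨U, V, hU, hV, hxU, hyV, hd⟩ := t2_separation h
  exact ⟨s ∩ f ⁻¹' U, s ∩ f ⁻¹' V, hf.isOpen_inter_preimage hs hU, hf.isOpen_inter_preimage hs hV,
    ⟨hx, hxU⟩, ⟨hy, hyV⟩, (hd.preimage f).mono inter_subset_right inter_subset_right⟩

/-- Points with different angles are separated by the sine or the cosine. With equal angles,
distinct points differ in a coordinate that is not collapsed, and its projection is continuous on an
open set containing both. -/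
instance t2Space [T2Space F₁] [T2Space F₂] : T2Space (Suspension F₁ F₂) := by
  refine ⟨fun y y' hne ↦ ?_⟩
  by_cases hs : sinAngle y = sinAngle y'
  swap
  · exact continuous_sinAngle.continuousOn.exists_disjoint_of_ne isOpen_univ trivial trivial hs
  by_cases hc : cosAngle y = cosAngle y'
  swap
  · exact continuous_cosAngle.continuousOn.exists_disjoint_of_ne isOpen_univ trivial trivial hc
  obtain ⟨θ, a, b, rfl⟩ := exists_mk y
  obtain ⟨θ', a', b', rfl⟩ := exists_mk y'
  have hθ : θ = θ' := Subtype.ext (Real.injOn_sin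
    ⟨by linarith [θ.2.1, Real.pi_pos], θ.2.2⟩ ⟨by linarith [θ'.2.1, Real.pi_pos], θ'.2.2⟩ hs)
  subst hθ
  by_cases h₁ : (θ : ℝ) ≠ Real.pi / 2 ∧ a ≠ a'
  · refine continuousOn_fst.exists_disjoint_of_ne
      (isOpen_lt continuous_const continuous_cosAngle) ((cos_pos_iff θ).2 h₁.1)
      ((cos_pos_iff θ).2 h₁.1) ?_
    rw [fst_mk a b h₁.1, fst_mk a' b' h₁.1]
    exact h₁.2
  by_cases h₂ : (θ : ℝ) ≠ 0 ∧ b ≠ b'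
  · refine continuousOn_snd.exists_disjoint_of_ne
      (isOpen_lt continuous_const continuous_sinAngle) ((sin_pos_iff θ).2 h₂.1)
      ((sin_pos_iff θ).2 h₂.1) ?_
    rw [snd_mk a b h₂.1, snd_mk a' b' h₂.1]
    exact h₂.2
  · exact absurd (mk_eq_mk.2 ⟨rfl, fun h ↦ by_contra fun h' ↦ h₁ ⟨h, h'⟩,
      fun h ↦ by_contra fun h' ↦ h₂ ⟨h, h'⟩⟩) hne

/-- Openness is tested upstairs, where the preimage of the image of W is cut out by the continuous
map (log tan θ, a, b) on the open set 0 < θ < π/2. -/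
theorem isOpenEmbedding_incl :
    IsOpenEmbedding (incl : ℝ × (F₁ × F₂) → Suspension F₁ F₂) := by
  refine .of_continuous_injective_isOpenMap ?_ ?_ ?_
  · refine continuous_quotient_mk'.comp ?_
    refine Continuous.prodMk (Continuous.subtype_mk ?_ _) (by fun_prop)
    exact contDiff_susAngle.continuous.comp continuous_fst
  · rintro m m' h
    have h₁ := congrArg fst h
    have h₂ := congrArg snd h
    rw [fst_incl, fst_incl] at h₁
    rw [snd_incl, snd_incl] at h₂
    have h₃ : susAngle m.1 = susAngle m'.1 :=
      congrArg (Subtype.val : Icc (0 : ℝ) (Real.pi / 2) → ℝ) (mk_eq_mk.1 h).1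
    refine Prod.ext ?_ (Prod.ext h₁ h₂)
    rw [← log_tan_susAngle m.1, h₃, log_tan_susAngle]
  · intro W hW
    refine isOpen_coinduced.2 ?_
    have hU : IsOpen {x : Icc (0 : ℝ) (Real.pi / 2) × F₁ × F₂ | 0 < Real.sin x.1 ∧ 0 < Real.cos x.1} :=
      isOpen_sin_pos.and isOpen_cos_pos
    have hc : ContinuousOn (fun x : Icc (0 : ℝ) (Real.pi / 2) × F₁ × F₂ ↦
        (Real.log (Real.sin x.1 / Real.cos x.1), x.2))
        {x | 0 < Real.sin x.1 ∧ 0 < Real.cos x.1} := by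
      refine ContinuousOn.prodMk (ContinuousOn.log (ContinuousOn.div (by fun_prop) (by fun_prop)
        fun x hx ↦ hx.2.ne') fun x hx ↦ (div_pos hx.1 hx.2).ne') (by fun_prop)
    convert hc.isOpen_inter_preimage hU hW using 1
    ext ⟨θ, a, b⟩
    constructor
    · rintro ⟨m, hm, h⟩
      have h₁ : (θ : ℝ) = susAngle m.1 :=
        (congrArg (Subtype.val : Icc (0 : ℝ) (Real.pi / 2) → ℝ) (mk_eq_mk.1 h).1).symm
      have h₂ : m.2.1 = a := (mk_eq_mk.1 h).2.1 (susAngle_mem m.1).2.ne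
      have h₃ : m.2.2 = b := (mk_eq_mk.1 h).2.2 (susAngle_mem m.1).1.ne'
      refine ⟨⟨?_, ?_⟩, ?_⟩
      · change 0 < Real.sin θ; rw [h₁]; exact sin_susAngle_pos _
      · change 0 < Real.cos θ; rw [h₁]; exact cos_susAngle_pos _
      · change (Real.log (Real.sin θ / Real.cos θ), a, b) ∈ W
        rw [← Real.tan_eq_sin_div_cos, h₁, log_tan_susAngle, ← h₂, ← h₃]
        exact hm
    · rintro ⟨⟨h₁, h₂⟩, h₃⟩
      change 0 < Real.sin θ at h₁
      change 0 < Real.cos θ at h₂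
      have hθ : (θ : ℝ) ∈ Ioo 0 (Real.pi / 2) :=
        ⟨lt_of_le_of_ne θ.2.1 (Ne.symm ((sin_pos_iff θ).1 h₁)),
          lt_of_le_of_ne θ.2.2 ((cos_pos_iff θ).1 h₂)⟩
      refine ⟨_, h₃, mk_eq_mk.2 ⟨Subtype.ext ?_, fun _ ↦ rfl, fun _ ↦ rfl⟩⟩
      change susAngle (Real.log (Real.sin θ / Real.cos θ)) = θ
      rw [← Real.tan_eq_sin_div_cos, susAngle_log_tan hθ]

end

/-! ### The cone bundles -/

/-- The width of the cone bundles of the suspension. -/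
noncomputable def width : ℝ := √2⁻¹

theorem width_pos : 0 < width := by rw [width]; positivity

/-- With squared width 1/2, the open tubes sin θ < width and cos θ < width are disjoint and miss
exactly θ = π/4. -/
theorem width_sq : width ^ 2 = 1 / 2 := by rw [width, Real.sq_sqrt (by norm_num)]; norm_num

theorem width_lt_one : width < 1 := by have := width_sq; nlinarith [width_pos]

theorem Ioo_width_subset {s : ℝ} (hs : s ∈ Ioo 0 width) : s ∈ Ioo (0 : ℝ) 1 :=
  ⟨hs.1, hs.2.trans width_lt_one⟩

variable (F₁ F₂ : Mfd.{u})

/-- The cone bundle over `F₁` at `θ = 0`. -/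
noncomputable def chartLeft : PartialDiffeomorph (F₁.I.prod (𝓘(ℝ, ℝ).prod F₂.I)) (susReg F₁ F₂).I
    (F₁ × (ℝ × F₂)) (susReg F₁ F₂) ∞ where
  toFun q := (logRad q.2.1, q.1, q.2.2)
  invFun m := (m.2.1, Real.sin (susAngle m.1), m.2.2)
  source := univ ×ˢ (Ioo 0 width ×ˢ univ)
  target := {m | Real.sin (susAngle m.1) < width}
  map_source' := by
    rintro ⟨a, s, b⟩ ⟨-, hs, -⟩
    change Real.sin (susAngle (logRad s)) < width
    rw [sin_susAngle_logRad (Ioo_width_subset hs)]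
    exact hs.2
  map_target' m hm := ⟨trivial, ⟨sin_susAngle_pos m.1, hm⟩, trivial⟩
  left_inv' := by
    rintro ⟨a, s, b⟩ ⟨-, hs, -⟩
    exact Prod.ext rfl (Prod.ext (sin_susAngle_logRad (Ioo_width_subset hs)) rfl)
  right_inv' m _ := Prod.ext (logRad_sin m.1) rfl
  open_source := isOpen_univ.prod (isOpen_Ioo.prod isOpen_univ)
  open_target := isOpen_lt ((Real.continuous_sin.comp contDiff_susAngle.continuous).comp
    continuous_fst) continuous_const
  contMDiffOn_toFun q hq := (ContMDiffAt.prodMk (ContMDiffAt.comp (g := logRad) q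
    (contDiffAt_logRad (Ioo_width_subset hq.2.1)).contMDiffAt
    (contMDiffAt_fst.comp q contMDiffAt_snd)) (contMDiffAt_fst.prodMk
    (contMDiffAt_snd.comp q contMDiffAt_snd))).contMDiffWithinAt
  contMDiffOn_invFun m _ := (ContMDiffAt.prodMk (contMDiffAt_fst.comp m contMDiffAt_snd)
    (ContMDiffAt.prodMk (ContMDiffAt.comp (g := fun t ↦ Real.sin (susAngle t)) m
      (Real.contDiff_sin.comp contDiff_susAngle).contMDiff.contMDiffAt contMDiffAt_fst)
      (contMDiffAt_snd.comp m contMDiffAt_snd))).contMDiffWithinAt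

/-- The cone bundle over `F₂` at `θ = π / 2`. -/
noncomputable def chartRight : PartialDiffeomorph (F₂.I.prod (𝓘(ℝ, ℝ).prod F₁.I)) (susReg F₁ F₂).I
    (F₂ × (ℝ × F₁)) (susReg F₁ F₂) ∞ where
  toFun q := (-logRad q.2.1, q.2.2, q.1)
  invFun m := (m.2.2, Real.cos (susAngle m.1), m.2.1)
  source := univ ×ˢ (Ioo 0 width ×ˢ univ)
  target := {m | Real.cos (susAngle m.1) < width}
  map_source' := by
    rintro ⟨a, s, b⟩ ⟨-, hs, -⟩
    change Real.cos (susAngle (-logRad s)) < width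
    rw [cos_susAngle_neg, sin_susAngle_logRad (Ioo_width_subset hs)]
    exact hs.2
  map_target' m hm := ⟨trivial, ⟨cos_susAngle_pos m.1, hm⟩, trivial⟩
  left_inv' := by
    rintro ⟨a, s, b⟩ ⟨-, hs, -⟩
    refine Prod.ext rfl (Prod.ext ?_ rfl)
    exact (cos_susAngle_neg _).trans (sin_susAngle_logRad (Ioo_width_subset hs))
  right_inv' m _ := by
    refine Prod.ext ?_ rfl
    change -logRad (Real.cos (susAngle m.1)) = m.1
    rw [← sin_susAngle_neg, logRad_sin, neg_neg]
  open_source := isOpen_univ.prod (isOpen_Ioo.prod isOpen_univ)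
  open_target := isOpen_lt ((Real.continuous_cos.comp contDiff_susAngle.continuous).comp
    continuous_fst) continuous_const
  contMDiffOn_toFun q hq := (ContMDiffAt.prodMk (ContMDiffAt.comp (g := fun s ↦ -logRad s) q
    (contDiffAt_logRad (Ioo_width_subset hq.2.1)).neg.contMDiffAt
    (contMDiffAt_fst.comp q contMDiffAt_snd)) (ContMDiffAt.prodMk
    (contMDiffAt_snd.comp q contMDiffAt_snd) contMDiffAt_fst)).contMDiffWithinAt
  contMDiffOn_invFun m _ := (ContMDiffAt.prodMk (contMDiffAt_snd.comp m contMDiffAt_snd)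
    (ContMDiffAt.prodMk (ContMDiffAt.comp (g := fun t ↦ Real.cos (susAngle t)) m
      (Real.contDiff_cos.comp contDiff_susAngle).contMDiff.contMDiffAt contMDiffAt_fst)
      (contMDiffAt_fst.comp m contMDiffAt_snd))).contMDiffWithinAt

variable {F₁ F₂} (κ₁ : F₁.Metric) (κ₂ : F₂.Metric)

/-- For s = sin θ one has dθ² = ds² / (1 − s²) and cos² θ = 1 − s². -/
theorem sq_chartLeft {s : ℝ} (hs : s ∈ Ioo 0 width) (a : F₁) (b : F₂) (u : TangentSpace F₁.I a)
    (t : ℝ) (v : TangentSpace F₂.I b) :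
    (susMetric κ₁ κ₂).sq (chartLeft F₁ F₂ (a, s, b)) (mfderiv (F₁.I.prod (𝓘(ℝ, ℝ).prod F₂.I))
      (susReg F₁ F₂).I (chartLeft F₁ F₂) (a, s, b) (u, t, v)) =
    (1 - s ^ 2)⁻¹ * t ^ 2 + ((1 - s ^ 2) * κ₁.sq a u + s ^ 2 * κ₂.sq b v) := by
  have hs' := Ioo_width_subset hs
  have k := hasMFDerivAt_snd (I := F₁.I) (I' := 𝓘(ℝ, ℝ).prod F₂.I) (a, s, b)
  have h : HasMFDerivAt (F₁.I.prod (𝓘(ℝ, ℝ).prod F₂.I)) (𝓘(ℝ, ℝ).prod (F₁.I.prod F₂.I))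
      (chartLeft F₁ F₂) (a, s, b) _ :=
    HasMFDerivAt.prodMk ((hasDerivAt_logRad hs').hasFDerivAt.hasMFDerivAt.comp (a, s, b)
      ((hasMFDerivAt_fst (I := 𝓘(ℝ, ℝ)) (I' := F₂.I) (s, b)).comp (a, s, b) k))
    (HasMFDerivAt.prodMk (hasMFDerivAt_fst (I := F₁.I) (I' := 𝓘(ℝ, ℝ).prod F₂.I) (a, s, b))
      ((hasMFDerivAt_snd (I := 𝓘(ℝ, ℝ)) (I' := F₂.I) (s, b)).comp (a, s, b) k))
  rw [h.mfderiv]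
  refine (susMetric_sq κ₁ κ₂ (logRad s, a, b) (t * (s * (1 - s ^ 2))⁻¹) u v).trans ?_
  have hp : 0 < 1 - s ^ 2 := by nlinarith [hs'.1, hs'.2]
  have h0 := hs'.1
  rw [mul_pow, Real.cos_sq', sin_susAngle_logRad hs']
  field_simp

theorem sq_chartRight {s : ℝ} (hs : s ∈ Ioo 0 width) (a : F₁) (b : F₂) (u : TangentSpace F₂.I b)
    (t : ℝ) (v : TangentSpace F₁.I a) :
    (susMetric κ₁ κ₂).sq (chartRight F₁ F₂ (b, s, a)) (mfderiv (F₂.I.prod (𝓘(ℝ, ℝ).prod F₁.I))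
      (susReg F₁ F₂).I (chartRight F₁ F₂) (b, s, a) (u, t, v)) =
    (1 - s ^ 2)⁻¹ * t ^ 2 + ((1 - s ^ 2) * κ₂.sq b u + s ^ 2 * κ₁.sq a v) := by
  have hs' := Ioo_width_subset hs
  have k := hasMFDerivAt_snd (I := F₂.I) (I' := 𝓘(ℝ, ℝ).prod F₁.I) (b, s, a)
  have h : HasMFDerivAt (F₂.I.prod (𝓘(ℝ, ℝ).prod F₁.I)) (𝓘(ℝ, ℝ).prod (F₁.I.prod F₂.I))
      (chartRight F₁ F₂) (b, s, a) _ :=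
    HasMFDerivAt.prodMk ((hasDerivAt_logRad hs').neg.hasFDerivAt.hasMFDerivAt.comp (b, s, a)
      ((hasMFDerivAt_fst (I := 𝓘(ℝ, ℝ)) (I' := F₁.I) (s, a)).comp (b, s, a) k))
    (HasMFDerivAt.prodMk ((hasMFDerivAt_snd (I := 𝓘(ℝ, ℝ)) (I' := F₁.I) (s, a)).comp (b, s, a) k)
      (hasMFDerivAt_fst (I := F₂.I) (I' := 𝓘(ℝ, ℝ).prod F₁.I) (b, s, a)))
  rw [h.mfderiv]
  refine (susMetric_sq κ₁ κ₂ (-logRad s, a, b) (t * -(s * (1 - s ^ 2))⁻¹) v u).trans ?_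
  have hp : 0 < 1 - s ^ 2 := by nlinarith [hs'.1, hs'.2]
  have h0 := hs'.1
  rw [cos_susAngle_neg, sin_susAngle_neg, mul_pow, Real.cos_sq', sin_susAngle_logRad hs']
  field_simp
  ring

/-- The difference is s² (t² / (1 − s²) − p), and 1 − s² > 1/2 inside the tube. So the exponent δ of
the edge metric is 2, with constant 2. -/
theorem abs_sq_sub_le {s t p q : ℝ} (hs : s ∈ Ioo 0 width) (hp : 0 ≤ p) (hq : 0 ≤ q) :
    |(1 - s ^ 2)⁻¹ * t ^ 2 + ((1 - s ^ 2) * p + s ^ 2 * q) - (p + t ^ 2 + s ^ 2 * q)| ≤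
      2 * s ^ (2 : ℝ) * (p + t ^ 2 + s ^ 2 * q) := by
  have h1 : s ^ 2 < 1 / 2 := by
    rw [← width_sq]; exact pow_lt_pow_left₀ hs.2 hs.1.le two_ne_zero
  have hpos : 0 < 1 - s ^ 2 := by linarith
  have h2 : (1 - s ^ 2)⁻¹ * t ^ 2 + ((1 - s ^ 2) * p + s ^ 2 * q) - (p + t ^ 2 + s ^ 2 * q) =
      s ^ 2 * ((1 - s ^ 2)⁻¹ * t ^ 2 - p) := by
    field_simp; ring
  have h3 : (1 - s ^ 2)⁻¹ ≤ 2 := by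
    rw [inv_le_comm₀ hpos two_pos]; linarith
  have h4 : 0 ≤ (1 - s ^ 2)⁻¹ := by positivity
  rw [Real.rpow_two, h2, abs_mul, abs_of_nonneg (sq_nonneg s), mul_comm 2, mul_assoc]
  refine mul_le_mul_of_nonneg_left ?_ (sq_nonneg s)
  have h5 := mul_le_mul_of_nonneg_right h3 (sq_nonneg t)
  have h6 := mul_nonneg (sq_nonneg s) hq
  have h7 := mul_nonneg h4 (sq_nonneg t)
  rw [abs_le]
  constructor <;> linarith [sq_nonneg t]

end Suspension

/-! ### The edge structure of the suspension -/

namespace Suspension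

/-- The strata of the suspension. -/
abbrev stratum (F₁ F₂ : Mfd.{u}) : Bool → Mfd.{u}
  | true => F₁
  | false => F₂

/-- The metrics of the strata. -/
abbrev stratumMetric {F₁ F₂ : Mfd.{u}} (κ₁ : F₁.Metric) (κ₂ : F₂.Metric) :
    ∀ α, (stratum F₁ F₂ α).Metric
  | true => κ₁
  | false => κ₂

/-- The distance functions to the strata. -/
noncomputable abbrev rad {F₁ F₂ : Type u} : Bool → Suspension F₁ F₂ → ℝ
  | true => sinAngle
  | false => cosAngle

section
variable (F₁ F₂ : Mfd.{u})

/-- The projections to the strata. -/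
noncomputable abbrev proj : ∀ α, Suspension F₁ F₂ → stratum F₁ F₂ α
  | true => fst
  | false => snd

variable [Nonempty F₁] [Nonempty F₂]

/-- The inclusions of the strata. -/
noncomputable abbrev vertex : ∀ α, stratum F₁ F₂ α → Suspension F₁ F₂
  | true => fun a ↦ mk ⟨0, le_rfl, by positivity⟩ a (Classical.arbitrary F₂)
  | false => fun b ↦ mk ⟨Real.pi / 2, by positivity, le_rfl⟩ (Classical.arbitrary F₁) b

/-- The trivializations of the cone bundles. -/
noncomputable abbrev chart : ∀ α, PartialDiffeomorph ((stratum F₁ F₂ α).I.prod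
    (𝓘(ℝ, ℝ).prod (stratum F₂ F₁ α).I)) (susReg F₁ F₂).I
    (stratum F₁ F₂ α × (ℝ × stratum F₂ F₁ α)) (susReg F₁ F₂) ∞
  | true => chartLeft F₁ F₂
  | false => chartRight F₁ F₂

end

theorem continuous_rad {F₁ F₂ : Type u} [TopologicalSpace F₁] [TopologicalSpace F₂] (α : Bool) :
    Continuous (rad α : Suspension F₁ F₂ → ℝ) := by
  cases α
  · exact continuous_cosAngle
  · exact continuous_sinAngle

theorem pos_of_lt_width {x y : ℝ} (hy : 0 ≤ y) (hx : 0 ≤ x) (h : x ^ 2 + y ^ 2 = 1)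
    (hlt : x < width) : 0 < y := by
  have h1 : x ^ 2 < 1 / 2 := by
    rw [← width_sq]; exact pow_lt_pow_left₀ hlt hx two_ne_zero
  rcases hy.eq_or_lt with h0 | h0
  · rw [← h0] at h; linarith
  · exact h0

theorem cosAngle_pos_of_lt {F₁ F₂ : Type u} {y : Suspension F₁ F₂} (h : sinAngle y < width) :
    0 < cosAngle y :=
  pos_of_lt_width (cosAngle_nonneg y) (sinAngle_nonneg y) (sin_sq_add_cos_sq y) h

theorem sinAngle_pos_of_lt {F₁ F₂ : Type u} {y : Suspension F₁ F₂} (h : cosAngle y < width) :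
    0 < sinAngle y :=
  pos_of_lt_width (sinAngle_nonneg y) (cosAngle_nonneg y)
    (by rw [add_comm]; exact sin_sq_add_cos_sq y) h

variable {F₁ F₂ : Mfd.{u}} [CompactSpace F₁] [CompactSpace F₂] [Nonempty F₁] [Nonempty F₂]
  (κ₁ : F₁.Metric) (κ₂ : F₂.Metric)

/-- The spherical suspension as an edge space. -/
noncomputable def edge : EdgeStructure (Suspension F₁ F₂) where
  compact := Quotient.compactSpace
  t2 := t2Space
  reg := susReg F₁ F₂
  h₀ := susMetric κ₁ κ₂
  incl := incl
  incl_openEmbedding := isOpenEmbedding_incl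
  ι := Bool
  finite_index := inferInstance
  nonempty_index := inferInstance
  S := stratum F₁ F₂
  compact_S α := by cases α <;> assumption
  nonempty_S α := by cases α <;> assumption
  q := stratumMetric κ₁ κ₂
  -- The stratum F₁ lies at θ = 0, where F₂ is collapsed, so its link is F₂; at θ = π/2 the roles
  -- are exchanged.
  F := stratum F₂ F₁
  compact_F α := by cases α <;> assumption
  nonempty_F α := by cases α <;> assumption
  κ := stratumMetric κ₂ κ₁
  width _ := width
  width_pos _ := width_pos
  vertex := vertex F₁ F₂
  tube α := {y | rad α y < width}
  isOpen_tube α := isOpen_lt (continuous_rad α) continuous_const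
  tube_disjoint := by
    have h : ∀ y : Suspension F₁ F₂, ¬(sinAngle y < width ∧ cosAngle y < width) := by
      rintro y ⟨h₁, h₂⟩
      have h₃ := sin_sq_add_cos_sq y
      have h₄ := width_sq
      have h₅ := pow_lt_pow_left₀ h₁ (sinAngle_nonneg y) two_ne_zero
      have h₆ := pow_lt_pow_left₀ h₂ (cosAngle_nonneg y) two_ne_zero
      linarith
    intro α β hαβ
    refine Set.disjoint_left.2 fun y (hy : rad α y < width) (hy' : rad β y < width) ↦ ?_
    cases α <;> cases β
    · exact hαβ rfl
    · exact h y ⟨hy', hy⟩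
    · exact h y ⟨hy, hy'⟩
    · exact hαβ rfl
  proj := proj F₁ F₂
  rad := rad
  continuousOn_proj α := by
    cases α
    · exact continuousOn_snd.mono fun y hy ↦ sinAngle_pos_of_lt hy
    · exact continuousOn_fst.mono fun y hy ↦ cosAngle_pos_of_lt hy
  continuousOn_rad α := (continuous_rad α).continuousOn
  rad_mem α y hy := by
    cases α
    · exact ⟨cosAngle_nonneg y, hy⟩
    · exact ⟨sinAngle_nonneg y, hy⟩
  isClosed_sublevel α t ht := by
    have h : IsClosed {y : Suspension F₁ F₂ | rad α y ≤ t} :=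
      isClosed_le (continuous_rad α) continuous_const
    convert h using 1
    ext y
    exact ⟨fun h ↦ h.2, fun h ↦ ⟨lt_of_le_of_lt h ht, h⟩⟩
  vertex_mem α x := by
    cases α
    · change Real.cos (Real.pi / 2) < width; rw [Real.cos_pi_div_two]; exact width_pos
    · change Real.sin 0 < width; rw [Real.sin_zero]; exact width_pos
  rad_vertex α x := by
    cases α
    · exact Real.cos_pi_div_two
    · exact Real.sin_zero
  proj_vertex α x := by
    have := Real.pi_pos
    cases α
    · exact snd_mk _ _ (by change Real.pi / 2 ≠ 0; linarith)
    · exact fst_mk _ _ (by change (0 : ℝ) ≠ Real.pi / 2; linarith)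
  vertex_proj α y hy h0 := by
    have := Real.pi_pos
    obtain ⟨θ, a, b, rfl⟩ := exists_mk y
    cases α
    · have h1 : (θ : ℝ) = Real.pi / 2 := by
        by_contra h
        exact ((cos_pos_iff θ).2 h).ne' h0
      refine mk_eq_mk.2 ⟨Subtype.ext h1.symm, fun h ↦ absurd rfl h, fun _ ↦ ?_⟩
      exact snd_mk a b (by rw [h1]; positivity)
    · have h1 : (θ : ℝ) = 0 := by
        by_contra h
        exact ((sin_pos_iff θ).2 h).ne' h0
      refine mk_eq_mk.2 ⟨Subtype.ext h1.symm, fun _ ↦ ?_, fun h ↦ absurd rfl h⟩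
      exact fst_mk a b (by rw [h1]; positivity)
  mem_reg_iff α y hy := by
    rw [mem_range_incl]
    cases α
    · exact ⟨fun h ↦ h.2, fun h ↦ ⟨sinAngle_pos_of_lt hy, h⟩⟩
    · exact ⟨fun h ↦ h.1, fun h ↦ ⟨h, cosAngle_pos_of_lt hy⟩⟩
  cover y := by
    rw [mem_range_incl]
    have h1 := sinAngle_nonneg y
    have h2 := cosAngle_nonneg y
    obtain ⟨θ, a, b, rfl⟩ := exists_mk y
    by_cases hs : (θ : ℝ) = 0
    · exact Or.inr ⟨true, a, mk_eq_mk.2 ⟨Subtype.ext hs.symm, fun _ ↦ rfl, fun h ↦ absurd rfl h⟩⟩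
    by_cases hc : (θ : ℝ) = Real.pi / 2
    · exact Or.inr ⟨false, b, mk_eq_mk.2 ⟨Subtype.ext hc.symm, fun h ↦ absurd rfl h, fun _ ↦ rfl⟩⟩
    · exact Or.inl ⟨(sin_pos_iff θ).2 hs, (cos_pos_iff θ).2 hc⟩
  -- Both cone bundles are trivial; one trivialization per stratum suffices.
  B _ := PUnit
  V _ _ := univ
  V_cover _ _ := ⟨PUnit.unit, trivial⟩
  ψ α _ := chart F₁ F₂ α
  ψ_source α _ := by cases α <;> rfl
  ψ_target α _ := by
    cases α
    · ext m; exact ⟨fun h ↦ ⟨h, trivial⟩, fun h ↦ h.1⟩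
    · ext m; exact ⟨fun h ↦ ⟨h, trivial⟩, fun h ↦ h.1⟩
  proj_ψ α _ x _ s _ f := by
    cases α
    · exact snd_incl _
    · exact fst_incl _
  rad_ψ α _ x _ s hs f := by
    cases α
    · exact (cos_susAngle_neg _).trans (sin_susAngle_logRad (Ioo_width_subset hs))
    · exact sin_susAngle_logRad (Ioo_width_subset hs)
  ψ_conic α _ _ x _ s _ s' _ f f' h := by
    cases α
    · have : f = f' := congrArg (fun m : ℝ × (F₁ × F₂) ↦ m.2.1) h
      rw [this]
    · have : f = f' := congrArg (fun m : ℝ × (F₁ × F₂) ↦ m.2.2) h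
      rw [this]
  metric_near_edge α := by
    refine ⟨2, 2, two_pos, fun _ x _ s hs f u t v ↦ ?_⟩
    cases α
    · have h := sq_chartRight κ₁ κ₂ hs f x u t v
      exact (congrArg (fun r ↦ |r - _|) h).le.trans
        (abs_sq_sub_le hs (κ₂.sq_nonneg _ _) (κ₁.sq_nonneg _ _))
    · have h := sq_chartLeft κ₁ κ₂ hs x f u t v
      exact (congrArg (fun r ↦ |r - _|) h).le.trans
        (abs_sq_sub_le hs (κ₁.sq_nonneg _ _) (κ₂.sq_nonneg _ _))

theorem isSphericalSuspension_edge : (edge κ₁ κ₂).IsSphericalSuspension κ₁ κ₂ := by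
  refine ⟨susPolar F₁ F₂, rfl, rfl, fun θ hθ a b ↦ ⟨?_, fun t v w ↦ susMetric_polar κ₁ κ₂ hθ a b t v w⟩⟩
  exact mk_eq_mk.2 ⟨Subtype.ext (susAngle_log_tan hθ), fun _ ↦ rfl, fun _ ↦ rfl⟩

end Suspension

/-! ### Shrinking a conic end -/

namespace ACStructure

variable {Z F : Mfd.{u}} {g : Z.Metric} {κ : F.Metric} {ν : ℝ} (A : ACStructure g κ ν)

/-- The conic end beyond a larger radius, with a smaller rate. -/
noncomputable def restrict {R ν' : ℝ} (hR : A.R₀ < R) (h1 : 1 ≤ R) (hν' : 0 < ν') (hν : ν' ≤ ν) :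
    ACStructure g κ ν' where
  compact_link := A.compact_link
  nonempty_link := A.nonempty_link
  rate_pos := hν'
  R₀ := R
  R₀_pos := A.R₀_pos.trans hR
  Φ :=
    { toFun := A.Φ
      invFun := A.Φ.invFun
      source := Ioi R ×ˢ univ
      target := {z | R < A.rho z}
      map_source' := by
        rintro ⟨r, f⟩ ⟨hr, -⟩
        change R < A.rho _
        rw [A.rho_Φ (hR.trans hr)]
        exact hr
      map_target' := fun z (hz : R < A.rho z) ↦ by
        rw [A.invFun_eq (hR.trans hz)]
        exact ⟨hz, trivial⟩
      left_inv' := by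
        rintro ⟨r, f⟩ ⟨hr, -⟩
        exact A.invFun_Φ (hR.trans hr) f
      right_inv' := fun z (hz : R < A.rho z) ↦ A.Φ.right_inv (A.mem_target_iff.2 (hR.trans hz))
      open_source := isOpen_Ioi.prod isOpen_univ
      open_target := isOpen_lt continuous_const A.continuous_rho
      contMDiffOn_toFun := fun p hp ↦
        (A.Φ.contMDiffAt (A.mem_source (hR.trans hp.1) p.2)).contMDiffWithinAt
      contMDiffOn_invFun := fun z (hz : R < A.rho z) ↦
        (A.Φ.contMDiffAt_invFun (A.mem_target_iff.2 (hR.trans hz))).contMDiffWithinAt }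
  source_eq := rfl
  isCompact_compl R' hR' := A.isCompact_compl R' (hR.trans hR')
  isClosed_end R' hR' := A.isClosed_end R' (hR.trans hR')
  asymptotic := by
    obtain ⟨C, hC⟩ := A.asymptotic
    refine ⟨max C 0, fun r hr f t v ↦ (hC r (hR.trans hr) f t v).trans ?_⟩
    have h2 : 0 ≤ t ^ 2 + r ^ 2 * κ.sq f v := by
      have := κ.sq_nonneg f v
      positivity
    have h3 : r ^ (-ν) ≤ r ^ (-ν') :=
      Real.rpow_le_rpow_of_exponent_le (by linarith [show R < r from hr]) (by linarith)
    have h4 : 0 ≤ r ^ (-ν) := Real.rpow_nonneg (by linarith [show R < r from hr]) _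
    refine mul_le_mul_of_nonneg_right ?_ h2
    exact (mul_le_mul_of_nonneg_right (le_max_left C 0) h4).trans
      (mul_le_mul_of_nonneg_left h3 (le_max_right C 0))

/-- Needed for R = 2K: the fibres of the blowup are given ends that start where σ and ρ agree, with
a rate common to both factors. -/
theorem rho_restrict {R ν' : ℝ} (hR : A.R₀ < R) (h1 : 1 ≤ R) (hν' : 0 < ν') (hν : ν' ≤ ν) (z : Z) :
    (A.restrict hR h1 hν' hν).rho z = max R (A.rho z) := by
  by_cases h : R < A.rho z
  · have h2 : z ∈ (A.restrict hR h1 hν' hν).Φ.target := h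
    rw [rho_of_mem _ h2, max_eq_right h.le]
    exact congrArg Prod.fst (A.invFun_eq (hR.trans h))
  · have h2 : z ∉ (A.restrict hR h1 hν' hν).Φ.target := h
    rw [rho, if_neg h2, max_eq_left (not_lt.1 h)]
    rfl

end ACStructure

/-! ### The wedge and the two fibre regions of a level set -/

namespace ACPair

variable {Z₁ Z₂ F₁ F₂ : Mfd.{u}} {g₁ : Z₁.Metric} {g₂ : Z₂.Metric} {κ₁ : F₁.Metric}
  {κ₂ : F₂.Metric} {ν₁ ν₂ : ℝ} (A : ACStructure g₁ κ₁ ν₁) (B : ACStructure g₂ κ₂ ν₂) {K : ℝ}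

theorem blend_swap (hA : A.R₀ < K) (hB : B.R₀ < K) (z : Z₂ × Z₁) (X : TangentSpace Z₁.I z.2)
    (Y : TangentSpace Z₂.I z.1) :
    (blend A B hA hB).sq z.swap (X, Y) = (blend B A hB hA).sq z (Y, X) := by
  have h := blend_sq B A hB hA z Y X
  have h2 := blend_sq A B hA hB z.swap X Y
  rw [weight_swap] at h2
  rw [h2, h]
  change (1 - weight B A K z) * (g₁.sq z.2 X + g₂.sq z.1 Y) + weight B A K z *
    (A.coneForm z.2 X X + B.coneForm z.1 Y Y) = (1 - weight B A K z) *
    (g₂.sq z.1 Y + g₁.sq z.2 X) + weight B A K z * (B.coneForm z.1 Y Y + A.coneForm z.2 X X)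
  ring

theorem compactSpace_levelMfd (hA : A.R₀ < K) (hB : B.R₀ < K) : CompactSpace (levelMfd hA hB) := by
  have hK : 0 < K := A.R₀_pos.trans hA
  have h1 : IsClosed {z : Z₁ × Z₂ | sqRadius A B K z = (10 * K) ^ 2} :=
    isClosed_eq (contMDiff_sqRadius A B hA hB).continuous continuous_const
  have h2 := (A.isCompact_sigma_le hA (10 * K)).prod (B.isCompact_sigma_le hB (10 * K))
  refine isCompact_iff_compactSpace.1 (h2.of_isClosed_subset h1 ?_)
  rintro ⟨z₁, z₂⟩ (hz : A.sigma K z₁ ^ 2 + B.sigma K z₂ ^ 2 = (10 * K) ^ 2)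
  have k₁ := A.le_sigma hK (z := z₁)
  have k₂ := B.le_sigma hK (z := z₂)
  refine ⟨show A.sigma K z₁ ≤ 10 * K from ?_, show B.sigma K z₂ ≤ 10 * K from ?_⟩ <;> nlinarith

variable (K) in
/-- The parametrization of the wedge where both factors are far out. -/
noncomputable def wedgeMap (r : ℝ) (m : ℝ × (F₁ × F₂)) : Z₁ × Z₂ :=
  (A.Φ (r * Real.cos (susAngle m.1), m.2.1), B.Φ (r * Real.sin (susAngle m.1), m.2.2))

/-- The domain of the wedge parametrization. -/
def wedge (F₁ F₂ : Type u) (K r : ℝ) : Set (ℝ × (F₁ × F₂)) :=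
  {m | 2 * K < r * Real.cos (susAngle m.1) ∧ 2 * K < r * Real.sin (susAngle m.1)}

theorem isOpen_wedge {F₁ F₂ : Type u} [TopologicalSpace F₁] [TopologicalSpace F₂] (K r : ℝ) :
    IsOpen (wedge F₁ F₂ K r) := by
  have h := contDiff_susAngle.continuous
  exact (isOpen_lt (f := fun _ ↦ 2 * K) (by fun_prop) (by fun_prop)).and
    (isOpen_lt (f := fun _ ↦ 2 * K) (by fun_prop) (by fun_prop))

section
variable {r : ℝ} {m : ℝ × (F₁ × F₂)} (hA : A.R₀ < K) (hB : B.R₀ < K) (hm : m ∈ wedge F₁ F₂ K r)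
include hA hB hm

theorem R₀_lt_of_mem_wedge : A.R₀ < r * Real.cos (susAngle m.1) ∧
    B.R₀ < r * Real.sin (susAngle m.1) := by
  have hK : 0 < K := A.R₀_pos.trans hA
  exact ⟨by linarith [hm.1], by linarith [hm.2]⟩

theorem sqRadius_wedgeMap : sqRadius A B K (wedgeMap A B r m) = r ^ 2 := by
  have hK : 0 < K := A.R₀_pos.trans hA
  rw [sqRadius, wedgeMap, A.sigma_Φ hK hm.1.le hA, B.sigma_Φ hK hm.2.le hB, mul_pow, mul_pow,
    ← mul_add, add_comm, Real.sin_sq_add_cos_sq, mul_one]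

theorem contMDiffAt_wedgeMap : ContMDiffAt (𝓘(ℝ, ℝ).prod (F₁.I.prod F₂.I)) (Z₁.I.prod Z₂.I) ∞
    (wedgeMap A B r) m := by
  have h := R₀_lt_of_mem_wedge A B hA hB hm
  have h1 : ContDiff ℝ ∞ fun t ↦ r * Real.cos (susAngle t) :=
    contDiff_const.mul (Real.contDiff_cos.comp contDiff_susAngle)
  have h2 : ContDiff ℝ ∞ fun t ↦ r * Real.sin (susAngle t) :=
    contDiff_const.mul (Real.contDiff_sin.comp contDiff_susAngle)
  exact (A.contMDiffAt_Φ (a := fun m : ℝ × (F₁ × F₂) ↦ r * Real.cos (susAngle m.1))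
    (b := fun m ↦ m.2.1) h.1 (ContMDiffAt.comp (g := fun t ↦ r * Real.cos (susAngle t)) m
      h1.contMDiff.contMDiffAt contMDiffAt_fst) (contMDiffAt_fst.comp m contMDiffAt_snd)).prodMk
    (B.contMDiffAt_Φ (a := fun m : ℝ × (F₁ × F₂) ↦ r * Real.sin (susAngle m.1))
    (b := fun m ↦ m.2.2) h.2 (ContMDiffAt.comp (g := fun t ↦ r * Real.sin (susAngle t)) m
      h2.contMDiff.contMDiffAt contMDiffAt_fst) (contMDiffAt_snd.comp m contMDiffAt_snd))

end

theorem cos_sin_susAngle_log {a b r : ℝ} (ha : 0 < a) (hb : 0 < b) (hr : 0 < r)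
    (h : a ^ 2 + b ^ 2 = r ^ 2) :
    r * Real.cos (susAngle (Real.log (b / a))) = a ∧
      r * Real.sin (susAngle (Real.log (b / a))) = b := by
  set θ := susAngle (Real.log (b / a))
  have hc : 0 < Real.cos θ := cos_susAngle_pos _
  have hs : 0 < Real.sin θ := sin_susAngle_pos _
  have h1 : Real.sin θ / Real.cos θ = b / a := by
    rw [← Real.tan_eq_sin_div_cos, tan_susAngle, Real.exp_log (by positivity)]
  rw [div_eq_div_iff hc.ne' ha.ne'] at h1
  have h2 := Real.sin_sq_add_cos_sq θ
  have h3 : a ^ 2 * (Real.sin θ ^ 2 + Real.cos θ ^ 2) = (r * Real.cos θ) ^ 2 := by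
    calc a ^ 2 * (Real.sin θ ^ 2 + Real.cos θ ^ 2) = (Real.sin θ * a) ^ 2 + a ^ 2 * Real.cos θ ^ 2 := by ring
      _ = (a ^ 2 + b ^ 2) * Real.cos θ ^ 2 := by rw [h1]; ring
      _ = (r * Real.cos θ) ^ 2 := by rw [h]; ring
  have h4 : r * Real.cos θ = a := by
    rw [h2, mul_one] at h3
    exact ((pow_left_inj₀ ha.le (by positivity) two_ne_zero).1 h3).symm
  refine ⟨h4, ?_⟩
  have : Real.cos θ * (r * Real.sin θ) = Real.cos θ * b := by
    calc Real.cos θ * (r * Real.sin θ) = Real.sin θ * (r * Real.cos θ) := by ring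
      _ = Real.cos θ * b := by rw [h4, h1]; ring
  exact mul_left_cancel₀ hc.ne' this

section
variable {A B}
variable (hA : A.R₀ < K) (hB : B.R₀ < K) {r : ℝ} (hr : 10 * K < r)

/-- The embedding of the wedge in the level set. -/
noncomputable def wedgeChart : PartialDiffeomorph (susReg F₁ F₂).I (levelMfd hA hB).I
    (susReg F₁ F₂) (levelMfd hA hB) ∞ where
  toFun m := contract hA hB r (wedgeMap A B r m)
  invFun y := (Real.log (B.rho (expand hA hB r y).2 / A.rho (expand hA hB r y).1),
    A.link (expand hA hB r y).1, B.link (expand hA hB r y).2)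
  source := wedge F₁ F₂ K r
  target := {y | 2 * K < A.rho (expand hA hB r y).1 ∧ 2 * K < B.rho (expand hA hB r y).2}
  map_source' m hm := by
    have h := R₀_lt_of_mem_wedge A B hA hB hm
    rw [mem_ofPred_eq, expand_contract hA hB hr.le (sqRadius_wedgeMap A B hA hB hm)]
    change 2 * K < A.rho (A.Φ _) ∧ 2 * K < B.rho (B.Φ _)
    rw [A.rho_Φ h.1, B.rho_Φ h.2]
    exact hm
  map_target' y hy := by
    have hK : 0 < K := A.R₀_pos.trans hA
    have h1 := sqRadius_expand hA hB hr.le y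
    rw [sqRadius, A.sigma_of_ge hK hy.1.le, B.sigma_of_ge hK hy.2.le] at h1
    have h := cos_sin_susAngle_log (A.rho_pos _) (B.rho_pos _) (by linarith) h1
    refine ⟨?_, ?_⟩
    · exact lt_of_lt_of_eq hy.1 h.1.symm
    · exact lt_of_lt_of_eq hy.2 h.2.symm
  left_inv' m hm := by
    have hK : 0 < K := A.R₀_pos.trans hA
    have h := R₀_lt_of_mem_wedge A B hA hB hm
    rw [expand_contract hA hB hr.le (sqRadius_wedgeMap A B hA hB hm)]
    change (Real.log (B.rho (B.Φ _) / A.rho (A.Φ _)), A.link (A.Φ _), B.link (B.Φ _)) = m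
    rw [A.rho_Φ h.1, B.rho_Φ h.2, A.link_Φ h.1, B.link_Φ h.2, mul_div_mul_left _ _ (by linarith),
      ← Real.tan_eq_sin_div_cos, log_tan_susAngle]
  right_inv' y hy := by
    have hK : 0 < K := A.R₀_pos.trans hA
    have h1 := sqRadius_expand hA hB hr.le y
    rw [sqRadius, A.sigma_of_ge hK hy.1.le, B.sigma_of_ge hK hy.2.le] at h1
    have h := cos_sin_susAngle_log (A.rho_pos _) (B.rho_pos _) (by linarith) h1
    have h2 : wedgeMap A B r (Real.log (B.rho (expand hA hB r y).2 / A.rho (expand hA hB r y).1),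
        A.link (expand hA hB r y).1, B.link (expand hA hB r y).2) = expand hA hB r y := by
      rw [wedgeMap, h.1, h.2, A.Φ_rho_link (by linarith [hy.1]), B.Φ_rho_link (by linarith [hy.2])]
    rw [h2, contract_expand hA hB hr.le]
  open_source := isOpen_wedge K r
  open_target := by
    have h := (contMDiff_expand hA hB hr).continuous
    exact (isOpen_lt continuous_const (A.continuous_rho.comp (continuous_fst.comp h))).and
      (isOpen_lt continuous_const (B.continuous_rho.comp (continuous_snd.comp h)))
  contMDiffOn_toFun m hm := (contMDiffAt_contract hA hB (r := fun _ ↦ r) hr contMDiffAt_const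
    (contMDiffAt_wedgeMap A B hA hB hm) (by
      filter_upwards [(isOpen_wedge K r).mem_nhds hm] with m' hm'
      exact sqRadius_wedgeMap A B hA hB hm')).contMDiffWithinAt
  contMDiffOn_invFun y hy := by
    have hK : 0 < K := A.R₀_pos.trans hA
    have h := contMDiff_expand hA hB hr y
    have h1 : ContMDiffAt (levelMfd hA hB).I Z₁.I ∞ (fun y ↦ (expand hA hB r y).1) y :=
      contMDiffAt_fst.comp y h
    have h2 : ContMDiffAt (levelMfd hA hB).I Z₂.I ∞ (fun y ↦ (expand hA hB r y).2) y :=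
      contMDiffAt_snd.comp y h
    have hA' : A.R₀ < A.rho (expand hA hB r y).1 := by linarith [hy.1]
    have hB' : B.R₀ < B.rho (expand hA hB r y).2 := by linarith [hy.2]
    have h3 : ContMDiffAt (levelMfd hA hB).I 𝓘(ℝ, ℝ × ℝ) ∞
        (fun y ↦ (A.rho (expand hA hB r y).1, B.rho (expand hA hB r y).2)) y :=
      ((A.contMDiffAt_rho hA').comp y h1).prodMk_space ((B.contMDiffAt_rho hB').comp y h2)
    have h4 : ContDiffAt ℝ ∞ (fun p : ℝ × ℝ ↦ Real.log (p.2 / p.1))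
        (A.rho (expand hA hB r y).1, B.rho (expand hA hB r y).2) :=
      ContDiffAt.log (ContDiffAt.div contDiffAt_snd contDiffAt_fst (A.rho_pos _).ne')
        (div_pos (B.rho_pos _) (A.rho_pos _)).ne'
    have h5 : ContMDiffAt (levelMfd hA hB).I 𝓘(ℝ, ℝ) ∞
        (fun y ↦ Real.log (B.rho (expand hA hB r y).2 / A.rho (expand hA hB r y).1)) y :=
      ContMDiffAt.comp (g := fun p : ℝ × ℝ ↦ Real.log (p.2 / p.1)) y h4.contMDiffAt h3
    exact (h5.prodMk (((A.contMDiffAt_link hA').comp y h1).prodMk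
      ((B.contMDiffAt_link hB').comp y h2))).contMDiffWithinAt

variable {c : ℝ} (hc : c ≤ 4 / 5)

/-- The embedding of the region where the first factor is far out in the level set. -/
noncomputable def regionChartLeft : PartialDiffeomorph (F₁.I.prod Z₂.I) (levelMfd hA hB).I
    (F₁ × Z₂) (levelMfd hA hB) ∞ where
  toFun q := contract hA hB r (regionMap A B K r q)
  invFun y := (A.link (expand hA hB r y).1, (expand hA hB r y).2)
  source := univ ×ˢ {w | B.sigma K w < c * r}
  target := {y | B.sigma K (expand hA hB r y).2 < c * r}
  map_source' := by
    rintro ⟨f, w⟩ ⟨-, hw : B.sigma K w < c * r⟩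
    have hK : 0 < K := A.R₀_pos.trans hA
    have hw' : B.sigma K w < 4 / 5 * r := by nlinarith
    rw [mem_ofPred_eq, expand_contract hA hB hr.le (sqRadius_regionMap A B hK hr.le hw' hA f)]
    exact hw
  map_target' y hy := ⟨trivial, hy⟩
  left_inv' := by
    rintro ⟨f, w⟩ ⟨-, hw : B.sigma K w < c * r⟩
    have hK : 0 < K := A.R₀_pos.trans hA
    have hw' : B.sigma K w < 4 / 5 * r := by nlinarith
    rw [expand_contract hA hB hr.le (sqRadius_regionMap A B hK hr.le hw' hA f),
      link_regionMap A B hK hr.le hw' hA f]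
    rfl
  right_inv' y (hy : B.sigma K (expand hA hB r y).2 < c * r) := by
    have hK : 0 < K := A.R₀_pos.trans hA
    have hw' : B.sigma K (expand hA hB r y).2 < 4 / 5 * r := by nlinarith
    rw [regionMap_link A B hK hA hr.le (sqRadius_expand hA hB hr.le y) hw',
      contract_expand hA hB hr.le]
  open_source := isOpen_univ.prod (isOpen_sigma_lt hB)
  open_target := (isOpen_sigma_lt hB).preimage
    (continuous_snd.comp (contMDiff_expand hA hB hr).continuous)
  contMDiffOn_toFun := by
    rintro ⟨f, w⟩ ⟨-, hw : B.sigma K w < c * r⟩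
    have hK : 0 < K := A.R₀_pos.trans hA
    have hw' : B.sigma K w < 4 / 5 * r := by nlinarith
    refine (contMDiffAt_contract hA hB (r := fun _ ↦ r) hr contMDiffAt_const
      (contMDiffAt_regionMap A B (r := fun _ ↦ r) (a := Prod.fst) (b := Prod.snd) hA hB hr.le hw'
        contMDiffAt_const contMDiffAt_fst contMDiffAt_snd) ?_).contMDiffWithinAt
    have h := (isOpen_sigma_lt (B := B) (r := 4 / 5 * r) hB).preimage
      (continuous_snd (X := F₁) (Y := Z₂))
    filter_upwards [h.mem_nhds hw'] with q hq
    exact sqRadius_regionMap A B hK hr.le hq hA _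
  contMDiffOn_invFun y (hy : B.sigma K (expand hA hB r y).2 < c * r) := by
    have hK : 0 < K := A.R₀_pos.trans hA
    have hw' : B.sigma K (expand hA hB r y).2 < 4 / 5 * r := by nlinarith
    have h := contMDiff_expand hA hB hr y
    exact (((A.contMDiffAt_link (lt_rho_of_lt A B hr.le hA (sqRadius_expand hA hB hr.le y)
      hw')).comp y (contMDiffAt_fst.comp y h)).prodMk (contMDiffAt_snd.comp y h)).contMDiffWithinAt

/-- The embedding of the region where the second factor is far out in the level set. -/
noncomputable def regionChartRight : PartialDiffeomorph (F₂.I.prod Z₁.I) (levelMfd hA hB).I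
    (F₂ × Z₁) (levelMfd hA hB) ∞ where
  toFun q := contract hA hB r (regionMap B A K r q).swap
  invFun y := (B.link (expand hA hB r y).2, (expand hA hB r y).1)
  source := univ ×ˢ {w | A.sigma K w < c * r}
  target := {y | A.sigma K (expand hA hB r y).1 < c * r}
  map_source' := by
    rintro ⟨f, w⟩ ⟨-, hw : A.sigma K w < c * r⟩
    have hK : 0 < K := A.R₀_pos.trans hA
    have hw' : A.sigma K w < 4 / 5 * r := by nlinarith
    rw [mem_ofPred_eq, expand_contract hA hB hr.le (by
      rw [sqRadius_swap, sqRadius_regionMap B A hK hr.le hw' hB f])]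
    exact hw
  map_target' y hy := ⟨trivial, hy⟩
  left_inv' := by
    rintro ⟨f, w⟩ ⟨-, hw : A.sigma K w < c * r⟩
    have hK : 0 < K := A.R₀_pos.trans hA
    have hw' : A.sigma K w < 4 / 5 * r := by nlinarith
    rw [expand_contract hA hB hr.le (by
      rw [sqRadius_swap, sqRadius_regionMap B A hK hr.le hw' hB f]), Prod.snd_swap,
      link_regionMap B A hK hr.le hw' hB f]
    rfl
  right_inv' y (hy : A.sigma K (expand hA hB r y).1 < c * r) := by
    have hK : 0 < K := A.R₀_pos.trans hA
    have hw' : A.sigma K (expand hA hB r y).1 < 4 / 5 * r := by nlinarith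
    have h := regionMap_link B A (z := (expand hA hB r y).swap) hK hB hr.le
      ((sqRadius_swap A B _).trans (sqRadius_expand hA hB hr.le y)) hw'
    rw [Prod.fst_swap, Prod.snd_swap] at h
    rw [h, Prod.swap_swap, contract_expand hA hB hr.le]
  open_source := isOpen_univ.prod (isOpen_sigma_lt hA)
  open_target := (isOpen_sigma_lt hA).preimage
    (continuous_fst.comp (contMDiff_expand hA hB hr).continuous)
  contMDiffOn_toFun := by
    rintro ⟨f, w⟩ ⟨-, hw : A.sigma K w < c * r⟩
    have hK : 0 < K := A.R₀_pos.trans hA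
    have hw' : A.sigma K w < 4 / 5 * r := by nlinarith
    have h1 := contMDiffAt_regionMap B A (r := fun _ ↦ r) (a := Prod.fst) (b := Prod.snd)
      (J := F₂.I.prod Z₁.I) (x := (f, w)) hB hA hr.le hw'
        contMDiffAt_const contMDiffAt_fst contMDiffAt_snd
    refine (contMDiffAt_contract hA hB (r := fun _ ↦ r) hr contMDiffAt_const
      (z := fun q ↦ (regionMap B A K r q).swap)
      ((contMDiffAt_snd.comp (f, w) h1).prodMk (contMDiffAt_fst.comp (f, w) h1))
      ?_).contMDiffWithinAt
    have h := (isOpen_sigma_lt (B := A) (r := 4 / 5 * r) hA).preimage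
      (continuous_snd (X := F₂) (Y := Z₁))
    filter_upwards [h.mem_nhds hw'] with q hq
    rw [sqRadius_swap]
    exact sqRadius_regionMap B A hK hr.le hq hB _
  contMDiffOn_invFun y (hy : A.sigma K (expand hA hB r y).1 < c * r) := by
    have hK : 0 < K := A.R₀_pos.trans hA
    have hw' : A.sigma K (expand hA hB r y).1 < 4 / 5 * r := by nlinarith
    have h := contMDiff_expand hA hB hr y
    have h2 := lt_rho_of_lt B A (z := (expand hA hB r y).swap) hr.le hB
      ((sqRadius_swap A B _).trans (sqRadius_expand hA hB hr.le y)) hw'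
    exact (((B.contMDiffAt_link h2).comp y (contMDiffAt_snd.comp y h)).prodMk
      (contMDiffAt_fst.comp y h)).contMDiffWithinAt

end

end ACPair

/-! ### Pullbacks of the interpolated metric and the fibre estimate -/

theorem hasDerivAt_susAngle (t : ℝ) :
    HasDerivAt susAngle (Real.sin (susAngle t) * Real.cos (susAngle t)) t := by
  refine (Real.hasDerivAt_exp t).arctan.congr_deriv ?_
  have h1 : Real.sin (susAngle t) = Real.exp t * Real.cos (susAngle t) := by
    rw [← tan_susAngle, Real.tan_mul_cos (cos_susAngle_pos t).ne']
  have h2 : Real.cos (susAngle t) ^ 2 = 1 / (1 + Real.exp t ^ 2) := Real.cos_sq_arctan _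
  rw [h1, mul_assoc, ← sq, h2]
  ring

theorem ACStructure.coneForm_mfderiv_Φ {Z F : Mfd.{u}} {g : Z.Metric} {κ : F.Metric} {ν : ℝ}
    (A : ACStructure g κ ν) {r : ℝ} (hr : A.R₀ < r) (f : F) (a : ℝ) (b : TangentSpace F.I f) :
    A.coneForm (A.Φ (r, f)) (mfderiv (𝓘(ℝ, ℝ).prod F.I) Z.I A.Φ (r, f) (a, b))
      (mfderiv (𝓘(ℝ, ℝ).prod F.I) Z.I A.Φ (r, f) (a, b)) = a ^ 2 + r ^ 2 * κ.sq f b := by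
  rw [A.coneForm_apply, A.radial_mfderiv_Φ hr, A.rho_Φ hr, sq a]
  congr 2
  -- The angular component lives over the link of Φ(r, f), which equals f only propositionally.
  have h : ∀ (f' : F) (_ : f' = f) (b' : F.E), b' = b → κ.sq f' b' = κ.sq f b := by
    rintro _ rfl _ rfl; rfl
  exact h _ (A.link_Φ hr f) _ (A.angular_mfderiv_Φ hr f a b)

theorem abs_interpolation_sub_le {χ a b e : ℝ} (h0 : 0 ≤ χ) (h1 : χ ≤ 1) (h : |a - b| ≤ e) :
    |(1 - χ) * a + χ * b - b| ≤ e := by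
  have : (1 - χ) * a + χ * b - b = (1 - χ) * (a - b) := by ring
  rw [this, abs_mul, abs_of_nonneg (by linarith)]
  nlinarith [abs_nonneg (a - b)]

namespace ACPair

variable {Z₁ Z₂ F₁ F₂ : Mfd.{u}} {g₁ : Z₁.Metric} {g₂ : Z₂.Metric} {κ₁ : F₁.Metric}
  {κ₂ : F₂.Metric} {ν₁ ν₂ : ℝ} (A : ACStructure g₁ κ₁ ν₁) (B : ACStructure g₂ κ₂ ν₂) {K : ℝ}

theorem mfderiv_regionMap (hA : A.R₀ < K) (hB : B.R₀ < K) {r : ℝ} (hr : 10 * K ≤ r) (f : F₁)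
    {w : Z₂} (hw : B.sigma K w < 4 / 5 * r) (u : TangentSpace F₁.I f) (X : TangentSpace Z₂.I w) :
    mfderiv (F₁.I.prod Z₂.I) (Z₁.I.prod Z₂.I) (regionMap A B K r) (f, w) (u, X) =
      (mfderiv (𝓘(ℝ, ℝ).prod F₁.I) Z₁.I A.Φ (coradius B K r w, f)
        (-(B.sigma K w * B.dsigma K w X) / coradius B K r w, u), X) := by
  have hK : 0 < K := A.R₀_pos.trans hA
  have hpos : 0 < coradius B K r w := by linarith [six_lt_coradius B hK hr hw]
  have h0 : r ^ 2 - B.sigma K w ^ 2 ≠ 0 := by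
    rw [← sq_coradius B hK hr hw]; positivity
  have h1 : HasDerivAt (fun s : ℝ ↦ √(r ^ 2 - s ^ 2)) (-B.sigma K w / coradius B K r w)
      (B.sigma K w) := by
    have h := (((hasDerivAt_id (B.sigma K w)).pow 2).const_sub (r ^ 2)).sqrt h0
    refine h.congr_deriv ?_
    change -(2 * B.sigma K w ^ 1 * 1) / (2 * coradius B K r w) = _
    field_simp
  have h2 := ((B.contMDiff_sigma hB w).mdifferentiableAt (by simp)).hasMFDerivAt
  have h3 := hasMFDerivAt_snd (I := F₁.I) (I' := Z₂.I) (f, w)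
  have h4 := hasMFDerivAt_fst (I := F₁.I) (I' := Z₂.I) (f, w)
  have h5 := ((A.Φ.contMDiffAt (A.mem_source (R₀_lt_coradius A B hK hr hw hA) f)).mdifferentiableAt
    (by simp)).hasMFDerivAt
  have h6 := (h1.hasFDerivAt.hasMFDerivAt.comp w h2).comp (f, w) h3
  have h7 : HasMFDerivAt (F₁.I.prod Z₂.I) (Z₁.I.prod Z₂.I) (regionMap A B K r) (f, w) _ :=
    (HasMFDerivAt.comp (f, w) h5 (h6.prodMk h4)).prodMk h3
  rw [h7.mfderiv]
  refine Prod.ext ?_ rfl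
  change mfderiv (𝓘(ℝ, ℝ).prod F₁.I) Z₁.I A.Φ (coradius B K r w, f)
    (B.dsigma K w X * (-B.sigma K w / coradius B K r w), u) = _
  congr 2
  ring

theorem mfderiv_wedgeMap {r : ℝ} {m : ℝ × (F₁ × F₂)} (h₁ : A.R₀ < r * Real.cos (susAngle m.1))
    (h₂ : B.R₀ < r * Real.sin (susAngle m.1)) (t : ℝ) (u : TangentSpace F₁.I m.2.1)
    (v : TangentSpace F₂.I m.2.2) :
    mfderiv (𝓘(ℝ, ℝ).prod (F₁.I.prod F₂.I)) (Z₁.I.prod Z₂.I) (wedgeMap A B r) m (t, u, v) =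
      (mfderiv (𝓘(ℝ, ℝ).prod F₁.I) Z₁.I A.Φ (r * Real.cos (susAngle m.1), m.2.1)
        (-(r * Real.sin (susAngle m.1)) *
          (Real.sin (susAngle m.1) * Real.cos (susAngle m.1) * t), u),
      mfderiv (𝓘(ℝ, ℝ).prod F₂.I) Z₂.I B.Φ (r * Real.sin (susAngle m.1), m.2.2)
        (r * Real.cos (susAngle m.1) *
          (Real.sin (susAngle m.1) * Real.cos (susAngle m.1) * t), v)) := by
  have hθ := hasDerivAt_susAngle m.1
  have k₁ := hθ.cos.const_mul r
  have k₂ := hθ.sin.const_mul r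
  have h3 := hasMFDerivAt_snd (I := 𝓘(ℝ, ℝ)) (I' := F₁.I.prod F₂.I) m
  have h4 := hasMFDerivAt_fst (I := 𝓘(ℝ, ℝ)) (I' := F₁.I.prod F₂.I) m
  have h5 := ((A.Φ.contMDiffAt (A.mem_source h₁ m.2.1)).mdifferentiableAt (by simp)).hasMFDerivAt
  have h6 := ((B.Φ.contMDiffAt (B.mem_source h₂ m.2.2)).mdifferentiableAt (by simp)).hasMFDerivAt
  have h7 : HasMFDerivAt (𝓘(ℝ, ℝ).prod (F₁.I.prod F₂.I)) (Z₁.I.prod Z₂.I) (wedgeMap A B r) m _ :=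
    (HasMFDerivAt.comp m h5 ((k₁.hasFDerivAt.hasMFDerivAt.comp m h4).prodMk
      ((hasMFDerivAt_fst (I := F₁.I) (I' := F₂.I) m.2).comp m h3))).prodMk
    (HasMFDerivAt.comp m h6 ((k₂.hasFDerivAt.hasMFDerivAt.comp m h4).prodMk
      ((hasMFDerivAt_snd (I := F₁.I) (I' := F₂.I) m.2).comp m h3)))
  rw [h7.mfderiv]
  change (mfderiv (𝓘(ℝ, ℝ).prod F₁.I) Z₁.I A.Φ (r * Real.cos (susAngle m.1), m.2.1)
        (t * (r * (-Real.sin (susAngle m.1) *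
          (Real.sin (susAngle m.1) * Real.cos (susAngle m.1)))), u),
      mfderiv (𝓘(ℝ, ℝ).prod F₂.I) Z₂.I B.Φ (r * Real.sin (susAngle m.1), m.2.2)
        (t * (r * (Real.cos (susAngle m.1) *
          (Real.sin (susAngle m.1) * Real.cos (susAngle m.1)))), v)) = _
  have e₁ : t * (r * (-Real.sin (susAngle m.1) *
      (Real.sin (susAngle m.1) * Real.cos (susAngle m.1)))) = -(r * Real.sin (susAngle m.1)) *
      (Real.sin (susAngle m.1) * Real.cos (susAngle m.1) * t) := by ring
  have e₂ : t * (r * (Real.cos (susAngle m.1) *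
      (Real.sin (susAngle m.1) * Real.cos (susAngle m.1)))) = r * Real.cos (susAngle m.1) *
      (Real.sin (susAngle m.1) * Real.cos (susAngle m.1) * t) := by ring
  rw [e₁, e₂]

/-- A product of cones is the cone over the suspension: for the radii r cos θ and r sin θ with r
fixed, the two squared differentials add up to r² dθ². -/
theorem coneForm_wedgeMap {r : ℝ} {m : ℝ × (F₁ × F₂)} (h₁ : A.R₀ < r * Real.cos (susAngle m.1))
    (h₂ : B.R₀ < r * Real.sin (susAngle m.1)) (t : ℝ) (u : TangentSpace F₁.I m.2.1)
    (v : TangentSpace F₂.I m.2.2) :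
    coneSum A B (wedgeMap A B r m)
      (mfderiv (𝓘(ℝ, ℝ).prod (F₁.I.prod F₂.I)) (Z₁.I.prod Z₂.I) (wedgeMap A B r) m (t, u, v))
      (mfderiv (𝓘(ℝ, ℝ).prod (F₁.I.prod F₂.I)) (Z₁.I.prod Z₂.I) (wedgeMap A B r) m (t, u, v)) =
    r ^ 2 * (susMetric κ₁ κ₂).sq m (t, u, v) := by
  rw [mfderiv_wedgeMap A B h₁ h₂]
  refine (congrArg₂ (· + ·) (A.coneForm_mfderiv_Φ h₁ _ _ _) (B.coneForm_mfderiv_Φ h₂ _ _ _)).trans ?_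
  refine Eq.trans ?_ (congrArg (r ^ 2 * ·) (susMetric_sq κ₁ κ₂ m t u v).symm)
  have h := Real.sin_sq_add_cos_sq (susAngle m.1)
  linear_combination (r * Real.sin (susAngle m.1) * Real.cos (susAngle m.1) * t) ^ 2 * h

/-- Interpolating towards the cone metrics only decreases the error of the product metric, and that
error decays in terms of any common lower bound μ ≥ 1 for the two radii. -/
theorem abs_blend_sub_coneSum_le {C μ ν' : ℝ} (hA : A.R₀ < K) (hB : B.R₀ < K)
    (SA : A.IsScale K C) (SB : B.IsScale K C) (h₁ : ν' ≤ ν₁) (h₂ : ν' ≤ ν₂) (h0 : 0 ≤ ν') {z : Z₁ × Z₂}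
    (hμ : 1 ≤ μ) (k₁ : μ ≤ A.rho z.1) (k₂ : μ ≤ B.rho z.2) (l₁ : A.R₀ < A.rho z.1)
    (l₂ : B.R₀ < B.rho z.2) (V : TangentSpace (Z₁.prod Z₂).I z) :
    |(blend A B hA hB).sq z V - coneSum A B z V V| ≤ C * μ ^ (-ν') * coneSum A B z V V := by
  have d₁ := SA.decay z.1 l₁ V.1
  have d₂ := SB.decay z.2 l₂ V.2
  have p₁ := A.coneForm_nonneg z.1 V.1
  have p₂ := B.coneForm_nonneg z.2 V.2
  have hC := SA.C_ge
  have hdec : ∀ {ρ ν : ℝ}, μ ≤ ρ → ν' ≤ ν → ρ ^ (-ν) ≤ μ ^ (-ν') := by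
    intro ρ ν h h'
    exact (Real.rpow_le_rpow_of_nonpos (by linarith) h (by linarith)).trans
      (Real.rpow_le_rpow_of_exponent_le hμ (by linarith))
  have e₁ := hdec k₁ h₁
  have e₂ := hdec k₂ h₂
  have key : |(g₁.sq z.1 V.1 + g₂.sq z.2 V.2) - (A.coneForm z.1 V.1 V.1 + B.coneForm z.2 V.2 V.2)| ≤
      C * μ ^ (-ν') * (A.coneForm z.1 V.1 V.1 + B.coneForm z.2 V.2 V.2) := by
    have f₁ := mul_le_mul_of_nonneg_right (mul_le_mul_of_nonneg_left e₁ (by linarith : 0 ≤ C)) p₁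
    have f₂ := mul_le_mul_of_nonneg_right (mul_le_mul_of_nonneg_left e₂ (by linarith : 0 ≤ C)) p₂
    calc _ = |(g₁.sq z.1 V.1 - A.coneForm z.1 V.1 V.1) + (g₂.sq z.2 V.2 - B.coneForm z.2 V.2 V.2)| := by
          congr 1; ring
      _ ≤ _ := abs_add_le _ _
      _ ≤ _ := by rw [mul_add]; linarith
  exact abs_interpolation_sub_le (weight_nonneg A B z) (weight_le_one A B z) key

theorem blend_sq_of_weight_eq_one (hA : A.R₀ < K) (hB : B.R₀ < K) {z : Z₁ × Z₂}
    (h : weight A B K z = 1) (V : TangentSpace (Z₁.prod Z₂).I z) :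
    (blend A B hA hB).sq z V = coneSum A B z V V := by
  refine (blend_sq A B hA hB z V.1 V.2).trans ?_
  rw [h, sub_self, zero_mul, zero_add, one_mul]
  rfl

/-- There are three errors. The radius √(r² − s²) is not r and not constant: c₁ − r²q = d² − s²q,
which is controlled by s²/r². The metric g₁ deviates from its cone. Finally χ(c₂ − G) need not be
small, but it occurs only if s ≥ r/2, where e ≥ 1/2 anyway. The respective constants 3C, 6C² and 2
sum to at most 11C². In the application q = κ₁(u), G = g₂(X), and d is the radial velocity of the
first factor. -/
theorem fibre_estimate {C e r s q G d ρ c₁ G₁ c₂ χ : ℝ} (hC : 1 ≤ C) (he : 0 ≤ e)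
    (hr : 0 < r) (hq : 0 ≤ q) (hG : 0 ≤ G) (hs0 : 0 ≤ s) (hs : s ≤ r * e) (hsr : s ≤ r)
    (hd : d ^ 2 * ρ ^ 2 ≤ s ^ 2 * (C * G)) (hρ : ρ ^ 2 = r ^ 2 - s ^ 2) (hρr : 9 * r ^ 2 ≤ 25 * ρ ^ 2)
    (hc₁ : c₁ = d ^ 2 + ρ ^ 2 * q) (hG₁ : |G₁ - c₁| ≤ C * (2 * e) * c₁)
    (hχ0 : 0 ≤ χ) (hχ1 : χ ≤ 1) (hχ : χ ≠ 0 → |c₂ - G| ≤ G ∧ r ≤ 2 * s) :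
    |(1 - χ) * (G₁ + G) + χ * (c₁ + c₂) - (r ^ 2 * q + G)| ≤ 11 * C ^ 2 * e * (r ^ 2 * q + G) := by
  have hss : s ^ 2 ≤ r ^ 2 * e := by nlinarith
  -- From ρ² ≥ 9r²/25 the factor is 25/9, rounded up to 3.
  have hd1 : d ^ 2 * r ^ 2 ≤ 3 * s ^ 2 * (C * G) := by nlinarith [sq_nonneg d, sq_nonneg (s * d), mul_nonneg (sq_nonneg s) (mul_nonneg (by linarith : 0 ≤ C) hG)]
  have hCG : 0 ≤ C * G := mul_nonneg (by linarith) hG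
  have hd2 : d ^ 2 ≤ 3 * (C * G) := by
    have h : d ^ 2 * r ^ 2 ≤ 3 * (C * G) * r ^ 2 := by
      nlinarith [mul_le_mul_of_nonneg_right (pow_le_pow_left₀ hs0 hsr 2) hCG]
    exact le_of_mul_le_mul_right h (by positivity)
  have hd3 : d ^ 2 ≤ 3 * e * (C * G) := by
    have h : d ^ 2 * r ^ 2 ≤ 3 * e * (C * G) * r ^ 2 := by
      nlinarith [mul_le_mul_of_nonneg_right hss hCG]
    exact le_of_mul_le_mul_right h (by positivity)
  have hrq : 0 ≤ r ^ 2 * q := by positivity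
  have hc1 : c₁ ≤ 3 * C * (r ^ 2 * q + G) := by
    rw [hc₁, hρ]
    nlinarith [mul_nonneg (sq_nonneg s) hq, mul_nonneg (by linarith : 0 ≤ C - 1) hrq]
  have h1 : |c₁ - r ^ 2 * q| ≤ 3 * C * e * (r ^ 2 * q + G) := by
    have h : c₁ - r ^ 2 * q = d ^ 2 - s ^ 2 * q := by rw [hc₁, hρ]; ring
    have hsq : s ^ 2 * q ≤ r ^ 2 * e * q := mul_le_mul_of_nonneg_right hss hq
    have k1 : 0 ≤ e * (r ^ 2 * q) := mul_nonneg he hrq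
    have k2 : 0 ≤ s ^ 2 * q := by positivity
    have k3 : 0 ≤ (C - 1) * (e * (r ^ 2 * q)) := mul_nonneg (by linarith) k1
    have k4 : 0 ≤ e * (C * G) := mul_nonneg he hCG
    rw [h, abs_le]
    constructor <;> nlinarith [sq_nonneg d]
  have h2 : |(1 - χ) * G₁ + χ * c₁ - c₁| ≤ 6 * C ^ 2 * e * (r ^ 2 * q + G) := by
    refine abs_interpolation_sub_le hχ0 hχ1 (hG₁.trans ?_)
    have := mul_le_mul_of_nonneg_left hc1 (by positivity : 0 ≤ C * (2 * e))
    linarith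
  have h3 : |χ * (c₂ - G)| ≤ 2 * e * (r ^ 2 * q + G) := by
    have hN : 0 ≤ e * (r ^ 2 * q) := mul_nonneg he hrq
    by_cases h0 : χ = 0
    · rw [h0, zero_mul, abs_zero]; positivity
    · obtain ⟨k1, k2⟩ := hχ h0
      have k3 : 1 ≤ 2 * e := by
        have : r * 1 ≤ r * (2 * e) := by linarith
        exact le_of_mul_le_mul_left this hr
      rw [abs_mul, abs_of_nonneg hχ0]
      have k4 : χ * |c₂ - G| ≤ 1 * G := mul_le_mul hχ1 k1 (abs_nonneg _) zero_le_one
      nlinarith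
  have hCC : C ≤ C ^ 2 := by nlinarith
  have hN : 0 ≤ e * (r ^ 2 * q + G) := by positivity
  calc _ = |((1 - χ) * G₁ + χ * c₁ - c₁) + (c₁ - r ^ 2 * q) + χ * (c₂ - G)| := by congr 1; ring
    _ ≤ |(1 - χ) * G₁ + χ * c₁ - c₁| + |c₁ - r ^ 2 * q| + |χ * (c₂ - G)| := abs_add_three _ _ _
    _ ≤ 11 * C ^ 2 * e * (r ^ 2 * q + G) := by nlinarith

theorem abs_blend_regionMap_sub_le {C δ : ℝ} (hA : A.R₀ < K) (hB : B.R₀ < K)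
    (SA : A.IsScale K C) (SB : B.IsScale K C) (hδ0 : 0 ≤ δ) (hδ : δ ≤ 1) (hδν : δ ≤ ν₁) {r : ℝ} (hr : 10 * K < r) (f : F₁)
    {w : Z₂} (hw : B.sigma K w < 4 / 5 * r) (u : TangentSpace F₁.I f) (X : TangentSpace Z₂.I w) :
    |(r ^ 2)⁻¹ * (blend A B hA hB).sq (regionMap A B K r (f, w))
      (mfderiv (F₁.I.prod Z₂.I) (Z₁.I.prod Z₂.I) (regionMap A B K r) (f, w) (u, X)) -
      (κ₁.sq f u + (r⁻¹) ^ 2 * g₂.sq w X)| ≤ 11 * C ^ 2 * (r⁻¹ * max (2 * K) (B.rho w)) ^ δ *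
        (κ₁.sq f u + (r⁻¹) ^ 2 * g₂.sq w X) := by
  have hK : 0 < K := A.R₀_pos.trans hA
  have hr0 : 0 < r := by linarith
  have h1K := SA.one_le
  have hσ := B.le_sigma hK (z := w)
  have hco := lt_coradius B hK hr.le hw
  set ρ := coradius B K r w with hρdef
  have hρ2 : ρ ^ 2 = r ^ 2 - B.sigma K w ^ 2 := sq_coradius B hK hr.le hw
  have hR : A.R₀ < ρ := R₀_lt_coradius A B hK hr.le hw hA
  have hρw : B.rho w ≤ max (4 / 5 * r) (2 * K) := B.rho_le_of_sigma_le hK hw.le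
  -- This is ε times the radial function of the fibre, whose end starts at 2K.
  set t := r⁻¹ * max (2 * K) (B.rho w) with ht
  have hmax : max (2 * K) (B.rho w) ≤ r :=
    max_le (by linarith) (hρw.trans (max_le (by linarith) (by linarith)))
  have ht0 : r⁻¹ ≤ t := by
    rw [ht]; exact le_mul_of_one_le_right (by positivity) ((by linarith : 1 ≤ 2 * K).trans (le_max_left _ _))
  have ht1 : t ≤ 1 := by rw [ht, inv_mul_le_iff₀ hr0]; linarith
  have htpos : 0 < t := (inv_pos.2 hr0).trans_le ht0
  have hte : t ≤ t ^ δ := by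
    conv_lhs => rw [← Real.rpow_one t]
    exact Real.rpow_le_rpow_of_exponent_ge htpos ht1 hδ
  have hσt : B.sigma K w ≤ r * t := by
    rw [ht, ← mul_assoc, mul_inv_cancel₀ hr0.ne', one_mul, max_comm]
    exact (smoothRadius_le_max hK).trans (max_le_max le_rfl (by linarith))
  set X₁ := mfderiv (𝓘(ℝ, ℝ).prod F₁.I) Z₁.I A.Φ (ρ, f)
    (-(B.sigma K w * B.dsigma K w X) / ρ, u) with hX₁
  -- The first radius exceeds 3r/5, and r⁻¹ ≤ t because 2K ≥ 1; the factor 2 bounds (5/3)^δ.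
  have hdec : ρ ^ (-ν₁) ≤ 2 * t ^ δ := by
    have e1 : ρ ^ (-ν₁) ≤ ρ ^ (-δ) := Real.rpow_le_rpow_of_exponent_le (by linarith) (by linarith)
    have e2 : ρ ^ (-δ) ≤ (3 / 5 * r) ^ (-δ) :=
      Real.rpow_le_rpow_of_nonpos (by positivity) hco.le (by linarith)
    have e3 : (3 / 5 * r) ^ (-δ) = (5 / 3) ^ δ * r⁻¹ ^ δ := by
      rw [Real.rpow_neg (by positivity), ← Real.inv_rpow (by positivity),
        ← Real.mul_rpow (by positivity) (by positivity)]
      congr 1; field_simp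
    have e4 : (5 / 3 : ℝ) ^ δ ≤ 2 := by
      calc (5 / 3 : ℝ) ^ δ ≤ (5 / 3) ^ (1 : ℝ) :=
            Real.rpow_le_rpow_of_exponent_le (by norm_num) hδ
        _ ≤ 2 := by rw [Real.rpow_one]; norm_num
    have e5 : r⁻¹ ^ δ ≤ t ^ δ := Real.rpow_le_rpow (by positivity) ht0 hδ0
    calc ρ ^ (-ν₁) ≤ (5 / 3) ^ δ * r⁻¹ ^ δ := by rw [← e3]; exact e1.trans e2
      _ ≤ 2 * t ^ δ := mul_le_mul e4 e5 (by positivity) (by norm_num)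
  have hfib := fibre_estimate (C := C) (e := t ^ δ) (r := r) (s := B.sigma K w) (q := κ₁.sq f u)
    (G := g₂.sq w X) (d := -(B.sigma K w * B.dsigma K w X) / ρ) (ρ := ρ)
    (c₁ := A.coneForm (A.Φ (ρ, f)) X₁ X₁) (G₁ := g₁.sq (A.Φ (ρ, f)) X₁) (c₂ := B.coneForm w X X)
    (χ := weight A B K (regionMap A B K r (f, w))) SA.C_ge (by positivity) hr0 (κ₁.sq_nonneg _ _)
    (g₂.sq_nonneg _ _) (by linarith) (hσt.trans (mul_le_mul_of_nonneg_left hte hr0.le))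
    (by linarith) ?_ hρ2 (by nlinarith) (A.coneForm_mfderiv_Φ hR f _ u) ?_
    (weight_nonneg A B _) (weight_le_one A B _) ?_
  · have hb : (blend A B hA hB).sq (regionMap A B K r (f, w))
      (mfderiv (F₁.I.prod Z₂.I) (Z₁.I.prod Z₂.I) (regionMap A B K r) (f, w) (u, X)) =
      (1 - weight A B K (regionMap A B K r (f, w))) * (g₁.sq (A.Φ (ρ, f)) X₁ + g₂.sq w X) +
      weight A B K (regionMap A B K r (f, w)) *
        (A.coneForm (A.Φ (ρ, f)) X₁ X₁ + B.coneForm w X X) := by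
      rw [mfderiv_regionMap A B hA hB hr.le f hw]
      exact blend_sq A B hA hB (regionMap A B K r (f, w)) X₁ X
    rw [hb]
    have e1 : ∀ x : ℝ, (r ^ 2)⁻¹ * x - (κ₁.sq f u + (r⁻¹) ^ 2 * g₂.sq w X) =
      (r ^ 2)⁻¹ * (x - (r ^ 2 * κ₁.sq f u + g₂.sq w X)) := by
      intro x; field_simp
    have e2 : κ₁.sq f u + (r⁻¹) ^ 2 * g₂.sq w X =
      (r ^ 2)⁻¹ * (r ^ 2 * κ₁.sq f u + g₂.sq w X) := by field_simp
    rw [e1, abs_mul, abs_of_nonneg (by positivity), e2, mul_left_comm]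
    exact mul_le_mul_of_nonneg_left hfib (by positivity)
  · have := SB.dsigma_sq_le w X
    have h : (-(B.sigma K w * B.dsigma K w X) / ρ) ^ 2 * ρ ^ 2 =
        B.sigma K w ^ 2 * B.dsigma K w X ^ 2 := by
      have : ρ ≠ 0 := by linarith
      field_simp
    rw [h]
    exact mul_le_mul_of_nonneg_left this (sq_nonneg _)
  · have h := SA.decay (A.Φ (ρ, f)) (by rw [A.rho_Φ hR]; exact hR) X₁
    rw [A.rho_Φ hR] at h
    refine h.trans (mul_le_mul_of_nonneg_right (mul_le_mul_of_nonneg_left hdec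
      (by linarith [SA.C_ge])) (A.coneForm_nonneg _ _))
  · intro hχ
    have h1 := coneWeight_ne_zero hχ
    rw [sigma_regionMap A B hK hr.le hw hA, ← hρdef, hρ2] at h1
    have h2 := weight_ne_zero A B hK hχ
    have h3 := SB.half w (by linarith [show 2 * K < B.rho w from h2.2]) X
    have h4 := B.coneForm_nonneg w X
    constructor
    · rw [abs_sub_comm]
      rw [abs_le] at h3 ⊢
      constructor <;> linarith
    · have h5 : r ^ 2 < 4 * B.sigma K w ^ 2 := by
        have : (regionMap A B K r (f, w)).2 = w := rfl
        rw [this] at h1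
        linarith [h1.2.2]
      nlinarith

end ACPair

/-! ### Estimates in the charts of the level set -/

namespace ACPair

variable {Z₁ Z₂ F₁ F₂ : Mfd.{u}} {g₁ : Z₁.Metric} {g₂ : Z₂.Metric} {κ₁ : F₁.Metric}
  {κ₂ : F₂.Metric} {ν₁ ν₂ : ℝ} {A : ACStructure g₁ κ₁ ν₁} {B : ACStructure g₂ κ₂ ν₂} {K : ℝ}
  (hA : A.R₀ < K) (hB : B.R₀ < K)

section
variable {r : ℝ} (hr : 10 * K < r)

theorem sq_wedgeChart {m : ℝ × (F₁ × F₂)} (hm : m ∈ wedge F₁ F₂ K r)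
    (v : TangentSpace (susReg F₁ F₂).I m) :
    (levelMetric hA hB r hr).sq (wedgeChart hA hB hr m)
      (mfderiv (susReg F₁ F₂).I (levelMfd hA hB).I (wedgeChart hA hB hr) m v) =
    (r ^ 2)⁻¹ * (blend A B hA hB).sq (wedgeMap A B r m)
      (mfderiv (𝓘(ℝ, ℝ).prod (F₁.I.prod F₂.I)) (Z₁.I.prod Z₂.I) (wedgeMap A B r) m v) := by
  refine levelMetric_sq_mfderiv hA hB hr
    (((wedgeChart hA hB hr).contMDiffAt hm).mdifferentiableAt (by simp)) ?_ v
  filter_upwards [(isOpen_wedge K r).mem_nhds hm] with m' hm'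
  exact expand_contract hA hB hr.le (sqRadius_wedgeMap A B hA hB hm')

variable {c : ℝ} (hc : c ≤ 4 / 5)

theorem sq_regionChartLeft (f : F₁) {w : Z₂} (hw : B.sigma K w < c * r) (u : TangentSpace F₁.I f)
    (X : TangentSpace Z₂.I w) :
    (levelMetric hA hB r hr).sq (regionChartLeft hA hB hr hc (f, w))
      (mfderiv (F₁.I.prod Z₂.I) (levelMfd hA hB).I (regionChartLeft hA hB hr hc) (f, w) (u, X)) =
    (r ^ 2)⁻¹ * (blend A B hA hB).sq (regionMap A B K r (f, w))
      (mfderiv (F₁.I.prod Z₂.I) (Z₁.I.prod Z₂.I) (regionMap A B K r) (f, w) (u, X)) := by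
  have hK : 0 < K := A.R₀_pos.trans hA
  have hw' : (f, w) ∈ (regionChartLeft hA hB hr hc).source := ⟨trivial, hw⟩
  refine levelMetric_sq_mfderiv hA hB hr
    (((regionChartLeft hA hB hr hc).contMDiffAt hw').mdifferentiableAt (by simp)) ?_ (u, X)
  filter_upwards [(regionChartLeft hA hB hr hc).open_source.mem_nhds hw'] with q hq
  have hq' : B.sigma K q.2 < c * r := hq.2
  exact expand_contract hA hB hr.le (sqRadius_regionMap A B hK hr.le (by nlinarith) hA q.1)

theorem sq_regionChartRight (f : F₂) {w : Z₁} (hw : A.sigma K w < c * r) (u : TangentSpace F₂.I f)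
    (X : TangentSpace Z₁.I w) :
    (levelMetric hA hB r hr).sq (regionChartRight hA hB hr hc (f, w))
      (mfderiv (F₂.I.prod Z₁.I) (levelMfd hA hB).I (regionChartRight hA hB hr hc) (f, w) (u, X)) =
    (r ^ 2)⁻¹ * (blend B A hB hA).sq (regionMap B A K r (f, w))
      (mfderiv (F₂.I.prod Z₁.I) (Z₂.I.prod Z₁.I) (regionMap B A K r) (f, w) (u, X)) := by
  have hK : 0 < K := A.R₀_pos.trans hA
  have hw' : (f, w) ∈ (regionChartRight hA hB hr hc).source := ⟨trivial, hw⟩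
  have hw₄ : A.sigma K w < 4 / 5 * r := by nlinarith
  have h := levelMetric_sq_mfderiv hA hB hr (G := fun q ↦ (regionMap B A K r q).swap)
    (((regionChartRight hA hB hr hc).contMDiffAt hw').mdifferentiableAt (by simp)) (by
      filter_upwards [(regionChartRight hA hB hr hc).open_source.mem_nhds hw'] with q hq
      have hq' : A.sigma K q.2 < c * r := hq.2
      exact expand_contract hA hB hr.le (by
        rw [sqRadius_swap, sqRadius_regionMap B A hK hr.le (by nlinarith) hB])) (u, X)
  have h1 := ((contMDiffAt_regionMap B A (r := fun _ ↦ r) (a := Prod.fst) (b := Prod.snd)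
      (J := F₂.I.prod Z₁.I) (x := (f, w)) hB hA hr.le hw₄
        contMDiffAt_const contMDiffAt_fst contMDiffAt_snd).mdifferentiableAt
          (by simp)).hasMFDerivAt
  have h2 : HasMFDerivAt (F₂.I.prod Z₁.I) (Z₁.I.prod Z₂.I)
      (fun q ↦ (regionMap B A K r q).swap) (f, w) _ :=
    ((hasMFDerivAt_snd (I := Z₂.I) (I' := Z₁.I) (regionMap B A K r (f, w))).comp (f, w) h1).prodMk
    ((hasMFDerivAt_fst (I := Z₂.I) (I' := Z₁.I) (regionMap B A K r (f, w))).comp (f, w) h1)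
  rw [h2.mfderiv] at h
  exact h.trans (congrArg ((r ^ 2)⁻¹ * ·) (blend_swap A B hA hB (regionMap B A K r (f, w)) _ _))

end

theorem _root_.Suspension.width_le : Suspension.width ≤ 4 / 5 := by
  nlinarith [Suspension.width_sq, Suspension.width_pos]

theorem _root_.Suspension.lt_width : 1 / 2 < Suspension.width := by
  nlinarith [Suspension.width_sq, Suspension.width_pos]

/-- Outside a tube the coordinate is at least width > 1/2, so r times it exceeds 5K and the wedge
condition is automatic. Hence the wedge is the domain which a blowup prescribes for the embedding of
the regular part. -/
theorem mem_wedge_iff {r : ℝ} (hK : 0 < K) (hr : 10 * K < r) (m : ℝ × (F₁ × F₂)) :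
    m ∈ wedge F₁ F₂ K r ↔ ∀ α, Suspension.rad α (Suspension.incl m) < Suspension.width →
      r⁻¹ * (2 * K) < Suspension.rad α (Suspension.incl m) := by
  have hr0 : 0 < r := by linarith
  have hw := Suspension.lt_width
  have key : ∀ x : ℝ, 2 * K < r * x ↔ (x < Suspension.width → r⁻¹ * (2 * K) < x) := by
    intro x
    rw [inv_mul_lt_iff₀ hr0]
    refine ⟨fun h _ ↦ h, fun h ↦ ?_⟩
    by_cases hx : x < Suspension.width
    · exact h hx
    · nlinarith [not_lt.1 hx]
  constructor
  · rintro ⟨h₁, h₂⟩ α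
    cases α
    · exact (key _).1 h₁
    · exact (key _).1 h₂
  · intro h
    exact ⟨(key _).2 (h false), (key _).2 (h true)⟩

/-- Since sin² + cos² = 1 = 2 width², only θ = π/4 lies outside both tubes. -/
theorem width_of_forall {m : ℝ × (F₁ × F₂)}
    (h : ∀ α, ¬ Suspension.rad α (Suspension.incl m) < Suspension.width) :
    Real.sin (susAngle m.1) = Suspension.width ∧ Real.cos (susAngle m.1) = Suspension.width := by
  have h₁ : Suspension.width ≤ Real.sin (susAngle m.1) := not_lt.1 (h true)
  have h₂ : Suspension.width ≤ Real.cos (susAngle m.1) := not_lt.1 (h false)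
  have h₃ := Real.sin_sq_add_cos_sq (susAngle m.1)
  have h₄ := Suspension.width_sq
  have h₅ := Suspension.width_pos
  constructor <;> nlinarith

/-- Where both radii are large, contracting dilates both and keeps θ and the links, so the result
does not depend on r. This is the ε-independence of the identification away from the tubes. -/
theorem contract_wedgeMap {r : ℝ} (hr : 10 * K < r) {m : ℝ × (F₁ × F₂)} (hm : m ∈ wedge F₁ F₂ K r)
    (h₁ : Real.cos (susAngle m.1) < 4 / 5) (h₂ : Real.sin (susAngle m.1) < 4 / 5) :
    contract hA hB r (wedgeMap A B r m) = toLevelMfd hA hB (wedgeMap A B (10 * K) m) := by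
  have hK : 0 < K := A.R₀_pos.trans hA
  have hr0 : 0 < r := by linarith
  have h := R₀_lt_of_mem_wedge A B hA hB hm
  have k₁ : A.sigma K (wedgeMap A B r m).1 = r * Real.cos (susAngle m.1) :=
    A.sigma_Φ hK hm.1.le hA _
  have k₂ : B.sigma K (wedgeMap A B r m).2 = r * Real.sin (susAngle m.1) :=
    B.sigma_Φ hK hm.2.le hB _
  have l₁ : A.link (wedgeMap A B r m).1 = m.2.1 := A.link_Φ h.1 _
  have l₂ : B.link (wedgeMap A B r m).2 = m.2.2 := B.link_Φ h.2 _
  rw [contract, transport_of_left A B (by rw [k₂]; nlinarith),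
    transport_overlap A B hA hB hr.le le_rfl (isChange_unstretch hK hr.le)
      (sqRadius_wedgeMap A B hA hB hm) (by rw [k₁]; nlinarith) (by rw [k₂]; nlinarith), k₁, k₂, l₁,
    l₂, wedgeMap]
  congr 4 <;> field_simp

/-- If the second radius is r sin θ, the first is r cos θ. This is the gluing of the fibres to the
wedge along s = ε ρ. -/
theorem regionMap_end {r ρ : ℝ} (hr : 0 < r) (hρ : 0 < ρ) (hρr : ρ < r) (hB2 : 2 * K ≤ ρ) (hB : B.R₀ < K)
    (f : F₁) (f' : F₂) :
    regionMap A B K r (f, B.Φ (ρ, f')) = wedgeMap A B r (logRad (r⁻¹ * ρ), f, f') := by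
  have hs : r⁻¹ * ρ ∈ Ioo (0 : ℝ) 1 :=
    ⟨by positivity, by rw [inv_mul_lt_iff₀ hr]; linarith⟩
  have hK := B.R₀_pos.trans hB
  rw [regionMap, wedgeMap]
  dsimp only
  rw [sin_susAngle_logRad hs, coradius, B.sigma_Φ hK hB2 hB, mul_inv_cancel_left₀ hr.ne',
    susAngle_logRad hs, Real.cos_arcsin]
  congr 3
  have : r ^ 2 - ρ ^ 2 = r ^ 2 * (1 - (r⁻¹ * ρ) ^ 2) := by field_simp
  rw [this, Real.sqrt_mul (sq_nonneg r), Real.sqrt_sq hr.le]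

theorem regionMap_end_swap {r ρ : ℝ} (hr : 0 < r) (hρ : 0 < ρ) (hρr : ρ < r) (hA2 : 2 * K ≤ ρ)
    (hA : A.R₀ < K) (f : F₂) (f' : F₁) :
    (regionMap B A K r (f, A.Φ (ρ, f'))).swap = wedgeMap A B r (-logRad (r⁻¹ * ρ), f', f) := by
  rw [regionMap_end (A := B) (B := A) hr hρ hρr hA2 hA f f', wedgeMap, wedgeMap]
  dsimp only
  rw [cos_susAngle_neg, sin_susAngle_neg]
  rfl

variable {C ν : ℝ} (SA : A.IsScale K C) (SB : B.IsScale K C)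

/-- Both factors have radius at least r x, and (r x)^(−ν) is the required (ε / x)^ν. Here x will be
the sine or the cosine of θ, whichever is smaller. -/
theorem abs_wedgeChart_sub_le (h₁ : ν ≤ ν₁) (h₂ : ν ≤ ν₂) (h0 : 0 ≤ ν) {r : ℝ} (hr : 10 * K < r)
    {m : ℝ × (F₁ × F₂)} (hm : m ∈ wedge F₁ F₂ K r) {x : ℝ} (hx : 0 < x)
    (hx1 : r⁻¹ * (2 * K) < x)
    (hxs : x ≤ Real.sin (susAngle m.1)) (hxc : x ≤ Real.cos (susAngle m.1))
    (v : TangentSpace (susReg F₁ F₂).I m) (SA : A.IsScale K C) (SB : B.IsScale K C) :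
    |(levelMetric hA hB r hr).sq (wedgeChart hA hB hr m)
      (mfderiv (susReg F₁ F₂).I (levelMfd hA hB).I (wedgeChart hA hB hr) m v) -
        (susMetric κ₁ κ₂).sq m v| ≤ C * (r⁻¹ / x) ^ ν * (susMetric κ₁ κ₂).sq m v := by
  have hK : 0 < K := A.R₀_pos.trans hA
  have h1K := SA.one_le
  have hr0 : 0 < r := by linarith
  have hR := R₀_lt_of_mem_wedge A B hA hB hm
  rw [inv_mul_lt_iff₀ hr0] at hx1
  rw [sq_wedgeChart hA hB hr hm]
  have hcone := coneForm_wedgeMap A B hR.1 hR.2 v.1 v.2.1 v.2.2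
  have hest := abs_blend_sub_coneSum_le A B (μ := r * x) hA hB SA SB h₁ h₂ h0
    (z := wedgeMap A B r m) (by linarith)
    ((mul_le_mul_of_nonneg_left hxc hr0.le).trans (A.rho_Φ hR.1 _).ge)
    ((mul_le_mul_of_nonneg_left hxs hr0.le).trans (B.rho_Φ hR.2 _).ge)
    (hR.1.trans_eq (A.rho_Φ hR.1 _).symm) (hR.2.trans_eq (B.rho_Φ hR.2 _).symm)
    (mfderiv (𝓘(ℝ, ℝ).prod (F₁.I.prod F₂.I)) (Z₁.I.prod Z₂.I) (wedgeMap A B r) m v)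
  have hcone' : coneSum A B (wedgeMap A B r m)
      (mfderiv (𝓘(ℝ, ℝ).prod (F₁.I.prod F₂.I)) (Z₁.I.prod Z₂.I) (wedgeMap A B r) m v)
      (mfderiv (𝓘(ℝ, ℝ).prod (F₁.I.prod F₂.I)) (Z₁.I.prod Z₂.I) (wedgeMap A B r) m v) =
    r ^ 2 * (susMetric κ₁ κ₂).sq m v := hcone
  rw [hcone'] at hest
  have e : ∀ y z : ℝ, (r ^ 2)⁻¹ * y - z = (r ^ 2)⁻¹ * (y - r ^ 2 * z) := by
    intro y z; field_simp
  have e2 : (r * x) ^ (-ν) = (r⁻¹ / x) ^ ν := by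
    rw [Real.rpow_neg (by positivity), ← Real.inv_rpow (by positivity)]
    congr 1; field_simp
  rw [e2] at hest
  rw [e, abs_mul, abs_of_nonneg (by positivity)]
  calc _ ≤ (r ^ 2)⁻¹ * (C * (r⁻¹ / x) ^ ν * (r ^ 2 * (susMetric κ₁ κ₂).sq m v)) :=
        mul_le_mul_of_nonneg_left hest (by positivity)
    _ = _ := by field_simp

/-- At θ = π/4 both radii are r/√2, the weight of the cone metrics is 1 because r² ≥ 17K², and the
sum of the cone metrics restricts to r² h₀. -/
theorem wedgeChart_sq_of_width {r : ℝ} (hr : 10 * K < r) {m : ℝ × (F₁ × F₂)}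
    (hs : Real.sin (susAngle m.1) = Suspension.width)
    (hc : Real.cos (susAngle m.1) = Suspension.width) (v : TangentSpace (susReg F₁ F₂).I m) :
    (levelMetric hA hB r hr).sq (wedgeChart hA hB hr m)
      (mfderiv (susReg F₁ F₂).I (levelMfd hA hB).I (wedgeChart hA hB hr) m v) =
        (susMetric κ₁ κ₂).sq m v := by
  have hK : 0 < K := A.R₀_pos.trans hA
  have hw := Suspension.lt_width
  have hr0 : 0 < r := by linarith
  have hm : m ∈ wedge F₁ F₂ K r := by
    constructor
    · rw [hc]; nlinarith
    · rw [hs]; nlinarith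
  have hR := R₀_lt_of_mem_wedge A B hA hB hm
  rw [sq_wedgeChart hA hB hr hm]
  have h1 : weight A B K (wedgeMap A B r m) = 1 := by
    have k₁ : A.sigma K (wedgeMap A B r m).1 = r * Real.cos (susAngle m.1) :=
      A.sigma_Φ hK hm.1.le hA _
    have k₂ : B.sigma K (wedgeMap A B r m).2 = r * Real.sin (susAngle m.1) :=
      B.sigma_Φ hK hm.2.le hB _
    rw [weight, k₁, k₂, hc, hs]
    refine coneWeight_self hK ?_
    rw [mul_pow, Suspension.width_sq]
    nlinarith
  have hcone : coneSum A B (wedgeMap A B r m)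
      (mfderiv (𝓘(ℝ, ℝ).prod (F₁.I.prod F₂.I)) (Z₁.I.prod Z₂.I) (wedgeMap A B r) m v)
      (mfderiv (𝓘(ℝ, ℝ).prod (F₁.I.prod F₂.I)) (Z₁.I.prod Z₂.I) (wedgeMap A B r) m v) =
    r ^ 2 * (susMetric κ₁ κ₂).sq m v := coneForm_wedgeMap A B hR.1 hR.2 v.1 v.2.1 v.2.2
  rw [blend_sq_of_weight_eq_one A B hA hB h1]
  refine (congrArg ((r ^ 2)⁻¹ * ·) hcone).trans ?_
  field_simp

end ACPair

/-! ### The level sets as a resolution blowup -/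

namespace ACPair

open Suspension (stratum stratumMetric width)

variable {Z₁ Z₂ F₁ F₂ : Mfd.{u}} {g₁ : Z₁.Metric} {g₂ : Z₂.Metric} {κ₁ : F₁.Metric}
  {κ₂ : F₂.Metric} {ν₁ ν₂ : ℝ} {A : ACStructure g₁ κ₁ ν₁} {B : ACStructure g₂ κ₂ ν₂} {K : ℝ}
  (hA : A.R₀ < K) (hB : B.R₀ < K)

/-- The asymptotically conic fibres. -/
noncomputable abbrev fibreAC (A : ACStructure g₁ κ₁ ν₁) (B : ACStructure g₂ κ₂ ν₂) {ν : ℝ}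
    (hA : A.R₀ < K) (hB : B.R₀ < K) (h1K : 1 ≤ K) (h0 : 0 < ν)
    (h₁ : ν ≤ ν₁) (h₂ : ν ≤ ν₂) :
    ∀ α, ACStructure (stratumMetric g₂ g₁ α) (stratumMetric κ₂ κ₁ α) ν
  | true => B.restrict (R := 2 * K) (by linarith) (by linarith) h0 h₂
  | false => A.restrict (R := 2 * K) (by linarith) (by linarith) h0 h₁

section
variable {r : ℝ} (hr : 10 * K < r)

/-- The charts of the fibre bundles. -/
noncomputable abbrev fibreChart : ∀ α, PartialDiffeomorph
    ((stratum F₁ F₂ α).I.prod (stratum Z₂ Z₁ α).I) (levelMfd hA hB).I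
    (stratum F₁ F₂ α × stratum Z₂ Z₁ α) (levelMfd hA hB) ∞
  | true => regionChartLeft hA hB hr Suspension.width_le
  | false => regionChartRight hA hB hr Suspension.width_le

theorem level_cover (y : levelMfd hA hB) : y ∈ (wedgeChart hA hB hr).target ∨
    ∃ α, y ∈ (fibreChart hA hB hr α).target := by
  have hK : 0 < K := A.R₀_pos.trans hA
  by_cases h₁ : B.sigma K (expand hA hB r y).2 < width * r
  · exact Or.inr ⟨true, h₁⟩
  by_cases h₂ : A.sigma K (expand hA hB r y).1 < width * r
  · exact Or.inr ⟨false, h₂⟩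
  have hw := Suspension.lt_width
  left
  refine ⟨(A.lt_rho_iff hK le_rfl).2 ?_, (B.lt_rho_iff hK le_rfl).2 ?_⟩ <;> nlinarith

theorem fibreChart_disjoint {α β : Bool} (h : α ≠ β) :
    Disjoint (fibreChart hA hB hr α).target (fibreChart hA hB hr β).target := by
  have hK : 0 < K := A.R₀_pos.trans hA
  have key : ∀ y : levelMfd hA hB, ¬(B.sigma K (expand hA hB r y).2 < width * r ∧
      A.sigma K (expand hA hB r y).1 < width * r) := by
    rintro y ⟨h₁, h₂⟩
    have h3 := sqRadius_expand hA hB hr.le y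
    rw [sqRadius] at h3
    have k₁ := A.le_sigma hK (z := (expand hA hB r y).1)
    have k₂ := B.le_sigma hK (z := (expand hA hB r y).2)
    have h4 := pow_lt_pow_left₀ h₁ (by linarith) two_ne_zero
    have h5 := pow_lt_pow_left₀ h₂ (by linarith) two_ne_zero
    rw [mul_pow, Suspension.width_sq] at h4 h5
    linarith
  refine Set.disjoint_left.2 fun y hy hy' ↦ ?_
  cases α <;> cases β
  · exact h rfl
  · exact key y ⟨hy', hy⟩
  · exact key y ⟨hy, hy'⟩
  · exact h rfl

theorem lt_rho_of_regionChartLeft (f : F₁) (w : Z₂) (hw : B.sigma K w < 4 / 5 * r)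
    (h : contract hA hB r (regionMap A B K r (f, w)) ∈ (wedgeChart hA hB hr).target) :
    2 * K < B.rho w := by
  have hK : 0 < K := A.R₀_pos.trans hA
  have h2 := h.2
  change 2 * K < B.rho (expand hA hB r (contract hA hB r (regionMap A B K r (f, w)))).2 at h2
  rw [expand_contract hA hB hr.le (sqRadius_regionMap A B hK hr.le hw hA f)] at h2
  exact h2

theorem lt_rho_of_regionChartRight (f : F₂) (w : Z₁) (hw : A.sigma K w < 4 / 5 * r)
    (h : contract hA hB r (regionMap B A K r (f, w)).swap ∈ (wedgeChart hA hB hr).target) :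
    2 * K < A.rho w := by
  have hK : 0 < K := A.R₀_pos.trans hA
  have h2 := h.1
  change 2 * K < A.rho (expand hA hB r (contract hA hB r (regionMap B A K r (f, w)).swap)).1 at h2
  rw [expand_contract hA hB hr.le (by
    rw [sqRadius_swap]
    exact sqRadius_regionMap B A hK hr.le hw hB f)] at h2
  exact h2

/-- As width · r > 5K lies beyond the smoothing zone, cutting a fibre by σ or by the radial function
of its restricted end is the same. -/
theorem sigma_lt_iff (hB : B.R₀ < K) (hr : 10 * K < r) (w : Z₂) :
    max (2 * K) (B.rho w) < width * r ↔ B.sigma K w < width * r := by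
  have hK : 0 < K := B.R₀_pos.trans hB
  have hw := Suspension.lt_width
  have h2 : 2 * K ≤ width * r := by nlinarith
  have h3 : 2 * K < width * r := by nlinarith
  rw [max_lt_iff, ← not_le, ← not_le, B.le_rho_iff hK h2, not_le, not_le]
  exact ⟨fun h ↦ h.2, fun h ↦ ⟨h3, h⟩⟩

end

theorem levelRadius_facts {ε : ℝ} (hε : ε ∈ Ioo 0 (10 * K)⁻¹) :
    ε = (levelRadius K ε)⁻¹ ∧ width / ε = width * levelRadius K ε := by
  rw [levelRadius_of_mem hε, inv_inv]
  exact ⟨rfl, div_eq_mul_inv _ _⟩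

variable {C ν : ℝ}

section
variable [CompactSpace F₁] [CompactSpace F₂] [Nonempty F₁] [Nonempty F₂]

/-- The level sets as a resolution blowup of the suspension. -/
noncomputable def levelBlowup (SA : A.IsScale K C) (SB : B.IsScale K C) (h0 : 0 < ν)
    (h1 : ν ≤ 1) (h₁ : ν ≤ ν₁) (h₂ : ν ≤ ν₂) :
    ResolutionBlowup (Suspension.edge κ₁ κ₂) (levelMfd hA hB) (levelFamily hA hB) ν where
  compact := compactSpace_levelMfd A B hA hB
  -- The parameters ε < 1/(10K) correspond to the levels r > 10K.
  ε₀ := (10 * K)⁻¹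
  ε₀_pos := by have := A.R₀_pos.trans hA; positivity
  smooth_family := contMDiffOn_levelFamily hA hB
  -- Over the stratum F₁ the cone on F₂ is replaced by Z₂, and over F₂ the cone on F₁ by Z₁.
  W := stratum Z₂ Z₁
  gW := stratumMetric g₂ g₁
  ac := fibreAC A B hA hB SA.one_le h0 h₁ h₂
  width_gt α := by
    have hK : 0 < K := A.R₀_pos.trans hA
    have hw := Suspension.lt_width
    have : (10 * K)⁻¹ * (2 * K) < width := by
      have : (10 * K)⁻¹ * (2 * K) = 1 / 5 := by field_simp; norm_num
      linarith
    cases α <;> exact this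
  J ε := wedgeChart hA hB (lt_levelRadius (A.R₀_pos.trans hA) ε)
  J_source ε hε := by
    have hK : 0 < K := A.R₀_pos.trans hA
    have hr := lt_levelRadius hK ε
    ext m
    refine (mem_wedge_iff hK hr m).trans ?_
    rw [← (levelRadius_facts hε).1]
    refine forall_congr' fun α ↦ ?_
    cases α <;> rfl
  T ε α _ := fibreChart hA hB (lt_levelRadius (A.R₀_pos.trans hA) ε) α
  T_source ε hε α _ := by
    have hK : 0 < K := A.R₀_pos.trans hA
    have hr := lt_levelRadius hK ε
    have h : width / ε = width * levelRadius K ε := (levelRadius_facts hε).2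
    cases α
    · ext ⟨f, w⟩
      change True ∧ A.sigma K w < width * levelRadius K ε ↔
        True ∧ (A.restrict (R := 2 * K) _ _ h0 h₁).rho w < width / ε
      rw [A.rho_restrict, h, sigma_lt_iff hA hr]
    · ext ⟨f, w⟩
      change True ∧ B.sigma K w < width * levelRadius K ε ↔
        True ∧ (B.restrict (R := 2 * K) _ _ h0 h₂).rho w < width / ε
      rw [B.rho_restrict, h, sigma_lt_iff hB hr]
  cover ε hε y := by
    rcases level_cover hA hB (lt_levelRadius (A.R₀_pos.trans hA) ε) y with h | ⟨α, h⟩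
    · exact Or.inl h
    · exact Or.inr ⟨α, PUnit.unit, h⟩
  gluing ε hε α _ x _ ρ hρ f := by
    have hK : 0 < K := A.R₀_pos.trans hA
    have hr := lt_levelRadius hK ε
    obtain ⟨e₁, e₂⟩ := levelRadius_facts hε
    have hlt : ρ < levelRadius K ε := by
      have h1 : ρ < width * levelRadius K ε := lt_of_lt_of_eq hρ.2 e₂
      nlinarith [Suspension.width_lt_one]
    cases α
    · have h1 : 2 * K < ρ := hρ.1
      have h := regionMap_end_swap (A := A) (B := B) (r := levelRadius K ε) (ρ := ρ) (by linarith)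
        (by linarith) hlt h1.le hA x f
      rw [← e₁] at h
      exact congrArg (contract hA hB (levelRadius K ε)) h
    · have h1 : 2 * K < ρ := hρ.1
      have h := regionMap_end (A := A) (B := B) (r := levelRadius K ε) (ρ := ρ) (by linarith)
        (by linarith) hlt h1.le hB x f
      rw [← e₁] at h
      exact congrArg (contract hA hB (levelRadius K ε)) h
  core_disjoint ε hε α _ p hp h := by
    have hK : 0 < K := A.R₀_pos.trans hA
    have hr := lt_levelRadius hK ε
    have hw' := Suspension.width_le
    cases α
    · have hw : A.sigma K p.2 < width * levelRadius K ε := hp.2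
      exact lt_rho_of_regionChartRight hA hB hr p.1 p.2 (by nlinarith) h
    · have hw : B.sigma K p.2 < width * levelRadius K ε := hp.2
      exact lt_rho_of_regionChartLeft hA hB hr p.1 p.2 (by nlinarith) h
  edge_disjoint ε hε α β _ _ h := fibreChart_disjoint hA hB _ h
  T_proj ε hε α _ _ p hp p' hp' h :=
    congrArg Prod.fst ((fibreChart hA hB (lt_levelRadius (A.R₀_pos.trans hA) ε) α).injOn hp hp' h)
  T_transition ε hε ε' hε' α _ _ x w w' h h' heq := by
    -- With a single trivialization per stratum, injectivity gives w = w', and nothing depends on ε.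
    have := (fibreChart hA hB (lt_levelRadius (A.R₀_pos.trans hA) ε) α).injOn h.1 h'.1 heq
    rw [this]
  J_const ε hε ε' hε' m hm := by
    have hK : 0 < K := A.R₀_pos.trans hA
    have hw := Suspension.lt_width
    have hw' := Suspension.width_sq
    obtain ⟨hs, hc⟩ := width_of_forall hm
    have key : ∀ ε, contract hA hB (levelRadius K ε) (wedgeMap A B (levelRadius K ε) m) =
        toLevelMfd hA hB (wedgeMap A B (10 * K) m) := by
      intro ε
      have hr := lt_levelRadius hK ε
      refine contract_wedgeMap hA hB hr ⟨?_, ?_⟩ ?_ ?_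
      · rw [hc]; nlinarith
      · rw [hs]; nlinarith
      · rw [hc]; nlinarith
      · rw [hs]; nlinarith
    exact (key ε).trans (key ε').symm
  metric_outer ε hε m hm v := by
    obtain ⟨hs, hc⟩ := width_of_forall hm
    exact wedgeChart_sq_of_width hA hB (lt_levelRadius (A.R₀_pos.trans hA) ε) hs hc v
  metric_tube α := by
    refine ⟨C, fun ε hε m hm hα v ↦ ?_⟩
    have hK : 0 < K := A.R₀_pos.trans hA
    have hr := lt_levelRadius hK ε
    have e₁ := (levelRadius_facts hε).1
    have hm' : m ∈ wedge F₁ F₂ K (levelRadius K ε) := hm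
    have hlt := (mem_wedge_iff hK hr m).1 hm' α hα
    have hw' := Suspension.width_sq
    have hsc := Real.sin_sq_add_cos_sq (susAngle m.1)
    have hs := sin_susAngle_pos m.1
    have hc := cos_susAngle_pos m.1
    cases α
    -- In this tube the distance cos θ to the stratum is the smaller of sine and cosine, so it
    -- bounds both radii from below.
    · have hα' : Real.cos (susAngle m.1) < width := hα
      have h := abs_wedgeChart_sub_le hA hB h₁ h₂ h0.le hr hm' hc hlt (by nlinarith) le_rfl v SA SB
      rw [← e₁] at h
      exact h
    · have hα' : Real.sin (susAngle m.1) < width := hα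
      have h := abs_wedgeChart_sub_le hA hB h₁ h₂ h0.le hr hm' hs hlt le_rfl (by nlinarith) v SA SB
      rw [← e₁] at h
      exact h
  metric_fibre α := by
    refine ⟨11 * C ^ 2, ν, h0, fun ε hε _ x _ w hw u v ↦ ?_⟩
    have hK : 0 < K := A.R₀_pos.trans hA
    have hr := lt_levelRadius hK ε
    obtain ⟨e₁, e₂⟩ := levelRadius_facts hε
    cases α
    · have e₃ : ((fibreAC A B hA hB SA.one_le h0 h₁ h₂) false).rho w = max (2 * K) (A.rho w) :=
        A.rho_restrict _ _ _ _ w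
      have hw' : A.sigma K w < width * levelRadius K ε :=
        (sigma_lt_iff hA hr w).1 (lt_of_lt_of_eq (lt_of_eq_of_lt e₃.symm hw) e₂)
      have h := abs_blend_regionMap_sub_le B A hB hA SB SA h0.le h1 h₂ hr x
        (w := w) (by nlinarith [Suspension.width_le]) u v
      rw [← sq_regionChartRight hA hB hr Suspension.width_le x hw' u v, ← e₁] at h
      exact h.trans_eq (congrArg (fun q : ℝ ↦ 11 * C ^ 2 * (ε * q) ^ ν * _) e₃.symm)
    · have e₃ : ((fibreAC A B hA hB SA.one_le h0 h₁ h₂) true).rho w = max (2 * K) (B.rho w) :=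
        B.rho_restrict _ _ _ _ w
      have hw' : B.sigma K w < width * levelRadius K ε :=
        (sigma_lt_iff hB hr w).1 (lt_of_lt_of_eq (lt_of_eq_of_lt e₃.symm hw) e₂)
      have h := abs_blend_regionMap_sub_le A B hA hB SA SB h0.le h1 h₁ hr x
        (w := w) (by nlinarith [Suspension.width_le]) u v
      rw [← sq_regionChartLeft hA hB hr Suspension.width_le x hw' u v, ← e₁] at h
      exact h.trans_eq (congrArg (fun q : ℝ ↦ 11 * C ^ 2 * (ε * q) ^ ν * _) e₃.symm)

end

end ACPair

/-! ### Comparison of the product metric with dr² + r² h -/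

/-- Polarization: the hypothesis for tU + X and tU − X also bounds the mixed terms b(U, X) − c(U,
X). As b(X, X) is kept exact, the error carries the factor φ; this factor later compensates weak
decay at small radii. -/
theorem abs_form_add_sub_le {E : Type*} [NormedAddCommGroup E] [NormedSpace ℝ E]
    {b c : E →L[ℝ] E →L[ℝ] ℝ} (hb : ∀ X Y, b X Y = b Y X) (hc : ∀ X Y, c X Y = c Y X) {μ φ : ℝ}
    (h : ∀ X, |b X X - c X X| ≤ μ * c X X) (h0 : 0 ≤ φ) (h1 : φ ≤ 1) (t : ℝ) (U X : E) :
    |b (t • φ • U + X) (t • φ • U + X) - b X X - (t ^ 2 * φ ^ 2 * c U U + 2 * t * φ * c U X)| ≤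
      μ * φ * (2 * t ^ 2 * c U U + c X X) := by
  have e₁ := h U
  have e₂ := h (t • U + X)
  have e₃ := h (t • U - X)
  simp only [map_add, map_sub, map_smul, add_apply,
    sub_apply, smul_apply, smul_eq_mul, hb X U, hc X U]
    at e₂ e₃ ⊢
  have k₂ : |t ^ 2 * (b U U - c U U) + 2 * (t * (b U X - c U X)) + (b X X - c X X)| ≤
      μ * (t ^ 2 * c U U + 2 * (t * c U X) + c X X) := by
    refine le_of_eq_of_le ?_ (e₂.trans_eq ?_) <;> ring_nf
  have k₃ : |t ^ 2 * (b U U - c U U) - 2 * (t * (b U X - c U X)) + (b X X - c X X)| ≤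
      μ * (t ^ 2 * c U U - 2 * (t * c U X) + c X X) := by
    refine le_of_eq_of_le ?_ (e₃.trans_eq ?_) <;> ring_nf
  have k₄ : |2 * (t * (b U X - c U X))| ≤ μ * (t ^ 2 * c U U + c X X) := by
    rw [abs_le] at k₂ k₃ ⊢
    constructor <;> linarith
  have k₅ : |t ^ 2 * φ * (b U U - c U U)| ≤ μ * (t ^ 2 * c U U) := by
    rw [abs_mul, abs_of_nonneg (by positivity)]
    have : t ^ 2 * φ * |b U U - c U U| ≤ t ^ 2 * 1 * (μ * c U U) := by
      have := abs_nonneg (b U U - c U U)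
      gcongr
    linarith
  calc _ = φ * |t ^ 2 * φ * (b U U - c U U) + 2 * (t * (b U X - c U X))| := by
        rw [← abs_of_nonneg h0, ← abs_mul, abs_of_nonneg h0]; congr 1; ring
    _ ≤ φ * (|t ^ 2 * φ * (b U U - c U U)| + |2 * (t * (b U X - c U X))|) := by
        gcongr; exact abs_add_le _ _
    _ ≤ φ * (μ * (t ^ 2 * c U U) + μ * (t ^ 2 * c U U + c X X)) := by gcongr
    _ = _ := by ring

theorem rpow_neg_le_two_mul {r x ν ν' : ℝ} (hr : 0 < r) (hx : r ≤ 2 * x) (hx1 : 1 ≤ x) (h0 : 0 ≤ ν) (h1 : ν ≤ 1)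
    (h : ν ≤ ν') : x ^ (-ν') ≤ 2 * r ^ (-ν) := by
  calc x ^ (-ν') ≤ x ^ (-ν) := Real.rpow_le_rpow_of_exponent_le hx1 (by linarith)
    _ ≤ (r / 2) ^ (-ν) := Real.rpow_le_rpow_of_nonpos (by positivity) (by linarith) (by linarith)
    _ = 2 ^ ν * r ^ (-ν) := by
      rw [Real.div_rpow hr.le two_pos.le, Real.rpow_neg two_pos.le, div_inv_eq_mul, mul_comm]
    _ ≤ 2 ^ (1 : ℝ) * r ^ (-ν) := mul_le_mul_of_nonneg_right
      (Real.rpow_le_rpow_of_exponent_le one_le_two h1) (by positivity)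
    _ = _ := by rw [Real.rpow_one]

/-- An offset E ≤ 3K contributes terms of size E r / ρ² ≤ 25K / (3r), and 1/r ≤ e. This is the error
caused by the non-conic change of radii near the cores, and it allows no rate better than 1. -/
theorem offset_estimate {K C r ρ e t x c G E : ℝ} (hK : 0 ≤ K) (hC : 1 ≤ C) (hr : 0 < r)
    (hρ : 0 < ρ) (hρr : 9 * r ^ 2 ≤ 25 * ρ ^ 2) (he : 1 ≤ r * e) (he0 : 0 ≤ e) (hE0 : 0 ≤ E)
    (hE : E ≤ 3 * K) (hEr : E ≤ r) (hc : 0 ≤ c) (hG : 0 ≤ G) (hx : x ^ 2 ≤ C * G) :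
    |t ^ 2 * (E * E / ρ ^ 2) - 2 * t * x * (E * r / ρ ^ 2)| ≤
      18 * (K * C) * e * (t ^ 2 + (c + G)) := by
  have hEρ : E * r / ρ ^ 2 ≤ 9 * K * e := by
    rw [div_le_iff₀ (by positivity)]
    have h1 : E * r ≤ 3 * K * r := mul_le_mul_of_nonneg_right hE hr.le
    have h2 : 3 * K * r * 1 ≤ 3 * K * r * (r * e) := mul_le_mul_of_nonneg_left he (by positivity)
    have h3 : K * e * (9 * r ^ 2) ≤ K * e * (25 * ρ ^ 2) :=
      mul_le_mul_of_nonneg_left hρr (by positivity)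
    have h4 : 0 ≤ K * e * ρ ^ 2 := by positivity
    linarith
  have hEE : E * E / ρ ^ 2 ≤ 9 * K * e := by
    refine le_trans ?_ hEρ
    gcongr
  have h0 := sq_nonneg t
  have h1 : |2 * t * x| ≤ t ^ 2 + C * G := by
    rw [abs_le]; constructor <;> nlinarith [sq_nonneg (t + x), sq_nonneg (t - x)]
  have h3 : 0 ≤ E * r / ρ ^ 2 := by positivity
  have h4 : |2 * t * x * (E * r / ρ ^ 2)| ≤ (t ^ 2 + C * G) * (9 * K * e) := by
    rw [abs_mul, abs_of_nonneg h3]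
    exact mul_le_mul h1 hEρ h3 (by positivity)
  have h5 : |t ^ 2 * (E * E / ρ ^ 2)| ≤ t ^ 2 * (9 * K * e) := by
    rw [abs_of_nonneg (by positivity)]
    exact mul_le_mul_of_nonneg_left hEE h0
  have l₁ : C * c ≥ 0 := by positivity
  have l₂ : 0 ≤ (C - 1) * t ^ 2 := mul_nonneg (by linarith) h0
  have l₃ : 0 ≤ C * G := by positivity
  have h6 : t ^ 2 ≤ C * (t ^ 2 + (c + G)) := by linarith
  have h7 : t ^ 2 + C * G ≤ C * (t ^ 2 + (c + G)) := by linarith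
  have h8 : 0 ≤ 9 * K * e := by positivity
  calc _ ≤ _ := abs_sub _ _
    _ ≤ t ^ 2 * (9 * K * e) + (t ^ 2 + C * G) * (9 * K * e) := add_le_add h5 h4
    _ ≤ C * (t ^ 2 + (c + G)) * (9 * K * e) + C * (t ^ 2 + (c + G)) * (9 * K * e) := by gcongr
    _ = _ := by ring

theorem sq_radial_rate_le {r s ρ φ : ℝ} (hr : 0 < r) (hs : 0 ≤ s) (hρ : 0 < ρ)
    (hρ2 : ρ ^ 2 = r ^ 2 - s ^ 2) (hρr : 9 * r ^ 2 ≤ 25 * ρ ^ 2) (hφ : 0 ≤ φ) (hE0 : r * φ ≤ s) :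
    ((r - s * φ) / ρ) ^ 2 ≤ 25 / 9 := by
  have h0 : s ≤ r := abs_le_of_sq_le_sq' (by linarith [sq_nonneg ρ]) hr.le |>.2
  have h1 : s * φ ≤ r := by
    have h2 : r * (s * φ) ≤ r * r := by
      calc r * (s * φ) = s * (r * φ) := by ring
        _ ≤ s * s := by gcongr
        _ ≤ r * r := by gcongr
    exact le_of_mul_le_mul_left h2 hr
  have h2 : 0 ≤ s * φ := by positivity
  rw [div_pow, div_le_iff₀ (by positivity)]
  have := pow_le_pow_left₀ (by linarith : 0 ≤ r - s * φ) (by linarith : r - s * φ ≤ r) 2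
  linarith

/-- If the offset s − rφ vanished, the velocity ((r − sφ)/ρ, φ) would be the unit vector (ρ, s)/r,
orthogonal to the tangent vectors of the level set. `i₁` and `i₂` compute the defects of length and
of orthogonality in terms of the offset; `ha` is tangency. -/
theorem flow_identity {r s ρ φ t x a q G : ℝ} (hρ : 0 < ρ) (hρ2 : ρ ^ 2 = r ^ 2 - s ^ 2)
    (ha : ρ * a + s * x = 0) :
    (t * ((r - s * φ) / ρ) + a) ^ 2 + q + (t ^ 2 * φ ^ 2 + 2 * t * φ * x + G) =
      t ^ 2 + (a ^ 2 + q + G) + (t ^ 2 * ((s - r * φ) * (s - r * φ) / ρ ^ 2) -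
        2 * t * x * ((s - r * φ) * r / ρ ^ 2)) := by
  have ha' : a = -(s * x) / ρ := by rw [eq_div_iff hρ.ne']; linarith
  have i₁ : ((r - s * φ) / ρ) ^ 2 + φ ^ 2 = 1 + (s - r * φ) * (s - r * φ) / ρ ^ 2 := by
    field_simp
    rw [hρ2]; ring
  have i₂ : (r - s * φ) / ρ * a + φ * x = - x * ((s - r * φ) * r / ρ ^ 2) := by
    rw [ha']
    field_simp
    rw [hρ2]; ring
  linear_combination t ^ 2 * i₁ + 2 * t * i₂

/-- The four errors are those of the first metric, of the second metric, of the offset, and of b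
against the cone metric of the first factor plus G. Relative to M they are 12, 2, 18 and 4 times K C
e, and M ≤ 2(t² + b) doubles their sum 36. -/
theorem flow_estimate {K C r s ρ φ e t x a q G b G₁ G₂ : ℝ} (hK : 1 ≤ K) (hC : 1 ≤ C)
    (hr : 0 < r) (hs : 0 ≤ s) (hρ : 0 < ρ) (hρ2 : ρ ^ 2 = r ^ 2 - s ^ 2)
    (hρr : 9 * r ^ 2 ≤ 25 * ρ ^ 2) (he : 1 ≤ r * e) (hφ : 0 ≤ φ) (hE0 : r * φ ≤ s)
    (hE : s - r * φ ≤ 3 * K) (hq : 0 ≤ q) (hG : 0 ≤ G) (hx : x ^ 2 ≤ C * G)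
    (ha : ρ * a + s * x = 0)
    (hG₁ : |G₁ - ((t * ((r - s * φ) / ρ) + a) ^ 2 + q)| ≤
      2 * C * e * ((t * ((r - s * φ) / ρ) + a) ^ 2 + q))
    (hG₂ : |G₂ - (t ^ 2 * φ ^ 2 + 2 * t * φ * x + G)| ≤ C * e * (2 * t ^ 2 + 2 * G))
    (hb : |b - (a ^ 2 + q + G)| ≤ 4 * C * e * (a ^ 2 + q + G))
    (hb2 : a ^ 2 + q + G ≤ 2 * b) :
    |G₁ + G₂ - (t ^ 2 + b)| ≤ 72 * (K * C) * e * (t ^ 2 + b) := by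
  have he0 : 0 < e := pos_of_mul_pos_right (lt_of_lt_of_le one_pos he) hr.le
  have ht2 := sq_nonneg t
  have ha2 := sq_nonneg a
  have hsr : s ≤ r := abs_le_of_sq_le_sq' (by linarith [sq_nonneg ρ]) hr.le |>.2
  have k₁ := sq_radial_rate_le hr hs hρ hρ2 hρr hφ hE0
  have T₃ := offset_estimate (t := t) (c := a ^ 2 + q) (by linarith) hC hr hρ hρr he he0.le
    (by linarith) hE (by linarith [mul_nonneg hr.le hφ]) (by positivity) hG hx
  have hid := flow_identity (t := t) (q := q) (G := G) (φ := φ) hρ hρ2 ha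
  generalize (r - s * φ) / ρ = n at *
  generalize t ^ 2 * ((s - r * φ) * (s - r * φ) / ρ ^ 2) -
    2 * t * x * ((s - r * φ) * r / ρ ^ 2) = P at *
  have hc1 : (t * n + a) ^ 2 + q ≤ 6 * (t ^ 2 + (a ^ 2 + q + G)) := by
    nlinarith [sq_nonneg (t * n - a), mul_le_mul_of_nonneg_left k₁ ht2]
  have T₁ : |G₁ - ((t * n + a) ^ 2 + q)| ≤ 12 * C * e * (t ^ 2 + (a ^ 2 + q + G)) := by
    refine hG₁.trans ?_
    have := mul_le_mul_of_nonneg_left hc1 (by positivity : 0 ≤ 2 * C * e)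
    linarith
  have T₂ : |G₂ - (t ^ 2 * φ ^ 2 + 2 * t * φ * x + G)| ≤
      2 * C * e * (t ^ 2 + (a ^ 2 + q + G)) := by
    refine hG₂.trans ?_
    have := mul_nonneg (by positivity : 0 ≤ 2 * C * e) (by positivity : 0 ≤ a ^ 2 + q)
    linarith
  have T₄ : |b - (a ^ 2 + q + G)| ≤ 4 * C * e * (t ^ 2 + (a ^ 2 + q + G)) := by
    refine hb.trans ?_
    have := mul_nonneg (by positivity : 0 ≤ 4 * C * e) ht2
    linarith
  have hM2 : t ^ 2 + (a ^ 2 + q + G) ≤ 2 * (t ^ 2 + b) := by linarith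
  have heM : 0 ≤ e * (t ^ 2 + (a ^ 2 + q + G)) := by positivity
  obtain ⟨M, hM⟩ : ∃ M, t ^ 2 + (a ^ 2 + q + G) = M := ⟨_, rfl⟩
  rw [hM] at hid T₁ T₂ T₃ T₄ hM2 heM
  have hKC : C * (e * M) ≤ K * C * (e * M) := by
    have := mul_nonneg (by positivity : 0 ≤ C) heM
    nlinarith
  calc _ = |(G₁ - ((t * n + a) ^ 2 + q)) + (G₂ - (t ^ 2 * φ ^ 2 + 2 * t * φ * x + G)) +
        P - (b - (a ^ 2 + q + G))| := by
        congr 1; linear_combination hid - hM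
    _ ≤ 12 * C * e * M + 2 * C * e * M + 18 * (K * C) * e * M + 4 * C * e * M := by
        refine (abs_sub _ _).trans (add_le_add ((abs_add_three _ _ _).trans ?_) T₄)
        exact add_le_add (add_le_add T₁ T₂) T₃
    _ ≤ 36 * (K * C) * e * M := by linarith
    _ ≤ _ := by
        have := mul_le_mul_of_nonneg_left hM2 (by positivity : 0 ≤ 36 * (K * C) * e)
        linarith

namespace ACStructure

variable {Z F : Mfd.{u}} {g : Z.Metric} {κ : F.Metric} {ν : ℝ} (A : ACStructure g κ ν)

theorem eq_of_radial_of_angular {z : Z} (hz : A.R₀ < A.rho z) {X Y : TangentSpace Z.I z}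
    (h₁ : A.radial z X = A.radial z Y) (h₂ : A.angular z X = A.angular z Y) : X = Y := by
  rw [← A.mfderiv_Φ_radial_angular hz X, ← A.mfderiv_Φ_radial_angular hz Y, h₁, h₂]

theorem exists_radial_field {z : Z} (hz : A.R₀ < A.rho z) :
    ∃ U : TangentSpace Z.I z, A.radial z U = 1 ∧ A.angular z U = 0 := by
  obtain ⟨r, f, hr, rfl⟩ : ∃ r f, A.R₀ < r ∧ A.Φ (r, f) = z := ⟨_, _, hz, A.Φ_rho_link hz⟩
  exact ⟨_, A.radial_mfderiv_Φ hr f 1 0, A.angular_mfderiv_Φ hr f 1 0⟩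

theorem radial_add (z : Z) (X Y : TangentSpace Z.I z) :
    A.radial z (X + Y) = A.radial z X + A.radial z Y := by
  rw [radial, map_add]; rfl

theorem radial_smul (z : Z) (t : ℝ) (X : TangentSpace Z.I z) :
    A.radial z (t • X) = t * A.radial z X := by
  rw [radial, map_smul]; rfl

theorem angular_add (z : Z) (X Y : TangentSpace Z.I z) :
    A.angular z (X + Y) = A.angular z X + A.angular z Y := by
  rw [angular, map_add]; rfl

theorem angular_smul (z : Z) (t : ℝ) (X : TangentSpace Z.I z) :
    A.angular z (t • X) = t • A.angular z X := by
  rw [angular, map_smul]; rfl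

/-- N is φ times the unit radial field U of the cone, whose cone product with X is the radial
component of X. So `abs_form_add_sub_le` applies with b = g and c the cone metric. -/
theorem abs_sq_radial_add_sub_le {μ φ : ℝ} {z : Z} (hz : A.R₀ < A.rho z)
    (h : ∀ X, |g.sq z X - A.coneForm z X X| ≤ μ * A.coneForm z X X) (h0 : 0 ≤ φ) (h1 : φ ≤ 1)
    (t : ℝ) (N X : TangentSpace Z.I z) (hN : A.radial z N = φ) (hN' : A.angular z N = 0) :
    |g.sq z (t • N + X) - (t ^ 2 * φ ^ 2 + 2 * t * φ * A.radial z X + g.sq z X)| ≤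
      μ * φ * (2 * t ^ 2 + A.coneForm z X X) := by
  obtain ⟨U, hU, hU'⟩ := A.exists_radial_field hz
  have hNU : N = φ • U := A.eq_of_radial_of_angular hz (by rw [hN, A.radial_smul, hU, mul_one])
    (by rw [hN', A.angular_smul, hU', smul_zero])
  have e₁ : A.coneForm z U U = 1 := by
    rw [A.coneForm_apply, hU, hU', map_zero, mul_zero]; norm_num
  have e₂ : A.coneForm z U X = A.radial z X := by
    rw [A.coneForm_apply, hU, hU', map_zero, zero_apply]; ring
  have key : |g.inner z (t • φ • U + X) (t • φ • U + X) - g.inner z X X -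
      (t ^ 2 * φ ^ 2 * A.coneForm z U U + 2 * t * φ * A.coneForm z U X)| ≤
      μ * φ * (2 * t ^ 2 * A.coneForm z U U + A.coneForm z X X) := abs_form_add_sub_le (E := Z.E) (b := g.inner z) (c := A.coneForm z) (g.symm z)
    (A.coneForm_symm z) h h0 h1 t U X
  rw [e₁, e₂] at key
  subst hNU
  refine le_of_eq_of_le ?_ (key.trans_eq ?_)
  · congr 1
    change _ = g.sq z (t • φ • U + X) - g.sq z X - _
    ring
  · ring

end ACStructure

namespace ACPair

variable {Z₁ Z₂ F₁ F₂ : Mfd.{u}} {g₁ : Z₁.Metric} {g₂ : Z₂.Metric} {κ₁ : F₁.Metric}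
  {κ₂ : F₂.Metric} {ν₁ ν₂ : ℝ} {A : ACStructure g₁ κ₁ ν₁} {B : ACStructure g₂ κ₂ ν₂} {K : ℝ}
  (hA : A.R₀ < K) (hB : B.R₀ < K)

/-- The product metric and the model metric on a level set agree up to lower order terms, for the
velocity `(N₁, N₂)` of the flow transversal to the level sets. -/
theorem abs_prod_sub_blend_le {C ν r t φ : ℝ} {z : Z₁ × Z₂} (SA : A.IsScale K C)
    (SB : B.IsScale K C) (h0 : 0 ≤ ν) (h1 : ν ≤ 1) (h₁ : ν ≤ ν₁) (h₂ : ν ≤ ν₂) (hr : 10 * K < r)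
    (hz : sqRadius A B K z = r ^ 2) (hw : B.sigma K z.2 < 4 / 5 * r)
    (N₁ V₁ : TangentSpace Z₁.I z.1) (N₂ V₂ : TangentSpace Z₂.I z.2)
    (hN₁ : A.radial z.1 N₁ = (r - B.sigma K z.2 * φ) / A.sigma K z.1)
    (hN₁' : A.angular z.1 N₁ = 0)
    (hN₂ : (2 * K < B.rho z.2 ∧ B.radial z.2 N₂ = φ ∧ B.angular z.2 N₂ = 0) ∨ (N₂ = 0 ∧ φ = 0))
    (hφ : 0 ≤ φ) (hE0 : r * φ ≤ B.sigma K z.2) (hE : B.sigma K z.2 - r * φ ≤ 3 * K)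
    (hV : A.sigma K z.1 * A.dsigma K z.1 V₁ + B.sigma K z.2 * B.dsigma K z.2 V₂ = 0) :
    |g₁.sq z.1 (t • N₁ + V₁) + g₂.sq z.2 (t • N₂ + V₂) - (t ^ 2 + (blend A B hA hB).sq z (V₁, V₂))|
      ≤ 72 * (K * C) * r ^ (-ν) * (t ^ 2 + (blend A B hA hB).sq z (V₁, V₂)) := by
  have hK : 0 < K := A.R₀_pos.trans hA
  have h1K := SA.one_le
  have hC := SA.C_ge
  have hr0 : 0 < r := by linarith
  have hσ := B.le_sigma hK (z := z.2)
  have hσ₁ := A.le_sigma hK (z := z.1)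
  have hρ2 : A.sigma K z.1 ^ 2 = r ^ 2 - B.sigma K z.2 ^ 2 := by
    rw [← hz, sqRadius]; ring
  have hρr : 9 * r ^ 2 ≤ 25 * A.sigma K z.1 ^ 2 := by nlinarith
  have hρ3 : 3 * r ≤ 5 * A.sigma K z.1 := by nlinarith
  have hρ₁ : A.rho z.1 = A.sigma K z.1 := A.rho_eq_sigma hK (by linarith)
  have hR₁ : A.R₀ < A.rho z.1 := by linarith
  -- Uses ν ≤ 1: errors of size 1/r are at most r^(−ν).
  have he : 1 ≤ r * r ^ (-ν) := by
    rw [mul_comm, ← Real.rpow_add_one hr0.ne']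
    exact Real.one_le_rpow (by linarith) (by linarith)
  have he0 : 0 < r ^ (-ν) := by positivity
  have hg₁ : ∀ X, |g₁.sq z.1 X - A.coneForm z.1 X X| ≤
      2 * C * r ^ (-ν) * A.coneForm z.1 X X := by
    intro X
    refine (SA.decay z.1 hR₁ X).trans (mul_le_mul_of_nonneg_right ?_ (A.coneForm_nonneg _ _))
    have := rpow_neg_le_two_mul (x := A.rho z.1) hr0 (by linarith) (by linarith) h0 h1 h₁
    nlinarith
  have hcone₁ : ∀ X, A.coneForm z.1 X X = A.radial z.1 X ^ 2 +
      A.rho z.1 ^ 2 * κ₁.sq (A.link z.1) (A.angular z.1 X) := by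
    intro X; rw [A.coneForm_apply, ← sq]; rfl
  have hφ1 : φ ≤ 1 := by
    have : r * φ ≤ r * 1 := by linarith
    exact le_of_mul_le_mul_left this hr0
  have hG := g₂.sq_nonneg z.2 V₂
  have c₁ := A.coneForm_nonneg z.1 V₁
  have c₂ := B.coneForm_nonneg z.2 V₂
  have hhalf : K ≤ B.rho z.2 → B.coneForm z.2 V₂ V₂ ≤ 2 * g₂.sq z.2 V₂ ∧
      2 * g₂.sq z.2 V₂ ≤ 3 * B.coneForm z.2 V₂ V₂ := by
    intro h
    have := abs_le.1 (SB.half z.2 h V₂)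
    constructor <;> linarith [this.1, this.2]
  have hhalf₁ := abs_le.1 (SA.half z.1 (by linarith) V₁)
  have hV₁ : A.dsigma K z.1 V₁ = A.radial z.1 V₁ := A.dsigma_of_ge hA (by linarith) V₁
  rw [hV₁] at hV
  have hχ0 := weight_nonneg A B (K := K) z
  have hχ1 := weight_le_one A B (K := K) z
  have hχ : weight A B K z ≠ 0 → r ≤ 2 * B.sigma K z.2 ∧ 2 * K < B.rho z.2 := by
    intro h
    have k₁ := coneWeight_ne_zero h
    have k₂ := (weight_ne_zero A B hK h).2
    refine ⟨?_, k₂⟩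
    rw [hρ2] at k₁
    nlinarith [k₁.2.2]
  have hbl := blend_sq A B hA hB z V₁ V₂
  have hsum : A.radial z.1 V₁ ^ 2 + A.rho z.1 ^ 2 * κ₁.sq (A.link z.1) (A.angular z.1 V₁) +
      g₂.sq z.2 V₂ = A.coneForm z.1 V₁ V₁ + g₂.sq z.2 V₂ := by rw [hcone₁]
  refine flow_estimate (C := C) (K := K) (r := r) (s := B.sigma K z.2) (ρ := A.sigma K z.1)
    (φ := φ) (x := B.dsigma K z.2 V₂) (a := A.radial z.1 V₁)
    (q := A.rho z.1 ^ 2 * κ₁.sq (A.link z.1) (A.angular z.1 V₁)) (G := g₂.sq z.2 V₂)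
    h1K hC hr0 (by linarith) (by linarith) hρ2 hρr he hφ hE0 hE
    (mul_nonneg (sq_nonneg _) (κ₁.sq_nonneg _ _)) hG (SB.dsigma_sq_le _ _) hV ?_ ?_ ?_ ?_
  · have h := hg₁ (t • N₁ + V₁)
    rw [hcone₁, A.radial_add, A.radial_smul, A.angular_add, A.angular_smul, hN₁, hN₁', smul_zero,
      zero_add] at h
    exact h
  · rcases hN₂ with ⟨h2K, hN, hN'⟩ | ⟨hN, hφ0⟩
    · have hR₂ : B.R₀ < B.rho z.2 := by linarith
      have h := B.abs_sq_radial_add_sub_le hR₂ (SB.decay z.2 hR₂) hφ hφ1 t N₂ V₂ hN hN'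
      have hσρ : B.sigma K z.2 = B.rho z.2 := B.sigma_of_ge hK h2K.le
      rw [B.dsigma_of_ge hB (hσρ ▸ h2K.le)]
      -- The second radius may be small compared to r, but φ ≤ ρ₂/r, and ρ₂^(−ν) ρ₂/r ≤ r^(−ν)
      -- because ρ₂ ≤ r and ν ≤ 1.
      have hμ : B.rho z.2 ^ (-ν₂) * φ ≤ r ^ (-ν) := by
        have e₁ : B.rho z.2 ^ (-ν₂) ≤ B.rho z.2 ^ (-ν) :=
          Real.rpow_le_rpow_of_exponent_le (by linarith) (by linarith)
        have e₂ : r * φ ≤ B.rho z.2 := hσρ ▸ hE0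
        have e₃ : B.rho z.2 ^ (-ν) * B.rho z.2 ≤ r ^ (-ν) * r := by
          rw [← Real.rpow_add_one (by linarith), ← Real.rpow_add_one (by linarith)]
          exact Real.rpow_le_rpow (by linarith) (by linarith) (by linarith)
        have e₄ : r * (B.rho z.2 ^ (-ν₂) * φ) ≤ r * r ^ (-ν) := by
          calc r * (B.rho z.2 ^ (-ν₂) * φ) = B.rho z.2 ^ (-ν₂) * (r * φ) := by ring
            _ ≤ B.rho z.2 ^ (-ν) * B.rho z.2 := by
              have := B.rho_pos z.2
              gcongr
            _ ≤ r * r ^ (-ν) := by linarith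
        exact le_of_mul_le_mul_left e₄ hr0
      refine h.trans ?_
      have k₁ := (hhalf (by linarith)).1
      calc C * B.rho z.2 ^ (-ν₂) * φ * (2 * t ^ 2 + B.coneForm z.2 V₂ V₂)
          = C * (B.rho z.2 ^ (-ν₂) * φ) * (2 * t ^ 2 + B.coneForm z.2 V₂ V₂) := by ring
        _ ≤ C * r ^ (-ν) * (2 * t ^ 2 + 2 * g₂.sq z.2 V₂) := by gcongr
    · rw [hN, hφ0, smul_zero, zero_add]
      have : g₂.sq z.2 V₂ - (t ^ 2 * 0 ^ 2 + 2 * t * 0 * B.dsigma K z.2 V₂ + g₂.sq z.2 V₂) = 0 := by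
        ring
      rw [this, abs_zero]
      positivity
  · rw [hsum, hbl]
    have d₁ := hg₁ V₁
    -- Where the weight does not vanish, the second radius is at least r/2, so its decay is of order
    -- r^(−ν).
    have d₂ : weight A B K z * |B.coneForm z.2 V₂ V₂ - g₂.sq z.2 V₂| ≤
        4 * C * r ^ (-ν) * g₂.sq z.2 V₂ := by
      by_cases h : weight A B K z = 0
      · rw [h, zero_mul]; positivity
      · obtain ⟨k₁, k₂⟩ := hχ h
        have k₃ : B.rho z.2 = B.sigma K z.2 := (B.sigma_of_ge hK k₂.le).symm
        have k₄ := SB.decay z.2 (by linarith) V₂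
        have k₅ := rpow_neg_le_two_mul (x := B.rho z.2) hr0 (by linarith) (by linarith) h0 h1 h₂
        have k₆ := (hhalf (by linarith)).1
        rw [abs_sub_comm]
        calc _ ≤ 1 * |g₂.sq z.2 V₂ - B.coneForm z.2 V₂ V₂| :=
              mul_le_mul_of_nonneg_right hχ1 (abs_nonneg _)
          _ ≤ C * (2 * r ^ (-ν)) * (2 * g₂.sq z.2 V₂) := by
              rw [one_mul]
              refine k₄.trans ?_
              gcongr
          _ = _ := by ring
    calc _ = |(1 - weight A B K z) * (g₁.sq z.1 V₁ - A.coneForm z.1 V₁ V₁) +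
          weight A B K z * (B.coneForm z.2 V₂ V₂ - g₂.sq z.2 V₂)| := by congr 1; ring
      _ ≤ (1 - weight A B K z) * |g₁.sq z.1 V₁ - A.coneForm z.1 V₁ V₁| +
          weight A B K z * |B.coneForm z.2 V₂ V₂ - g₂.sq z.2 V₂| := by
        refine (abs_add_le _ _).trans ?_
        rw [abs_mul, abs_mul, abs_of_nonneg hχ0, abs_of_nonneg (by linarith : 0 ≤ 1 - weight A B K z)]
      _ ≤ 1 * (2 * C * r ^ (-ν) * A.coneForm z.1 V₁ V₁) + 4 * C * r ^ (-ν) * g₂.sq z.2 V₂ := by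
        refine add_le_add (mul_le_mul (by linarith) d₁ (abs_nonneg _) zero_le_one) d₂
      _ ≤ _ := by
        have : 0 ≤ C * r ^ (-ν) * A.coneForm z.1 V₁ V₁ := by positivity
        linarith
  · rw [hsum, hbl]
    have d₁ : (1 - weight A B K z) * A.coneForm z.1 V₁ V₁ ≤
        (1 - weight A B K z) * (2 * g₁.sq z.1 V₁) :=
      mul_le_mul_of_nonneg_left (by linarith [hhalf₁.1]) (by linarith)
    have d₂ : weight A B K z * (2 * g₂.sq z.2 V₂) ≤
        weight A B K z * (3 * B.coneForm z.2 V₂ V₂) := by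
      by_cases h : weight A B K z = 0
      · rw [h, zero_mul, zero_mul]
      · exact mul_le_mul_of_nonneg_left (hhalf (by linarith [(hχ h).2])).2 hχ0
    have d₃ : 0 ≤ weight A B K z * A.coneForm z.1 V₁ V₁ := mul_nonneg hχ0 c₁
    have d₄ : 0 ≤ weight A B K z * B.coneForm z.2 V₂ V₂ := mul_nonneg hχ0 c₂
    have d₅ : 0 ≤ weight A B K z * g₂.sq z.2 V₂ := mul_nonneg hχ0 hG
    have d₆ : 0 ≤ (1 - weight A B K z) * g₂.sq z.2 V₂ := mul_nonneg (by linarith) hG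
    linarith

end ACPair

namespace ACStructure

variable {Z F : Mfd.{u}} {g : Z.Metric} {κ : F.Metric} {ν : ℝ} (A : ACStructure g κ ν)

theorem hasMFDerivAt_Φ_curve {a : ℝ → ℝ} {a' r : ℝ} (ha : HasDerivAt a a' r) (hr : A.R₀ < a r)
    (f : F) : ∃ D : ℝ →L[ℝ] Z.E, HasMFDerivAt 𝓘(ℝ, ℝ) Z.I (fun s ↦ A.Φ (a s, f)) r D ∧
      D 1 = mfderiv (𝓘(ℝ, ℝ).prod F.I) Z.I A.Φ (a r, f) (a', 0) := by
  have h1 := ((A.Φ.contMDiffAt (A.mem_source hr f)).mdifferentiableAt (by simp)).hasMFDerivAt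
  have h2 := HasMFDerivAt.comp r h1 (ha.hasFDerivAt.hasMFDerivAt.prodMk (hasMFDerivAt_const f r))
  refine ⟨_, h2, ?_⟩
  change mfderiv (𝓘(ℝ, ℝ).prod F.I) Z.I A.Φ (a r, f) ((1 : ℝ) * a', 0) = _
  rw [one_mul]

end ACStructure

/-! ### The velocity of the level sets and the QAC structure -/

namespace ACPair

variable {Z₁ Z₂ F₁ F₂ : Mfd.{u}} {g₁ : Z₁.Metric} {g₂ : Z₂.Metric} {κ₁ : F₁.Metric}
  {κ₂ : F₂.Metric} {ν₁ ν₂ : ℝ} {A : ACStructure g₁ κ₁ ν₁} {B : ACStructure g₂ κ₂ ν₂} {K : ℝ}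
  (hA : A.R₀ < K) (hB : B.R₀ < K)

variable (A B K) in
/-- `(N₁, N₂)` satisfies the equations of the velocity of the flow transversal to the level
sets, on the part where the first factor is far out. -/
structure IsFlowVelocity (r φ : ℝ) (z : Z₁ × Z₂) (N₁ : TangentSpace Z₁.I z.1)
    (N₂ : TangentSpace Z₂.I z.2) : Prop where
  radial_left : A.radial z.1 N₁ = (r - B.sigma K z.2 * φ) / A.sigma K z.1
  angular_left : A.angular z.1 N₁ = 0
  right : (2 * K < B.rho z.2 ∧ B.radial z.2 N₂ = φ ∧ B.angular z.2 N₂ = 0) ∨ (N₂ = 0 ∧ φ = 0)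
  nonneg : 0 ≤ φ
  offset_nonneg : r * φ ≤ B.sigma K z.2
  offset_le : B.sigma K z.2 - r * φ ≤ 3 * K

/-- With s₀ the initial second radius, that radius moves at the constant rate φ = `radialRate K s₀`.
The first radius, the square root of r² minus its square, moves at the rate (r − sφ)/ρ. The links
are fixed, and a second component in the core does not move at all. -/
theorem exists_flowVelocity {r : ℝ} (hr : 10 * K < r) {z : Z₁ × Z₂}
    (h₂ : B.sigma K z.2 < 4 / 5 * (10 * K)) (hA : A.R₀ < K) (hB : B.R₀ < K) :
    ∃ (φ : ℝ) (D₁ : ℝ →L[ℝ] Z₁.E) (D₂ : ℝ →L[ℝ] Z₂.E),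
      HasMFDerivAt 𝓘(ℝ, ℝ) Z₁.I (fun s ↦ (transportLeft A B K s (stretch K s) z).1) r D₁ ∧
      HasMFDerivAt 𝓘(ℝ, ℝ) Z₂.I (fun s ↦ (transportLeft A B K s (stretch K s) z).2) r D₂ ∧
      IsFlowVelocity A B K r φ (transportLeft A B K r (stretch K r) z) (D₁ 1) (D₂ 1) := by
  have hK : 0 < K := A.R₀_pos.trans hA
  set s₀ := B.sigma K z.2 with hs₀
  have hs₀K : K ≤ s₀ := B.le_sigma hK
  have hch := isChange_stretch hK hr.le
  have hσ : ∀ s, 10 * K ≤ s → B.sigma K (B.radialMap K (stretch K s) z.2) = stretch K s s₀ := by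
    intro s hs
    have h := isChange_stretch hK hs
    exact B.sigma_radialMap hB h.id_of_le h.strictMono
  have hlt : stretch K r s₀ < 4 / 5 * r := hch.lt (by linarith) h₂
  have hσr := hσ r hr.le
  have hw : B.sigma K (B.radialMap K (stretch K r) z.2) < 4 / 5 * r := hσr ▸ hlt
  have hco := R₀_lt_coradius A B hK hr.le hw hA
  have hsix := six_lt_coradius B hK hr.le hw
  have hsq := sq_coradius B hK hr.le hw
  have hcd : HasDerivAt (fun s ↦ coradius B K s (B.radialMap K (stretch K s) z.2))
      ((r - stretch K r s₀ * radialRate K s₀) /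
        coradius B K r (B.radialMap K (stretch K r) z.2)) r := by
    have h0 : r ^ 2 - stretch K r s₀ ^ 2 ≠ 0 := by
      rw [← hσr, ← hsq]
      have : 0 < coradius B K r (B.radialMap K (stretch K r) z.2) := by linarith
      positivity
    have h1 : HasDerivAt (fun s : ℝ ↦ √(s ^ 2 - stretch K s s₀ ^ 2)) _ r :=
      (((hasDerivAt_id r).pow 2).sub ((hasDerivAt_stretch K r s₀).pow 2)).sqrt h0
    refine (h1.congr_deriv ?_).congr_of_eventuallyEq ?_
    · rw [coradius, hσr]
      change (2 * r ^ 1 * 1 - 2 * stretch K r s₀ ^ 1 * radialRate K s₀) /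
        (2 * √(r ^ 2 - stretch K r s₀ ^ 2)) = _
      have : √(r ^ 2 - stretch K r s₀ ^ 2) ≠ 0 := by
        have := hsix
        rw [coradius, hσr] at this
        linarith
      field_simp
    · filter_upwards [lt_mem_nhds hr] with s hs
      rw [coradius, hσ s hs.le]
  obtain ⟨D₁, hD₁, hD₁'⟩ := A.hasMFDerivAt_Φ_curve hcd hco (A.link z.1)
  have hA₁ : A.sigma K (transportLeft A B K r (stretch K r) z).1 =
      coradius B K r (B.radialMap K (stretch K r) z.2) :=
    sigma_regionMap A B hK hr.le hw hA (A.link z.1)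
  have hB₁ : B.sigma K (transportLeft A B K r (stretch K r) z).2 = stretch K r s₀ := hσr
  -- The offset depends on the initial radius only, which makes it bounded uniformly in r.
  have hoff : stretch K r s₀ - r * radialRate K s₀ = s₀ - 10 * K * radialRate K s₀ := by
    rw [stretch]; ring
  have k₁ := stretch_offset_nonneg (u := s₀) hK (by linarith)
  have k₂ := stretch_offset_le (u := s₀) hK
  have key : ∃ D₂ : ℝ →L[ℝ] Z₂.E,
      HasMFDerivAt 𝓘(ℝ, ℝ) Z₂.I (fun s ↦ B.radialMap K (stretch K s) z.2) r D₂ ∧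
      ((2 * K < B.rho (B.radialMap K (stretch K r) z.2) ∧
        B.radial (B.radialMap K (stretch K r) z.2) (D₂ 1) = radialRate K s₀ ∧
        B.angular (B.radialMap K (stretch K r) z.2) (D₂ 1) = 0) ∨
      (D₂ 1 = 0 ∧ radialRate K s₀ = 0)) := by
    by_cases h : 2 * K < B.rho z.2
    · have hρ : s₀ = B.rho z.2 := B.sigma_of_ge hK h.le
      have hlt' := B.lt_radial_of_lt hB hch.id_of_le hch.strictMono h
      obtain ⟨D₂, hD₂, hD₂'⟩ := B.hasMFDerivAt_Φ_curve (hasDerivAt_stretch K r (B.rho z.2))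
        (by linarith) (B.link z.2)
      have e : ∀ s, B.radialMap K (stretch K s) z.2 = B.Φ (stretch K s (B.rho z.2), B.link z.2) :=
        fun s ↦ if_pos h
      refine ⟨D₂, hD₂.congr_of_eventuallyEq (Eventually.of_forall e), Or.inl ?_⟩
      rw [e r, hD₂', hρ]
      refine ⟨?_, B.radial_mfderiv_Φ (by linarith) _ _ _, B.angular_mfderiv_Φ (by linarith) _ _ _⟩
      rwa [B.rho_Φ (by linarith)]
    · refine ⟨0, (hasMFDerivAt_const z.2 r).congr_of_eventuallyEq (Eventually.of_forall fun s ↦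
        B.radialMap_of_le (not_lt.1 h)), Or.inr ⟨rfl, radialRate_of_le hK ?_⟩⟩
      by_contra hlt
      exact h ((B.lt_rho_iff hK le_rfl).2 (not_le.1 hlt))
  obtain ⟨D₂, hD₂, hD₂'⟩ := key
  refine ⟨radialRate K s₀, D₁, D₂, hD₁, hD₂, ?_, ?_, hD₂', radialRate_nonneg hK, ?_, ?_⟩
  · rw [hA₁, hB₁, hD₁']
    exact A.radial_mfderiv_Φ hco _ _ _
  · rw [hD₁']
    exact A.angular_mfderiv_Φ hco _ _ _
  · rw [hB₁]; linarith
  · rw [hB₁]; linarith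

/-- The level equation σ₁² + σ₂² = r², differentiated along the level set. -/
theorem sigma_mul_dsigma_eq_zero {r : ℝ} (hr : 10 * K < r) (y : levelMfd hA hB)
    (v : TangentSpace (levelMfd hA hB).I y) :
    A.sigma K (expand hA hB r y).1 * A.dsigma K (expand hA hB r y).1
        (mfderiv (levelMfd hA hB).I (Z₁.I.prod Z₂.I) (expand hA hB r) y v).1 +
      B.sigma K (expand hA hB r y).2 * B.dsigma K (expand hA hB r y).2
        (mfderiv (levelMfd hA hB).I (Z₁.I.prod Z₂.I) (expand hA hB r) y v).2 = 0 := by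
  have h0 := ((contMDiff_expand hA hB hr y).mdifferentiableAt (by simp)).hasMFDerivAt
  have h1 := (hasMFDerivAt_fst (I := Z₁.I) (I' := Z₂.I) (expand hA hB r y)).comp y h0
  have h2 := (hasMFDerivAt_snd (I := Z₁.I) (I' := Z₂.I) (expand hA hB r y)).comp y h0
  have h3 := HasMFDerivAt.comp y ((A.contMDiff_sigma hA
    (expand hA hB r y).1).mdifferentiableAt (by simp)).hasMFDerivAt h1
  have h4 := HasMFDerivAt.comp y ((B.contMDiff_sigma hB
    (expand hA hB r y).2).mdifferentiableAt (by simp)).hasMFDerivAt h2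
  have h5 := (((hasDerivAt_id (A.sigma K (expand hA hB r y).1)).pow 2).hasFDerivAt.hasMFDerivAt.comp
    y h3).add (((hasDerivAt_id (B.sigma K (expand hA hB r y).2)).pow
      2).hasFDerivAt.hasMFDerivAt.comp y h4)
  have h6 : HasMFDerivAt (levelMfd hA hB).I 𝓘(ℝ, ℝ) (fun y' ↦ sqRadius A B K (expand hA hB r y')) y
    _ := h5
  have h7 : HasMFDerivAt (levelMfd hA hB).I 𝓘(ℝ, ℝ) (fun y' ↦ sqRadius A B K (expand hA hB r y')) y
      0 := (hasMFDerivAt_const (r ^ 2) y).congr_of_eventuallyEq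
    (Eventually.of_forall fun y' ↦ sqRadius_expand hA hB hr.le y')
  have h8 := congrArg (fun L : (levelMfd hA hB).E →L[ℝ] ℝ ↦ L v) (hasMFDerivAt_unique h6 h7)
  change A.dsigma K (expand hA hB r y).1
      (mfderiv (levelMfd hA hB).I (Z₁.I.prod Z₂.I) (expand hA hB r) y v).1 *
        (2 * A.sigma K (expand hA hB r y).1 ^ 1 * 1) +
    B.dsigma K (expand hA hB r y).2
      (mfderiv (levelMfd hA hB).I (Z₁.I.prod Z₂.I) (expand hA hB r) y v).2 *
        (2 * B.sigma K (expand hA hB r y).2 ^ 1 * 1) = 0 at h8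
  linarith

end ACPair

theorem mfderiv_prod_apply {E H E' H' M N : Type*} [NormedAddCommGroup E]
    [NormedSpace ℝ E] [TopologicalSpace H] {I : ModelWithCorners ℝ E H} [NormedAddCommGroup E']
    [NormedSpace ℝ E'] [TopologicalSpace H'] {J : ModelWithCorners ℝ E' H'}
    [TopologicalSpace M] [ChartedSpace H M] [TopologicalSpace N] [ChartedSpace H' N]
    {f : ℝ × M → N} {r : ℝ} {y : M} (hf : MDifferentiableAt (𝓘(ℝ, ℝ).prod I) J f (r, y))
    {D : ℝ →L[ℝ] E'} (hD : HasMFDerivAt 𝓘(ℝ, ℝ) J (fun s ↦ f (s, y)) r D)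
    {N : TangentSpace J (f (r, y))} (hN : D 1 = N) (t : ℝ) (v : TangentSpace I y) :
    mfderiv (𝓘(ℝ, ℝ).prod I) J f (r, y) (t, v) =
      t • N + mfderiv I J (fun y' ↦ f (r, y')) y v := by
  refine (mfderiv_prod_eq_add_apply hf).trans ?_
  have h := congrArg (fun L : ℝ →L[ℝ] E' ↦ L t) hD.mfderiv
  refine congrArg₂ (fun a b : E' ↦ a + b) (h.trans ?_) rfl
  rw [← hN]
  change D t = t • D 1
  rw [← map_smul, smul_eq_mul, mul_one]

theorem Mfd.Metric.prod_sq_add {M N : Mfd.{u}} (g : M.Metric) (h : N.Metric) (p : M × N) (t : ℝ)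
    (X Y : TangentSpace (M.I.prod N.I) p) : (g.prod h).sq p (t • X + Y) =
      g.sq p.1 (t • X.1 + Y.1) + h.sq p.2 (t • X.2 + Y.2) := rfl

namespace ACPair

variable {Z₁ Z₂ F₁ F₂ : Mfd.{u}} {g₁ : Z₁.Metric} {g₂ : Z₂.Metric} {κ₁ : F₁.Metric}
  {κ₂ : F₂.Metric} {ν₁ ν₂ : ℝ} {A : ACStructure g₁ κ₁ ν₁} {B : ACStructure g₂ κ₂ ν₂} {K : ℝ}
  (hA : A.R₀ < K) (hB : B.R₀ < K)

/-- Either recipe for the transport gives a flow velocity as in `IsFlowVelocity`; the right one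
reduces to the same estimate with the factors exchanged, because `blend` is symmetric. -/
theorem abs_prod_sub_levelMetric_le {C ν r : ℝ} (SA : A.IsScale K C) (SB : B.IsScale K C)
    (h0 : 0 ≤ ν) (h1 : ν ≤ 1) (h₁ : ν ≤ ν₁) (h₂ : ν ≤ ν₂) (hr : 10 * K < r) (y : levelMfd hA hB)
    (t : ℝ) (v : TangentSpace (levelMfd hA hB).I y) :
    ∃ (D : ℝ →L[ℝ] Z₁.E × Z₂.E) (N : TangentSpace (Z₁.I.prod Z₂.I) (expand hA hB r y)),
      HasMFDerivAt 𝓘(ℝ, ℝ) (Z₁.I.prod Z₂.I) (fun s ↦ expand hA hB s y) r D ∧ D 1 = N ∧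
      |(g₁.prod g₂).sq (expand hA hB r y)
        (t • N + mfderiv (levelMfd hA hB).I (Z₁.I.prod Z₂.I) (expand hA hB r) y v) - (t ^ 2 + r ^ 2 * (levelMetric hA hB r hr).sq y v)| ≤
        72 * (K * C) * r ^ (-ν) * (t ^ 2 + r ^ 2 * (levelMetric hA hB r hr).sq y v) := by
  have hK : 0 < K := A.R₀_pos.trans hA
  have hr0 : 0 < r := by linarith
  have hL : r ^ 2 * (levelMetric hA hB r hr).sq y v = (blend A B hA hB).sq (expand hA hB r y)
      (mfderiv (levelMfd hA hB).I (Z₁.I.prod Z₂.I) (expand hA hB r) y v) := by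
    have : (levelMetric hA hB r hr).sq y v = (r ^ 2)⁻¹ * (blend A B hA hB).sq (expand hA hB r y)
      (mfderiv (levelMfd hA hB).I (Z₁.I.prod Z₂.I) (expand hA hB r) y v) := rfl
    rw [this, mul_inv_cancel_left₀ (by positivity)]
  rw [hL]
  have hy := sqRadius_levelVal hA hB y
  have hV := sigma_mul_dsigma_eq_zero hA hB hr y v
  have hz := sqRadius_expand hA hB hr.le y
  have hch := isChange_stretch hK hr.le
  generalize mfderiv (levelMfd hA hB).I (Z₁.I.prod Z₂.I) (expand hA hB r) y v = V at *
  rcases sigma_lt_or A B (by linarith) hK hy with h | h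
  · have e : (fun s ↦ expand hA hB s y) =
        fun s ↦ transportLeft A B K s (stretch K s) (levelVal hA hB y) :=
      funext fun s ↦ transport_of_left A B h
    have er : expand hA hB r y = transportLeft A B K r (stretch K r) (levelVal hA hB y) :=
      congrFun e r
    obtain ⟨φ, D₁, D₂, hD₁, hD₂, hN⟩ := exists_flowVelocity hr h hA hB
    have hw : B.sigma K (transportLeft A B K r (stretch K r) (levelVal hA hB y)).2 < 4 / 5 * r :=
      sigma_transportLeft_lt A B hB hch (by linarith) h
    rw [e]
    generalize expand hA hB r y = z at *
    subst er
    have key := abs_prod_sub_blend_le (t := t) hA hB SA SB h0 h1 h₁ h₂ hr hz hw _ V.1 _ V.2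
      hN.radial_left hN.angular_left hN.right hN.nonneg hN.offset_nonneg hN.offset_le hV
    refine ⟨_, (D₁ 1, D₂ 1), hD₁.prodMk hD₂, rfl, ?_⟩
    exact (congrArg (fun a : ℝ ↦ |a - _|)
      (Mfd.Metric.prod_sq_add g₁ g₂ _ t (D₁ 1, D₂ 1) V)).trans_le key
  · have e : (fun s ↦ expand hA hB s y) =ᶠ[𝓝 r]
        fun s ↦ (transportLeft B A K s (stretch K s) (levelVal hA hB y).swap).swap := by
      filter_upwards [lt_mem_nhds hr] with s hs
      exact transport_of_right A B hA hB le_rfl hs.le (isChange_stretch hK hs.le) hy h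
    have er : expand hA hB r y =
        (transportLeft B A K r (stretch K r) (levelVal hA hB y).swap).swap := e.self_of_nhds
    obtain ⟨φ, D₁, D₂, hD₁, hD₂, hN⟩ := exists_flowVelocity (A := B) (B := A)
      (z := (levelVal hA hB y).swap) hr h hB hA
    have hw : A.sigma K (transportLeft B A K r (stretch K r) (levelVal hA hB y).swap).2 <
        4 / 5 * r :=
      sigma_transportLeft_lt B A (z := (levelVal hA hB y).swap) hA hch (by linarith) h
    have hD := (hD₂.prodMk hD₁).congr_of_eventuallyEq e
    clear e
    generalize transportLeft B A K r (stretch K r) (levelVal hA hB y).swap = w at *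
    generalize expand hA hB r y = z at *
    subst er
    refine ⟨_, (D₂ 1, D₁ 1), hD, rfl, ?_⟩
    have key := abs_prod_sub_blend_le (t := t) hB hA SB SA h0 h1 h₂ h₁ hr
      (by rw [← sqRadius_swap]; exact hz) hw _ V.2 _ V.1
      hN.radial_left hN.angular_left hN.right hN.nonneg hN.offset_nonneg hN.offset_le
      ((add_comm _ _).trans hV)
    rw [← blend_swap A B hA hB w V.1 V.2, add_comm (g₂.sq _ _)] at key
    exact (congrArg (fun a : ℝ ↦ |a - _|)
      (Mfd.Metric.prod_sq_add g₁ g₂ _ t (D₂ 1, D₁ 1) V)).trans_le key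

theorem flowDiffeo_image {R : ℝ} (hR : 10 * K < R) {s : Set ℝ} (hs : s ⊆ Ici R) :
    flowDiffeo hA hB '' (s ×ˢ univ) = {w | √(sqRadius A B K w) ∈ s} := by
  have hK : 0 < K := A.R₀_pos.trans hA
  ext w
  constructor
  · rintro ⟨⟨r, y⟩, ⟨hr : r ∈ s, -⟩, rfl⟩
    have hrR : R ≤ r := hs hr
    rw [flowDiffeo_apply, mem_ofPred_eq, sqRadius_expand hA hB (by linarith),
      Real.sqrt_sq (by linarith)]
    exact hr
  · intro (hw : √(sqRadius A B K w) ∈ s)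
    have hwR : R ≤ √(sqRadius A B K w) := hs hw
    refine ⟨(√(sqRadius A B K w), contract hA hB √(sqRadius A B K w) w), ⟨hw, trivial⟩, ?_⟩
    rw [flowDiffeo_apply]
    refine expand_contract hA hB (by linarith) (Real.sq_sqrt ?_).symm
    rw [sqRadius]; positivity

include hA hB in
theorem continuous_sqrt_sqRadius : Continuous fun w : Z₁ × Z₂ ↦ √(sqRadius A B K w) :=
  Real.continuous_sqrt.comp (contMDiff_sqRadius A B hA hB).continuous

section
variable [CompactSpace F₁] [CompactSpace F₂] [Nonempty F₁] [Nonempty F₂]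

/-- The product of two asymptotically conic manifolds as a QAC space. -/
noncomputable def qacStructure {C ν : ℝ} (SA : A.IsScale K C) (SB : B.IsScale K C) (h0 : 0 < ν)
    (h1 : ν ≤ 1) (h₁ : ν ≤ ν₁) (h₂ : ν ≤ ν₂) :
    QACStructure (g₁.prod g₂) (Suspension.edge κ₁ κ₂) ν where
  rate_pos := h0
  Y := levelMfd hA hB
  h := levelFamily hA hB
  blowup := levelBlowup hA hB SA SB h0 h1 h₁ h₂
  R₀ := 10 * K
  R₀_pos := by have := A.R₀_pos.trans hA; positivity
  R₀_large := le_rfl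
  Ψ := flowDiffeo hA hB
  source_eq := rfl
  isCompact_compl R hR := by
    have hK : 0 < K := A.R₀_pos.trans hA
    rw [flowDiffeo_image hA hB hR Ioi_subset_Ici_self]
    have h1 : IsClosed {w : Z₁ × Z₂ | √(sqRadius A B K w) ∈ Ioi R}ᶜ :=
      (isOpen_Ioi.preimage (continuous_sqrt_sqRadius hA hB)).isClosed_compl
    have h2 := (A.isCompact_sigma_le hA R).prod (B.isCompact_sigma_le hB R)
    refine h2.of_isClosed_subset h1 ?_
    rintro ⟨z₁, z₂⟩ hz
    have hz' : √(A.sigma K z₁ ^ 2 + B.sigma K z₂ ^ 2) ≤ R := not_lt.1 hz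
    exact ⟨show A.sigma K z₁ ≤ R from
      (Real.le_sqrt_of_sq_le (by linarith [sq_nonneg (B.sigma K z₂)])).trans hz',
      show B.sigma K z₂ ≤ R from
      (Real.le_sqrt_of_sq_le (by linarith [sq_nonneg (A.sigma K z₁)])).trans hz'⟩
  isClosed_end R hR := by
    rw [flowDiffeo_image hA hB hR le_rfl]
    exact isClosed_Ici.preimage (continuous_sqrt_sqRadius hA hB)
  asymptotic := by
    refine ⟨72 * (K * C), fun r hr y t v ↦ ?_⟩
    have hr' : 10 * K < r := hr
    obtain ⟨D, N, hD, hN, h⟩ := abs_prod_sub_levelMetric_le hA hB SA SB h0.le h1 h₁ h₂ hr' y t v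
    have e := mfderiv_prod_apply ((contMDiffAt_expand hA hB hr' y).mdifferentiableAt (by simp))
      hD hN t v
    rw [levelFamily_inv hA hB hr']
    rw [← e] at h
    exact h

end

end ACPair

theorem exists_qacStructure {Z₁ Z₂ F₁ F₂ : Mfd.{u}} [CompactSpace F₁] [CompactSpace F₂]
    [Nonempty F₁] [Nonempty F₂] {g₁ : Z₁.Metric} {g₂ : Z₂.Metric} {κ₁ : F₁.Metric}
    {κ₂ : F₂.Metric} {ν₁ ν₂ : ℝ} (A : ACStructure g₁ κ₁ ν₁) (B : ACStructure g₂ κ₂ ν₂) :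
    Nonempty (QACStructure (g₁.prod g₂) (Suspension.edge κ₁ κ₂) (min 1 (min ν₁ ν₂))) := by
  obtain ⟨K, ⟨C₁, S₁⟩, ⟨C₂, S₂⟩⟩ := (A.exists_isScale.and B.exists_isScale).exists
  exact ⟨ACPair.qacStructure S₁.R₀_lt S₂.R₀_lt (S₁.mono (le_max_left C₁ C₂))
    (S₂.mono (le_max_right C₁ C₂)) (lt_min one_pos (lt_min A.rate_pos B.rate_pos))
    (min_le_left _ _) ((min_le_right _ _).trans (min_le_left _ _))
    ((min_le_right _ _).trans (min_le_right _ _))⟩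

/-! ### Curves, speed and Riemannian distance -/

namespace Mfd.Metric

variable {M N : Mfd.{u}} (g : M.Metric)

/-- The speed of a curve. -/
noncomputable def speed (γ : ℝ → M) (t : ℝ) : ℝ := √(g.sq (γ t) (mfderiv 𝓘(ℝ, ℝ) M.I γ t (1 : ℝ)))

theorem speed_nonneg (γ : ℝ → M) (t : ℝ) : 0 ≤ g.speed γ t := Real.sqrt_nonneg _

theorem sq_speed (γ : ℝ → M) (t : ℝ) :
    g.speed γ t ^ 2 = g.sq (γ t) (mfderiv 𝓘(ℝ, ℝ) M.I γ t (1 : ℝ)) :=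
  Real.sq_sqrt (g.sq_nonneg _ _)

theorem enorm_eq (x : M) (v : TangentSpace M.I x) :
    letI : RiemannianBundle (fun x : M ↦ TangentSpace M.I x) := ⟨g.toRiemannianMetric⟩
    ‖v‖ₑ = ENNReal.ofReal √(g.sq x v) := by
  let _ : RiemannianBundle (fun x : M ↦ TangentSpace M.I x) := ⟨g.toRiemannianMetric⟩
  rw [← ofReal_norm, norm_eq_sqrt_real_inner]
  rfl

/-- The velocity is the tangent map applied to the section (t, 1), hence continuous in the tangent
bundle, where the metric is continuous. -/
theorem continuousAt_speed {γ : ℝ → M} {t : ℝ} (h : ContMDiffAt 𝓘(ℝ, ℝ) M.I 1 γ t) :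
    ContinuousAt (g.speed γ) t := by
  let _ : RiemannianBundle (fun x : M ↦ TangentSpace M.I x) := ⟨g.toRiemannianMetric⟩
  obtain ⟨u, hu, hγ⟩ := (contMDiffAt_iff_contMDiffOn_nhds (by simp)).1 h
  obtain ⟨s, hsu, hs, hts⟩ := mem_nhds_iff.1 hu
  have h1 := (hγ.mono hsu).continuousOn_tangentMapWithin le_rfl hs.uniqueMDiffOn
  have h2 : ContinuousOn (fun t ↦ (⟨t, (1 : ℝ)⟩ : TangentBundle 𝓘(ℝ, ℝ) ℝ)) s :=
    ((tangentBundleModelSpaceHomeomorph 𝓘(ℝ, ℝ)).symm.continuous.comp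
      (continuous_id.prodMk (continuous_const (y := (1 : ℝ))))).continuousOn
  have h3 : ContinuousAt (fun t ↦ (⟨γ t, mfderiv 𝓘(ℝ, ℝ) M.I γ t (1 : ℝ)⟩ : TangentBundle M.I M))
      t := by
    refine ((h1.comp h2 fun t ht ↦ ht).congr fun t ht ↦ ?_).continuousAt (hs.mem_nhds hts)
    rw [← mfderivWithin_of_isOpen hs ht]
    rfl
  have : IsContinuousRiemannianBundle M.E (fun x : M ↦ TangentSpace M.I x) :=
    ⟨g.inner, g.contMDiff.continuous, fun _ _ _ ↦ rfl⟩
  have h4 := h3.inner_bundle (F := M.E) (E := fun x : M ↦ TangentSpace M.I x) h3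
  exact Real.continuous_sqrt.continuousAt.comp h4

theorem edist_le_ofReal {γ : ℝ → M} {a b : ℝ} (hab : a ≤ b)
    (hγ : ∀ t ∈ Icc a b, ContMDiffAt 𝓘(ℝ, ℝ) M.I 1 γ t) {v : ℝ → ℝ} (hv : ContinuousOn v (Icc a b))
    (h : ∀ t ∈ Ioo a b, g.speed γ t ≤ v t) {x y : M} (hx : γ a = x) (hy : γ b = y) :
    g.edist x y ≤ ENNReal.ofReal (∫ t in a..b, v t) := by
  let _ : RiemannianBundle (fun x : M ↦ TangentSpace M.I x) := ⟨g.toRiemannianMetric⟩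
  have h1 : g.edist x y ≤ Manifold.pathELength M.I γ a b :=
    Manifold.riemannianEDist_le_pathELength (fun t ht ↦ (hγ t ht).contMDiffWithinAt) hx hy hab
  refine h1.trans ?_
  rw [Manifold.pathELength_eq_lintegral_mfderiv_Ioo]
  have hint := (hv.integrableOn_Icc (μ := MeasureTheory.volume)).mono_set Ioo_subset_Icc_self
  rw [intervalIntegral.integral_of_le hab, MeasureTheory.integral_Ioc_eq_integral_Ioo,
    MeasureTheory.ofReal_integral_eq_lintegral_ofReal hint]
  · refine MeasureTheory.setLIntegral_mono' measurableSet_Ioo fun t ht ↦ ?_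
    rw [g.enorm_eq]
    exact ENNReal.ofReal_le_ofReal (h t ht)
  · refine (MeasureTheory.ae_restrict_iff' measurableSet_Ioo).2 (Eventually.of_forall fun t ht ↦ ?_)
    exact (g.speed_nonneg γ t).trans (h t ht)

theorem exists_curve {x y : M} {L : ℝ} (h : g.edist x y < ENNReal.ofReal L) :
    ∃ γ : ℝ → M, ContMDiff 𝓘(ℝ, ℝ) M.I 1 γ ∧ γ 0 = x ∧ γ 1 = y ∧ ∫ t in (0 : ℝ)..1, g.speed γ t < L := by
  let _ : RiemannianBundle (fun x : M ↦ TangentSpace M.I x) := ⟨g.toRiemannianMetric⟩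
  obtain ⟨γ, h0, h1, hγ, hl, -⟩ :=
    Manifold.exists_lt_locally_constant_of_riemannianEDist_lt (I := M.I) h zero_lt_one
  refine ⟨γ, hγ, h0, h1, ?_⟩
  have hc : Continuous (g.speed γ) := continuous_iff_continuousAt.2 fun t ↦
    g.continuousAt_speed (hγ t)
  rw [Manifold.pathELength_eq_lintegral_mfderiv_Ioo] at hl
  have hint := (hc.continuousOn.integrableOn_Icc (a := 0) (b := 1)
    (μ := MeasureTheory.volume)).mono_set Ioo_subset_Icc_self
  have e : ENNReal.ofReal (∫ t in (0 : ℝ)..1, g.speed γ t) =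
      ∫⁻ t in Ioo (0 : ℝ) 1, ‖mfderiv 𝓘(ℝ, ℝ) M.I γ t (1 : ℝ)‖ₑ := by
    rw [intervalIntegral.integral_of_le zero_le_one, MeasureTheory.integral_Ioc_eq_integral_Ioo,
      MeasureTheory.ofReal_integral_eq_lintegral_ofReal hint
        (Eventually.of_forall fun t ↦ g.speed_nonneg γ t)]
    refine MeasureTheory.setLIntegral_congr_fun measurableSet_Ioo fun t _ ↦ ?_
    rw [g.enorm_eq]
    rfl
  have hl' : ENNReal.ofReal (∫ t in (0 : ℝ)..1, g.speed γ t) < ENNReal.ofReal L := by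
    rw [e]; exact hl
  exact ((ENNReal.ofReal_lt_ofReal_iff_of_nonneg
    (intervalIntegral.integral_nonneg zero_le_one fun t _ ↦ g.speed_nonneg γ t)).1 hl')

end Mfd.Metric

namespace Mfd.Metric

variable {M N : Mfd.{u}} (g : M.Metric)

theorem sq_smul (x : M) (c : ℝ) (v : TangentSpace M.I x) : g.sq x (c • v) = c ^ 2 * g.sq x v := by
  change g.inner x (c • v) (c • v) = c ^ 2 * g.inner x v v
  rw [map_smul, map_smul, smul_apply, smul_eq_mul, smul_eq_mul]
  ring

theorem speed_comp {γ : ℝ → M} {σ : ℝ → ℝ} {c t : ℝ} (hγ : MDifferentiableAt 𝓘(ℝ, ℝ) M.I γ (σ t))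
    (hσ : HasDerivAt σ c t) : g.speed (γ ∘ σ) t = |c| * g.speed γ (σ t) := by
  have h : mfderiv 𝓘(ℝ, ℝ) M.I (γ ∘ σ) t (1 : ℝ) =
      c • (mfderiv 𝓘(ℝ, ℝ) M.I γ (σ t) (1 : ℝ) : TangentSpace M.I (γ (σ t))) := by
    have h1 := hγ.hasMFDerivAt.comp t hσ.hasFDerivAt.hasMFDerivAt
    rw [h1.mfderiv]
    refine Eq.trans ?_ ((mfderiv 𝓘(ℝ, ℝ) M.I γ (σ t)).map_smul c (1 : ℝ))
    change mfderiv 𝓘(ℝ, ℝ) M.I γ (σ t) ((1 : ℝ) • c) = mfderiv 𝓘(ℝ, ℝ) M.I γ (σ t) (c • (1 : ℝ))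
    simp only [smul_eq_mul, one_mul, mul_one]
  have h2 : g.sq ((γ ∘ σ) t) (mfderiv 𝓘(ℝ, ℝ) M.I (γ ∘ σ) t (1 : ℝ)) =
      c ^ 2 * g.sq (γ (σ t)) (mfderiv 𝓘(ℝ, ℝ) M.I γ (σ t) (1 : ℝ)) :=
    (congrArg (fun v ↦ g.sq (γ (σ t)) v) h).trans (g.sq_smul _ _ _)
  unfold speed
  rw [h2, Real.sqrt_mul (_root_.sq_nonneg c), Real.sqrt_sq_eq_abs]

/-- Invert s(t) = (∫₀ᵗ v + τ t) / L with τ = L − ∫₀¹ v > 0. The term τ t keeps s strictly increasing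
where v vanishes, and the inverse has derivative L / (v + τ), so the new speed is below L. -/
theorem exists_reparametrization {v : ℝ → ℝ} (hv : Continuous v) (hv0 : ∀ t, 0 ≤ v t) {L : ℝ}
    (hL : ∫ t in (0 : ℝ)..1, v t < L) :
    ∃ σ σ' : ℝ → ℝ, ContDiff ℝ 1 σ ∧ σ 0 = 0 ∧ σ 1 = 1 ∧ (∀ t, HasDerivAt σ (σ' t) t) ∧
      ∀ t, |σ' t| * v (σ t) ≤ L := by
  have hI : 0 ≤ ∫ t in (0 : ℝ)..1, v t := intervalIntegral.integral_nonneg zero_le_one fun t _ ↦ hv0 t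
  obtain ⟨τ, hτ⟩ : ∃ τ, τ = L - ∫ t in (0 : ℝ)..1, v t := ⟨_, rfl⟩
  have hτ0 : 0 < τ := by linarith
  have hL0 : 0 < L := by linarith
  have hV : ∀ t, HasDerivAt (fun t ↦ ∫ u in (0 : ℝ)..t, v u) (v t) t := fun t ↦
    intervalIntegral.integral_hasDerivAt_right (hv.intervalIntegrable _ _)
      hv.stronglyMeasurable.stronglyMeasurableAtFilter hv.continuousAt
  have hVm : Monotone fun t ↦ ∫ u in (0 : ℝ)..t, v u :=
    monotone_of_deriv_nonneg (fun t ↦ (hV t).differentiableAt) fun t ↦ by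
      rw [(hV t).deriv]; exact hv0 t
  obtain ⟨s, hs⟩ : ∃ s : ℝ → ℝ, s = fun t ↦ ((∫ u in (0 : ℝ)..t, v u) + τ * t) / L := ⟨_, rfl⟩
  have hs' : ∀ t, HasDerivAt s ((v t + τ) / L) t := fun t ↦ by
    rw [hs]
    simpa using ((hV t).add ((hasDerivAt_id t).const_mul τ)).div_const L
  have hc : Continuous s := continuous_iff_continuousAt.2 fun t ↦ (hs' t).continuousAt
  have hmono : StrictMono s := strictMono_of_deriv_pos fun t ↦ by
    rw [(hs' t).deriv]; have := hv0 t; positivity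
  have h0 : s 0 = 0 := by simp [hs]
  have h1 : s 1 = 1 := by
    simp only [hs, hτ]
    field_simp
    ring
  have htop : Tendsto s atTop atTop := by
    refine tendsto_atTop_mono' _ ?_
      ((tendsto_id.const_mul_atTop hτ0).atTop_div_const hL0 : Tendsto (fun t ↦ τ * t / L) atTop atTop)
    filter_upwards [eventually_ge_atTop 0] with t ht
    rw [hs]
    have : 0 ≤ ∫ u in (0 : ℝ)..t, v u := by simpa using hVm ht
    simp only
    gcongr
    linarith
  have hbot : Tendsto s atBot atBot := by
    refine tendsto_atBot_mono' _ ?_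
      ((tendsto_id.const_mul_atBot hτ0).atBot_div_const hL0 : Tendsto (fun t ↦ τ * t / L) atBot atBot)
    filter_upwards [eventually_le_atBot 0] with t ht
    rw [hs]
    have : ∫ u in (0 : ℝ)..t, v u ≤ 0 := by simpa using hVm ht
    simp only
    gcongr
    linarith
  obtain ⟨e, he⟩ : ∃ e : ℝ ≃o ℝ, ∀ t, e t = s t :=
    ⟨hmono.orderIsoOfSurjective s (hc.surjective htop hbot), fun t ↦ rfl⟩
  have hsσ : ∀ t, s (e.symm t) = t := fun t ↦ by rw [← he, e.apply_symm_apply]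
  have hσ : ∀ t, HasDerivAt e.symm ((v (e.symm t) + τ) / L)⁻¹ t := fun t ↦
    (hs' (e.symm t)).of_local_left_inverse e.symm.continuous.continuousAt
      (by have := hv0 (e.symm t); positivity) (Eventually.of_forall hsσ)
  refine ⟨e.symm, fun t ↦ ((v (e.symm t) + τ) / L)⁻¹, ?_, ?_, ?_, hσ, fun t ↦ ?_⟩
  · refine contDiff_one_iff_deriv.2 ⟨fun t ↦ (hσ t).differentiableAt, ?_⟩
    have : deriv e.symm = fun t ↦ ((v (e.symm t) + τ) / L)⁻¹ := funext fun t ↦ (hσ t).deriv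
    rw [this]
    refine (((hv.comp e.symm.continuous).add continuous_const).div_const L).inv₀ fun t ↦ ?_
    have := hv0 (e.symm t)
    change (v (e.symm t) + τ) / L ≠ 0
    positivity
  · rw [e.symm_apply_eq, he, h0]
  · rw [e.symm_apply_eq, he, h1]
  · have := hv0 (e.symm t)
    simp only
    rw [abs_of_nonneg (by positivity), inv_div, div_mul_eq_mul_div, div_le_iff₀ (by positivity)]
    nlinarith

/-- Points at distance less than `L` are joined by a curve of speed at most `L` on `[0, 1]`. -/
theorem exists_curve_speed_le {x y : M} {L : ℝ} (h : g.edist x y < ENNReal.ofReal L) :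
    ∃ γ : ℝ → M, ContMDiff 𝓘(ℝ, ℝ) M.I 1 γ ∧ γ 0 = x ∧ γ 1 = y ∧ ∀ t, g.speed γ t ≤ L := by
  obtain ⟨γ, hγ, h0, h1, hl⟩ := g.exists_curve h
  obtain ⟨σ, σ', hσ, hσ0, hσ1, hd, hb⟩ := exists_reparametrization
    (continuous_iff_continuousAt.2 fun t ↦ g.continuousAt_speed (hγ t)) (g.speed_nonneg γ) hl
  refine ⟨γ ∘ σ, hγ.comp hσ.contMDiff, by simp [hσ0, h0], by simp [hσ1, h1], fun t ↦ ?_⟩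
  rw [g.speed_comp ((hγ _).mdifferentiableAt one_ne_zero) (hd t)]
  exact hb t

theorem edist_self (x : M) : g.edist x x = 0 := by
  let _ : RiemannianBundle (fun x : M ↦ TangentSpace M.I x) := ⟨g.toRiemannianMetric⟩
  exact Manifold.riemannianEDist_self

theorem edist_comm (x y : M) : g.edist x y = g.edist y x := by
  let _ : RiemannianBundle (fun x : M ↦ TangentSpace M.I x) := ⟨g.toRiemannianMetric⟩
  exact Manifold.riemannianEDist_comm

theorem edist_triangle (x y z : M) : g.edist x z ≤ g.edist x y + g.edist y z := by
  let _ : RiemannianBundle (fun x : M ↦ TangentSpace M.I x) := ⟨g.toRiemannianMetric⟩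
  exact Manifold.riemannianEDist_triangle

theorem eventually_edist_lt (x : M) {c : ℝ≥0∞} (hc : 0 < c) : ∀ᶠ y in 𝓝 x, g.edist x y < c := by
  let _ : RiemannianBundle (fun x : M ↦ TangentSpace M.I x) := ⟨g.toRiemannianMetric⟩
  have : IsContinuousRiemannianBundle M.E (fun x : M ↦ TangentSpace M.I x) :=
    ⟨g.inner, g.contMDiff.continuous, fun _ _ _ ↦ rfl⟩
  exact eventually_riemannianEDist_lt M.I x hc

/-- The set of points at finite distance from x is open and closed. -/
theorem edist_ne_top [ConnectedSpace M] (x y : M) : g.edist x y ≠ ⊤ := by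
  have h : IsClopen {y | g.edist x y < ⊤} := by
    constructor
    · refine isOpen_compl_iff.1 (isOpen_iff_mem_nhds.2 fun y hy ↦ ?_)
      filter_upwards [g.eventually_edist_lt y ENNReal.zero_lt_top] with z hz hz'
      refine hy ((g.edist_triangle x z y).trans_lt (ENNReal.add_lt_top.2 ⟨hz', ?_⟩))
      rwa [g.edist_comm]
    · refine isOpen_iff_mem_nhds.2 fun y (hy : g.edist x y < ⊤) ↦ ?_
      filter_upwards [g.eventually_edist_lt y ENNReal.zero_lt_top] with z hz
      exact (g.edist_triangle x y z).trans_lt (ENNReal.add_lt_top.2 ⟨hy, hz⟩)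
  have hx : x ∈ {y | g.edist x y < ⊤} := by
    change g.edist x x < ⊤
    rw [g.edist_self]
    exact ENNReal.zero_lt_top
  have h' : {y | g.edist x y < ⊤} = univ := h.eq_univ ⟨x, hx⟩
  have : y ∈ {y | g.edist x y < ⊤} := h' ▸ mem_univ y
  exact this.ne

theorem dist_nonneg (x y : M) : 0 ≤ g.dist x y := ENNReal.toReal_nonneg

theorem dist_comm (x y : M) : g.dist x y = g.dist y x := by
  unfold dist
  rw [g.edist_comm]

theorem dist_le {x y : M} {L : ℝ} (hL : 0 ≤ L) (h : g.edist x y ≤ ENNReal.ofReal L) :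
    g.dist x y ≤ L := ENNReal.toReal_le_of_le_ofReal hL h

theorem dist_le_of_speed_le {γ : ℝ → M} {a b L : ℝ} (hab : a ≤ b)
    (hγ : ∀ t ∈ Icc a b, ContMDiffAt 𝓘(ℝ, ℝ) M.I 1 γ t) (hL : 0 ≤ L)
    (h : ∀ t ∈ Ioo a b, g.speed γ t ≤ L) : g.dist (γ a) (γ b) ≤ L * (b - a) := by
  refine g.dist_le (mul_nonneg hL (sub_nonneg.2 hab))
    ((g.edist_le_ofReal hab hγ continuousOn_const h rfl rfl).trans (le_of_eq ?_))
  rw [intervalIntegral.integral_const, smul_eq_mul, mul_comm]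

section Connected

variable [ConnectedSpace M]

theorem edist_eq (x y : M) : g.edist x y = ENNReal.ofReal (g.dist x y) :=
  (ENNReal.ofReal_toReal (g.edist_ne_top x y)).symm

theorem edist_lt_ofReal {x y : M} {L : ℝ} (h : g.dist x y < L) :
    g.edist x y < ENNReal.ofReal L := by
  rw [g.edist_eq]
  exact (ENNReal.ofReal_lt_ofReal_iff_of_nonneg (g.dist_nonneg x y)).2 h

theorem dist_triangle (x y z : M) : g.dist x z ≤ g.dist x y + g.dist y z := by
  unfold dist
  rw [← ENNReal.toReal_add (g.edist_ne_top _ _) (g.edist_ne_top _ _)]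
  exact ENNReal.toReal_mono (ENNReal.add_ne_top.2 ⟨g.edist_ne_top _ _, g.edist_ne_top _ _⟩)
    (g.edist_triangle x y z)

theorem continuous_dist (q : M) : Continuous (g.dist q) := by
  refine continuous_iff_continuousAt.2 fun x ↦ Metric.tendsto_nhds.2 fun e he ↦ ?_
  filter_upwards [g.eventually_edist_lt x (ENNReal.ofReal_pos.2 he)] with y hy
  rw [g.edist_eq, ENNReal.ofReal_lt_ofReal_iff he] at hy
  rw [Real.dist_eq, abs_sub_lt_iff]
  have h1 := g.dist_triangle q x y
  have h2 := g.dist_triangle q y x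
  rw [g.dist_comm y x] at h2
  constructor <;> linarith

end Connected

end Mfd.Metric

/-! ### The distance of a Riemannian product -/

namespace Mfd.Metric

variable {M N : Mfd.{u}} (g : M.Metric) (h : N.Metric)

theorem sq_speed_of_hasMFDerivAt {γ : ℝ → M} {t : ℝ} {D : ℝ →L[ℝ] M.E}
    (hD : HasMFDerivAt 𝓘(ℝ, ℝ) M.I γ t D) {v : TangentSpace M.I (γ t)} (hv : D 1 = v) :
    g.speed γ t ^ 2 = g.sq (γ t) v := by
  rw [sq_speed, hD.mfderiv]
  exact congrArg (g.sq (γ t)) hv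

theorem sq_speed_prod {γ : ℝ → M} {η : ℝ → N} {t : ℝ} (hγ : MDifferentiableAt 𝓘(ℝ, ℝ) M.I γ t)
    (hη : MDifferentiableAt 𝓘(ℝ, ℝ) N.I η t) :
    (g.prod h).speed (fun t ↦ ((γ t, η t) : M × N)) t ^ 2 = g.speed γ t ^ 2 + h.speed η t ^ 2 := by
  have h1 : HasMFDerivAt 𝓘(ℝ, ℝ) (M.I.prod N.I) (fun t ↦ ((γ t, η t) : M × N)) t
      ((mfderiv 𝓘(ℝ, ℝ) M.I γ t).prod (mfderiv 𝓘(ℝ, ℝ) N.I η t)) :=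
    hγ.hasMFDerivAt.prodMk hη.hasMFDerivAt
  rw [(g.prod h).sq_speed_of_hasMFDerivAt h1 (v := (mfderiv 𝓘(ℝ, ℝ) M.I γ t (1 : ℝ),
    mfderiv 𝓘(ℝ, ℝ) N.I η t (1 : ℝ))) rfl, g.sq_speed, h.sq_speed]
  exact prod_sq g h _ _ _

variable [ConnectedSpace M] [ConnectedSpace N]

/-- Run almost shortest curves of the two factors simultaneously, each with speed at most its
distance plus e, and let e tend to 0. -/
theorem le_sqrt_dist_prod (x y : M × N) :
    (g.prod h).dist x y ≤ √(g.dist x.1 y.1 ^ 2 + h.dist x.2 y.2 ^ 2) := by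
  have key : ∀ e : ℝ, 0 < e →
      (g.prod h).dist x y ≤ √((g.dist x.1 y.1 + e) ^ 2 + (h.dist x.2 y.2 + e) ^ 2) := by
    intro e he
    obtain ⟨γ, hγ, hγ0, hγ1, hγl⟩ := g.exists_curve_speed_le
      (g.edist_lt_ofReal (lt_add_of_pos_right (g.dist x.1 y.1) he))
    obtain ⟨η, hη, hη0, hη1, hηl⟩ := h.exists_curve_speed_le
      (h.edist_lt_ofReal (lt_add_of_pos_right (h.dist x.2 y.2) he))
    have := (g.prod h).dist_le_of_speed_le (γ := fun t ↦ ((γ t, η t) : M × N)) zero_le_one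
      (fun t _ ↦ (hγ t).prodMk (hη t)) (Real.sqrt_nonneg
        ((g.dist x.1 y.1 + e) ^ 2 + (h.dist x.2 y.2 + e) ^ 2)) (fun t _ ↦ by
        refine Real.le_sqrt_of_sq_le ?_
        rw [sq_speed_prod g h ((hγ t).mdifferentiableAt one_ne_zero)
          ((hη t).mdifferentiableAt one_ne_zero)]
        exact add_le_add (pow_le_pow_left₀ (g.speed_nonneg _ _) (hγl t) 2)
          (pow_le_pow_left₀ (h.speed_nonneg _ _) (hηl t) 2))
    rw [hγ0, hγ1, hη0, hη1] at this
    simpa using this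
  refine ge_of_tendsto (f := fun e : ℝ ↦ √((g.dist x.1 y.1 + e) ^ 2 + (h.dist x.2 y.2 + e) ^ 2))
    (x := 𝓝[>] 0) ?_ (by filter_upwards [self_mem_nhdsWithin] with e he using key e he)
  have : ContinuousAt (fun e : ℝ ↦ √((g.dist x.1 y.1 + e) ^ 2 + (h.dist x.2 y.2 + e) ^ 2)) 0 := by
    fun_prop
  simpa using this.tendsto.mono_left nhdsWithin_le_nhds

/-- Cauchy–Schwarz against the constant vector (a, b) of the two distances: for a curve of speed at
most L, a|γ₁'| + b|γ₂'| ≤ √(a² + b²) L. Integrating gives a² + b² ≤ √(a² + b²) L. -/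
theorem sqrt_le_dist_prod (x y : M × N) :
    √(g.dist x.1 y.1 ^ 2 + h.dist x.2 y.2 ^ 2) ≤ (g.prod h).dist x y := by
  refine le_of_forall_gt_imp_ge_of_dense fun L hL ↦ ?_
  have hL0 : 0 ≤ L := ((g.prod h).dist_nonneg x y).trans hL.le
  obtain ⟨γ, hγ, hγ0, hγ1, hγl⟩ := (g.prod h).exists_curve_speed_le
    ((g.prod h).edist_lt_ofReal hL)
  have hγ' : ContMDiff 𝓘(ℝ, ℝ) (M.I.prod N.I) 1 (fun t ↦ ((γ t : M × N))) := hγ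
  have c1 : ContMDiff 𝓘(ℝ, ℝ) M.I 1 fun t ↦ (γ t : M × N).1 := contMDiff_fst.comp hγ'
  have c2 : ContMDiff 𝓘(ℝ, ℝ) N.I 1 fun t ↦ (γ t : M × N).2 := contMDiff_snd.comp hγ'
  have s1 : Continuous (g.speed fun t ↦ (γ t : M × N).1) :=
    continuous_iff_continuousAt.2 fun t ↦ g.continuousAt_speed (c1 t)
  have s2 : Continuous (h.speed fun t ↦ (γ t : M × N).2) :=
    continuous_iff_continuousAt.2 fun t ↦ h.continuousAt_speed (c2 t)
  have d1 : g.dist x.1 y.1 ≤ ∫ t in (0 : ℝ)..1, g.speed (fun t ↦ (γ t : M × N).1) t :=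
    g.dist_le (intervalIntegral.integral_nonneg zero_le_one fun t _ ↦ g.speed_nonneg _ _)
      (g.edist_le_ofReal zero_le_one (fun t _ ↦ c1 t) s1.continuousOn (fun t _ ↦ le_rfl)
        (congrArg Prod.fst hγ0) (congrArg Prod.fst hγ1))
  have d2 : h.dist x.2 y.2 ≤ ∫ t in (0 : ℝ)..1, h.speed (fun t ↦ (γ t : M × N).2) t :=
    h.dist_le (intervalIntegral.integral_nonneg zero_le_one fun t _ ↦ h.speed_nonneg _ _)
      (h.edist_le_ofReal zero_le_one (fun t _ ↦ c2 t) s2.continuousOn (fun t _ ↦ le_rfl)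
        (congrArg Prod.snd hγ0) (congrArg Prod.snd hγ1))
  have a0 := g.dist_nonneg x.1 y.1
  have b0 := h.dist_nonneg x.2 y.2
  generalize g.dist x.1 y.1 = a at *
  generalize h.dist x.2 y.2 = b at *
  have hab : 0 ≤ a ^ 2 + b ^ 2 := by positivity
  have hle : ∀ t, a * g.speed (fun t ↦ (γ t : M × N).1) t + b * h.speed (fun t ↦ (γ t : M × N).2) t
      ≤ √(a ^ 2 + b ^ 2) * L := by
    intro t
    have hs := sq_speed_prod g h ((c1 t).mdifferentiableAt one_ne_zero)
      ((c2 t).mdifferentiableAt one_ne_zero)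
    have hs' : g.speed (fun t ↦ (γ t : M × N).1) t ^ 2 + h.speed (fun t ↦ (γ t : M × N).2) t ^ 2 ≤
        L ^ 2 := hs.symm.trans_le (pow_le_pow_left₀ ((g.prod h).speed_nonneg _ _) (hγl t) 2)
    refine abs_le_of_sq_le_sq' ?_ (mul_nonneg (Real.sqrt_nonneg _) hL0) |>.2
    rw [mul_pow, Real.sq_sqrt hab]
    generalize g.speed (fun t ↦ (γ t : M × N).1) t = p at *
    generalize h.speed (fun t ↦ (γ t : M × N).2) t = q at *
    nlinarith [_root_.sq_nonneg (a * q - b * p), mul_le_mul_of_nonneg_left hs' hab]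
  have hint := intervalIntegral.integral_mono (μ := MeasureTheory.volume) (zero_le_one (α := ℝ))
    (Continuous.intervalIntegrable (by fun_prop) 0 1)
    (continuous_const.intervalIntegrable (μ := MeasureTheory.volume) 0 1) hle
  rw [intervalIntegral.integral_add ((s1.const_mul a).intervalIntegrable 0 1)
    ((s2.const_mul b).intervalIntegrable 0 1), intervalIntegral.integral_const_mul,
    intervalIntegral.integral_const_mul, intervalIntegral.integral_const] at hint
  have e : a ^ 2 + b ^ 2 ≤ √(a ^ 2 + b ^ 2) * L := by
    have := mul_le_mul_of_nonneg_left d1 a0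
    have := mul_le_mul_of_nonneg_left d2 b0
    simp only [sub_zero, one_smul] at hint
    nlinarith
  by_contra! hlt
  have hpos : 0 < √(a ^ 2 + b ^ 2) := hL0.trans_lt hlt
  have := mul_lt_mul_of_pos_left hlt hpos
  rw [Real.mul_self_sqrt hab] at this
  linarith

/-- The distance of a Riemannian product. -/
theorem dist_prod (x y : M × N) :
    (g.prod h).dist x y = √(g.dist x.1 y.1 ^ 2 + h.dist x.2 y.2 ^ 2) :=
  le_antisymm (le_sqrt_dist_prod g h x y) (sqrt_le_dist_prod g h x y)

end Mfd.Metric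

/-! ### Radial distance bounds on an AC manifold -/

namespace ACStructure

variable {Z F : Mfd.{u}} {g : Z.Metric} {κ : F.Metric} {ν : ℝ} (A : ACStructure g κ ν)

/-- On the part `ρ ≥ K`, the metric and the cone metric differ by a factor close to one. -/
def IsConicFrom (η K : ℝ) : Prop :=
  A.R₀ < K ∧ ∀ z, K ≤ A.rho z → ∀ X : TangentSpace Z.I z,
    (1 - η) ^ 2 * A.coneForm z X X ≤ g.sq z X ∧ g.sq z X ≤ (1 + η) ^ 2 * A.coneForm z X X

theorem exists_isConicFrom {η : ℝ} (hη : 0 < η) (hη1 : η < 1) : ∃ K, A.IsConicFrom η K := by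
  obtain ⟨C, hC, h⟩ := A.abs_sq_sub_coneForm_le
  have hlim : Tendsto (fun r : ℝ ↦ C * r ^ (-ν)) atTop (𝓝 0) := by
    simpa using (tendsto_rpow_neg_atTop A.rate_pos).const_mul C
  obtain ⟨K, hK⟩ := eventually_atTop.1 (hlim.eventually (gt_mem_nhds hη))
  refine ⟨max K (A.R₀ + 1), lt_max_of_lt_right (by linarith), fun z hz X ↦ ?_⟩
  have h1 := h z ((lt_add_one _).trans_le ((le_max_right _ _).trans hz)) X
  have h2 := hK _ ((le_max_left _ _).trans hz)
  have h0 := A.coneForm_nonneg z X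
  generalize A.coneForm z X X = c at *
  -- The bound by η suffices since (1 − η)² ≤ 1 − η and 1 + η ≤ (1 + η)². Squares are used so that
  -- lengths change by 1 ± η.
  have h3 := (abs_le.1 (h1.trans (mul_le_mul_of_nonneg_right h2.le h0)))
  constructor
  · nlinarith [mul_nonneg h0 (mul_nonneg hη.le (sub_nonneg.2 hη1.le))]
  · nlinarith [mul_nonneg h0 hη.le, mul_nonneg h0 (_root_.sq_nonneg η)]

theorem contMDiffAt_Φ_curve {a : ℝ → ℝ} {c : ℝ → F} {t : ℝ} (ht : A.R₀ < a t)
    (ha : ContDiffAt ℝ 1 a t) (hc : ContMDiffAt 𝓘(ℝ, ℝ) F.I 1 c t) :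
    ContMDiffAt 𝓘(ℝ, ℝ) Z.I 1 (fun t ↦ A.Φ (a t, c t)) t :=
  ((A.Φ.contMDiffAt (A.mem_source ht (c t))).of_le (by simp)).comp
    (g := A.Φ) (f := fun t ↦ (a t, c t)) t (ha.contMDiffAt.prodMk hc)

theorem speed_Φ_curve_le {η K : ℝ} (hK : A.IsConicFrom η K) (hη : 0 ≤ η) {a : ℝ → ℝ} {c : ℝ → F}
    {t a' : ℝ} (ht : K ≤ a t) (ha : HasDerivAt a a' t) (hc : MDifferentiableAt 𝓘(ℝ, ℝ) F.I c t) :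
    g.speed (fun t ↦ A.Φ (a t, c t)) t ≤ (1 + η) * √(a' ^ 2 + (a t * κ.speed c t) ^ 2) := by
  have hr : A.R₀ < a t := hK.1.trans_le ht
  have h1 := ((A.Φ.contMDiffAt (A.mem_source hr (c t))).mdifferentiableAt (by simp)).hasMFDerivAt
  have h2 := HasMFDerivAt.comp t h1 (ha.hasFDerivAt.hasMFDerivAt.prodMk hc.hasMFDerivAt)
  have h3 := g.sq_speed_of_hasMFDerivAt h2 (v := mfderiv (𝓘(ℝ, ℝ).prod F.I) Z.I A.Φ (a t, c t)
      (a', mfderiv 𝓘(ℝ, ℝ) F.I c t (1 : ℝ))) (by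
    change mfderiv (𝓘(ℝ, ℝ).prod F.I) Z.I A.Φ (a t, c t)
      ((1 : ℝ) * a', mfderiv 𝓘(ℝ, ℝ) F.I c t (1 : ℝ)) = _
    rw [one_mul])
  have h4 := (hK.2 (A.Φ (a t, c t)) (by rwa [A.rho_Φ hr]) (mfderiv (𝓘(ℝ, ℝ).prod F.I) Z.I A.Φ
    (a t, c t) (a', mfderiv 𝓘(ℝ, ℝ) F.I c t (1 : ℝ)))).2
  rw [A.coneForm_mfderiv_Φ hr, ← κ.sq_speed] at h4
  refine abs_le_of_sq_le_sq' ?_ (by positivity) |>.2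
  rw [mul_pow, Real.sq_sqrt (by positivity), mul_pow (a t)]
  exact h3.trans_le h4

theorem hasDerivAt_rho_le_sq_speed {η K : ℝ} (hK : A.IsConicFrom η K) {γ : ℝ → Z} {t : ℝ}
    (hγ : MDifferentiableAt 𝓘(ℝ, ℝ) Z.I γ t) (ht : K ≤ A.rho (γ t)) :
    ∃ r', HasDerivAt (A.rho ∘ γ) r' t ∧ (1 - η) ^ 2 *
      (r' ^ 2 + (A.rho (γ t) * κ.speed (A.link ∘ γ) t) ^ 2) ≤ g.speed γ t ^ 2 := by
  have hr : A.R₀ < A.rho (γ t) := hK.1.trans_le ht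
  obtain ⟨D, h1, hD⟩ : ∃ D : ℝ →L[ℝ] ℝ, HasMFDerivAt 𝓘(ℝ, ℝ) 𝓘(ℝ, ℝ) (A.rho ∘ γ) t D ∧
      D 1 = mfderiv Z.I 𝓘(ℝ, ℝ) A.rho (γ t) (mfderiv 𝓘(ℝ, ℝ) Z.I γ t (1 : ℝ)) :=
    ⟨_, HasMFDerivAt.comp t ((A.contMDiffAt_rho hr).mdifferentiableAt (by simp)).hasMFDerivAt
      hγ.hasMFDerivAt, rfl⟩
  have h2 := HasMFDerivAt.comp t ((A.contMDiffAt_link hr).mdifferentiableAt (by simp)).hasMFDerivAt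
    hγ.hasMFDerivAt
  obtain ⟨X, hX⟩ : ∃ X : TangentSpace Z.I (γ t), X = mfderiv 𝓘(ℝ, ℝ) Z.I γ t (1 : ℝ) := ⟨_, rfl⟩
  refine ⟨A.radial (γ t) X, ?_, ?_⟩
  · have h3 : HasFDerivAt (A.rho ∘ γ) D t := h1.hasFDerivAt
    have e : D 1 = A.radial (γ t) X := by rw [hX, hD, A.mfderiv_rho hr]
    exact h3.hasDerivAt.congr_deriv e
  · have h4 := κ.sq_speed_of_hasMFDerivAt h2 (v := A.angular (γ t) X) (by
      rw [hX, ← A.mfderiv_link hr]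
      rfl)
    have h5 := (hK.2 (γ t) ht X).1
    rw [A.coneForm_apply] at h5
    rw [mul_pow, h4, g.sq_speed, ← hX, sq (A.radial (γ t) X)]
    exact h5

theorem dist_Φ_radial_le {η K : ℝ} (hK : A.IsConicFrom η K) (hη : 0 ≤ η) {r s : ℝ} (hr : K ≤ r)
    (hrs : r ≤ s) (f : F) : g.dist (A.Φ (r, f)) (A.Φ (s, f)) ≤ (1 + η) * (s - r) := by
  refine g.dist_le_of_speed_le (γ := fun t ↦ A.Φ (t, f)) hrs (fun t ht ↦
    A.contMDiffAt_Φ_curve (a := fun t ↦ t) (c := fun _ ↦ f) (hK.1.trans_le (hr.trans ht.1))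
      contDiffAt_id contMDiffAt_const) (by positivity) fun t ht ↦ ?_
  have h := A.speed_Φ_curve_le hK hη (a := fun t ↦ t) (c := fun _ ↦ f) (hr.trans ht.1.le)
    (hasDerivAt_id t) (mdifferentiableAt_const)
  have h0 : κ.speed (fun _ ↦ f) t = 0 := by
    have := κ.sq_speed_of_hasMFDerivAt (hasMFDerivAt_const f t) (v := 0) rfl
    have h0 : κ.sq f 0 = 0 := by simp [Mfd.Metric.sq]
    rw [h0] at this
    exact pow_eq_zero_iff two_ne_zero |>.1 this
  rw [h0] at h
  simpa using h

section Connected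

variable [ConnectedSpace Z]

/-- The distance from q is bounded on the compact part ρ ≤ K, and beyond it one follows a radial
ray. -/
theorem exists_dist_le_rho {η K : ℝ} (hK : A.IsConicFrom η K) (hη : 0 ≤ η) (q : Z) :
    ∃ C, 0 ≤ C ∧ ∀ z, g.dist q z ≤ (1 + η) * A.rho z + C := by
  obtain ⟨C, hC⟩ := (A.isCompact_rho_le hK.1).exists_bound_of_continuousOn
    (g.continuous_dist q).continuousOn
  have hK0 : 0 < K := A.R₀_pos.trans hK.1
  refine ⟨max C 0, le_max_right _ _, fun z ↦ ?_⟩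
  have hz0 : 0 < A.rho z := A.R₀_pos.trans_le (A.R₀_le_rho z)
  have hb : ∀ y, A.rho y ≤ K → g.dist q y ≤ max C 0 := fun y hy ↦
    (le_abs_self _).trans ((hC y hy).trans (le_max_left _ _))
  rcases le_total (A.rho z) K with hz | hz
  · have := hb z hz
    nlinarith
  · have h1 := hb (A.Φ (K, A.link z)) (by rw [A.rho_Φ hK.1])
    have h2 := A.dist_Φ_radial_le hK hη le_rfl hz (A.link z)
    rw [A.Φ_rho_link (hK.1.trans_le hz)] at h2
    have h3 := g.dist_triangle q (A.Φ (K, A.link z)) z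
    nlinarith

/-- Follow a curve from z to x after the last time T at which ρ ≤ K. From then on it is in the conic
region, where ρ grows at most at the rate L / (1 − η), and the mean value theorem applies. -/
theorem mul_rho_sub_le_dist {η K : ℝ} (hK : A.IsConicFrom η K) (hη1 : η < 1) {x z : Z}
    (hz : A.rho z ≤ K) : (1 - η) * (A.rho x - K) ≤ g.dist x z := by
  rcases le_or_gt (A.rho x) K with hx | hx
  · exact (mul_nonpos_of_nonneg_of_nonpos (by linarith) (by linarith)).trans (g.dist_nonneg _ _)
  refine le_of_forall_gt_imp_ge_of_dense fun L hL ↦ ?_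
  have hL0 : 0 ≤ L := (g.dist_nonneg x z).trans hL.le
  rw [g.dist_comm] at hL
  obtain ⟨γ, hγ, h0, h1, hl⟩ := g.exists_curve_speed_le (g.edist_lt_ofReal hL)
  have hc : Continuous fun t ↦ A.rho (γ t) := A.continuous_rho.comp hγ.continuous
  have hcl : IsCompact (Icc 0 1 ∩ {t | A.rho (γ t) ≤ K}) :=
    isCompact_Icc.inter_right (isClosed_le hc continuous_const)
  obtain ⟨T, ⟨hT1, hTK : A.rho (γ T) ≤ K⟩, hTmax⟩ := hcl.exists_isMaxOn
    ⟨0, ⟨le_rfl, zero_le_one⟩, by change A.rho (γ 0) ≤ K; rwa [h0]⟩ continuousOn_id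
  have hT : T < 1 := lt_of_le_of_ne hT1.2 fun h ↦ by
    rw [h, h1] at hTK
    exact hTK.not_gt hx
  have hgt : ∀ t ∈ Ioo T 1, K ≤ A.rho (γ t) := fun t ht ↦ by
    by_contra! hlt
    exact (hTmax ⟨⟨hT1.1.trans ht.1.le, ht.2.le⟩, hlt.le⟩).not_gt ht.1
  have hd : ∀ t, ∃ r', t ∈ Ioo T 1 → HasDerivAt (A.rho ∘ γ) r' t ∧ (1 - η) * r' ≤ L := by
    intro t
    by_cases ht : t ∈ Ioo T 1
    · obtain ⟨r', h2, h3⟩ := A.hasDerivAt_rho_le_sq_speed hK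
        ((hγ t).mdifferentiableAt one_ne_zero) (hgt t ht)
      refine ⟨r', fun _ ↦ ⟨h2, abs_le_of_sq_le_sq' ?_ hL0 |>.2⟩⟩
      have h4 : g.speed γ t ^ 2 ≤ L ^ 2 := pow_le_pow_left₀ (g.speed_nonneg _ _) (hl t) 2
      rw [mul_pow]
      nlinarith [mul_nonneg (_root_.sq_nonneg (1 - η))
        (_root_.sq_nonneg (A.rho (γ t) * κ.speed (A.link ∘ γ) t))]
    · exact ⟨0, fun h ↦ (ht h).elim⟩
  choose r' hr' using hd
  obtain ⟨c, hcm, hcs⟩ := exists_hasDerivAt_eq_slope (A.rho ∘ γ) r' hT hc.continuousOn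
    fun t ht ↦ (hr' t ht).1
  have h5 := (hr' c hcm).2
  rw [eq_div_iff (by linarith)] at hcs
  simp only [Function.comp_apply, h1] at hcs
  nlinarith [mul_le_mul_of_nonneg_right h5 (sub_nonneg.2 hT.le), hT1.1,
    mul_nonneg (sub_nonneg.2 hη1.le) (sub_nonneg.2 hTK), mul_nonneg hL0 hT1.1]

end Connected

end ACStructure

/-! ### Plane polar coordinates and the distance of the cone -/

/-- The distance of the points with polar coordinates `(r, 0)` and `(s, a)` in the plane. -/
noncomputable def polarDist (r s a : ℝ) : ℝ := √(r ^ 2 + s ^ 2 - 2 * r * s * Real.cos a)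

section

variable (r s a : ℝ)

/-- The law of cosines. It reduces the Lipschitz bounds in the radii to the triangle inequality in
ℂ. -/
theorem polarDist_eq_norm : polarDist r s a = ‖s * Complex.exp (a * Complex.I) - r‖ := by
  rw [polarDist, Complex.norm_def, Complex.normSq_apply]
  congr 1
  simp only [Complex.sub_re, Complex.re_ofReal_mul, Complex.exp_ofReal_mul_I_re, Complex.ofReal_re,
    Complex.sub_im, Complex.im_ofReal_mul, Complex.exp_ofReal_mul_I_im, Complex.ofReal_im]
  nlinarith [Real.sin_sq_add_cos_sq a]

theorem polarDist_comm : polarDist r s a = polarDist s r a := by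
  unfold polarDist
  congr 1
  ring

theorem polarDist_nonneg : 0 ≤ polarDist r s a := Real.sqrt_nonneg _

theorem sq_polarDist : polarDist r s a ^ 2 = r ^ 2 + s ^ 2 - 2 * r * s * Real.cos a :=
  Real.sq_sqrt (by
    nlinarith [_root_.sq_nonneg (r - s * Real.cos a), Real.sin_sq_add_cos_sq a,
      _root_.sq_nonneg (s * Real.sin a)])

theorem abs_polarDist_sub_le (r' : ℝ) : |polarDist r s a - polarDist r' s a| ≤ |r - r'| := by
  rw [polarDist_eq_norm, polarDist_eq_norm]
  refine (abs_norm_sub_norm_le _ _).trans ?_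
  rw [sub_sub_sub_cancel_left, ← Complex.ofReal_sub, Complex.norm_real, Real.norm_eq_abs,
    abs_sub_comm]

theorem abs_polarDist_sub_le' (s' : ℝ) : |polarDist r s a - polarDist r s' a| ≤ |s - s'| := by
  rw [polarDist_comm r s, polarDist_comm r s']
  exact abs_polarDist_sub_le s r a s'

variable {r s}

theorem polarDist_zero_left (hs : 0 ≤ s) : polarDist 0 s a = s := by
  simp [polarDist, Real.sqrt_sq hs]

theorem polarDist_le_add (hr : 0 ≤ r) (hs : 0 ≤ s) : polarDist r s a ≤ r + s :=
  abs_le_of_sq_le_sq' (by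
    rw [sq_polarDist]
    nlinarith [mul_nonneg (mul_nonneg hr hs) (neg_le_iff_add_nonneg'.1 (Real.neg_one_le_cos a))])
    (by positivity) |>.2

theorem sub_le_polarDist (hr : 0 ≤ r) (hs : 0 ≤ s) : s - r ≤ polarDist r s a :=
  abs_le_of_sq_le_sq' (by
    rw [sq_polarDist]
    nlinarith [mul_nonneg (mul_nonneg hr hs) (sub_nonneg.2 (Real.cos_le_one a))])
    (polarDist_nonneg r s a) |>.2

theorem polarDist_pi (hr : 0 ≤ r) (hs : 0 ≤ s) : polarDist r s Real.pi = r + s := by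
  rw [polarDist, Real.cos_pi, show r ^ 2 + s ^ 2 - 2 * r * s * -1 = (r + s) ^ 2 by ring,
    Real.sqrt_sq (by positivity)]

theorem continuous_polarDist (r s : ℝ) : Continuous (polarDist r s) := by
  unfold polarDist
  fun_prop

end

/-- A curve given in polar coordinates bounds the distance of its end points. -/
theorem polarDist_le_of_curve {ρ φ ρ' φ' : ℝ → ℝ} {L : ℝ} (hρ : ∀ t ∈ Icc (0 : ℝ) 1,
    HasDerivAt ρ (ρ' t) t) (hφ : ∀ t ∈ Icc (0 : ℝ) 1, HasDerivAt φ (φ' t) t) (hφ0 : φ 0 = 0)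
    (hL : 0 ≤ L) (h : ∀ t ∈ Icc (0 : ℝ) 1, ρ' t ^ 2 + (ρ t * φ' t) ^ 2 ≤ L ^ 2) :
    polarDist (ρ 0) (ρ 1) (φ 1) ≤ L := by
  have hd : ∀ t ∈ Icc (0 : ℝ) 1, HasDerivAt (fun t ↦ (ρ t : ℂ) * Complex.exp (φ t * Complex.I))
      (ρ' t * Complex.exp (φ t * Complex.I) +
        ρ t * (Complex.exp (φ t * Complex.I) * (φ' t * Complex.I))) t := fun t ht ↦
    ((hρ t ht).ofReal_comp).mul (((hφ t ht).ofReal_comp.mul_const Complex.I).cexp)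
  have := norm_image_sub_le_of_norm_deriv_le_segment' (C := L)
    (fun t ht ↦ (hd t ht).hasDerivWithinAt) (fun t ht ↦ ?_) 1 ⟨zero_le_one, le_rfl⟩
  · rw [polarDist_eq_norm]
    simpa [hφ0] using this
  · have e : (ρ' t * Complex.exp (φ t * Complex.I) +
        ρ t * (Complex.exp (φ t * Complex.I) * (φ' t * Complex.I)) : ℂ) =
        Complex.exp (φ t * Complex.I) * ((ρ' t : ℝ) + (ρ t * φ' t : ℝ) * Complex.I) := by
      push_cast
      ring
    rw [e, norm_mul, Complex.norm_exp_ofReal_mul_I, one_mul, Complex.norm_add_mul_I]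
    exact (Real.sqrt_le_left hL).2 (h t ⟨ht.1, ht.2.le⟩)

namespace Mfd.Metric

variable {M : Mfd.{u}} (g : M.Metric)

theorem angle_nonneg (x y : M) : 0 ≤ g.angle x y := ENNReal.toReal_nonneg

theorem angle_le_pi (x y : M) : g.angle x y ≤ Real.pi :=
  ENNReal.toReal_le_of_le_ofReal Real.pi_pos.le (min_le_right _ _)

theorem angle_le {x y : M} {L : ℝ} (hL : 0 ≤ L) (h : g.edist x y ≤ ENNReal.ofReal L) :
    g.angle x y ≤ L := ENNReal.toReal_le_of_le_ofReal hL ((min_le_left _ _).trans h)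

theorem edist_lt_of_angle_lt {x y : M} {L : ℝ} (h : g.angle x y < L) (hL : L ≤ Real.pi) :
    g.edist x y < ENNReal.ofReal L := by
  have h1 : min (g.edist x y) (ENNReal.ofReal Real.pi) < ENNReal.ofReal L :=
    (ENNReal.lt_ofReal_iff_toReal_lt (ne_top_of_le_ne_top ENNReal.ofReal_ne_top
      (min_le_right _ _))).2 h
  exact (min_lt_iff.1 h1).resolve_right fun h ↦ (ENNReal.ofReal_le_ofReal hL).not_gt h

end Mfd.Metric

namespace ACStructure

variable {Z F : Mfd.{u}} {g : Z.Metric} {κ : F.Metric} {ν : ℝ} (A : ACStructure g κ ν)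

/-- The distance of the images of two points in the cone. -/
noncomputable def coneDist (x y : Z) : ℝ :=
  polarDist (A.rho x) (A.rho y) (κ.angle (A.link x) (A.link y))

theorem coneDist_le_add (x y : Z) : A.coneDist x y ≤ A.rho x + A.rho y :=
  polarDist_le_add _ (A.R₀_pos.le.trans (A.R₀_le_rho x)) (A.R₀_pos.le.trans (A.R₀_le_rho y))

/-- Develop the curve into the plane, with ρ as radius and the arc length of the link curve as
angle. -/
theorem coneDist_le_of_curve {η K L : ℝ} (hK : A.IsConicFrom η K) (hη1 : η < 1) {γ : ℝ → Z}
    (hγ : ContMDiff 𝓘(ℝ, ℝ) Z.I 1 γ) (hl : ∀ t, g.speed γ t ≤ L)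
    (hγK : ∀ t ∈ Icc (0 : ℝ) 1, K ≤ A.rho (γ t)) :
    (1 - η) * A.coneDist (γ 0) (γ 1) ≤ L := by
  have hL : 0 ≤ L := (g.speed_nonneg γ 0).trans (hl 0)
  have hη' : 0 < 1 - η := by linarith
  have hlink : ∀ t ∈ Icc (0 : ℝ) 1, ContMDiffAt 𝓘(ℝ, ℝ) F.I 1 (A.link ∘ γ) t := fun t ht ↦
    ((A.contMDiffAt_link (hK.1.trans_le (hγK t ht))).of_le (by simp)).comp t (hγ t)
  have hs : ContinuousOn (κ.speed (A.link ∘ γ)) (Icc 0 1) := fun t ht ↦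
    (κ.continuousAt_speed (hlink t ht)).continuousWithinAt
  -- The speed is extended by constants beyond [0, 1], so that its integral is differentiable at the
  -- end points too.
  obtain ⟨s, hsc, hse, hs0⟩ : ∃ s : ℝ → ℝ, Continuous s ∧
      (∀ t ∈ Icc (0 : ℝ) 1, s t = κ.speed (A.link ∘ γ) t) ∧ ∀ t, 0 ≤ s t :=
    ⟨IccExtend zero_le_one ((Icc 0 1).domRestrict (κ.speed (A.link ∘ γ))),
      (continuousOn_iff_continuous_domRestrict.1 hs).Icc_extend', fun t ht ↦
      IccExtend_of_mem _ _ ht, fun t ↦ κ.speed_nonneg _ _⟩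
  have hφ : ∀ t, HasDerivAt (fun t ↦ ∫ u in (0 : ℝ)..t, s u) (s t) t := fun t ↦
    intervalIntegral.integral_hasDerivAt_right (hsc.intervalIntegrable _ _)
      hsc.stronglyMeasurable.stronglyMeasurableAtFilter hsc.continuousAt
  have hA0 : 0 ≤ ∫ u in (0 : ℝ)..1, s u :=
    intervalIntegral.integral_nonneg zero_le_one fun t _ ↦ hs0 t
  have ha : κ.angle (A.link (γ 0)) (A.link (γ 1)) ≤ ∫ u in (0 : ℝ)..1, s u :=
    κ.angle_le hA0 (κ.edist_le_ofReal zero_le_one hlink hsc.continuousOn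
      (fun t ht ↦ (hse t ⟨ht.1.le, ht.2.le⟩).ge) rfl rfl)
  -- The arc length may exceed the truncated angle; multiplying it by k ≤ 1 makes the plane curve
  -- end at the right angle and does not increase its speed.
  obtain ⟨k, hk0, hk1, hk⟩ : ∃ k : ℝ, 0 ≤ k ∧ k ≤ 1 ∧
      k * ∫ u in (0 : ℝ)..1, s u = κ.angle (A.link (γ 0)) (A.link (γ 1)) := by
    have ha0 := κ.angle_nonneg (A.link (γ 0)) (A.link (γ 1))
    rcases hA0.eq_or_lt with h | h
    · exact ⟨1, zero_le_one, le_rfl, by rw [← h] at ha ⊢; linarith⟩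
    · exact ⟨_ / _, div_nonneg ha0 hA0, (div_le_one h).2 ha, div_mul_cancel₀ _ h.ne'⟩
  have hρ : ∀ t, ∃ r', t ∈ Icc (0 : ℝ) 1 → HasDerivAt (A.rho ∘ γ) r' t ∧ (1 - η) ^ 2 *
      (r' ^ 2 + (A.rho (γ t) * κ.speed (A.link ∘ γ) t) ^ 2) ≤ g.speed γ t ^ 2 := by
    intro t
    by_cases ht : t ∈ Icc (0 : ℝ) 1
    · obtain ⟨r', h⟩ := A.hasDerivAt_rho_le_sq_speed hK
        ((hγ t).mdifferentiableAt one_ne_zero) (hγK t ht)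
      exact ⟨r', fun _ ↦ h⟩
    · exact ⟨0, fun h ↦ (ht h).elim⟩
  choose ρ' hρ' using hρ
  have key := polarDist_le_of_curve (ρ := A.rho ∘ γ) (φ := fun t ↦ k * ∫ u in (0 : ℝ)..t, s u)
    (φ' := fun t ↦ k * s t) (L := L / (1 - η)) (fun t ht ↦ (hρ' t ht).1)
    (fun t _ ↦ (hφ t).const_mul k) (by simp) (by positivity) (fun t ht ↦ by
      have h1 := (hρ' t ht).2.trans (pow_le_pow_left₀ (g.speed_nonneg _ _) (hl t) 2)
      rw [div_pow, le_div_iff₀ (by positivity), mul_comm]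
      refine le_trans ?_ h1
      rw [← hse t ht, Function.comp_apply]
      have hk2 : k ^ 2 ≤ 1 := pow_le_one₀ hk0 hk1
      have : (A.rho (γ t) * (k * s t)) ^ 2 ≤ (A.rho (γ t) * s t) ^ 2 := by
        nlinarith [mul_nonneg (_root_.sq_nonneg (A.rho (γ t) * s t)) (sub_nonneg.2 hk2)]
      gcongr)
  simp only [hk] at key
  rw [mul_comm]
  exact (le_div_iff₀ hη').1 key

/-- A curve which stays in ρ ≥ K can be developed. One which enters ρ < K has length at least (1 −
η)(ρ(x) + ρ(y) − 2K), while the cone distance never exceeds ρ(x) + ρ(y). -/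
theorem exists_coneDist_le [ConnectedSpace Z] {η K : ℝ} (hK : A.IsConicFrom η K) (hη : 0 < η)
    (hη1 : η < 1) (x y : Z) :
    A.coneDist x y ≤ g.dist x y + η * (A.rho x + A.rho y) + 2 * K := by
  have hK0 : 0 < K := A.R₀_pos.trans hK.1
  have hE := A.coneDist_le_add x y
  refine le_of_forall_pos_le_add fun e he ↦ ?_
  obtain ⟨L, hL⟩ : ∃ L, L = g.dist x y + e := ⟨_, rfl⟩
  have hL' : g.dist x y < L := by linarith
  have hL0 : 0 ≤ L := (g.dist_nonneg x y).trans hL'.le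
  obtain ⟨γ, hγ, h0, h1, hl⟩ := g.exists_curve_speed_le (g.edist_lt_ofReal hL')
  by_cases hγK : ∀ t ∈ Icc (0 : ℝ) 1, K ≤ A.rho (γ t)
  · have := A.coneDist_le_of_curve hK hη1 hγ hl hγK
    rw [h0, h1] at this
    nlinarith [mul_le_mul_of_nonneg_left hE hη.le]
  · push Not at hγK
    obtain ⟨t, ht, htK⟩ := hγK
    have d1 := g.dist_le_of_speed_le ht.1 (fun s _ ↦ hγ s) hL0 fun s _ ↦ hl s
    have d2 := g.dist_le_of_speed_le ht.2 (fun s _ ↦ hγ s) hL0 fun s _ ↦ hl s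
    rw [h0] at d1
    rw [h1, g.dist_comm] at d2
    have e1 := A.mul_rho_sub_le_dist hK hη1 (x := x) htK.le
    have e2 := A.mul_rho_sub_le_dist hK hη1 (x := y) htK.le
    nlinarith [mul_pos hK0 hη]

end ACStructure

/-- A segment of the plane which does not meet the origin, in polar coordinates. -/
theorem exists_polar_segment {r s Θ : ℝ} (hr : 0 < r) (hs : 0 < s) (hΘ : 0 < Θ)
    (hΘ' : Θ < Real.pi) : ∃ R φ R' φ' : ℝ → ℝ, (∀ t ∈ Icc (0 : ℝ) 1, 0 < R t ∧ ContDiffAt ℝ 1 R t ∧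
      ContDiffAt ℝ 1 φ t ∧ HasDerivAt R (R' t) t ∧ HasDerivAt φ (φ' t) t ∧ 0 ≤ φ' t ∧
      R' t ^ 2 + (R t * φ' t) ^ 2 = polarDist r s Θ ^ 2) ∧ ContinuousOn φ' (Icc 0 1) ∧
      R 0 = r ∧ R 1 = s ∧ φ 0 = 0 ∧ φ 1 = Θ := by
  have hsin : 0 < Real.sin Θ := Real.sin_pos_of_pos_of_lt_pi hΘ hΘ'
  obtain ⟨d, hd⟩ : ∃ d : ℂ, d = s * Complex.exp (Θ * Complex.I) - r := ⟨_, rfl⟩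
  obtain ⟨w, hw⟩ : ∃ w : ℝ → ℂ, w = fun t : ℝ ↦ (r : ℂ) + t * d := ⟨_, rfl⟩
  have hdre : d.re = s * Real.cos Θ - r := by
    simp [hd, Complex.exp_ofReal_mul_I_re]
  have hdim : d.im = s * Real.sin Θ := by
    simp [hd, Complex.exp_ofReal_mul_I_im]
  have hwre : ∀ t, (w t).re = r + t * d.re := fun t ↦ by simp [hw]
  have hwim : ∀ t, (w t).im = t * d.im := fun t ↦ by simp [hw]
  -- As 0 < Θ < π, the segment starts on the positive axis and then stays in the upper half plane,
  -- so the principal logarithm supplies its polar coordinates.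
  have hslit : ∀ t ∈ Icc (0 : ℝ) 1, w t ∈ Complex.slitPlane := by
    intro t ht
    rcases ht.1.eq_or_lt with h | h
    · left
      rw [hwre, ← h]
      simpa using hr
    · right
      rw [hwim, hdim]
      positivity
  have hw' : ∀ t, HasDerivAt w d t := fun t ↦ by
    rw [hw]
    simpa using (((hasDerivAt_id t).ofReal_comp).mul_const d).const_add (r : ℂ)
  have hlog : ∀ t ∈ Icc (0 : ℝ) 1, HasDerivAt (fun t ↦ Complex.log (w t)) (d / w t) t :=
    fun t ht ↦ (hw' t).clog_real (hslit t ht)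
  have hwc : ContDiff ℝ 1 w := by
    rw [hw]
    exact contDiff_const.add ((Complex.ofRealCLM.contDiff).mul contDiff_const)
  have hlogc : ∀ t ∈ Icc (0 : ℝ) 1, ContDiffAt ℝ 1 (fun t ↦ Complex.log (w t)) t := fun t ht ↦
    ((Complex.contDiffAt_log (hslit t ht)).restrict_scalars ℝ).comp t hwc.contDiffAt
  have hre : ∀ t ∈ Icc (0 : ℝ) 1, HasDerivAt (fun t ↦ (Complex.log (w t)).re) (d / w t).re t :=
    fun t ht ↦ (Complex.reCLM.hasFDerivAt.comp_hasDerivAt t (hlog t ht))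
  have him : ∀ t ∈ Icc (0 : ℝ) 1, HasDerivAt (fun t ↦ (Complex.log (w t)).im) (d / w t).im t :=
    fun t ht ↦ (Complex.imCLM.hasFDerivAt.comp_hasDerivAt t (hlog t ht))
  have hne : ∀ t ∈ Icc (0 : ℝ) 1, w t ≠ 0 := fun t ht ↦ Complex.slitPlane_ne_zero (hslit t ht)
  have hR : ∀ t ∈ Icc (0 : ℝ) 1, Real.exp (Complex.log (w t)).re = ‖w t‖ := fun t ht ↦ by
    rw [Complex.log_re, Real.exp_log (norm_pos_iff.2 (hne t ht))]
  refine ⟨fun t ↦ Real.exp (Complex.log (w t)).re, fun t ↦ (Complex.log (w t)).im,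
    fun t ↦ Real.exp (Complex.log (w t)).re * (d / w t).re, fun t ↦ (d / w t).im,
    fun t ht ↦ ⟨Real.exp_pos _, ?_, ?_, (hre t ht).exp, him t ht, ?_, ?_⟩, ?_, ?_, ?_, ?_, ?_⟩
  · exact (Complex.reCLM.contDiff.contDiffAt.comp t (hlogc t ht)).exp
  · exact Complex.imCLM.contDiff.contDiffAt.comp t (hlogc t ht)
  · have e : (d / w t).im = r * (s * Real.sin Θ) / Complex.normSq (w t) := by
      rw [Complex.div_im, hwre, hwim, hdim]
      ring
    simp only [e]
    exact div_nonneg (by positivity) (Complex.normSq_nonneg _)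
  · have e : (d / w t).re ^ 2 + (d / w t).im ^ 2 = ‖d‖ ^ 2 / ‖w t‖ ^ 2 := by
      rw [← div_pow, ← norm_div, ← Complex.normSq_eq_norm_sq, Complex.normSq_apply]
      ring
    have hpos : 0 < ‖w t‖ := norm_pos_iff.2 (hne t ht)
    simp only [hR t ht]
    rw [mul_pow, mul_pow, ← mul_add, e, polarDist_eq_norm, ← hd]
    field_simp
  · refine Complex.continuous_im.comp_continuousOn
      (continuousOn_const.div hwc.continuous.continuousOn fun t ht ↦ hne t ht)
  · simp only [hR 0 ⟨le_rfl, zero_le_one⟩]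
    simp [hw, abs_of_pos hr]
  · simp only [hR 1 ⟨zero_le_one, le_rfl⟩]
    simp [hw, hd, Complex.norm_exp_ofReal_mul_I, abs_of_pos hs]
  · simp [hw, Complex.log_im, Complex.arg_ofReal_of_nonneg hr.le]
  · have := Complex.arg_mul_cos_add_sin_mul_I hs ⟨by linarith [Real.pi_pos], hΘ'.le⟩
    simp only [Complex.log_im]
    refine Eq.trans ?_ this
    rw [hw, hd, Complex.exp_mul_I]
    simp

namespace ACStructure

variable {Z F : Mfd.{u}} {g : Z.Metric} {κ : F.Metric} {ν : ℝ} (A : ACStructure g κ ν)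

/-- Moving a plane curve outwards by K adds at most K φ' to its speed. -/
theorem sqrt_add_mul_le {R' R φ' E K : ℝ} (hR : 0 ≤ R) (hφ : 0 ≤ φ') (hK : 0 ≤ K) (hE : 0 ≤ E)
    (h : R' ^ 2 + (R * φ') ^ 2 = E ^ 2) {σ : ℝ} (hσ : 0 ≤ σ) (hσφ : σ ≤ φ') :
    √(R' ^ 2 + ((R + K) * σ) ^ 2) ≤ E + K * φ' := by
  refine Real.sqrt_le_iff.2 ⟨by positivity, ?_⟩
  have h1 : R * φ' ≤ E := abs_le_of_sq_le_sq' (by nlinarith [_root_.sq_nonneg R']) hE |>.2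
  have h2 : ((R + K) * σ) ^ 2 ≤ ((R + K) * φ') ^ 2 := by gcongr
  nlinarith [mul_nonneg hK hφ, mul_le_mul_of_nonneg_right h1 (mul_nonneg hK hφ)]

/-- The plane segment is lifted to the end, with radius shifted by K so that it stays in the conic
region, while the link runs through a curve from f to f' of speed at most Θ, timed by φ/Θ. The shift
costs K Θ. -/
theorem dist_Φ_le {η K : ℝ} (hK : A.IsConicFrom η K) (hη : 0 ≤ η) {r s Θ : ℝ} (hr : 0 < r)
    (hs : 0 < s) (hΘ : 0 < Θ) (hΘ' : Θ < Real.pi) {f f' : F}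
    (h : κ.edist f f' < ENNReal.ofReal Θ) :
    g.dist (A.Φ (r + K, f)) (A.Φ (s + K, f')) ≤ (1 + η) * (polarDist r s Θ + K * Θ) := by
  have hK0 : 0 < K := A.R₀_pos.trans hK.1
  obtain ⟨c, hc, hc0, hc1, hcl⟩ := κ.exists_curve_speed_le h
  obtain ⟨R, φ, R', φ', hp, hφc, hR0, hR1, hφ0, hφ1⟩ := exists_polar_segment hr hs hΘ hΘ'
  have hE : 0 ≤ polarDist r s Θ := polarDist_nonneg _ _ _
  have hint : ∫ t in (0 : ℝ)..1, φ' t = Θ := by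
    rw [intervalIntegral.integral_eq_sub_of_hasDerivAt (f := φ), hφ1, hφ0, sub_zero]
    · intro t ht
      rw [uIcc_of_le zero_le_one] at ht
      exact (hp t ht).2.2.2.2.1
    · refine ContinuousOn.intervalIntegrable ?_
      rwa [uIcc_of_le zero_le_one]
  have hφi : IntervalIntegrable φ' MeasureTheory.volume 0 1 :=
    ContinuousOn.intervalIntegrable (by rwa [uIcc_of_le zero_le_one])
  refine g.dist_le (by positivity) ((g.edist_le_ofReal (γ := fun t ↦ A.Φ (R t + K, c (φ t / Θ)))
    (v := fun t ↦ (1 + η) * (polarDist r s Θ + K * φ' t)) zero_le_one (fun t ht ↦ ?_)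
    (by fun_prop) (fun t ht ↦ ?_) (by simp [hR0, hφ0, hc0])
    (by simp [hR1, hφ1, hc1, hΘ.ne'])).trans (le_of_eq ?_))
  · obtain ⟨h0, h1, h2, -⟩ := hp t ht
    refine A.contMDiffAt_Φ_curve (a := fun t ↦ R t + K) (c := fun t ↦ c (φ t / Θ))
      (hK.1.trans (lt_add_of_pos_left K h0)) (h1.add contDiffAt_const)
      (ContMDiffAt.comp t (g := c) (f := fun t ↦ φ t / Θ) (hc _) (h2.div_const Θ).contMDiffAt)
  · obtain ⟨h0, -, -, h1, h2, h3, h4⟩ := hp t ⟨ht.1.le, ht.2.le⟩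
    have hcd := (hc (φ t / Θ)).mdifferentiableAt one_ne_zero
    refine (A.speed_Φ_curve_le hK hη (a := fun t ↦ R t + K) (c := c ∘ fun t ↦ φ t / Θ)
      (lt_add_of_pos_left K h0).le (h1.add_const K) (hcd.comp (f := fun t ↦ φ t / Θ) t
        (h2.div_const Θ).differentiableAt.mdifferentiableAt)).trans ?_
    have hsp := κ.speed_comp (σ := fun t ↦ φ t / Θ) hcd (h2.div_const Θ)
    refine mul_le_mul_of_nonneg_left (sqrt_add_mul_le h0.le h3 hK0.le hE h4 (κ.speed_nonneg _ _)
      ?_) (by positivity)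
    rw [hsp, abs_of_nonneg (by positivity)]
    refine (mul_le_mul_of_nonneg_left (hcl _) (by positivity)).trans (le_of_eq ?_)
    field_simp
  · rw [intervalIntegral.integral_const_mul, intervalIntegral.integral_add
      (continuous_const.intervalIntegrable 0 1) (hφi.const_mul K), intervalIntegral.integral_const_mul,
      hint, intervalIntegral.integral_const]
    simp

/-- Move both points outwards by K along their rays, apply `dist_Φ_le`, and let Θ decrease to the
angle. -/
theorem dist_le_of_angle_lt_pi [ConnectedSpace Z] {η K : ℝ} (hK : A.IsConicFrom η K) (hη : 0 ≤ η)
    {x y : Z} (hx : K ≤ A.rho x) (hy : K ≤ A.rho y)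
    (h : κ.angle (A.link x) (A.link y) < Real.pi) :
    g.dist x y ≤ (1 + η) * (A.coneDist x y + K * Real.pi + 2 * K) := by
  have hK0 : 0 < K := A.R₀_pos.trans hK.1
  have hx' := A.Φ_rho_link (hK.1.trans_le hx)
  have hy' := A.Φ_rho_link (hK.1.trans_le hy)
  have key : ∀ Θ ∈ Ioo (κ.angle (A.link x) (A.link y)) Real.pi,
      g.dist x y ≤ (1 + η) * (polarDist (A.rho x) (A.rho y) Θ + K * Real.pi + 2 * K) := by
    intro Θ hΘ
    have hΘ0 := (κ.angle_nonneg _ _).trans_lt hΘ.1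
    have h1 := A.dist_Φ_le hK hη (hK0.trans_le hx) (hK0.trans_le hy) hΘ0 hΘ.2
      (κ.edist_lt_of_angle_lt hΘ.1 hΘ.2.le)
    have h2 := A.dist_Φ_radial_le hK hη hx (le_add_of_nonneg_right hK0.le) (A.link x)
    have h3 := A.dist_Φ_radial_le hK hη hy (le_add_of_nonneg_right hK0.le) (A.link y)
    rw [hx'] at h2
    rw [hy'] at h3
    have t1 := g.dist_triangle x (A.Φ (A.rho x + K, A.link x)) y
    have t2 := g.dist_triangle (A.Φ (A.rho x + K, A.link x)) (A.Φ (A.rho y + K, A.link y)) y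
    rw [g.dist_comm (A.Φ (A.rho y + K, A.link y)) y] at t2
    have h4 : (1 + η) * (K * Θ) ≤ (1 + η) * (K * Real.pi) := by
      have := hΘ.2.le
      gcongr
    nlinarith
  refine ge_of_tendsto (x := 𝓝[>] κ.angle (A.link x) (A.link y)) (f := fun Θ ↦
    (1 + η) * (polarDist (A.rho x) (A.rho y) Θ + K * Real.pi + 2 * K)) ?_
    (by filter_upwards [Ioo_mem_nhdsGT h] with Θ hΘ using key Θ hΘ)
  have hcont := continuous_polarDist (A.rho x) (A.rho y)
  have : Continuous fun Θ ↦ (1 + η) * (polarDist (A.rho x) (A.rho y) Θ + K * Real.pi + 2 * K) := by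
    fun_prop
  exact (this.tendsto _).mono_left nhdsWithin_le_nhds

/-- If a point lies in ρ ≤ K or the angle is π, the cone distance is ρ(x) + ρ(y) up to 2K, and a
detour through a fixed point is good enough. Otherwise the segment of `dist_le_of_angle_lt_pi` is
available. -/
theorem exists_dist_le_coneDist [ConnectedSpace Z] [Nonempty Z] {η K : ℝ} (hK : A.IsConicFrom η K)
    (hη : 0 ≤ η) : ∃ C, ∀ x y, g.dist x y ≤ A.coneDist x y + η * (A.rho x + A.rho y) + C := by
  obtain ⟨C, hC0, hC⟩ := A.exists_dist_le_rho hK hη (Classical.arbitrary Z)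
  have hK0 : 0 < K := A.R₀_pos.trans hK.1
  have hpi := Real.pi_pos
  have hD : ∀ x y, g.dist x y ≤ (1 + η) * (A.rho x + A.rho y) + 2 * C := fun x y ↦ by
    have := g.dist_triangle x (Classical.arbitrary Z) y
    rw [g.dist_comm x (Classical.arbitrary Z)] at this
    nlinarith [hC x, hC y]
  have hpos : ∀ x, 0 ≤ A.rho x := fun x ↦ A.R₀_pos.le.trans (A.R₀_le_rho x)
  refine ⟨2 * C + 2 * K + (1 + η) * (K * Real.pi + 2 * K), fun x y ↦ ?_⟩
  have hp : 0 ≤ (1 + η) * (K * Real.pi + 2 * K) := by positivity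
  rcases le_or_gt (A.rho x) K with hx | hx
  · have h1 : A.rho y - A.rho x ≤ A.coneDist x y := sub_le_polarDist _ (hpos x) (hpos y)
    linarith [hD x y]
  rcases le_or_gt (A.rho y) K with hy | hy
  · have h1 : A.rho x - A.rho y ≤ A.coneDist x y := by
      rw [coneDist, polarDist_comm]
      exact sub_le_polarDist _ (hpos y) (hpos x)
    linarith [hD x y]
  rcases (κ.angle_le_pi (A.link x) (A.link y)).eq_or_lt with h | h
  · have h1 : A.coneDist x y = A.rho x + A.rho y := by
      rw [coneDist, h, polarDist_pi (hpos x) (hpos y)]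
    linarith [hD x y]
  · have h1 := A.dist_le_of_angle_lt_pi hK hη hx.le hy.le h
    have h2 := mul_le_mul_of_nonneg_left (A.coneDist_le_add x y) hη
    linarith

/-- At large scales, the distance of an asymptotically conic manifold is the one of its cone. -/
theorem exists_abs_coneDist_sub_dist_le [ConnectedSpace Z] {η : ℝ} (hη : 0 < η) (hη1 : η < 1) :
    ∃ C, 0 ≤ C ∧ ∀ x y, |A.coneDist x y - g.dist x y| ≤ η * (A.rho x + A.rho y) + C := by
  obtain ⟨K, hK⟩ := A.exists_isConicFrom hη hη1
  have hK0 : 0 < K := A.R₀_pos.trans hK.1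
  obtain ⟨C, hC⟩ := A.exists_dist_le_coneDist hK hη.le
  refine ⟨max C (2 * K), le_max_of_le_right (by positivity), fun x y ↦ abs_le.2 ⟨?_, ?_⟩⟩
  · linarith [hC x y, le_max_left C (2 * K)]
  · linarith [A.exists_coneDist_le hK hη hη1 x y, le_max_right C (2 * K)]

end ACStructure

/-! ### The cone over the suspension as a product of cones -/

theorem abs_sqrt_sub_sqrt_le (a b c d : ℝ) :
    |√(a ^ 2 + b ^ 2) - √(c ^ 2 + d ^ 2)| ≤ |a - c| + |b - d| := by
  have h := abs_norm_sub_norm_le (a + b * Complex.I : ℂ) (c + d * Complex.I)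
  rw [Complex.norm_add_mul_I, Complex.norm_add_mul_I] at h
  refine h.trans ((Complex.norm_le_abs_re_add_abs_im _).trans (le_of_eq ?_))
  simp

theorem sqrt_mul_sq_add_mul_sq {c : ℝ} (hc : 0 ≤ c) (a b : ℝ) :
    √((c * a) ^ 2 + (c * b) ^ 2) = c * √(a ^ 2 + b ^ 2) := by
  rw [mul_pow, mul_pow, ← mul_add, Real.sqrt_mul (_root_.sq_nonneg c), Real.sqrt_sq hc]

theorem polarDist_mul {c : ℝ} (hc : 0 ≤ c) (r s a : ℝ) :
    polarDist (c * r) (c * s) a = c * polarDist r s a := by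
  unfold polarDist
  rw [show (c * r) ^ 2 + (c * s) ^ 2 - 2 * (c * r) * (c * s) * Real.cos a =
    c ^ 2 * (r ^ 2 + s ^ 2 - 2 * r * s * Real.cos a) by ring, Real.sqrt_mul (_root_.sq_nonneg c),
    Real.sqrt_sq hc]

theorem polarDist_zero (r s : ℝ) : polarDist r s 0 = |r - s| := by
  rw [polarDist, Real.cos_zero, ← Real.sqrt_sq_eq_abs]
  congr 1
  ring

namespace Suspension

variable {F₁ F₂ : Mfd.{u}}

/-- The point of the cone over the suspension which corresponds to the point of the product of the
cones with radii `s₁`, `s₂` and link components `a`, `b`. -/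
noncomputable def conePoint (s₁ s₂ : ℝ≥0) (a : F₁) (b : F₂) : Cone (Suspension F₁ F₂) :=
  Quotient.mk (coneSetoid _) (⟨√(s₁ ^ 2 + s₂ ^ 2), Real.sqrt_nonneg _⟩, Suspension.mk
    ⟨Real.arccos (s₁ / √(s₁ ^ 2 + s₂ ^ 2)), Real.arccos_nonneg _,
      Real.arccos_le_pi_div_two.2 (by positivity)⟩ a b)

theorem sqrt_mul_cos_arccos {s t : ℝ} (hs : 0 ≤ s) :
    √(s ^ 2 + t ^ 2) * Real.cos (Real.arccos (s / √(s ^ 2 + t ^ 2))) = s := by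
  have h : s ≤ √(s ^ 2 + t ^ 2) := Real.le_sqrt_of_sq_le (by nlinarith [_root_.sq_nonneg t])
  rw [Real.cos_arccos (by have : 0 ≤ s / √(s ^ 2 + t ^ 2) := by positivity
                          linarith) (div_le_one_of_le₀ h (by positivity))]
  rcases (Real.sqrt_nonneg (s ^ 2 + t ^ 2)).eq_or_lt with h0 | h0
  · rw [← h0] at h ⊢
    linarith
  · field_simp

theorem sqrt_mul_sin_arccos {s t : ℝ} (hs : 0 ≤ s) (ht : 0 ≤ t) :
    √(s ^ 2 + t ^ 2) * Real.sin (Real.arccos (s / √(s ^ 2 + t ^ 2))) = t := by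
  have h1 := sqrt_mul_cos_arccos (t := t) hs
  have h2 := Real.sin_nonneg_of_nonneg_of_le_pi (Real.arccos_nonneg (s / √(s ^ 2 + t ^ 2)))
    (Real.arccos_le_pi _)
  have h3 := Real.sin_sq_add_cos_sq (Real.arccos (s / √(s ^ 2 + t ^ 2)))
  have h4 := Real.sq_sqrt (show 0 ≤ s ^ 2 + t ^ 2 by positivity)
  have h5 := Real.sqrt_nonneg (s ^ 2 + t ^ 2)
  generalize Real.cos (Real.arccos (s / √(s ^ 2 + t ^ 2))) = c at *
  generalize Real.sin (Real.arccos (s / √(s ^ 2 + t ^ 2))) = σ at *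
  generalize √(s ^ 2 + t ^ 2) = r at *
  refine (pow_left_inj₀ (mul_nonneg h5 h2) ht two_ne_zero).1 ?_
  have : (r * σ) ^ 2 + (r * c) ^ 2 = r ^ 2 := by linear_combination r ^ 2 * h3
  rw [h1] at this
  linarith

/-- With s₁ = r cos θ, s₂ = r sin θ and likewise for t₁, t₂, the term r s cos d of the suspension
splits into the corresponding terms of the two cones, so the squared distances add. The arccosine
cancels since its argument lies in [−1, 1]. -/
theorem cone_dist_conePoint (κ₁ : F₁.Metric) (κ₂ : F₂.Metric) (s₁ s₂ t₁ t₂ : ℝ≥0) (a a' : F₁)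
    (b b' : F₂) : Cone.dist (Suspension.dist κ₁ κ₂) (conePoint s₁ s₂ a b) (conePoint t₁ t₂ a' b') =
      √(polarDist s₁ t₁ (κ₁.angle a a') ^ 2 + polarDist s₂ t₂ (κ₂.angle b b') ^ 2) := by
  rw [sq_polarDist, sq_polarDist]
  obtain ⟨θ, hθ⟩ : ∃ θ, θ = Real.arccos ((s₁ : ℝ) / √((s₁ : ℝ) ^ 2 + (s₂ : ℝ) ^ 2)) := ⟨_, rfl⟩
  obtain ⟨φ, hφ⟩ : ∃ φ, φ = Real.arccos ((t₁ : ℝ) / √((t₁ : ℝ) ^ 2 + (t₂ : ℝ) ^ 2)) := ⟨_, rfl⟩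
  obtain ⟨r, hr⟩ : ∃ r, r = √((s₁ : ℝ) ^ 2 + (s₂ : ℝ) ^ 2) := ⟨_, rfl⟩
  obtain ⟨s, hs⟩ : ∃ s, s = √((t₁ : ℝ) ^ 2 + (t₂ : ℝ) ^ 2) := ⟨_, rfl⟩
  obtain ⟨X, hX⟩ : ∃ X, X = Real.cos θ * Real.cos φ * Real.cos (κ₁.angle a a') +
      Real.sin θ * Real.sin φ * Real.cos (κ₂.angle b b') := ⟨_, rfl⟩
  have e1 : r * Real.cos θ = s₁ := by rw [hr, hθ]; exact sqrt_mul_cos_arccos s₁.2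
  have e2 : r * Real.sin θ = s₂ := by rw [hr, hθ]; exact sqrt_mul_sin_arccos s₁.2 s₂.2
  have e3 : s * Real.cos φ = t₁ := by rw [hs, hφ]; exact sqrt_mul_cos_arccos t₁.2
  have e4 : s * Real.sin φ = t₂ := by rw [hs, hφ]; exact sqrt_mul_sin_arccos t₁.2 t₂.2
  have hr2 : r ^ 2 = (s₁ : ℝ) ^ 2 + (s₂ : ℝ) ^ 2 := by rw [hr, Real.sq_sqrt (by positivity)]
  have hs2 : s ^ 2 = (t₁ : ℝ) ^ 2 + (t₂ : ℝ) ^ 2 := by rw [hs, Real.sq_sqrt (by positivity)]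
  have h : Cone.dist (Suspension.dist κ₁ κ₂) (conePoint s₁ s₂ a b) (conePoint t₁ t₂ a' b') =
      √(r ^ 2 + s ^ 2 - 2 * r * s * Real.cos (min (Real.arccos X) Real.pi)) := by
    rw [hX, hθ, hφ, hr, hs]
    rfl
  have c1 : 0 ≤ Real.cos θ * Real.cos φ := by
    rw [hθ, hφ]
    exact mul_nonneg (Real.cos_nonneg_of_neg_pi_div_two_le_of_le
      (by linarith [Real.pi_pos, Real.arccos_nonneg ((s₁ : ℝ) / √((s₁ : ℝ) ^ 2 + (s₂ : ℝ) ^ 2))])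
      (Real.arccos_le_pi_div_two.2 (by positivity))) (Real.cos_nonneg_of_neg_pi_div_two_le_of_le
      (by linarith [Real.pi_pos, Real.arccos_nonneg ((t₁ : ℝ) / √((t₁ : ℝ) ^ 2 + (t₂ : ℝ) ^ 2))])
      (Real.arccos_le_pi_div_two.2 (by positivity)))
  have c2 : 0 ≤ Real.sin θ * Real.sin φ := by
    rw [hθ, hφ]
    exact mul_nonneg (Real.sin_nonneg_of_nonneg_of_le_pi (Real.arccos_nonneg _)
      (Real.arccos_le_pi _)) (Real.sin_nonneg_of_nonneg_of_le_pi (Real.arccos_nonneg _)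
      (Real.arccos_le_pi _))
  have c3 : Real.cos θ * Real.cos φ + Real.sin θ * Real.sin φ ≤ 1 := by
    rw [← Real.cos_sub]; exact Real.cos_le_one _
  have hX1 : X ≤ 1 := by
    have := mul_le_mul_of_nonneg_left (Real.cos_le_one (κ₁.angle a a')) c1
    have := mul_le_mul_of_nonneg_left (Real.cos_le_one (κ₂.angle b b')) c2
    linarith
  have hX2 : -1 ≤ X := by
    have := mul_le_mul_of_nonneg_left (Real.neg_one_le_cos (κ₁.angle a a')) c1
    have := mul_le_mul_of_nonneg_left (Real.neg_one_le_cos (κ₂.angle b b')) c2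
    linarith
  rw [h, min_eq_left (Real.arccos_le_pi _), Real.cos_arccos hX2 hX1, hr2, hs2]
  congr 1
  have : r * s * X = s₁ * t₁ * Real.cos (κ₁.angle a a') + s₂ * t₂ * Real.cos (κ₂.angle b b') := by
    rw [hX, ← e1, ← e2, ← e3, ← e4]
    ring
  linear_combination -2 * this

theorem exists_conePoint (c : Cone (Suspension F₁ F₂)) :
    ∃ s₁ s₂ a b, c = conePoint s₁ s₂ a b := by
  obtain ⟨⟨r, y⟩, rfl⟩ := Quotient.exists_rep c
  obtain ⟨θ, a, b, rfl⟩ := exists_mk y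
  have hc : 0 ≤ Real.cos θ := Real.cos_nonneg_of_neg_pi_div_two_le_of_le
    (by linarith [θ.2.1, Real.pi_pos]) θ.2.2
  have hs : 0 ≤ Real.sin θ := Real.sin_nonneg_of_nonneg_of_le_pi θ.2.1
    (by linarith [θ.2.2, Real.pi_pos])
  have e : √(((r * ⟨Real.cos θ, hc⟩ : ℝ≥0) : ℝ) ^ 2 + ((r * ⟨Real.sin θ, hs⟩ : ℝ≥0) : ℝ) ^ 2) = r := by
    change √(((r : ℝ) * Real.cos θ) ^ 2 + ((r : ℝ) * Real.sin θ) ^ 2) = r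
    rw [sqrt_mul_sq_add_mul_sq r.coe_nonneg, Real.cos_sq_add_sin_sq, Real.sqrt_one, mul_one]
  refine ⟨r * ⟨Real.cos θ, hc⟩, r * ⟨Real.sin θ, hs⟩, a, b, Quotient.sound ⟨?_, fun hr ↦ ?_⟩⟩
  · exact NNReal.coe_injective e.symm
  · have hr0 : (r : ℝ) ≠ 0 := NNReal.coe_ne_zero.2 hr
    refine congrArg (fun θ ↦ Suspension.mk θ a b) (Subtype.ext ?_)
    simp only [e]
    change (θ : ℝ) = Real.arccos ((r : ℝ) * Real.cos θ / r)
    rw [mul_div_cancel_left₀ _ hr0, Real.arccos_cos θ.2.1 (by linarith [θ.2.2, Real.pi_pos])]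

/-- The angle of this representative is arccos (0 / 0) = arccos 0, but at radius 0 the cone forgets
it. -/
theorem conePoint_zero [Nonempty F₁] [Nonempty F₂] (a : F₁) (b : F₂) :
    conePoint 0 0 a b = Cone.vertex (Suspension F₁ F₂) :=
  have h : (⟨√(((0 : ℝ≥0) : ℝ) ^ 2 + ((0 : ℝ≥0) : ℝ) ^ 2), Real.sqrt_nonneg _⟩ : ℝ≥0) = 0 :=
    NNReal.coe_injective
      (show √(((0 : ℝ≥0) : ℝ) ^ 2 + ((0 : ℝ≥0) : ℝ) ^ 2) = ((0 : ℝ≥0) : ℝ) by simp)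
  Quotient.sound ⟨h, fun hne ↦ (hne h).elim⟩

end Suspension

/-! ### Gromov–Hausdorff approximations -/

namespace ACStructure

variable {Z F : Mfd.{u}} {g : Z.Metric} {κ : F.Metric} {ν : ℝ} (A : ACStructure g κ ν)
  [ConnectedSpace Z]

/-- The cone distance to p is at least ρ(x) − ρ(p); compare with the distance for η = 1/2. -/
theorem exists_rho_le_dist (p : Z) : ∃ C, 0 ≤ C ∧ ∀ x, A.rho x ≤ 2 * g.dist p x + C := by
  obtain ⟨C, hC, h⟩ := A.exists_abs_coneDist_sub_dist_le (g := g) (η := 1 / 2) (by norm_num)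
    (by norm_num)
  have hpos : ∀ x, 0 ≤ A.rho x := fun x ↦ A.R₀_pos.le.trans (A.R₀_le_rho x)
  refine ⟨3 * A.rho p + 2 * C, by linarith [hpos p], fun x ↦ ?_⟩
  have h1 : A.rho x - A.rho p ≤ A.coneDist p x := sub_le_polarDist _ (hpos p) (hpos x)
  have h2 := (abs_le.1 (h p x)).2
  linarith

/-- The distance is the one of the cone, up to an error which is small compared to the distances
to the base point; radial errors bounded by `ρ p` are allowed. -/
theorem exists_abs_polarDist_sub_dist_le (p : Z) {η : ℝ} (hη : 0 < η) : ∃ C, 0 ≤ C ∧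
    ∀ x y m n, |m - A.rho x| ≤ A.rho p → |n - A.rho y| ≤ A.rho p →
      |polarDist m n (κ.angle (A.link x) (A.link y)) - g.dist x y| ≤
        η * (g.dist p x + g.dist p y) + C := by
  -- Half of η absorbs the factor 2 in ρ ≤ 2 d(p, ·) + C'.
  obtain ⟨η', hη', hη1, hηη⟩ : ∃ η' : ℝ, 0 < η' ∧ η' < 1 ∧ η' * 2 ≤ η :=
    ⟨min (1 / 2) (η / 2), by positivity, (min_le_left _ _).trans_lt (by norm_num), by
      linarith [min_le_right (1 / 2) (η / 2)]⟩
  obtain ⟨C, hC, h⟩ := A.exists_abs_coneDist_sub_dist_le (g := g) hη' hη1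
  obtain ⟨C', hC', h'⟩ := A.exists_rho_le_dist (g := g) p
  have hp : 0 ≤ A.rho p := A.R₀_pos.le.trans (A.R₀_le_rho p)
  refine ⟨2 * A.rho p + C + η * C', by positivity, fun x y m n hm hn ↦ ?_⟩
  have h1 := abs_polarDist_sub_le m n (κ.angle (A.link x) (A.link y)) (A.rho x)
  have h2 := abs_polarDist_sub_le' (A.rho x) n (κ.angle (A.link x) (A.link y)) (A.rho y)
  have h3 := h x y
  have hx := g.dist_nonneg p x
  have hy := g.dist_nonneg p y
  have h4 : η' * (A.rho x + A.rho y) ≤ η * (g.dist p x + g.dist p y) + η * C' := by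
    have := mul_le_mul_of_nonneg_left (add_le_add (h' x) (h' y)) hη'.le
    nlinarith
  have e : polarDist m n (κ.angle (A.link x) (A.link y)) - g.dist x y =
      (polarDist m n (κ.angle (A.link x) (A.link y)) -
        polarDist (A.rho x) n (κ.angle (A.link x) (A.link y))) +
      (polarDist (A.rho x) n (κ.angle (A.link x) (A.link y)) -
        polarDist (A.rho x) (A.rho y) (κ.angle (A.link x) (A.link y))) +
      (A.coneDist x y - g.dist x y) := by
    unfold coneDist
    ring
  rw [e]
  refine (abs_add_three _ _ _).trans ?_
  linarith

theorem exists_dist_le_mul_rho (p : Z) {η : ℝ} (hη : 0 < η) :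
    ∃ C, 0 ≤ C ∧ ∀ x, g.dist p x ≤ (1 + η) * A.rho x + C := by
  obtain ⟨K, hK⟩ := A.exists_isConicFrom (η := min (1 / 2) η) (by positivity)
    ((min_le_left _ _).trans_lt (by norm_num))
  obtain ⟨C, hC, h⟩ := A.exists_dist_le_rho hK (by positivity) p
  refine ⟨C, hC, fun x ↦ (h x).trans ?_⟩
  have := min_le_right (1 / 2) η
  have hpos : 0 ≤ A.rho x := A.R₀_pos.le.trans (A.R₀_le_rho x)
  gcongr

end ACStructure

theorem Mfd.Metric.angle_self {M : Mfd.{u}} (g : M.Metric) (x : M) : g.angle x x = 0 := by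
  unfold angle
  rw [g.edist_self, min_eq_left zero_le, ENNReal.toReal_zero]

namespace ACPair

open Suspension

variable {Z₁ Z₂ F₁ F₂ : Mfd.{u}} {g₁ : Z₁.Metric} {g₂ : Z₂.Metric} {κ₁ : F₁.Metric}
  {κ₂ : F₂.Metric} {ν₁ ν₂ : ℝ} (A : ACStructure g₁ κ₁ ν₁) (B : ACStructure g₂ κ₂ ν₂)

open Classical in
/-- The radial function of the first factor on the product, modified to vanish at the base point. -/
noncomputable def pointedRho (p z : Z₁ × Z₂) : ℝ≥0 :=
  if z = p then 0 else (A.rho z.1).toNNReal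

theorem pointedRho_self (p : Z₁ × Z₂) : pointedRho A p p = 0 := if_pos rfl

/-- Resetting the radius to 0 at the base point makes the approximation map p to the vertex exactly;
the price is at most ρ(p). -/
theorem abs_pointedRho_sub_le (p z : Z₁ × Z₂) :
    |(pointedRho A p z : ℝ) - A.rho z.1| ≤ A.rho p.1 := by
  have h : ∀ z, 0 ≤ A.rho z := fun z ↦ A.R₀_pos.le.trans (A.R₀_le_rho z)
  by_cases hz : z = p
  · rw [hz, pointedRho_self, NNReal.coe_zero, zero_sub, abs_neg, abs_of_nonneg (h _)]
  · rw [pointedRho, if_neg hz, Real.coe_toNNReal _ (h _), sub_self, abs_zero]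
    exact h _

/-- The approximation of the rescaled product by the cone over the suspension. -/
noncomputable def approx (p : Z₁ × Z₂) (ε : ℝ≥0) (z : Z₁ × Z₂) : Cone (Suspension F₁ F₂) :=
  conePoint (ε * pointedRho A p z) (ε * pointedRho B p.swap z.swap) (A.link z.1) (B.link z.2)

theorem cone_dist_approx (p : Z₁ × Z₂) (ε : ℝ≥0) (x y : Z₁ × Z₂) :
    Cone.dist (Suspension.dist κ₁ κ₂) (approx A B p ε x) (approx A B p ε y) =
      ε * √(polarDist (pointedRho A p x) (pointedRho A p y) (κ₁.angle (A.link x.1) (A.link y.1)) ^ 2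
        + polarDist (pointedRho B p.swap x.swap) (pointedRho B p.swap y.swap)
          (κ₂.angle (B.link x.2) (B.link y.2)) ^ 2) := by
  unfold approx
  rw [cone_dist_conePoint]
  simp only [NNReal.coe_mul]
  rw [polarDist_mul ε.coe_nonneg, polarDist_mul ε.coe_nonneg, sqrt_mul_sq_add_mul_sq ε.coe_nonneg]

/-- The two factors are estimated separately and recombined by `abs_sqrt_sub_sqrt_le`; the distances
of x and y from p in both factors give four terms of size η r. -/
theorem abs_cone_dist_approx_sub_le [ConnectedSpace Z₁] [ConnectedSpace Z₂] {η C₁ C₂ : ℝ}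
    (hη : 0 ≤ η) (p : Z₁ × Z₂)
    (h₁ : ∀ x y m n, |m - A.rho x| ≤ A.rho p.1 → |n - A.rho y| ≤ A.rho p.1 →
      |polarDist m n (κ₁.angle (A.link x) (A.link y)) - g₁.dist x y| ≤
        η * (g₁.dist p.1 x + g₁.dist p.1 y) + C₁)
    (h₂ : ∀ x y m n, |m - B.rho x| ≤ B.rho p.2 → |n - B.rho y| ≤ B.rho p.2 →
      |polarDist m n (κ₂.angle (B.link x) (B.link y)) - g₂.dist x y| ≤
        η * (g₂.dist p.2 x + g₂.dist p.2 y) + C₂) {ε : ℝ≥0} {r : ℝ} {x y : Z₁ × Z₂}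
    (hx : ε * (g₁.prod g₂).dist p x ≤ r) (hy : ε * (g₁.prod g₂).dist p y ≤ r) :
    |Cone.dist (Suspension.dist κ₁ κ₂) (approx A B p ε x) (approx A B p ε y) -
      ε * (g₁.prod g₂).dist x y| ≤ 4 * (η * r) + ε * (C₁ + C₂) := by
  have hle : ∀ z : Z₁ × Z₂, g₁.dist p.1 z.1 ≤ (g₁.prod g₂).dist p z ∧
      g₂.dist p.2 z.2 ≤ (g₁.prod g₂).dist p z := fun z ↦ by
    rw [Mfd.Metric.dist_prod]
    exact ⟨Real.le_sqrt_of_sq_le (by nlinarith [_root_.sq_nonneg (g₂.dist p.2 z.2)]),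
      Real.le_sqrt_of_sq_le (by nlinarith [_root_.sq_nonneg (g₁.dist p.1 z.1)])⟩
  have e1 := h₁ x.1 y.1 _ _ (abs_pointedRho_sub_le A p x) (abs_pointedRho_sub_le A p y)
  have e2 := h₂ x.2 y.2 _ _ (abs_pointedRho_sub_le B p.swap x.swap)
    (abs_pointedRho_sub_le B p.swap y.swap)
  have e3 := (abs_sqrt_sub_sqrt_le _ _ _ _).trans (add_le_add e1 e2)
  rw [cone_dist_approx, Mfd.Metric.dist_prod g₁ g₂ x y, ← mul_sub, abs_mul,
    abs_of_nonneg ε.coe_nonneg]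
  refine (mul_le_mul_of_nonneg_left e3 ε.coe_nonneg).trans ?_
  have hε := ε.coe_nonneg
  have hm : ∀ d D : ℝ, d ≤ D → ε * D ≤ r → η * (ε * d) ≤ η * r := fun d D h h' ↦
    mul_le_mul_of_nonneg_left ((mul_le_mul_of_nonneg_left h hε).trans h') hη
  have a1 := hm _ _ (hle x).1 hx
  have a2 := hm _ _ (hle x).2 hx
  have a3 := hm _ _ (hle y).1 hy
  have a4 := hm _ _ (hle y).2 hy
  linarith

theorem cone_dist_vertex [Nonempty F₁] [Nonempty F₂] (s t : ℝ≥0) (a : F₁) (b : F₂) :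
    Cone.dist (Suspension.dist κ₁ κ₂) (Cone.vertex (Suspension F₁ F₂)) (conePoint s t a b) =
      √((s : ℝ) ^ 2 + (t : ℝ) ^ 2) := by
  rw [← conePoint_zero a b, cone_dist_conePoint, NNReal.coe_zero,
    polarDist_zero_left _ s.coe_nonneg, polarDist_zero_left _ t.coe_nonneg]

theorem abs_mul_pointedRho_sub_le (p z : Z₁ × Z₂) {ε s : ℝ≥0} (hε : 0 < ε)
    (hz : A.rho z.1 = s / ε + (A.R₀ + 1)) :
    |((ε * pointedRho A p z : ℝ≥0) : ℝ) - s| ≤ ε * (A.rho p.1 + (A.R₀ + 1)) := by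
  have h := abs_pointedRho_sub_le A p z
  have hε' : (0 : ℝ) < ε := hε
  have e : ((ε * pointedRho A p z : ℝ≥0) : ℝ) - s =
      ε * ((pointedRho A p z - A.rho z.1) + (A.R₀ + 1)) := by
    rw [hz]
    push_cast
    field_simp
    ring
  rw [e, abs_mul, abs_of_pos hε']
  refine mul_le_mul_of_nonneg_left ((abs_add_le _ _).trans ?_) hε'.le
  rw [abs_of_pos (show 0 < A.R₀ + 1 by linarith [A.R₀_pos])]
  linarith

theorem mul_dist_prod_le [ConnectedSpace Z₁] [ConnectedSpace Z₂] {p z : Z₁ × Z₂} {ε : ℝ≥0}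
    {u₁ u₂ b₁ b₂ : ℝ} (h₁ : ε * g₁.dist p.1 z.1 ≤ u₁ + b₁) (h₂ : ε * g₂.dist p.2 z.2 ≤ u₂ + b₂)
    (hb₁ : 0 ≤ b₁) (hb₂ : 0 ≤ b₂) :
    ε * (g₁.prod g₂).dist p z ≤ √(u₁ ^ 2 + u₂ ^ 2) + (b₁ + b₂) := by
  have hε := ε.coe_nonneg
  have d1 := mul_nonneg hε (g₁.dist_nonneg p.1 z.1)
  have d2 := mul_nonneg hε (g₂.dist_nonneg p.2 z.2)
  rw [Mfd.Metric.dist_prod, ← sqrt_mul_sq_add_mul_sq hε]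
  have h := (abs_le.1 (abs_sqrt_sub_sqrt_le (u₁ + b₁) (u₂ + b₂) u₁ u₂)).2
  rw [add_sub_cancel_left, add_sub_cancel_left, abs_of_nonneg hb₁, abs_of_nonneg hb₂] at h
  have h' : √((ε * g₁.dist p.1 z.1) ^ 2 + (ε * g₂.dist p.2 z.2) ^ 2) ≤
      √((u₁ + b₁) ^ 2 + (u₂ + b₂) ^ 2) := by gcongr
  linarith

theorem mul_dist_le {η C : ℝ} {p z : Z₁} {ε s : ℝ≥0} (hε : 0 < ε)
    (hC : g₁.dist p z ≤ (1 + η) * A.rho z + C) (hz : A.rho z = s / ε + (A.R₀ + 1)) :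
    ε * g₁.dist p z ≤ (1 + η) * s + ε * ((1 + η) * (A.R₀ + 1) + C) := by
  have hε' : (0 : ℝ) < ε := hε
  refine (mul_le_mul_of_nonneg_left hC hε'.le).trans (le_of_eq ?_)
  rw [hz]
  field_simp
  ring

include A B in
/-- The tangent cone at infinity of a product of asymptotically conic manifolds. -/
theorem isTangentConeAtInfinity_prod [ConnectedSpace Z₁] [ConnectedSpace Z₂] [Nonempty F₁]
    [Nonempty F₂] : IsTangentConeAtInfinity (g₁.prod g₂) (Cone.dist (Suspension.dist κ₁ κ₂))
      (Cone.vertex (Suspension F₁ F₂)) := by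
  intro p r hr δ hδ
  -- Chosen so that 4 η r = δ/2.
  obtain ⟨η, hη⟩ : ∃ η, η = δ / (8 * r) := ⟨_, rfl⟩
  have hη0 : 0 < η := by rw [hη]; positivity
  have hηr : η * r = δ / 8 := by rw [hη]; field_simp
  obtain ⟨C₁, hC₁, h₁⟩ := A.exists_abs_polarDist_sub_dist_le (g := g₁) p.1 hη0
  obtain ⟨C₂, hC₂, h₂⟩ := B.exists_abs_polarDist_sub_dist_le (g := g₂) p.2 hη0
  obtain ⟨D₁, hD₁, k₁⟩ := A.exists_dist_le_mul_rho (g := g₁) p.1 hη0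
  obtain ⟨D₂, hD₂, k₂⟩ := B.exists_dist_le_mul_rho (g := g₂) p.2 hη0
  have hA := A.R₀_pos
  have hB := B.R₀_pos
  have hpA := A.R₀_le_rho p.1
  have hpB := B.R₀_le_rho p.2
  obtain ⟨b₁, hb₁⟩ : ∃ b, b = (1 + η) * (A.R₀ + 1) + D₁ := ⟨_, rfl⟩
  obtain ⟨b₂, hb₂⟩ : ∃ b, b = (1 + η) * (B.R₀ + 1) + D₂ := ⟨_, rfl⟩
  have hb₁0 : 0 ≤ b₁ := by rw [hb₁]; positivity
  have hb₂0 : 0 ≤ b₂ := by rw [hb₂]; positivity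
  -- M collects all additive constants; for ε < δ/(2M) each of them costs less than δ/2 after
  -- rescaling.
  obtain ⟨M, hM⟩ : ∃ M, M = C₁ + C₂ + (b₁ + b₂) +
    ((A.rho p.1 + (A.R₀ + 1)) + (B.rho p.2 + (B.R₀ + 1))) := ⟨_, rfl⟩
  have hM0 : 0 < M := by linarith
  filter_upwards [Ioo_mem_nhdsGT (show 0 < δ / (2 * M) by positivity)] with ε hε
  lift ε to ℝ≥0 using hε.1.le
  have hε0 : 0 < ε := hε.1
  have hεM : ε * M < δ / 2 := by
    have := (lt_div_iff₀ (by positivity)).1 hε.2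
    linarith
  have hεn := ε.coe_nonneg
  have hεle : ∀ c, c ≤ M → ε * c < δ / 2 := fun c hc ↦
    (mul_le_mul_of_nonneg_left hc hεn).trans_lt hεM
  refine ⟨approx A B p ε, ?_, fun x y hx hy ↦ ?_, fun c hc ↦ ?_⟩
  · unfold approx
    rw [pointedRho_self, pointedRho_self, mul_zero, conePoint_zero]
  · refine (abs_cone_dist_approx_sub_le A B hη0.le p h₁ h₂ hx.le hy.le).trans_lt ?_
    have := hεle (C₁ + C₂) (by linarith)
    linarith
  · obtain ⟨s₁, s₂, f₁, f₂, rfl⟩ := exists_conePoint c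
    rw [cone_dist_vertex] at hc
    have hr₁ : A.R₀ < (s₁ : ℝ) / ε + (A.R₀ + 1) := by
      have : 0 ≤ (s₁ : ℝ) / ε := by positivity
      linarith
    have hr₂ : B.R₀ < (s₂ : ℝ) / ε + (B.R₀ + 1) := by
      have : 0 ≤ (s₂ : ℝ) / ε := by positivity
      linarith
    -- The radius s₁/ε is shifted by R₀ + 1 to be sure to lie on the end; after rescaling the shift
    -- is of order ε.
    obtain ⟨z₁, hz₁, hf₁⟩ : ∃ z, A.rho z = (s₁ : ℝ) / ε + (A.R₀ + 1) ∧ A.link z = f₁ :=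
      ⟨_, A.rho_Φ hr₁ f₁, A.link_Φ hr₁ f₁⟩
    obtain ⟨z₂, hz₂, hf₂⟩ : ∃ z, B.rho z = (s₂ : ℝ) / ε + (B.R₀ + 1) ∧ B.link z = f₂ :=
      ⟨_, B.rho_Φ hr₂ f₂, B.link_Φ hr₂ f₂⟩
    refine ⟨(z₁, z₂), ?_, ?_⟩
    · refine (mul_dist_prod_le (z := (z₁, z₂)) (mul_dist_le A hε0 (k₁ z₁) hz₁)
        (mul_dist_le B hε0 (k₂ z₂) hz₂) (by rw [← hb₁]; positivity)
        (by rw [← hb₂]; positivity)).trans_lt ?_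
      rw [sqrt_mul_sq_add_mul_sq (by positivity), ← hb₁, ← hb₂, ← mul_add]
      have h3 := hεle (b₁ + b₂) (by linarith)
      -- What remains is (1 + η)(r − δ) + δ/2 < r, which holds as η r = δ/8.
      have h4 : (1 + η) * √((s₁ : ℝ) ^ 2 + (s₂ : ℝ) ^ 2) ≤ (1 + η) * (r - δ) := by gcongr
      nlinarith
    · unfold approx
      rw [hf₁, hf₂, cone_dist_conePoint, Mfd.Metric.angle_self, Mfd.Metric.angle_self,
        polarDist_zero, polarDist_zero]
      have h3 := (abs_le.1 (abs_sqrt_sub_sqrt_le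
        |((ε * pointedRho A p (z₁, z₂) : ℝ≥0) : ℝ) - s₁|
        |((ε * pointedRho B p.swap (z₁, z₂).swap : ℝ≥0) : ℝ) - s₂| 0 0)).2
      have h4 := abs_mul_pointedRho_sub_le A p (z₁, z₂) hε0 hz₁
      have h5 := abs_mul_pointedRho_sub_le B p.swap (z₁, z₂).swap hε0 hz₂
      have h6 := hεle ((A.rho p.1 + (A.R₀ + 1)) + (B.rho p.2 + (B.R₀ + 1))) (by linarith)
      simp only [sub_zero, abs_abs, ne_eq, OfNat.ofNat_ne_zero, not_false_eq_true, zero_pow,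
        add_zero, Real.sqrt_zero] at h3
      change |((ε * pointedRho B p.swap (z₁, z₂).swap : ℝ≥0) : ℝ) - s₂| ≤
        ε * (B.rho p.2 + (B.R₀ + 1)) at h5
      linarith

end ACPair

theorem mainTheorem11 (Z₁ Z₂ F₁ F₂ : Mfd.{u}) [ConnectedSpace Z₁] [ConnectedSpace Z₂]
    [Nonempty F₁] [Nonempty F₂]
    (g₁ : Z₁.Metric) (g₂ : Z₂.Metric) (κ₁ : F₁.Metric) (κ₂ : F₂.Metric) (ν₁ ν₂ : ℝ)
    (A₁ : ACStructure g₁ κ₁ ν₁) (A₂ : ACStructure g₂ κ₂ ν₂) :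
    (∃ 𝓔 : EdgeStructure (Suspension F₁ F₂), 𝓔.IsSphericalSuspension κ₁ κ₂ ∧
      Nonempty (QACStructure (g₁.prod g₂) 𝓔 (min 1 (min ν₁ ν₂)))) ∧
    IsTangentConeAtInfinity (g₁.prod g₂) (Cone.dist (Suspension.dist κ₁ κ₂))
      (Cone.vertex (Suspension F₁ F₂)) := by
  have := A₁.compact_link
  have := A₂.compact_link
  exact ⟨⟨Suspension.edge κ₁ κ₂, Suspension.isSphericalSuspension_edge κ₁ κ₂,
    exists_qacStructure A₁ A₂⟩, ACPair.isTangentConeAtInfinity_prod A₁ A₂⟩
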